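/- Let $\Omega\subset\mathbb R^2$ be a bounded smooth domain which is diffeomorphic (up to the boundary) to an annulus, with inner and outer boundary components $\Gamma_i,\Gamma_o$, and let $|\Omega|$ be its area. Fix $\alpha\in(0,1)$. For $K=\overline\Omega$ or $K=[0,|\Omega|]$ let $C^\infty_K$ be the Fréchet space of functions that are smooth on $K$ up to the boundary, graded by the Hölder norms $$\|f\|_{n,\alpha}=\sup_{0\le j\le n}\sup_K|\nabla^jf|+\sum_{j=0}^n[\nabla^jf]_\alpha,\qquad [g]_\alpha=\sup_{x\ne y\in K}\frac{|g(x)-g(y)|}{|x-y|^\alpha},\qquad n\ge0 .$$ Let $\mathcal F$ be the closed subspace of those $\omega\in C^\infty_{\overline\Omega}$ whose tangential derivative along $\partial\Omega$ vanishes, and let $\mathcal F_+$ be the open set of those $\omega\in\mathcal F$ with $\nabla\omega\neq0$ everywhere on $\overline\Omega$ and $\omega|_{\Gamma_i}<\omega|_{\Gamma_o}$. For $\omega\in\mathcal F_+$ and a function $u$ on $\overline\Omega$ put $$A_\omega(\lambda)=|\{x\in\Omega:\omega(x)<\lambda\}|,\qquad J_\omega u(\lambda)=\int_{\{x\in\overline\Omega:\,\omega(x)=\lambda\}}u\,dl,\qquad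 \lambda\in[\min\omega,\max\omega],$$ where $dl$ is arc length; $A_\omega$ is a bijection of $[\min\omega,\max\omega]$ onto $[0,|\Omega|]$ with inverse $A_\omega^{-1}$, and $J_\omega\frac1{|\nabla\omega|}>0$ on $[\min\omega,\max\omega]$. A map $P$ from a set $B$ in a graded Fréchet space to a graded Fréchet space is *tame* if it is continuous and every $u_0\in B$ has a neighborhood $V$ for which there are $r,b\in\mathbb N$ and constants $C_n$ with $|P(u)|_n\le C_n(|u|_{n+r}+1)$ for all $n\ge b$ and $u\in V\cap B$. If $B$ is open, $P$ is *smooth tame* if all its successive directional derivatives $D^kP(u)(v_1,\dots,v_k)$, $k\ge0$, exist (as limits in the Fréchet topology), where $D^{k+1}P(u)(v_1,\dots,v_k,w)=\lim_{t\to0}\frac{D^kP(u+tw)(v_1,\dots,v_k)-D^kP(u)(v_1,\dots,v_k)}t$, and each of them is continuous and tame jointly in all its variables. **Proposition.** (1) The map $Q:\mathcal F_+\to C^\infty_{[0,|\Omega|]}$, $Q(\omega)=A_\omega^{-1}$, is smooth tame, and for $\omega\in\mathcal F_+$, $\nu\in\mathcal F$, $$DQ(\omega)\nu=\frac{J_\omega\frac{\nu}{|\nabla\omega|}\circ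 A_\omega^{-1}}{J_\omega\frac1{|\nabla\omega|}\circ A_\omega^{-1}} .$$ Every $\omega_0\in\mathcal F_+$ has a $\|\cdot\|_{2,\alpha}$-neighborhood such that for every $n\ge0$ there is a constant $C$ with, for all $\omega\in\mathcal F_+$ in this neighborhood and all $\nu,\nu_1,\nu_2\in\mathcal F$, $$\|A_\omega^{-1}\|_{n,\alpha}\le C(\|\omega\|_{n,\alpha}+1),$$ $$\|DQ(\omega)\nu\|_{n,\alpha}\le C\left(\|\nu\|_{n,\alpha}+\|\omega\|_{n+1,\alpha}\|\nu\|_{1,\alpha}\right),$$ $$\|D^2Q(\omega)(\nu_1,\nu_2)\|_{n,\alpha}\le C\left(\|\nu_1\|_{n+1,\alpha}\|\nu_2\|_{1,\alpha}+\|\nu_1\|_{1,\alpha}\|\nu_2\|_{n+1,\alpha}+\|\omega\|_{n+2,\alpha}\|\nu_1\|_{2,\alpha}\|\nu_2\|_{2,\alpha}\right).$$ (2) The map $\mathcal F_+\times C^\infty_{\overline\Omega}\to C^\infty_{[0,|\Omega|]}$, $(\omega,u)\mapsto J_\omega u\circ A_\omega^{-1}$, is smooth tame. Every $\omega_0\in\mathcal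 F_+$ has a $\|\cdot\|_{2,\alpha}$-neighborhood such that for every $n\ge0$ there is a constant $C$ with, for all $\omega\in\mathcal F_+$ in this neighborhood and all $u\in C^\infty_{\overline\Omega}$, $J_\omega\frac u{|\nabla\omega|}\circ A_\omega^{-1}\in C^\infty_{[0,|\Omega|]}$ and $$\left\|J_\omega\frac u{|\nabla\omega|}\circ A_\omega^{-1}\right\|_{n,\alpha}\le C\left(\|u\|_{n,\alpha}+\|\omega\|_{n+1,\alpha}\|u\|_{1,\alpha}\right).$$ -/

import Mathlib

open Set Filter Topology MeasureTheory
open scoped NNReal ENNReal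

noncomputable section

/-! ### Smooth functions on a compact region, and their Hölder norms -/

section SmoothFunctions

variable {E : Type*} [NormedAddCommGroup E] [NormedSpace ℝ E]

/-- Restrictions to `K` of smooth functions on the whole space. A function on `K` is stored as its
extension by zero, so that two elements are equal iff they agree on `K`. -/
def smoothSubmodule (K : Set E) : Submodule ℝ (E → ℝ) where
  carrier := {f | (∀ x, x ∉ K → f x = 0) ∧ ∃ F : E → ℝ, ContDiff ℝ (⊤ : ℕ∞) F ∧ EqOn f F K}
  add_mem' := by
    rintro f g ⟨hf, F, hF, hfF⟩ ⟨hg, G, hG, hgG⟩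
    refine ⟨fun x hx => by simp [hf x hx, hg x hx], F + G, hF.add hG, fun x hx => ?_⟩
    simp [hfF hx, hgG hx]
  zero_mem' := ⟨fun _ _ => rfl, 0, contDiff_const, fun _ _ => rfl⟩
  smul_mem' := by
    rintro c f ⟨hf, F, hF, hfF⟩
    refine ⟨fun x hx => by simp [hf x hx], c • F, hF.const_smul c, fun x hx => ?_⟩
    simp [hfF hx]

/-- The space `C^∞_K` of smooth functions on `K` (up to the boundary), for `K` the closure of a
smooth bounded region. -/
def CInf (K : Set E) : Type _ := ↥(smoothSubmodule K)

namespace CInf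

variable {K : Set E}

instance : AddCommGroup (CInf K) := inferInstanceAs (AddCommGroup ↥(smoothSubmodule K))

instance : Module ℝ (CInf K) := inferInstanceAs (Module ℝ ↥(smoothSubmodule K))

instance : CoeFun (CInf K) (fun _ => E → ℝ) := ⟨Subtype.val⟩

/-- The `C^∞`-topology: uniform convergence on `K` of the derivatives of every order. -/
instance : TopologicalSpace (CInf K) :=
  ⨅ j : ℕ, TopologicalSpace.induced
    (fun f : CInf K => UniformFun.ofFun fun x : K => iteratedFDerivWithin ℝ j f K x) inferInstance

end CInf

/-- The Hölder seminorm `[g]_α` on `K`. -/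
def holderSeminorm {G : Type*} [NormedAddCommGroup G] (K : Set E) (α : ℝ) (g : E → G) : ℝ≥0∞ :=
  ⨆ (x ∈ K) (y ∈ K) (_ : x ≠ y), edist (g x) (g y) / edist x y ^ α

/-- The norm `‖f‖_n`: the supremum over `K` of the derivatives of order at most `n`. -/
def supNorm (K : Set E) (n : ℕ) (f : E → ℝ) : ℝ≥0∞ :=
  ⨆ (j ∈ Finset.range (n + 1)) (x ∈ K), ‖iteratedFDerivWithin ℝ j f K x‖ₑ

/-- The Hölder norm `‖f‖_{n,α}` on `K`, with values in `[0, ∞]`; it is finite if `f` is smooth on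
`K` and `K` is the closure of a smooth bounded region. -/
def holderNorm (K : Set E) (α : ℝ) (n : ℕ) (f : E → ℝ) : ℝ≥0∞ :=
  supNorm K n f +
    ∑ j ∈ Finset.range (n + 1), holderSeminorm K α (iteratedFDerivWithin ℝ j f K)

/-- The grading of `C^∞_K` by the Hölder norms. -/
def CInf.grading (K : Set E) (α : ℝ) (n : ℕ) (f : CInf K) : ℝ≥0∞ := holderNorm K α n f

end SmoothFunctions

/-! ### Smooth tame maps between graded spaces -/

section Tame

variable {X Y : Type*}

/-- The grading of a product of two graded spaces. -/
def prodGrading (p : ℕ → X → ℝ≥0∞) (q : ℕ → Y → ℝ≥0∞) (n : ℕ) (z : X × Y) : ℝ≥0∞ :=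
  p n z.1 + q n z.2

/-- The grading of a finite power of a graded space. -/
def powGrading (p : ℕ → X → ℝ≥0∞) (k : ℕ) (n : ℕ) (v : Fin k → X) : ℝ≥0∞ :=
  ∑ i, p n (v i)

/-- `P : B ⊆ X → Y` is tame: it is continuous and, near each point of `B`, it satisfies estimates
`|P u|_n ≤ C_n (|u|_{n+r} + 1)` for all `n ≥ b`. -/
structure IsTameOn [TopologicalSpace X] [TopologicalSpace Y]
    (p : ℕ → X → ℝ≥0∞) (q : ℕ → Y → ℝ≥0∞) (B : Set X) (P : X → Y) : Prop where
  continuousOn : ContinuousOn P B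
  estimate : ∀ u₀ ∈ B, ∃ V ∈ 𝓝 u₀, ∃ r b : ℕ, ∀ n, b ≤ n →
    ∃ C : ℝ≥0, ∀ u ∈ V ∩ B, q n (P u) ≤ C * (p (n + r) u + 1)

/-- `P : B ⊆ X → Y` is smooth tame on the open set `B`, with successive directional derivatives
`D k u (v₁, …, v_k) = D^k P(u)(v₁, …, v_k)`. Here `D^{k+1} P(u)(v₁, …, v_k, w)` is the derivative of
`D^k P(u)(v₁, …, v_k)` with respect to `u` in the direction `w`, the limit being taken in the
topology of `Y`, and each `D^k P` is continuous and tame jointly in all of its variables. -/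
structure IsSmoothTameOn [TopologicalSpace X] [AddCommGroup X] [Module ℝ X]
    [TopologicalSpace Y] [AddCommGroup Y] [Module ℝ Y]
    (p : ℕ → X → ℝ≥0∞) (q : ℕ → Y → ℝ≥0∞) (B : Set X) (P : X → Y)
    (D : (k : ℕ) → X → (Fin k → X) → Y) : Prop where
  isOpen : IsOpen B
  zero : ∀ u ∈ B, ∀ v : Fin 0 → X, D 0 u v = P u
  deriv : ∀ (k : ℕ), ∀ u ∈ B, ∀ (v : Fin k → X) (w : X),
    Tendsto (fun t : ℝ => t⁻¹ • (D k (u + t • w) v - D k u v)) (𝓝[≠] 0)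
      (𝓝 (D (k + 1) u (Fin.snoc (α := fun _ => X) v w)))
  tame : ∀ k : ℕ, IsTameOn (prodGrading p (powGrading p k)) q (B ×ˢ univ)
    (fun z : X × (Fin k → X) => D k z.1 z.2)

end Tame

/-! ### Annular domains, distribution functions and integrals over level sets -/

/-- The Euclidean plane. -/
abbrev Plane : Type := EuclideanSpace ℝ (Fin 2)

/-- `Ω` is a bounded smooth planar domain diffeomorphic (up to the boundary) to an annulus, with
inner boundary component `Γi` and outer boundary component `Γo`; the latter is the one that borders
the unbounded component of the complement. -/
structure IsAnnularDomain (Ω Γi Γo : Set Plane) : Prop where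
  exists_diffeo : ∃ Φ : OpenPartialHomeomorph Plane Plane,
    {x : Plane | 1 ≤ ‖x‖ ∧ ‖x‖ ≤ 2} ⊆ Φ.source ∧
    ContDiffOn ℝ (⊤ : ℕ∞) Φ Φ.source ∧ ContDiffOn ℝ (⊤ : ℕ∞) Φ.symm Φ.target ∧
    Φ '' {x : Plane | 1 < ‖x‖ ∧ ‖x‖ < 2} = Ω ∧
    Φ '' Metric.sphere 0 1 = Γi ∧ Φ '' Metric.sphere 0 2 = Γo
  outer : Γo = frontier {x : Plane |
    x ∉ closure Ω ∧ ¬ Bornology.IsBounded (connectedComponentIn (closure Ω)ᶜ x)}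

/-- The space `𝓕` of smooth functions on the closure of `Ω` whose tangential derivative along `∂Ω`
vanishes: the derivative along every smooth curve in `∂Ω` is zero. -/
def calF (Ω : Set Plane) : Submodule ℝ (CInf (closure Ω)) where
  carrier := {f | ∀ c : ℝ → Plane, ContDiff ℝ (⊤ : ℕ∞) c → (∀ s, c s ∈ frontier Ω) →
    ∀ s, HasDerivAt (fun s => f (c s)) 0 s}
  add_mem' := by
    intro f g hf hg c hc hcΩ s
    have h := (hf c hc hcΩ s).add (hg c hc hcΩ s)
    rw [add_zero] at h
    exact h
  zero_mem' := fun _ _ _ s => hasDerivAt_const s (0 : ℝ)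
  smul_mem' := by
    intro a f hf c hc hcΩ s
    have h := (hf c hc hcΩ s).const_mul a
    rw [mul_zero] at h
    exact h

/-- The grading of `𝓕` by the Hölder norms. -/
def calF.grading (Ω : Set Plane) (α : ℝ) (n : ℕ) (f : calF Ω) : ℝ≥0∞ :=
  CInf.grading (closure Ω) α n (f : CInf (closure Ω))

/-- `|∇f(x)|` for `x` in the closure of `Ω` (one-sided at the boundary). -/
def gradNorm (Ω : Set Plane) (f : Plane → ℝ) (x : Plane) : ℝ :=
  ‖gradientWithin f (closure Ω) x‖

/-- `𝓕₊`: the functions in `𝓕` without critical points in the closure of `Ω`, whose values on the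
inner boundary component are smaller than those on the outer one. -/
def calFPlus (Ω Γi Γo : Set Plane) : Set (calF Ω) :=
  {ω | (∀ x ∈ closure Ω, gradientWithin (ω : CInf (closure Ω)) (closure Ω) x ≠ 0) ∧
    ∀ x ∈ Γi, ∀ y ∈ Γo, (ω : CInf (closure Ω)) x < (ω : CInf (closure Ω)) y}

/-- The area `|Ω|`. -/
def area (Ω : Set Plane) : ℝ := volume.real Ω

/-- The distribution function `A_ω(l) = |{x ∈ Ω : ω(x) < l}|`. -/
def distFun (Ω : Set Plane) (ω : Plane → ℝ) (l : ℝ) : ℝ :=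
  volume.real {x | x ∈ Ω ∧ ω x < l}

/-- The inverse distribution function `A_ω⁻¹`, where `A_ω` is taken on the range of `ω` over the
closure of `Ω`. -/
def distInv (Ω : Set Plane) (ω : Plane → ℝ) : ℝ → ℝ :=
  Function.invFunOn (distFun Ω ω) (ω '' closure Ω)

/-- The integral `J_ω u(l)` of `u` over the level set `{ω = l}` in the closure of `Ω`, with respect
to arc length. -/
def levelInt (Ω : Set Plane) (ω u : Plane → ℝ) (l : ℝ) : ℝ :=
  ∫ x in {x | x ∈ closure Ω ∧ ω x = l}, u x ∂(Measure.hausdorffMeasure 1)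

end

open Set Filter Topology MeasureTheory
open scoped NNReal ENNReal
noncomputable section

set_option linter.unusedSectionVars false
set_option linter.style.haveILetI false

notation "C∞" => ContDiff ℝ (⊤ : ℕ∞)

/-! ### Hölder norms on an interval -/

/-- The supremum of `|f|` on `I`. -/
def supOn (I : Set ℝ) (f : ℝ → ℝ) : ℝ := sSup ((fun x => |f x|) '' I)

/-- The Hölder seminorm of `f` on `I`, as a real number. -/
def holOn (α : ℝ) (I : Set ℝ) (f : ℝ → ℝ) : ℝ :=
  sSup ((fun z : ℝ × ℝ => |f z.1 - f z.2| / |z.1 - z.2| ^ α) '' (I ×ˢ I))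

/-- The Hölder norm `sup |f| + [f]_α` on `I`. -/
def hB (α : ℝ) (I : Set ℝ) (f : ℝ → ℝ) : ℝ := supOn I f + holOn α I f

/-- `f` is bounded and Hölder continuous on `I`. -/
def HolderFin (α : ℝ) (I : Set ℝ) (f : ℝ → ℝ) : Prop :=
  ∃ A H : ℝ, (∀ x ∈ I, |f x| ≤ A) ∧ ∀ x ∈ I, ∀ y ∈ I, |f x - f y| ≤ H * |x - y| ^ α

lemma supOn_nonneg (I : Set ℝ) (f : ℝ → ℝ) : 0 ≤ supOn I f :=
  Real.sSup_nonneg (by rintro _ ⟨x, -, rfl⟩; positivity)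

lemma holOn_nonneg (α : ℝ) (I : Set ℝ) (f : ℝ → ℝ) : 0 ≤ holOn α I f :=
  Real.sSup_nonneg (by rintro _ ⟨x, -, rfl⟩; positivity)

lemma hB_nonneg (α : ℝ) (I : Set ℝ) (f : ℝ → ℝ) : 0 ≤ hB α I f :=
  add_nonneg (supOn_nonneg _ _) (holOn_nonneg _ _ _)

lemma HolderFin.abs_le_supOn {α : ℝ} {I : Set ℝ} {f : ℝ → ℝ} (h : HolderFin α I f) {x : ℝ}
    (hx : x ∈ I) : |f x| ≤ supOn I f := by
  obtain ⟨A, H, hA, -⟩ := h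
  exact le_csSup ⟨A, by rintro _ ⟨y, hy, rfl⟩; exact hA y hy⟩ ⟨x, hx, rfl⟩

lemma HolderFin.sub_le_holOn {α : ℝ} {I : Set ℝ} {f : ℝ → ℝ} (h : HolderFin α I f) {x y : ℝ}
    (hx : x ∈ I) (hy : y ∈ I) : |f x - f y| ≤ holOn α I f * |x - y| ^ α := by
  obtain ⟨A, H, -, hH⟩ := h
  rcases eq_or_ne x y with rfl | hxy
  · simpa using mul_nonneg (holOn_nonneg _ _ _) (Real.rpow_nonneg le_rfl _)
  have hpos : 0 < |x - y| ^ α := Real.rpow_pos_of_pos (abs_pos.2 (sub_ne_zero.2 hxy)) _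
  rw [← div_le_iff₀ hpos]
  refine le_csSup ⟨max H 0, ?_⟩ ⟨(x, y), ⟨hx, hy⟩, rfl⟩
  rintro _ ⟨⟨z, w⟩, ⟨hz, hw⟩, rfl⟩
  refine div_le_of_le_mul₀ (by positivity) (by positivity) ?_
  exact (hH z hz w hw).trans (mul_le_mul_of_nonneg_right (le_max_left _ _) (by positivity))

lemma HolderFin.abs_le {α : ℝ} {I : Set ℝ} {f : ℝ → ℝ} (h : HolderFin α I f) {x : ℝ}
    (hx : x ∈ I) : |f x| ≤ hB α I f :=
  (h.abs_le_supOn hx).trans (le_add_of_nonneg_right (holOn_nonneg _ _ _))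

lemma supOn_le {I : Set ℝ} {f : ℝ → ℝ} {A : ℝ} (hA : 0 ≤ A) (h : ∀ x ∈ I, |f x| ≤ A) :
    supOn I f ≤ A :=
  Real.sSup_le (by rintro _ ⟨x, hx, rfl⟩; exact h x hx) hA

lemma holOn_le {α : ℝ} {I : Set ℝ} {f : ℝ → ℝ} {H : ℝ} (hH : 0 ≤ H)
    (h : ∀ x ∈ I, ∀ y ∈ I, |f x - f y| ≤ H * |x - y| ^ α) : holOn α I f ≤ H :=
  Real.sSup_le (by
    rintro _ ⟨⟨x, y⟩, ⟨hx, hy⟩, rfl⟩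
    exact div_le_of_le_mul₀ (by positivity) hH (h x hx y hy)) hH

lemma hB_le {α : ℝ} {I : Set ℝ} {f : ℝ → ℝ} {A H : ℝ} (hA : 0 ≤ A) (hH : 0 ≤ H)
    (h : ∀ x ∈ I, |f x| ≤ A) (h' : ∀ x ∈ I, ∀ y ∈ I, |f x - f y| ≤ H * |x - y| ^ α) :
    hB α I f ≤ A + H := add_le_add (supOn_le hA h) (holOn_le hH h')

lemma hB_congr {α : ℝ} {I : Set ℝ} {f g : ℝ → ℝ} (h : EqOn f g I) : hB α I f = hB α I g := by
  unfold hB supOn holOn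
  congr 2
  · exact image_congr fun x hx => by rw [h hx]
  · exact image_congr fun z hz => by rw [h hz.1, h hz.2]

lemma hB_add_le {α : ℝ} {I : Set ℝ} {f g : ℝ → ℝ} (hf : HolderFin α I f) (hg : HolderFin α I g) :
    hB α I (f + g) ≤ hB α I f + hB α I g := by
  have := hB_le (α := α) (I := I) (f := f + g) (A := supOn I f + supOn I g)
    (H := holOn α I f + holOn α I g)
    (add_nonneg (supOn_nonneg _ _) (supOn_nonneg _ _))
    (add_nonneg (holOn_nonneg _ _ _) (holOn_nonneg _ _ _))
    (fun x hx => (abs_add_le _ _).trans (add_le_add (hf.abs_le_supOn hx) (hg.abs_le_supOn hx)))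
    (fun x hx y hy => by
      have := hf.sub_le_holOn hx hy
      have := hg.sub_le_holOn hx hy
      have h3 := abs_add_le (f x - f y) (g x - g y)
      simp only [Pi.add_apply]
      rw [add_mul, show f x + g x - (f y + g y) = (f x - f y) + (g x - g y) by ring]
      linarith)
  unfold hB at *
  linarith

lemma hB_mul_le {α : ℝ} {I : Set ℝ} {f g : ℝ → ℝ} (hf : HolderFin α I f) (hg : HolderFin α I g) :
    hB α I (f * g) ≤ hB α I f * hB α I g := by
  have h1 := supOn_nonneg I f
  have h2 := supOn_nonneg I g
  have h3 := holOn_nonneg α I f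
  have h4 := holOn_nonneg α I g
  have := hB_le (α := α) (I := I) (f := f * g) (A := supOn I f * supOn I g)
    (H := holOn α I f * supOn I g + supOn I f * holOn α I g)
    (by positivity) (by positivity)
    (fun x hx => by
      rw [Pi.mul_apply, abs_mul]
      exact mul_le_mul (hf.abs_le_supOn hx) (hg.abs_le_supOn hx) (abs_nonneg _) h1)
    (fun x hx y hy => by
      simp only [Pi.mul_apply]
      rw [show f x * g x - f y * g y = (f x - f y) * g x + f y * (g x - g y) by ring]
      refine (abs_add_le _ _).trans ?_
      rw [abs_mul, abs_mul, add_mul]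
      have a1 := mul_le_mul (hf.sub_le_holOn hx hy) (hg.abs_le_supOn hx) (abs_nonneg _)
        (by positivity)
      have a2 := mul_le_mul (hf.abs_le_supOn hy) (hg.sub_le_holOn hx hy) (abs_nonneg _) h1
      nlinarith)
  unfold hB at *
  nlinarith [mul_nonneg h3 h4]

lemma hB_const_mul {α : ℝ} {I : Set ℝ} {f : ℝ → ℝ} (c : ℝ) :
    hB α I (fun x => c * f x) = |c| * hB α I f := by
  unfold hB supOn holOn
  rw [mul_add]
  congr 1
  · rw [← smul_eq_mul |c|, ← Real.sSup_smul_of_nonneg (abs_nonneg c)]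
    congr 1
    ext y
    simp [mem_smul_set, abs_mul]
  · rw [← smul_eq_mul |c|, ← Real.sSup_smul_of_nonneg (abs_nonneg c)]
    congr 1
    ext y
    simp only [mem_image, mem_smul_set, smul_eq_mul, exists_exists_and_eq_and, ← mul_sub, abs_mul,
      mul_div_assoc]

/-- Smooth functions on `[p, q]`. -/
def Sm (p q : ℝ) (f : ℝ → ℝ) : Prop := ContDiffOn ℝ (⊤ : ℕ∞) f (Icc p q)

/-- The (one-sided at the end points) derivative on `[p, q]`. -/
def dI (p q : ℝ) (f : ℝ → ℝ) : ℝ → ℝ := derivWithin f (Icc p q)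

lemma Sm.deriv {p q : ℝ} (hpq : p < q) {f : ℝ → ℝ} (h : Sm p q f) : Sm p q (dI p q f) :=
  ContDiffOn.derivWithin h (uniqueDiffOn_Icc hpq) (by simp)

lemma Sm.hasDeriv {p q : ℝ} {f : ℝ → ℝ} (h : Sm p q f) {x : ℝ}
    (hx : x ∈ Icc p q) : HasDerivWithinAt f (dI p q f x) (Icc p q) x :=
  ((h x hx).differentiableWithinAt (by simp)).hasDerivWithinAt

lemma Sm.continuousOn {p q : ℝ} {f : ℝ → ℝ} (h : Sm p q f) : ContinuousOn f (Icc p q) :=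
  ContDiffOn.continuousOn h

lemma Sm.mul {p q : ℝ} {f g : ℝ → ℝ} (hf : Sm p q f) (hg : Sm p q g) : Sm p q (f * g) :=
  ContDiffOn.mul hf hg

lemma Sm.const_mul {p q : ℝ} {f : ℝ → ℝ} (hf : Sm p q f) (c : ℝ) : Sm p q (fun x => c * f x) :=
  contDiffOn_const.mul hf

lemma Sm.inv {p q : ℝ} {f : ℝ → ℝ} (hf : Sm p q f) (h0 : ∀ x ∈ Icc p q, f x ≠ 0) : Sm p q f⁻¹ :=
  ContDiffOn.inv hf h0

lemma Sm.comp {p q p' q' : ℝ} {f g : ℝ → ℝ} (hf : Sm p q f) (hg : Sm p' q' g)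
    (h : MapsTo g (Icc p' q') (Icc p q)) : Sm p' q' (f ∘ g) := ContDiffOn.comp hf hg h

lemma ContDiff.sm {f : ℝ → ℝ} (hf : C∞ f) (p q : ℝ) : Sm p q f :=
  hf.contDiffOn

lemma dI_congr {p q : ℝ} {f g : ℝ → ℝ} (h : EqOn f g (Icc p q)) :
    EqOn (dI p q f) (dI p q g) (Icc p q) :=
  fun _ hx => derivWithin_congr h (h hx)

lemma dI_eq {p q : ℝ} (hpq : p < q) {f : ℝ → ℝ} {x f' : ℝ} (hx : x ∈ Icc p q)
    (h : HasDerivWithinAt f f' (Icc p q) x) : dI p q f x = f' :=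
  h.derivWithin (uniqueDiffOn_Icc hpq x hx)

lemma Sm.bdd {p q : ℝ} {f : ℝ → ℝ} (h : Sm p q f) : ∃ A, 0 ≤ A ∧ ∀ x ∈ Icc p q, |f x| ≤ A := by
  obtain ⟨C, hC⟩ := isCompact_Icc.exists_bound_of_continuousOn h.continuousOn
  exact ⟨max C 0, le_max_right _ _, fun x hx => (hC x hx).trans (le_max_left _ _)⟩

lemma Sm.lipschitz {p q : ℝ} {f : ℝ → ℝ} (h : Sm p q f) {A : ℝ}
    (hA : ∀ x ∈ Icc p q, |dI p q f x| ≤ A) {x y : ℝ} (hx : x ∈ Icc p q) (hy : y ∈ Icc p q) :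
    |f x - f y| ≤ A * |x - y| :=
  (convex_Icc p q).norm_image_sub_le_of_norm_hasDerivWithin_le (fun _ hz => h.hasDeriv hz)
    (fun z hz => hA z hz) hy hx

lemma abs_sub_le_rpow {α p q x y : ℝ} (h1 : α ≤ 1) (hx : x ∈ Icc p q)
    (hy : y ∈ Icc p q) : |x - y| ≤ (q - p) ^ (1 - α) * |x - y| ^ α := by
  rcases eq_or_ne x y with rfl | hxy
  · have : 0 ≤ q - p := by linarith [hx.1, hx.2]
    simp only [sub_self, abs_zero]
    positivity
  have hpos : 0 < |x - y| := abs_pos.2 (sub_ne_zero.2 hxy)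
  have hle : |x - y| ≤ q - p := abs_sub_le_iff.2 ⟨by linarith [hx.1, hx.2, hy.1, hy.2],
    by linarith [hx.1, hx.2, hy.1, hy.2]⟩
  calc |x - y| = |x - y| ^ (1 - α) * |x - y| ^ α := by
        rw [← Real.rpow_add hpos]; simp
    _ ≤ _ := by gcongr

lemma Sm.holderFin {p q : ℝ} {f : ℝ → ℝ} (hpq : p < q) (h : Sm p q f) {α : ℝ} (h1 : α ≤ 1) :
    HolderFin α (Icc p q) f := by
  obtain ⟨A, -, hA⟩ := h.bdd
  obtain ⟨H, hH0, hH⟩ := (h.deriv hpq).bdd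
  refine ⟨A, H * (q - p) ^ (1 - α), hA, fun x hx y hy => (h.lipschitz hH hx hy).trans ?_⟩
  rw [mul_assoc]
  exact mul_le_mul_of_nonneg_left (abs_sub_le_rpow h1 hx hy) hH0

/-- The Hölder norm `∑_{j ≤ n} (sup |f^(j)| + [f^(j)]_α)` on `[p, q]`. -/
def hN (α p q : ℝ) : ℕ → (ℝ → ℝ) → ℝ
  | 0, f => hB α (Icc p q) f
  | n + 1, f => hB α (Icc p q) f + hN α p q n (dI p q f)

lemma hN_zero (α p q : ℝ) (f : ℝ → ℝ) : hN α p q 0 f = hB α (Icc p q) f := rfl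
lemma hN_succ (α p q : ℝ) (n : ℕ) (f : ℝ → ℝ) :
    hN α p q (n + 1) f = hB α (Icc p q) f + hN α p q n (dI p q f) := rfl

lemma hN_nonneg (α p q : ℝ) (n : ℕ) (f : ℝ → ℝ) : 0 ≤ hN α p q n f := by
  induction n generalizing f with
  | zero => exact hB_nonneg _ _ _
  | succ n ih => exact add_nonneg (hB_nonneg _ _ _) (ih _)

lemma hB_le_hN (α p q : ℝ) (n : ℕ) (f : ℝ → ℝ) : hB α (Icc p q) f ≤ hN α p q n f := by
  cases n with
  | zero => exact le_rfl
  | succ n => exact le_add_of_nonneg_right (hN_nonneg _ _ _ _ _)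

lemma hN_le_succ (α p q : ℝ) (n : ℕ) (f : ℝ → ℝ) : hN α p q n f ≤ hN α p q (n + 1) f := by
  induction n generalizing f with
  | zero => exact hB_le_hN _ _ _ 1 _
  | succ n ih => rw [hN_succ, hN_succ α p q (n + 1)]; exact add_le_add le_rfl (ih _)

lemma hN_mono (α p q : ℝ) (f : ℝ → ℝ) : Monotone fun n => hN α p q n f :=
  monotone_nat_of_le_succ fun n => hN_le_succ α p q n f

lemma hN_deriv_le (α p q : ℝ) (n : ℕ) (f : ℝ → ℝ) :
    hN α p q n (dI p q f) ≤ hN α p q (n + 1) f := le_add_of_nonneg_left (hB_nonneg _ _ _)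

lemma hN_congr {α p q : ℝ} {f g : ℝ → ℝ} (n : ℕ) (h : EqOn f g (Icc p q)) :
    hN α p q n f = hN α p q n g := by
  induction n generalizing f g with
  | zero => exact hB_congr h
  | succ n ih => rw [hN_succ, hN_succ, hB_congr h, ih (dI_congr h)]

lemma hN_add_le {α p q : ℝ} (hpq : p < q) (h1 : α ≤ 1) {f g : ℝ → ℝ} (n : ℕ)
    (hf : Sm p q f) (hg : Sm p q g) : hN α p q n (f + g) ≤ hN α p q n f + hN α p q n g := by
  induction n generalizing f g with
  | zero => exact hB_add_le (hf.holderFin hpq h1) (hg.holderFin hpq h1)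
  | succ n ih =>
    have e : EqOn (dI p q (f + g)) (dI p q f + dI p q g) (Icc p q) := fun x hx =>
      dI_eq hpq hx ((hf.hasDeriv hx).add (hg.hasDeriv hx))
    simp only [hN_succ]
    rw [hN_congr n e]
    linarith [hB_add_le (hf.holderFin hpq h1) (hg.holderFin hpq h1),
      ih (hf.deriv hpq) (hg.deriv hpq)]

lemma hN_const_mul {α p q : ℝ} (hpq : p < q) {f : ℝ → ℝ} (n : ℕ) (hf : Sm p q f) (c : ℝ) :
    hN α p q n (fun x => c * f x) = |c| * hN α p q n f := by
  induction n generalizing f with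
  | zero => exact hB_const_mul c
  | succ n ih =>
    have e : EqOn (dI p q (fun x => c * f x)) (fun x => c * dI p q f x) (Icc p q) := fun x hx =>
      dI_eq hpq hx ((hf.hasDeriv hx).const_mul c)
    simp only [hN_succ]
    rw [hN_congr n e, hB_const_mul, ih (hf.deriv hpq)]
    ring

/-! ### Interpolation -/

lemma abs_taylor_le {φ φ' φ'' : ℝ → ℝ} {k M : ℝ}
    (h1 : ∀ t ∈ uIcc 0 k, HasDerivWithinAt φ (φ' t) (uIcc 0 k) t)
    (h2 : ∀ t ∈ uIcc 0 k, HasDerivWithinAt φ' (φ'' t) (uIcc 0 k) t)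
    (hM : ∀ t ∈ uIcc 0 k, |φ'' t| ≤ M) : |φ k - φ 0 - k * φ' 0| ≤ M * |k| * |k| := by
  have hM0 : 0 ≤ M := (abs_nonneg _).trans (hM 0 left_mem_uIcc)
  have a1 : ∀ t ∈ uIcc 0 k, ‖φ' t - φ' 0‖ ≤ M * |k| := fun t ht => by
    refine ((convex_uIcc 0 k).norm_image_sub_le_of_norm_hasDerivWithin_le h2 hM
      left_mem_uIcc ht).trans (mul_le_mul_of_nonneg_left ?_ hM0)
    simpa using abs_sub_left_of_mem_uIcc ht
  have := (convex_uIcc 0 k).norm_image_sub_le_of_norm_hasDerivWithin_le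
    (f := fun t => φ t - t * φ' 0) (f' := fun t => φ' t - 1 * φ' 0)
    (fun t ht => (h1 t ht).sub ((hasDerivWithinAt_id t _).mul_const _)) (by simpa using a1)
    left_mem_uIcc right_mem_uIcc
  simp only [zero_mul, sub_zero, Real.norm_eq_abs] at this
  rwa [show φ k - φ 0 - k * φ' 0 = φ k - k * φ' 0 - φ 0 by ring]

lemma Sm.shift_deriv {p q k x : ℝ} {f : ℝ → ℝ} (h : Sm p q f) (hx : x ∈ Icc p q)
    (hxk : x + k ∈ Icc p q) {t : ℝ} (ht : t ∈ uIcc 0 k) :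
    HasDerivWithinAt (fun t => f (x + t)) (dI p q f (x + t)) (uIcc 0 k) t := by
  have hm : MapsTo (fun t => x + t) (uIcc 0 k) (Icc p q) := fun t ht => by
    have h1 := (mem_uIcc.1 ht)
    constructor <;> rcases h1 with h1 | h1 <;> linarith [hx.1, hx.2, hxk.1, hxk.2]
  have := (h.hasDeriv (hm ht)).comp t ((hasDerivWithinAt_id t (uIcc 0 k)).const_add x) hm
  simpa [Function.comp_def] using this

lemma abs_deriv_le_shift {p q : ℝ} (hpq : p < q) {α : ℝ} (h1 : α ≤ 1) {f : ℝ → ℝ}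
    (hf : Sm p q f) {k x : ℝ} (hk : k ≠ 0) (hx : x ∈ Icc p q) (hxk : x + k ∈ Icc p q) :
    |dI p q f x| ≤ 2 / |k| * supOn (Icc p q) f + |k| * supOn (Icc p q) (dI p q (dI p q f)) := by
  have hm : ∀ t ∈ uIcc 0 k, x + t ∈ Icc p q := fun t ht => by
    have h1 := (mem_uIcc.1 ht)
    constructor <;> rcases h1 with h1 | h1 <;> linarith [hx.1, hx.2, hxk.1, hxk.2]
  have hf1 := hf.deriv hpq
  have key := abs_taylor_le (φ := fun t => f (x + t)) (k := k)
    (M := supOn (Icc p q) (dI p q (dI p q f)))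
    (fun t ht => hf.shift_deriv hx hxk ht) (fun t ht => hf1.shift_deriv hx hxk ht)
    (fun t ht => ((hf1.deriv hpq).holderFin hpq h1).abs_le_supOn (hm t ht))
  simp only [add_zero] at key
  have b1 := (hf.holderFin hpq h1).abs_le_supOn hx
  have b2 := (hf.holderFin hpq h1).abs_le_supOn hxk
  have hk' : 0 < |k| := abs_pos.2 hk
  have : |k| * |dI p q f x| ≤ 2 * supOn (Icc p q) f
      + supOn (Icc p q) (dI p q (dI p q f)) * |k| * |k| := by
    rw [← abs_mul]
    have e : k * dI p q f x = (f (x + k) - f x) - (f (x + k) - f x - k * dI p q f x) := by ring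
    rw [e]
    have := abs_sub (f (x + k) - f x) (f (x + k) - f x - k * dI p q f x)
    have := abs_sub (f (x + k)) (f x)
    linarith
  rw [← mul_le_mul_iff_right₀ hk']
  refine this.trans (le_of_eq ?_)
  field_simp

lemma abs_deriv_sub_le_shift {p q : ℝ} (hpq : p < q) {α : ℝ} (h1 : α ≤ 1) {f : ℝ → ℝ}
    (hf : Sm p q f) {k x y : ℝ} (hk : k ≠ 0) (hx : x ∈ Icc p q) (hxk : x + k ∈ Icc p q)
    (hy : y ∈ Icc p q) (hyk : y + k ∈ Icc p q) :
    |dI p q f x - dI p q f y| ≤ (2 / |k| * holOn α (Icc p q) f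
      + |k| * holOn α (Icc p q) (dI p q (dI p q f))) * |x - y| ^ α := by
  have hm : ∀ x, x ∈ Icc p q → x + k ∈ Icc p q → ∀ t ∈ uIcc 0 k, x + t ∈ Icc p q :=
    fun x hx hxk t ht => by
      have h1 := (mem_uIcc.1 ht)
      constructor <;> rcases h1 with h1 | h1 <;> linarith [hx.1, hx.2, hxk.1, hxk.2]
  have hf1 := hf.deriv hpq
  have key := abs_taylor_le (φ := fun t => f (x + t) - f (y + t)) (k := k)
    (M := holOn α (Icc p q) (dI p q (dI p q f)) * |x - y| ^ α)
    (fun t ht => (hf.shift_deriv hx hxk ht).sub (hf.shift_deriv hy hyk ht))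
    (fun t ht => (hf1.shift_deriv hx hxk ht).sub (hf1.shift_deriv hy hyk ht))
    (fun t ht => by
      have := ((hf1.deriv hpq).holderFin hpq h1).sub_le_holOn (hm x hx hxk t ht) (hm y hy hyk t ht)
      simpa using this)
  simp only [add_zero] at key
  have b1 := (hf.holderFin hpq h1).sub_le_holOn hx hy
  have b2 := (hf.holderFin hpq h1).sub_le_holOn hxk hyk
  rw [add_sub_add_right_eq_sub] at b2
  have hk' : 0 < |k| := abs_pos.2 hk
  set d := dI p q f x - dI p q f y with hd
  set P := |x - y| ^ α
  have : |k| * |d| ≤ 2 * (holOn α (Icc p q) f * P)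
      + holOn α (Icc p q) (dI p q (dI p q f)) * P * |k| * |k| := by
    rw [← abs_mul]
    have e : k * d = ((f (x + k) - f (y + k)) - (f x - f y))
      - (f (x + k) - f (y + k) - (f x - f y) - k * d) := by ring
    rw [e]
    have := abs_sub ((f (x + k) - f (y + k)) - (f x - f y))
      (f (x + k) - f (y + k) - (f x - f y) - k * d)
    have := abs_sub (f (x + k) - f (y + k)) (f x - f y)
    linarith
  rw [← mul_le_mul_iff_right₀ hk']
  refine this.trans (le_of_eq ?_)
  field_simp

lemma hB_deriv_le {p q : ℝ} (hpq : p < q) {α : ℝ} (h0 : 0 ≤ α) (h1 : α ≤ 1) {f : ℝ → ℝ}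
    (hf : Sm p q f) {h : ℝ} (hh : 0 < h) (hh' : h ≤ (q - p) / 2) :
    hB α (Icc p q) (dI p q f) ≤
      4 / h * hB α (Icc p q) f + 2 * h * hB α (Icc p q) (dI p q (dI p q f)) := by
  set I := Icc p q
  set S := 2 / h * supOn I f + h * supOn I (dI p q (dI p q f))
  set H := 2 / h * holOn α I f + h * holOn α I (dI p q (dI p q f))
  have hS : 0 ≤ S := by
    have := supOn_nonneg I f; have := supOn_nonneg I (dI p q (dI p q f)); positivity
  have hH : 0 ≤ H := by
    have := holOn_nonneg α I f; have := holOn_nonneg α I (dI p q (dI p q f)); positivity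
  have habs : |h| = h := abs_of_pos hh
  have key : hB α I (dI p q f) ≤ S + 2 * H := by
    refine hB_le hS (by positivity) (fun x hx => ?_) (fun x hx y hy => ?_)
    · rcases le_total x ((p + q) / 2) with hx' | hx'
      · have := abs_deriv_le_shift hpq h1 hf hh.ne' hx ⟨by linarith [hx.1], by linarith⟩
        rwa [habs] at this
      · have := abs_deriv_le_shift hpq h1 hf (neg_ne_zero.2 hh.ne') hx
          ⟨by linarith, by linarith [hx.2]⟩
        rwa [abs_neg, habs] at this
    · have L : ∀ x ∈ I, ∀ y ∈ I, x ≤ (p + q) / 2 → y ≤ (p + q) / 2 →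
          |dI p q f x - dI p q f y| ≤ H * |x - y| ^ α := fun x hx y hy hx' hy' => by
        have := abs_deriv_sub_le_shift hpq h1 hf hh.ne' hx ⟨by linarith [hx.1], by linarith⟩
          hy ⟨by linarith [hy.1], by linarith⟩
        rwa [habs] at this
      have R : ∀ x ∈ I, ∀ y ∈ I, (p + q) / 2 ≤ x → (p + q) / 2 ≤ y →
          |dI p q f x - dI p q f y| ≤ H * |x - y| ^ α := fun x hx y hy hx' hy' => by
        have := abs_deriv_sub_le_shift hpq h1 hf (neg_ne_zero.2 hh.ne') hx
          ⟨by linarith, by linarith [hx.2]⟩ hy ⟨by linarith, by linarith [hy.2]⟩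
        rwa [abs_neg, habs] at this
      have M : ∀ x ∈ I, ∀ y ∈ I, x ≤ (p + q) / 2 → (p + q) / 2 ≤ y →
          |dI p q f x - dI p q f y| ≤ 2 * H * |x - y| ^ α := fun x hx y hy hx' hy' => by
        have hc : (p + q) / 2 ∈ I := ⟨by linarith, by linarith⟩
        have a1 := L x hx _ hc hx' le_rfl
        have a2 := R _ hc y hy le_rfl hy'
        have e1 : |x - (p + q) / 2| ^ α ≤ |x - y| ^ α := by
          refine Real.rpow_le_rpow (abs_nonneg _) ?_ h0
          rw [abs_of_nonpos (by linarith), abs_of_nonpos (by linarith)]; linarith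
        have e2 : |(p + q) / 2 - y| ^ α ≤ |x - y| ^ α := by
          refine Real.rpow_le_rpow (abs_nonneg _) ?_ h0
          rw [abs_of_nonpos (by linarith), abs_of_nonpos (by linarith)]; linarith
        have := abs_sub_le (dI p q f x) (dI p q f ((p + q) / 2)) (dI p q f y)
        have := mul_le_mul_of_nonneg_left e1 hH
        have := mul_le_mul_of_nonneg_left e2 hH
        linarith
      have Hp : 0 ≤ H * |x - y| ^ α := by positivity
      rcases le_total x ((p + q) / 2) with hx' | hx' <;>
        rcases le_total y ((p + q) / 2) with hy' | hy'
      · linarith [L x hx y hy hx' hy']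
      · exact M x hx y hy hx' hy'
      · rw [abs_sub_comm, abs_sub_comm x]; exact M y hy x hx hy' hx'
      · linarith [R x hx y hy hx' hy']
  have e1 := supOn_nonneg I f
  have e2 := supOn_nonneg I (dI p q (dI p q f))
  have : S + 2 * H ≤ 4 / h * hB α I f + 2 * h * hB α I (dI p q (dI p q f)) := by
    have a1 : 0 ≤ 2 / h * supOn I f := by positivity
    have a2 : 0 ≤ h * supOn I (dI p q (dI p q f)) := by positivity
    simp only [S, H, hB]
    have : 4 / h = 2 * (2 / h) := by ring
    rw [this]
    nlinarith
  exact key.trans this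

lemma hN_interp_aux {p q : ℝ} (hpq : p < q) {α : ℝ} (h0 : 0 ≤ α) (h1 : α ≤ 1) (n : ℕ) {f : ℝ → ℝ}
    (hf : Sm p q f) {h : ℝ} (hh : 0 < h) (hh1 : h ≤ 1) (hh' : h ≤ (q - p) / 2) :
    hN α p q (n + 1) f ≤ 5 / h * hN α p q n f + 5 * h * hN α p q (n + 2) f := by
  have hinv : 1 ≤ 1 / h := by rw [le_div_iff₀ hh]; linarith
  have hb : hB α (Icc p q) f ≤ 1 / h * hB α (Icc p q) f :=
    le_mul_of_one_le_left (hB_nonneg _ _ _) hinv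
  have e5 : 5 / h = 5 * (1 / h) := by ring
  have e4 : 4 / h = 4 * (1 / h) := by ring
  induction n generalizing f with
  | zero =>
    simp only [hN_succ, hN_zero]
    have := hB_deriv_le hpq h0 h1 hf hh hh'
    have b1 := hB_nonneg α (Icc p q) f
    have b2 := mul_nonneg hh.le (hB_nonneg α (Icc p q) (dI p q f))
    have b3 := mul_nonneg hh.le (hB_nonneg α (Icc p q) (dI p q (dI p q f)))
    have b4 := mul_nonneg hh.le b1
    rw [e4] at this
    rw [e5]
    nlinarith
  | succ n ih =>
    have := ih (hf.deriv hpq) (le_mul_of_one_le_left (hB_nonneg _ _ _) hinv)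
    rw [hN_succ α p q (n + 1) f, hN_succ α p q n f, hN_succ α p q (n + 2) f]
    have b1 := hB_nonneg α (Icc p q) f
    have b4 := mul_nonneg hh.le b1
    rw [e5] at this ⊢
    nlinarith

lemma hN_interp {p q ℓ : ℝ} (hℓ : 0 < ℓ) (hpq : ℓ ≤ q - p) {α : ℝ} (h0 : 0 ≤ α) (h1 : α ≤ 1)
    (n : ℕ) {f : ℝ → ℝ} (hf : Sm p q f) :
    hN α p q (n + 1) f ^ 2 ≤
      (10 / min 1 (ℓ / 2)) ^ 2 * (hN α p q n f * hN α p q (n + 2) f) := by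
  set h₀ := min 1 (ℓ / 2) with hh₀
  have hpos : 0 < h₀ := lt_min one_pos (by linarith)
  have hone : h₀ ≤ 1 := min_le_left _ _
  have hle : h₀ ≤ (q - p) / 2 := (min_le_right _ _).trans (by linarith)
  have hpq' : p < q := by linarith
  set a := hN α p q n f
  set b := hN α p q (n + 1) f
  set c := hN α p q (n + 2) f
  have ha : 0 ≤ a := hN_nonneg _ _ _ _ _
  have hb : 0 ≤ b := hN_nonneg _ _ _ _ _
  have hab : a ≤ b := hN_le_succ _ _ _ _ _
  have hbc : b ≤ c := hN_le_succ _ _ _ _ _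
  have key : ∀ h, 0 < h → h ≤ h₀ → b ≤ 5 / h * a + 5 * h * c := fun h hp hle' =>
    hN_interp_aux hpq' h0 h1 n hf hp (hle'.trans hone) (hle'.trans hle)
  rcases hb.eq_or_lt with hb0 | hb0
  · have : 0 ≤ c := hb.trans hbc
    rw [← hb0, zero_pow two_ne_zero]; positivity
  have hc0 : 0 < c := hb0.trans_le hbc
  rcases ha.eq_or_lt with ha0 | ha0
  · exfalso
    have hm : 0 < min h₀ (b / (10 * c)) := lt_min hpos (by positivity)
    have := key _ hm (min_le_left _ _)
    rw [← ha0, mul_zero, zero_add] at this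
    have h2 : 5 * min h₀ (b / (10 * c)) * c ≤ 5 * (b / (10 * c)) * c := by
      gcongr; exact min_le_right _ _
    have h3 : 5 * (b / (10 * c)) * c = b / 2 := by field_simp; norm_num
    linarith
  have hs : 0 < √(a / c) := Real.sqrt_pos.2 (by positivity)
  have hs1 : √(a / c) ≤ 1 :=
     Real.sqrt_le_one.2 ((div_le_one hc0).2 (hab.trans hbc))
  have hsq : √(a / c) ^ 2 = a / c := Real.sq_sqrt (by positivity)
  have := key (h₀ * √(a / c)) (by positivity) (mul_le_of_le_one_right hpos.le hs1)
  have e : 5 / (h₀ * √(a / c)) * a = 5 / h₀ * (√(a / c) * c) := by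
    have : a = √(a / c) ^ 2 * c := by rw [hsq]; field_simp
    field_simp
    linarith
  have hb2 : b ≤ 10 / h₀ * (√(a / c) * c) := by
    rw [e] at this
    have h3 : 5 * (h₀ * √(a / c)) * c ≤ 5 / h₀ * (√(a / c) * c) := by
      have : h₀ ≤ 1 / h₀ := by rw [le_div_iff₀ hpos]; nlinarith
      have e' : 5 / h₀ * (√(a / c) * c) = 5 * (1 / h₀) * (√(a / c) * c) := by ring
      rw [e', show 5 * (h₀ * √(a / c)) * c = 5 * h₀ * (√(a / c) * c) by ring]
      gcongr
    have : 10 / h₀ * (√(a / c) * c) = 5 / h₀ * (√(a / c) * c) + 5 / h₀ * (√(a / c) * c) := by ring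
    linarith
  calc b ^ 2 ≤ (10 / h₀ * (√(a / c) * c)) ^ 2 := by gcongr
    _ = (10 / h₀) ^ 2 * (√(a / c) ^ 2 * c ^ 2) := by ring
    _ = _ := by rw [hsq]; field_simp

lemma logConvex_le_max {n : ℕ} {Z : ℕ → ℝ} (hZ : ∀ k, 0 ≤ Z k)
    (h : ∀ k, k + 2 ≤ n → Z (k + 1) ^ 2 ≤ Z k * Z (k + 2)) {k : ℕ} (hk : k ≤ n) :
    Z k ≤ max (Z 0) (Z n) := by
  by_contra! hlt
  classical
  obtain ⟨m, hm, hmax⟩ := Finset.exists_max_image (Finset.range (n + 1)) Z ⟨0, by simp⟩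
  have hex : ∃ j, j ≤ n ∧ Z j = Z m := ⟨m, by simpa [Nat.lt_succ_iff] using hm, rfl⟩
  obtain ⟨hj, hjm⟩ := Nat.find_spec hex
  set j := Nat.find hex
  have hkm : Z k ≤ Z m := hmax k (by simpa [Nat.lt_succ_iff] using hk)
  have hj0 : j ≠ 0 := fun h0 => by
    rw [h0] at hjm; linarith [le_max_left (Z 0) (Z n)]
  have hjn : j ≠ n := fun h0 => by
    rw [h0] at hjm; linarith [le_max_right (Z 0) (Z n)]
  obtain ⟨i, hi⟩ := Nat.exists_eq_succ_of_ne_zero hj0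
  have h1 := h i (by omega)
  have hi' : Z (i + 1) = Z m := by rw [← hjm, hi]
  have h2 : Z (i + 2) ≤ Z m := hmax _ (by simp; omega)
  have h3 : Z i < Z m := lt_of_le_of_ne (hmax _ (by simp; omega)) fun he =>
    Nat.find_min hex (m := i) (by omega) ⟨by omega, he⟩
  have hpos : 0 < Z m := (hZ i).trans_lt h3
  rw [hi'] at h1
  nlinarith [hZ i, hZ (i + 2)]

lemma logConvex_mul_le {C : ℝ} (hC : 1 ≤ C) {x y : ℕ → ℝ} (hx : ∀ k, 0 ≤ x k) (hy : ∀ k, 0 ≤ y k)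
    (hx' : ∀ k, x (k + 1) ^ 2 ≤ C * (x k * x (k + 2)))
    (hy' : ∀ k, y (k + 1) ^ 2 ≤ C * (y k * y (k + 2))) (k l : ℕ) :
    x k * y l ≤ C ^ ((k + l) ^ 2) * (x (k + l) * y 0 + x 0 * y (k + l)) := by
  have h0 : 0 ≤ C := by linarith
  have key := logConvex_le_max (n := k + l) (Z := fun j => C ^ (j ^ 2) * (x j * y (k + l - j)))
    (fun j => by have := hx j; have := hy (k + l - j); positivity)
    (fun j hj => by
      obtain ⟨i, hi⟩ : ∃ i, k + l = j + 2 + i := ⟨k + l - (j + 2), by omega⟩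
      rw [show k + l - (j + 1) = i + 1 by omega, show k + l - j = i + 2 by omega,
        show k + l - (j + 2) = i by omega]
      have := mul_le_mul (hx' j) (hy' i) (sq_nonneg _)
        (by have := hx j; have := hx (j + 2); positivity)
      calc (C ^ ((j + 1) ^ 2) * (x (j + 1) * y (i + 1))) ^ 2
          = C ^ (2 * (j + 1) ^ 2) * (x (j + 1) ^ 2 * y (i + 1) ^ 2) := by ring
        _ ≤ C ^ (2 * (j + 1) ^ 2) * (C * (x j * x (j + 2)) * (C * (y i * y (i + 2)))) := by gcongr
        _ = _ := by ring) (k := k) (by omega)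
  simp only [add_tsub_cancel_left, zero_pow two_ne_zero, pow_zero, one_mul, Nat.sub_zero,
    Nat.sub_self] at key
  have e1 : 1 ≤ C ^ (k ^ 2) := one_le_pow₀ hC
  have e2 : 1 ≤ C ^ ((k + l) ^ 2) := one_le_pow₀ hC
  have p1 : 0 ≤ x k * y l := mul_nonneg (hx _) (hy _)
  have p2 : 0 ≤ x 0 * y (k + l) := mul_nonneg (hx _) (hy _)
  have p3 : 0 ≤ x (k + l) * y 0 := mul_nonneg (hx _) (hy _)
  have : max (x 0 * y (k + l)) (C ^ (k + l) ^ 2 * (x (k + l) * y 0)) ≤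
      C ^ ((k + l) ^ 2) * (x (k + l) * y 0 + x 0 * y (k + l)) := by
    refine max_le ?_ ?_ <;> nlinarith
  nlinarith

/-- Interpolation in bilinear form. -/
lemma exists_hN_mul_le {ℓ : ℝ} (hℓ : 0 < ℓ) (m : ℕ) : ∃ C : ℝ, 1 ≤ C ∧
    ∀ {α p q p' q' : ℝ}, 0 ≤ α → α ≤ 1 → ℓ ≤ q - p → ℓ ≤ q' - p' →
    ∀ {f g : ℝ → ℝ}, Sm p q f → Sm p' q' g → ∀ a b k l, k + l = m →
      hN α p q (a + k) f * hN α p' q' (b + l) g ≤ C * (hN α p q (a + m) f * hN α p' q' b g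
        + hN α p q a f * hN α p' q' (b + m) g) := by
  set C := (10 / min 1 (ℓ / 2)) ^ 2
  have hC : 1 ≤ C := by
    have hpos : 0 < min 1 (ℓ / 2) := lt_min one_pos (by linarith)
    refine one_le_pow₀ ?_
    rw [le_div_iff₀ hpos]
    linarith [min_le_left 1 (ℓ / 2)]
  refine ⟨C ^ (m ^ 2), one_le_pow₀ hC, ?_⟩
  intro α p q p' q' h0 h1 hpq hpq' f g hf hg a b k l hkl
  subst hkl
  exact logConvex_mul_le hC (x := fun k => hN α p q (a + k) f) (y := fun l => hN α p' q' (b + l) g)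
    (fun _ => hN_nonneg _ _ _ _ _) (fun _ => hN_nonneg _ _ _ _ _)
    (fun k => hN_interp hℓ hpq h0 h1 (a + k) hf) (fun k => hN_interp hℓ hpq' h0 h1 (b + k) hg) k l

/-! ### Tame estimates for products, reciprocals, roots and compositions -/

lemma exists_hN_mul {ℓ : ℝ} (hℓ : 0 < ℓ) (n : ℕ) : ∃ C : ℝ, 1 ≤ C ∧
    ∀ {α p q : ℝ}, 0 ≤ α → α ≤ 1 → ℓ ≤ q - p → ∀ {f g : ℝ → ℝ}, Sm p q f → Sm p q g →
      hN α p q n (f * g) ≤ C * (hN α p q n f * hN α p q 0 g + hN α p q 0 f * hN α p q n g) := by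
  induction n with
  | zero =>
    refine ⟨1, le_rfl, ?_⟩
    intro α p q h0 h1 hpq f g hf hg
    have hpq' : p < q := by linarith
    have := hB_mul_le (hf.holderFin hpq' h1) (hg.holderFin hpq' h1)
    have := mul_nonneg (hB_nonneg α (Icc p q) f) (hB_nonneg α (Icc p q) g)
    simp only [hN_zero]
    linarith
  | succ n ih =>
    obtain ⟨C, hC, H⟩ := ih
    obtain ⟨K, hK, HK⟩ := exists_hN_mul_le hℓ (n + 1)
    refine ⟨1 + 4 * C * K, by nlinarith, ?_⟩
    intro α p q h0 h1 hpq f g hf hg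
    have hpq' : p < q := by linarith
    have e : EqOn (dI p q (f * g)) (dI p q f * g + f * dI p q g) (Icc p q) := fun x hx =>
      dI_eq hpq' hx ((hf.hasDeriv hx).mul (hg.hasDeriv hx))
    have hf1 := hf.deriv hpq'
    have hg1 := hg.deriv hpq'
    have k1 := HK h0 h1 hpq hpq hf hg 0 0 1 n (by omega)
    have k2 := HK h0 h1 hpq hpq hf hg 0 0 n 1 (by omega)
    simp only [zero_add] at k1 k2
    have a1 := H h0 h1 hpq hf1 hg
    have a2 := H h0 h1 hpq hf hg1
    rw [hN_succ α p q n (f * g), hN_congr n e]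
    have a3 := hN_add_le hpq' h1 n (hf1.mul hg) (hf.mul hg1) (α := α)
    have a4 := hB_mul_le (hf.holderFin hpq' h1) (hg.holderFin hpq' h1)
    have b1 := hN_deriv_le α p q n f
    have b2 := hN_deriv_le α p q n g
    have b3 := hN_deriv_le α p q 0 f
    have b4 := hN_deriv_le α p q 0 g
    simp only [zero_add] at b3 b4
    have p1 := hN_nonneg α p q 0 f
    have p2 := hN_nonneg α p q 0 g
    have p3 := hN_nonneg α p q n f
    have p4 := hN_nonneg α p q n g
    set X := hN α p q (n + 1) f * hN α p q 0 g + hN α p q 0 f * hN α p q (n + 1) g with hX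
    have q1 : hN α p q (n + 1) f * hN α p q 0 g ≤ X := by
      have := mul_nonneg p1 (hN_nonneg α p q (n + 1) g); linarith
    have q2 : hN α p q 0 f * hN α p q (n + 1) g ≤ X := by
      have := mul_nonneg (hN_nonneg α p q (n + 1) f) p2; linarith
    have hX0 : 0 ≤ X := (mul_nonneg (hN_nonneg α p q (n + 1) f) p2).trans q1
    have c0 : hB α (Icc p q) (f * g) ≤ X := by
      refine a4.trans (le_trans ?_ q1)
      exact mul_le_mul_of_nonneg_right (hB_le_hN _ _ _ _ _) p2
    have c1 : hN α p q n (dI p q f) * hN α p q 0 g ≤ X :=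
      (mul_le_mul_of_nonneg_right b1 p2).trans q1
    have c2 : hN α p q 0 (dI p q f) * hN α p q n g ≤ K * X :=
      (mul_le_mul_of_nonneg_right b3 p4).trans k1
    have c3 : hN α p q n f * hN α p q 0 (dI p q g) ≤ K * X :=
      (mul_le_mul_of_nonneg_left b4 p3).trans k2
    have c4 : hN α p q 0 f * hN α p q n (dI p q g) ≤ X :=
      (mul_le_mul_of_nonneg_left b2 p1).trans q2
    have hKX : X ≤ K * X := le_mul_of_one_le_left hX0 hK
    calc hB α (Icc p q) (f * g) + hN α p q n (dI p q f * g + f * dI p q g)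
        ≤ X + (C * (K * X + K * X) + C * (K * X + K * X)) := by
          refine add_le_add c0 (a3.trans (add_le_add (a1.trans ?_) (a2.trans ?_))) <;>
          · refine mul_le_mul_of_nonneg_left ?_ (by linarith)
            linarith
      _ = _ := by ring

lemma hN_zero_inv_le {c : ℝ} (hc : 0 < c) {α p q : ℝ} (h1 : α ≤ 1) (hpq : p < q) {f : ℝ → ℝ}
    (hf : Sm p q f) (hfc : ∀ x ∈ Icc p q, c ≤ f x) :
    hN α p q 0 f⁻¹ ≤ 1 / c + 1 / c ^ 2 * hN α p q 0 f := by
  have hh := hf.holderFin hpq h1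
  have h0 := holOn_nonneg α (Icc p q) f
  have e1 : holOn α (Icc p q) f ≤ hB α (Icc p q) f := le_add_of_nonneg_left (supOn_nonneg _ _)
  refine (hB_le (α := α) (I := Icc p q) (f := f⁻¹) (A := 1 / c)
    (H := 1 / c ^ 2 * holOn α (Icc p q) f) (by positivity) (by positivity)
    (fun x hx => ?_) (fun x hx y hy => ?_)).trans ?_
  · have := hfc x hx
    rw [Pi.inv_apply, abs_inv, abs_of_pos (by linarith), one_div]
    exact inv_anti₀ hc this
  · have hx' := hfc x hx
    have hy' := hfc y hy
    have e : f⁻¹ x - f⁻¹ y = (f y - f x) / (f x * f y) := by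
      have : f x ≠ 0 := by linarith
      have : f y ≠ 0 := by linarith
      simp only [Pi.inv_apply]; field_simp
    rw [e, abs_div, abs_sub_comm, abs_of_pos (a := f x * f y) (by nlinarith)]
    have h3 : c ^ 2 ≤ f x * f y := by nlinarith
    calc |f x - f y| / (f x * f y) ≤ (holOn α (Icc p q) f * |x - y| ^ α) / c ^ 2 := by
          gcongr
          exact hh.sub_le_holOn hx hy
      _ = _ := by ring
  · rw [hN_zero]
    gcongr

lemma hN_zero_comp_le {α p q p' q' K : ℝ} (h0 : 0 ≤ α) (h1 : α ≤ 1) (hpq : p < q)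
    (hpq' : p' < q') {f g : ℝ → ℝ} (hf : Sm p q f) (hg : Sm p' q' g)
    (hm : MapsTo g (Icc p' q') (Icc p q)) (hK : 1 ≤ K) (hgK : hN α p' q' 1 g ≤ K) :
    hN α p' q' 0 (f ∘ g) ≤ K * hN α p q 0 f := by
  have hh := hf.holderFin hpq h1
  have n1 := holOn_nonneg α (Icc p q) f
  have n2 := supOn_nonneg (Icc p q) f
  refine (hB_le (α := α) (I := Icc p' q') (f := f ∘ g) (A := supOn (Icc p q) f)
    (H := K * holOn α (Icc p q) f) n2 (by positivity)
    (fun x hx => hh.abs_le_supOn (hm hx)) (fun x hx y hy => ?_)).trans ?_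
  · refine (hh.sub_le_holOn (hm hx) (hm hy)).trans ?_
    have hd : ∀ x ∈ Icc p' q', |dI p' q' g x| ≤ K := fun x hx =>
      ((((hg.deriv hpq').holderFin hpq' h1).abs_le hx).trans (hN_deriv_le α p' q' 0 g)).trans hgK
    have hl := hg.lipschitz hd hx hy
    calc holOn α (Icc p q) f * |g x - g y| ^ α ≤ holOn α (Icc p q) f * (K * |x - y|) ^ α := by
          gcongr
      _ = K ^ α * holOn α (Icc p q) f * |x - y| ^ α := by
          rw [Real.mul_rpow (by linarith) (abs_nonneg _)]; ring
      _ ≤ _ := by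
          gcongr
          exact (Real.rpow_le_rpow_of_exponent_le hK h1).trans_eq (Real.rpow_one K)
  · rw [hN_zero, hB]
    nlinarith

lemma exists_hN_comp {ℓ K : ℝ} (hℓ : 0 < ℓ) (hK : 1 ≤ K) (n : ℕ) : ∃ C : ℝ, 1 ≤ C ∧
    ∀ {α p q p' q' : ℝ}, 0 ≤ α → α ≤ 1 → ℓ ≤ q - p → ℓ ≤ q' - p' → ∀ {f g : ℝ → ℝ},
      Sm p q f → Sm p' q' g → MapsTo g (Icc p' q') (Icc p q) → hN α p' q' 1 g ≤ K →
      hN α p' q' n (f ∘ g) ≤ C * (hN α p q n f + hN α p q 1 f * hN α p' q' n g) := by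
  have deriv_comp : ∀ {p q p' q' : ℝ}, p < q → p' < q' → ∀ {f g : ℝ → ℝ}, Sm p q f → Sm p' q' g →
      MapsTo g (Icc p' q') (Icc p q) →
      EqOn (dI p' q' (f ∘ g)) ((dI p q f ∘ g) * dI p' q' g) (Icc p' q') :=
    fun _ hpq' f g hf hg hm x hx =>
      dI_eq hpq' hx ((hf.hasDeriv (hm hx)).comp x (hg.hasDeriv hx) hm)
  induction n with
  | zero =>
    refine ⟨K, hK, ?_⟩
    intro α p q p' q' h0 h1 hpq hpq' f g hf hg hm hgK
    refine (hN_zero_comp_le h0 h1 (by linarith) (by linarith) hf hg hm hK hgK).trans ?_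
    have := mul_nonneg (hN_nonneg α p q 1 f) (hN_nonneg α p' q' 0 g)
    nlinarith
  | succ n ih =>
    obtain ⟨C, hC, H⟩ := ih
    obtain ⟨K₁, hK₁, HK⟩ := exists_hN_mul_le hℓ n
    obtain ⟨M, hM, HM⟩ := exists_hN_mul hℓ n
    set T := M * (C * K * (1 + K₁ * (K + 1)) + K) with hT
    have hT0 : 0 ≤ T := by positivity
    refine ⟨K + T, by linarith, ?_⟩
    intro α p q p' q' h0 h1 hpq hpq' f g hf hg hm hgK
    have i1 : p < q := by linarith
    have i2 : p' < q' := by linarith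
    have hf1 := hf.deriv i1
    have hg1 := hg.deriv i2
    have c0 := hN_zero_comp_le h0 h1 i1 i2 hf hg hm hK hgK
    have c1 := hN_zero_comp_le h0 h1 i1 i2 hf1 hg hm hK hgK
    have sm1 : Sm p' q' (dI p q f ∘ g) := hf1.comp hg hm
    have d1 := H h0 h1 hpq hpq' hf1 hg hm hgK
    have m1 := HM h0 h1 hpq' sm1 hg1
    have b1 := hN_deriv_le α p q n f
    have b2 := hN_deriv_le α p' q' n g
    have b3 : hN α p q 0 (dI p q f) ≤ hN α p q 1 f := hN_deriv_le α p q 0 f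
    have b4 : hN α p' q' 0 (dI p' q' g) ≤ K := (hN_deriv_le α p' q' 0 g).trans hgK
    set X := hN α p q (n + 1) f + hN α p q 1 f * hN α p' q' (n + 1) g with hX
    have hG := hN_nonneg α p' q' (n + 1) g
    have hF := hN_nonneg α p q (n + 1) f
    have hF1 := hN_nonneg α p q 1 f
    have hF1' : hN α p q 1 f ≤ hN α p q (n + 1) f := hN_mono α p q f (by omega : 1 ≤ n + 1)
    have hX1 : hN α p q (n + 1) f ≤ X := by have := mul_nonneg hF1 hG; linarith
    have hX2 : hN α p q 1 f * hN α p' q' (n + 1) g ≤ X := by linarith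
    have hX0 : 0 ≤ X := hF.trans hX1
    have k1 : hN α p' q' n (dI p q f ∘ g) ≤ C * (1 + K₁ * (K + 1)) * X := by
      rcases n with _ | n
      · refine c1.trans ?_
        have hCK : K ≤ C * (1 + K₁ * (K + 1)) := by
          have : K ≤ K₁ * (K + 1) := by nlinarith
          nlinarith
        exact mul_le_mul hCK (b3.trans hX1) (hN_nonneg _ _ _ _ _) (by positivity)
      · refine d1.trans ?_
        rw [mul_assoc]
        refine mul_le_mul_of_nonneg_left ?_ (by linarith)
        have t1 : hN α p q 1 (dI p q f) * hN α p' q' (n + 1) g ≤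
            hN α p q (1 + 1) f * hN α p' q' (1 + n) g := by
          rw [add_comm 1 n]
          exact mul_le_mul_of_nonneg_right (hN_deriv_le α p q 1 f) (hN_nonneg _ _ _ _ _)
        have t2 := HK h0 h1 hpq hpq' hf hg 1 1 1 n (by omega)
        rw [add_comm 1 (n + 1)] at t2
        have t3 : hN α p q (n + 1 + 1) f * hN α p' q' 1 g ≤ hN α p q (n + 1 + 1) f * K :=
          mul_le_mul_of_nonneg_left hgK hF
        have t4 : hN α p q (n + 1 + 1) f * K ≤ K * X := by
          rw [mul_comm]; exact mul_le_mul_of_nonneg_left hX1 (by linarith)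
        have t5 : hN α p q 1 (dI p q f) * hN α p' q' (n + 1) g ≤ K₁ * (K * X + X) :=
          t1.trans (t2.trans (mul_le_mul_of_nonneg_left (by linarith) (by linarith)))
        linarith
    rw [hN_succ α p' q' n (f ∘ g), hN_congr n (deriv_comp i1 i2 hf hg hm)]
    have a0 : hB α (Icc p' q') (f ∘ g) ≤ K * X := by
      refine c0.trans (mul_le_mul_of_nonneg_left (le_trans ?_ hX1) (by linarith))
      exact hN_mono α p q f (Nat.zero_le _)
    have a1 : hN α p' q' n (dI p q f ∘ g * dI p' q' g) ≤ T * X := by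
      refine m1.trans ?_
      rw [hT, mul_assoc M]
      refine mul_le_mul_of_nonneg_left ?_ (by linarith)
      have t1 : hN α p' q' n (dI p q f ∘ g) * hN α p' q' 0 (dI p' q' g) ≤
          C * (1 + K₁ * (K + 1)) * X * K :=
        mul_le_mul k1 b4 (hN_nonneg _ _ _ _ _) (by positivity)
      have t2 : hN α p' q' 0 (dI p q f ∘ g) * hN α p' q' n (dI p' q' g) ≤
          K * hN α p q 1 f * hN α p' q' (n + 1) g :=
        mul_le_mul (c1.trans (mul_le_mul_of_nonneg_left b3 (by linarith))) b2
          (hN_nonneg _ _ _ _ _) (by positivity)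
      have t3 := mul_le_mul_of_nonneg_left hX2 (show 0 ≤ K by linarith)
      linarith
    linarith

/-! ### Comparison of norms -/

lemma hN_le_hN_zero_exp {α p q : ℝ} (hpq : p < q) (h1 : α ≤ 1) (n : ℕ) {f : ℝ → ℝ}
    (hf : Sm p q f) :
    hN α p q n f ≤ (1 + (q - p) ^ (1 - α)) * hN 0 p q (n + 1) f := by
  set c := (q - p) ^ (1 - α) with hcdef
  have hc : 0 ≤ c := Real.rpow_nonneg (by linarith) _
  have key : ∀ n, ∀ f, Sm p q f → hN α p q n f ≤ hN 0 p q n f + c * hN 0 p q n (dI p q f) := by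
    have base : ∀ f, Sm p q f → hB α (Icc p q) f ≤
        hB 0 (Icc p q) f + c * hB 0 (Icc p q) (dI p q f) := fun f hf => by
      have hf0 := hf.holderFin hpq zero_le_one
      have hd := (hf.deriv hpq).holderFin hpq (zero_le_one (α := ℝ))
      have n0 := hB_nonneg 0 (Icc p q) (dI p q f)
      refine hB_le (hB_nonneg _ _ _) (by positivity) (fun x hx => hf0.abs_le hx)
        (fun x hx y hy => ?_)
      refine (hf.lipschitz (fun z hz => hd.abs_le hz) hx hy).trans ?_
      have := mul_le_mul_of_nonneg_left (abs_sub_le_rpow (α := α) h1 hx hy) n0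
      rw [hcdef]
      linarith
    intro n
    induction n with
    | zero => exact base
    | succ n ih =>
      intro f hf
      rw [hN_succ, hN_succ 0 p q n f, hN_succ 0 p q n (dI p q f)]
      have := base f hf
      have := ih _ (hf.deriv hpq)
      linarith
  have := key n f hf
  have a1 := hN_le_succ 0 p q n f
  have a2 := mul_le_mul_of_nonneg_left (hN_deriv_le 0 p q n f) hc
  linarith

lemma hN_zero_exp_le {p q : ℝ} {n : ℕ} {f : ℝ → ℝ} {A : ℝ} (hA : 0 ≤ A)
    (h : ∀ j ≤ n, ∀ x ∈ Icc p q, |(dI p q)^[j] f x| ≤ A) : hN 0 p q n f ≤ 3 * (n + 1) * A := by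
  have base : ∀ f : ℝ → ℝ, (∀ x ∈ Icc p q, |f x| ≤ A) → hB 0 (Icc p q) f ≤ 3 * A := fun f hf => by
    refine (hB_le hA (by positivity : 0 ≤ 2 * A) hf fun x hx y hy => ?_).trans (by linarith)
    rw [Real.rpow_zero]
    linarith [abs_sub (f x) (f y), hf x hx, hf y hy]
  induction n generalizing f with
  | zero => simpa [hN_zero] using base f (h 0 le_rfl)
  | succ n ih =>
    have := ih (f := dI p q f) fun j hj x hx => by
      simpa using h (j + 1) (by omega) x hx
    have := base f (h 0 (by omega))
    rw [hN_succ]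
    push_cast
    linarith

lemma Sm.iterate {p q : ℝ} (hpq : p < q) {f : ℝ → ℝ} (hf : Sm p q f) (j : ℕ) :
    Sm p q ((dI p q)^[j] f) := by
  induction j generalizing f with
  | zero => exact hf
  | succ j ih => exact ih (hf.deriv hpq)

lemma hN_eq_sum (α p q : ℝ) (n : ℕ) (f : ℝ → ℝ) :
    hN α p q n f = ∑ j ∈ Finset.range (n + 1), hB α (Icc p q) ((dI p q)^[j] f) := by
  induction n generalizing f with
  | zero => simp [hN_zero]
  | succ n ih =>
    rw [hN_succ, ih, Finset.sum_range_succ' _ (n + 1), add_comm]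
    rfl

lemma iteratedDerivWithin_eq_dI {p q : ℝ} (f : ℝ → ℝ) (j : ℕ) :
    EqOn (iteratedDerivWithin j f (Icc p q)) ((dI p q)^[j] f) (Icc p q) := by
  induction j generalizing f with
  | zero => intro x _; simp
  | succ j ih =>
    intro x hx
    rw [iteratedDerivWithin_succ']
    exact ih _ hx

lemma holderNorm_Icc_le {α p q : ℝ} (hpq : p < q) (h1 : α ≤ 1) (n : ℕ) {f : ℝ → ℝ}
    (hf : Sm p q f) : holderNorm (Icc p q) α n f ≤ ENNReal.ofReal (hN α p q n f) := by
  have hfin : ∀ j, HolderFin α (Icc p q) ((dI p q)^[j] f) := fun j =>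
    (hf.iterate hpq j).holderFin hpq h1
  rw [hN_eq_sum, ENNReal.ofReal_sum_of_nonneg fun j _ => hB_nonneg _ _ _]
  have e : ∀ j, ENNReal.ofReal (hB α (Icc p q) ((dI p q)^[j] f)) =
      ENNReal.ofReal (supOn (Icc p q) ((dI p q)^[j] f)) +
      ENNReal.ofReal (holOn α (Icc p q) ((dI p q)^[j] f)) := fun j =>
    ENNReal.ofReal_add (supOn_nonneg _ _) (holOn_nonneg _ _ _)
  simp_rw [e]
  rw [Finset.sum_add_distrib]
  refine add_le_add ?_ (Finset.sum_le_sum fun j _ => ?_)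
  · refine iSup₂_le fun j hj => iSup₂_le fun x hx => ?_
    refine le_trans ?_ (Finset.single_le_sum (fun i _ => zero_le) hj)
    rw [← ofReal_norm, norm_iteratedFDerivWithin_eq_norm_iteratedDerivWithin,
      iteratedDerivWithin_eq_dI f j hx]
    exact ENNReal.ofReal_le_ofReal ((hfin j).abs_le_supOn hx)
  · refine iSup₂_le fun x hx => iSup₂_le fun y hy => iSup_le fun hxy => ?_
    have hd : 0 < |x - y| := abs_pos.2 (sub_ne_zero.2 hxy)
    have e1 : edist (iteratedFDerivWithin ℝ j f (Icc p q) x)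
        (iteratedFDerivWithin ℝ j f (Icc p q) y) =
        ENNReal.ofReal |(dI p q)^[j] f x - (dI p q)^[j] f y| := by
      rw [iteratedFDerivWithin_eq_equiv_comp, Function.comp_apply, Function.comp_apply,
        LinearIsometryEquiv.edist_map, iteratedDerivWithin_eq_dI f j hx,
        iteratedDerivWithin_eq_dI f j hy, edist_dist, Real.dist_eq]
    rw [e1, edist_dist, Real.dist_eq, ENNReal.ofReal_rpow_of_pos hd]
    refine ENNReal.div_le_of_le_mul ?_
    rw [← ENNReal.ofReal_mul (holOn_nonneg _ _ _)]
    exact ENNReal.ofReal_le_ofReal ((hfin j).sub_le_holOn hx hy)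

/-! ### Smooth tame maps through Hadamard derivatives -/

section Framework

/-- An increasing family of continuous subadditive gauges. -/
structure IsGr {X : Type*} [AddCommGroup X] [TopologicalSpace X] (p : ℕ → X → ℝ) : Prop where
  nonneg : ∀ n x, 0 ≤ p n x
  mono : ∀ x, Monotone fun n => p n x
  add_le : ∀ n x y, p n (x + y) ≤ p n x + p n y
  cont : ∀ n, Continuous (p n)
  zero : ∀ n, p n 0 = 0

/-- The product grading. -/
def prodGr {X Y : Type*} (p : ℕ → X → ℝ) (q : ℕ → Y → ℝ) (n : ℕ) (z : X × Y) : ℝ :=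
  p n z.1 + q n z.2

/-- The grading of a finite power. -/
def powGr {X : Type*} (p : ℕ → X → ℝ) (k : ℕ) (n : ℕ) (v : Fin k → X) : ℝ := ∑ i, p n (v i)

lemma IsGr.prod {X Y : Type*} [AddCommGroup X] [TopologicalSpace X] [AddCommGroup Y]
    [TopologicalSpace Y] {p : ℕ → X → ℝ} {q : ℕ → Y → ℝ} (hp : IsGr p) (hq : IsGr q) :
    IsGr (prodGr p q) where
  nonneg n x := add_nonneg (hp.nonneg _ _) (hq.nonneg _ _)
  mono x _ _ h := add_le_add (hp.mono x.1 h) (hq.mono x.2 h)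
  add_le n x y := by
    have := hp.add_le n x.1 y.1
    have := hq.add_le n x.2 y.2
    simp only [prodGr, Prod.fst_add, Prod.snd_add]
    linarith
  cont n := ((hp.cont n).comp continuous_fst).add ((hq.cont n).comp continuous_snd)
  zero n := by simp [prodGr, hp.zero, hq.zero]

lemma IsGr.pow {X : Type*} [AddCommGroup X] [TopologicalSpace X] {p : ℕ → X → ℝ} (hp : IsGr p)
    (k : ℕ) : IsGr (powGr p k) where
  nonneg n x := Finset.sum_nonneg fun i _ => hp.nonneg _ _
  mono x _ _ h := Finset.sum_le_sum fun i _ => hp.mono (x i) h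
  add_le n x y := by
    unfold powGr
    rw [← Finset.sum_add_distrib]
    exact Finset.sum_le_sum fun i _ => hp.add_le _ _ _
  cont n := continuous_finsetSum _ fun i _ => (hp.cont n).comp (continuous_apply i)
  zero n := by simp [powGr, hp.zero]

/-- Tameness with respect to real gradings. -/
structure TameMap {X Y : Type*} [TopologicalSpace X] [TopologicalSpace Y]
    (p : ℕ → X → ℝ) (q : ℕ → Y → ℝ) (B : Set X) (P : X → Y) : Prop where
  continuousOn : ContinuousOn P B
  estimate : ∀ u₀ ∈ B, ∃ V ∈ 𝓝 u₀, ∃ r : ℕ, ∀ n, ∃ C : ℝ, ∀ u ∈ V ∩ B,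
    q n (P u) ≤ C * (p (n + r) u + 1)

/-- `P'` is the Hadamard derivative of `P` at the points of `B`. -/
def HasHD {X Y : Type*} [AddCommGroup X] [Module ℝ X] [TopologicalSpace X]
    [AddCommGroup Y] [Module ℝ Y] [TopologicalSpace Y] (B : Set X) (P : X → Y)
    (P' : X × X → Y) : Prop :=
  ∀ u ∈ B, ∀ w, Tendsto (fun z : ℝ × X => z.1⁻¹ • (P (u + z.1 • z.2) - P u))
    (𝓝[≠] 0 ×ˢ 𝓝 w) (𝓝 (P' (u, w)))

/-- `P` is `k` times differentiable on `B` with tame iterated tangent maps. -/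
def SmT {Y : Type} [AddCommGroup Y] [Module ℝ Y] [TopologicalSpace Y] (q : ℕ → Y → ℝ) :
    ℕ → ∀ (X : Type) [AddCommGroup X] [Module ℝ X] [TopologicalSpace X],
      (ℕ → X → ℝ) → Set X → (X → Y) → Prop
  | 0, _, _, _, _, p, B, P => TameMap p q B P
  | k + 1, X, _, _, _, p, B, P => TameMap p q B P ∧ ∃ P' : X × X → Y,
      HasHD B P P' ∧ SmT q k (X × X) (prodGr p p) (B ×ˢ univ) P'

variable {X Y Z : Type}
  [AddCommGroup X] [Module ℝ X] [TopologicalSpace X]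
  [AddCommGroup Y] [Module ℝ Y] [TopologicalSpace Y]
  [AddCommGroup Z] [Module ℝ Z] [TopologicalSpace Z]
  {p : ℕ → X → ℝ} {q : ℕ → Y → ℝ} {r : ℕ → Z → ℝ}

lemma SmT.tameMap {k : ℕ} {B : Set X} {P : X → Y} (h : SmT q k X p B P) : TameMap p q B P := by
  cases k with
  | zero => exact h
  | succ k => exact h.1

lemma SmT.of_succ {k : ℕ} {B : Set X} {P : X → Y} (h : SmT q (k + 1) X p B P) :
    SmT q k X p B P := by
  revert X
  induction k with
  | zero => intro X _ _ _ p B P h; exact h.1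
  | succ k ih =>
    intro X _ _ _ p B P h
    obtain ⟨h1, P', h2, h3⟩ := h
    exact ⟨h1, P', h2, ih h3⟩

lemma TameMap.mono {B B' : Set X} {P : X → Y} (h : TameMap p q B P) (hB : B' ⊆ B) :
    TameMap p q B' P where
  continuousOn := h.continuousOn.mono hB
  estimate u hu := by
    obtain ⟨V, hV, r, H⟩ := h.estimate u (hB hu)
    refine ⟨V, hV, r, fun n => ?_⟩
    obtain ⟨C, hC⟩ := H n
    exact ⟨C, fun u hu => hC u ⟨hu.1, hB hu.2⟩⟩

lemma SmT.mono {k : ℕ} {B B' : Set X} {P : X → Y} (h : SmT q k X p B P) (hB : B' ⊆ B) :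
    SmT q k X p B' P := by
  revert X
  induction k with
  | zero => intro X _ _ _ p B B' P h hB; exact TameMap.mono h hB
  | succ k ih =>
    intro X _ _ _ p B B' P h hB
    obtain ⟨h1, P', h2, h3⟩ := h
    exact ⟨h1.mono hB, P', fun u hu => h2 u (hB hu), ih h3 (prod_mono hB subset_rfl)⟩

lemma TameMap.congr {B : Set X} {P P₂ : X → Y} (h : TameMap p q B P) (he : EqOn P₂ P B) :
    TameMap p q B P₂ where
  continuousOn := h.continuousOn.congr he
  estimate u hu := by
    obtain ⟨V, hV, r, H⟩ := h.estimate u hu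
    refine ⟨V, hV, r, fun n => ?_⟩
    obtain ⟨C, hC⟩ := H n
    exact ⟨C, fun u hu => by rw [he hu.2]; exact hC u hu⟩

variable [IsTopologicalAddGroup X] [ContinuousSMul ℝ X]

lemma tendsto_add_smul (u w : X) :
    Tendsto (fun z : ℝ × X => u + z.1 • z.2) (𝓝[≠] 0 ×ˢ 𝓝 w) (𝓝 u) := by
  have h : Tendsto (fun z : ℝ × X => u + z.1 • z.2) (𝓝 (0, w)) (𝓝 (u + (0 : ℝ) • w)) :=
    Continuous.tendsto (by fun_prop) ((0 : ℝ), w)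
  rw [zero_smul, add_zero, nhds_prod_eq] at h
  exact h.mono_left (prod_mono_left _ nhdsWithin_le_nhds)

lemma HasHD.congr {B : Set X} (hB : IsOpen B)
    {P P₂ : X → Y} {P' : X × X → Y} (h : HasHD B P P') (he : EqOn P₂ P B) : HasHD B P₂ P' := by
  intro u hu w
  refine (h u hu w).congr' ?_
  filter_upwards [(tendsto_add_smul u w).eventually (hB.mem_nhds hu)] with z hz
  rw [he hz, he hu]

lemma HasHD.unique [T2Space Y] {B : Set X} {P : X → Y} {P' P'' : X × X → Y} (h : HasHD B P P')
    (h' : HasHD B P P'') : EqOn P' P'' (B ×ˢ univ) := by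
  rintro ⟨u, w⟩ ⟨hu, -⟩
  exact tendsto_nhds_unique (h u hu w) (h' u hu w)

lemma HasHD.gateaux {B : Set X} {P : X → Y} {P' : X × X → Y} (h : HasHD B P P') {u : X}
    (hu : u ∈ B) (w : X) :
    Tendsto (fun t : ℝ => t⁻¹ • (P (u + t • w) - P u)) (𝓝[≠] 0) (𝓝 (P' (u, w))) :=
  (h u hu w).comp (tendsto_id.prodMk tendsto_const_nhds)

lemma SmT.congr {k : ℕ} {B : Set X} (hB : IsOpen B)
    {P P₂ : X → Y} (h : SmT q k X p B P) (he : EqOn P₂ P B) : SmT q k X p B P₂ := by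
  cases k with
  | zero => exact TameMap.congr h he
  | succ k =>
    obtain ⟨h1, P', h2, h3⟩ := h
    exact ⟨h1.congr he, P', h2.congr hB he, h3⟩

lemma SmT.linear (hp : IsGr p)
    (L : X →ₗ[ℝ] Y) (hL : Continuous L)
    (hb : ∃ s : ℕ, ∀ n, ∃ C : ℝ, ∀ x, q n (L x) ≤ C * p (n + s) x) (k : ℕ) (B : Set X) :
    SmT q k X p B L := by
  revert X
  induction k with
  | zero =>
    intro X _ _ _ p _ _ hp L hL ⟨s, hb⟩ B
    refine ⟨hL.continuousOn, fun u _ => ⟨univ, univ_mem, s, fun n => ?_⟩⟩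
    obtain ⟨C, hC⟩ := hb n
    refine ⟨|C|, fun u _ => (hC u).trans ?_⟩
    have := hp.nonneg (n + s) u
    calc C * p (n + s) u ≤ |C| * p (n + s) u := by gcongr; exact le_abs_self C
      _ ≤ _ := by gcongr; linarith
  | succ k ih =>
    intro X _ _ _ p _ _ hp L hL hb B
    have h0 := ih hp L hL hb B
    refine ⟨h0.tameMap, fun z => L z.2, fun u _ w => ?_, ?_⟩
    · have : Tendsto (fun z : ℝ × X => L z.2) (𝓝[≠] 0 ×ˢ 𝓝 w) (𝓝 (L w)) :=
        (hL.tendsto w).comp tendsto_snd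
      refine this.congr' ?_
      have : ∀ᶠ z : ℝ × X in 𝓝[≠] 0 ×ˢ 𝓝 w, z.1 ≠ 0 :=
        tendsto_fst.eventually (self_mem_nhdsWithin : {(0 : ℝ)}ᶜ ∈ 𝓝[≠] (0 : ℝ))
      filter_upwards [this] with z hz
      rw [map_add, map_smul, add_sub_cancel_left, smul_smul, inv_mul_cancel₀ hz, one_smul]
    · refine ih (hp.prod hp) (L ∘ₗ LinearMap.snd ℝ X X) (hL.comp continuous_snd) ?_ _
      obtain ⟨s, hb⟩ := hb
      refine ⟨s, fun n => ?_⟩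
      obtain ⟨C, hC⟩ := hb n
      refine ⟨|C|, fun z => (hC z.2).trans ?_⟩
      have h1 := hp.nonneg (n + s) z.1
      have h2 := hp.nonneg (n + s) z.2
      calc C * p (n + s) z.2 ≤ |C| * p (n + s) z.2 := by gcongr; exact le_abs_self C
        _ ≤ _ := by unfold prodGr; gcongr; linarith

lemma TameMap.pair {p : ℕ → X → ℝ} (hp : IsGr p) {B : Set X} {P : X → Y} {Q : X → Z}
    (hP : TameMap p q B P) (hQ : TameMap p r B Q) :
    TameMap p (prodGr q r) B (fun x => (P x, Q x)) where
  continuousOn := hP.continuousOn.prodMk hQ.continuousOn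
  estimate u hu := by
    obtain ⟨V, hV, s, H⟩ := hP.estimate u hu
    obtain ⟨V', hV', s', H'⟩ := hQ.estimate u hu
    refine ⟨V ∩ V', inter_mem hV hV', s + s', fun n => ?_⟩
    obtain ⟨C, hC⟩ := H n
    obtain ⟨C', hC'⟩ := H' n
    refine ⟨|C| + |C'|, fun x hx => ?_⟩
    have h1 := hC x ⟨hx.1.1, hx.2⟩
    have h2 := hC' x ⟨hx.1.2, hx.2⟩
    have m1 := hp.mono x (show n + s ≤ n + (s + s') by omega)
    have m2 := hp.mono x (show n + s' ≤ n + (s + s') by omega)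
    simp only at m1 m2
    have n1 := hp.nonneg (n + s) x
    have n2 := hp.nonneg (n + s') x
    have e1 : C * (p (n + s) x + 1) ≤ |C| * (p (n + (s + s')) x + 1) := by
      gcongr
      exact le_abs_self C
    have e2 : C' * (p (n + s') x + 1) ≤ |C'| * (p (n + (s + s')) x + 1) := by
      gcongr
      exact le_abs_self C'
    simp only [prodGr]
    linarith

lemma SmT.pair {p : ℕ → X → ℝ} (hp : IsGr p) {k : ℕ} {B : Set X} {P : X → Y} {Q : X → Z}
    (hP : SmT q k X p B P) (hQ : SmT r k X p B Q) :
    SmT (prodGr q r) k X p B (fun x => (P x, Q x)) := by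
  revert X
  induction k with
  | zero => intro X _ _ _ _ _ p hp B P Q hP hQ; exact TameMap.pair hp hP hQ
  | succ k ih =>
    intro X _ _ _ _ _ p hp B P Q hP hQ
    obtain ⟨h1, P', h2, h3⟩ := hP
    obtain ⟨g1, Q', g2, g3⟩ := hQ
    exact ⟨h1.pair hp g1, fun z => (P' z, Q' z), fun u hu w =>
      ((h2 u hu w).prodMk_nhds (g2 u hu w)), ih (hp.prod hp) h3 g3⟩

lemma TameMap.comp (hp : IsGr p) (hq : IsGr q) {B : Set X} {C : Set Y}
    {P : X → Y} {G : Y → Z} (hG : TameMap q r C G) (hP : TameMap p q B P) (hm : MapsTo P B C) :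
    TameMap p r B (G ∘ P) where
  continuousOn := hG.continuousOn.comp hP.continuousOn hm
  estimate u hu := by
    obtain ⟨V, hV, s, H⟩ := hP.estimate u hu
    obtain ⟨V', hV', s', H'⟩ := hG.estimate (P u) (hm hu)
    obtain ⟨V'', hV'', hsub⟩ := mem_nhdsWithin_iff_exists_mem_nhds_inter.1
      (hP.continuousOn u hu hV')
    refine ⟨V ∩ V'', inter_mem hV hV'', s' + s, fun n => ?_⟩
    obtain ⟨K', hK'⟩ := H' n
    obtain ⟨K, hK⟩ := H (n + s')
    refine ⟨|K'| * (|K| + 1), fun x hx => ?_⟩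
    have h1 := hK' (P x) ⟨hsub ⟨hx.1.2, hx.2⟩, hm hx.2⟩
    have h2 := hK x ⟨hx.1.1, hx.2⟩
    rw [add_assoc] at h2
    have n2 := hp.nonneg (n + (s' + s)) x
    have e2 : q (n + s') (P x) ≤ |K| * (p (n + (s' + s)) x + 1) :=
      h2.trans (by gcongr; exact le_abs_self K)
    have e3 : q (n + s') (P x) + 1 ≤ (|K| + 1) * (p (n + (s' + s)) x + 1) := by nlinarith
    have h0 : 0 ≤ q (n + s') (P x) + 1 := by linarith [hq.nonneg (n + s') (P x)]
    calc r n ((G ∘ P) x) ≤ |K'| * (q (n + s') (P x) + 1) :=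
          h1.trans (by gcongr; exact le_abs_self K')
      _ ≤ |K'| * ((|K| + 1) * (p (n + (s' + s)) x + 1)) := by gcongr
      _ = _ := by ring

lemma SmT.comp (hp : IsGr p) (hq : IsGr q)
    {k : ℕ} {B : Set X} {C : Set Y} {P : X → Y} {G : Y → Z} (hG : SmT r k Y q C G)
    (hP : SmT q k X p B P) (hm : MapsTo P B C) : SmT r k X p B (G ∘ P) := by
  revert X Y Z
  induction k with
  | zero => intro X Y Z _ _ _ _ _ _ _ _ _ p q r _ _ hp hq B C P G hG hP hm; exact TameMap.comp hp hq hG hP hm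
  | succ k ih =>
    intro X Y Z _ _ _ _ _ _ _ _ _ p q r _ _ hp hq B C P G hG hP hm
    have hPk := hP.of_succ
    obtain ⟨h1, P', h2, h3⟩ := hP
    obtain ⟨g1, G', g2, g3⟩ := hG
    refine ⟨g1.comp hp hq h1 hm, fun z => G' (P z.1, P' z), fun u hu w => ?_, ?_⟩
    · have key : Tendsto (fun z : ℝ × X => (z.1, z.1⁻¹ • (P (u + z.1 • z.2) - P u)))
          (𝓝[≠] 0 ×ˢ 𝓝 w) (𝓝[≠] 0 ×ˢ 𝓝 (P' (u, w))) := tendsto_fst.prodMk (h2 u hu w)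
      refine ((g2 (P u) (hm hu) (P' (u, w))).comp key).congr' ?_
      have : ∀ᶠ z : ℝ × X in 𝓝[≠] 0 ×ˢ 𝓝 w, z.1 ≠ 0 :=
        tendsto_fst.eventually (self_mem_nhdsWithin : {(0 : ℝ)}ᶜ ∈ 𝓝[≠] (0 : ℝ))
      filter_upwards [this] with z hz
      simp only [Function.comp_apply]
      rw [smul_smul, mul_inv_cancel₀ hz, one_smul, add_sub_cancel]
    · have hfst : SmT p k (X × X) (prodGr p p) (B ×ˢ univ) (LinearMap.fst ℝ X X) :=
        SmT.linear (hp.prod hp) (LinearMap.fst ℝ X X) continuous_fst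
          ⟨0, fun n => ⟨1, fun z => by
            rw [one_mul]; exact le_add_of_nonneg_right (hp.nonneg _ _)⟩⟩ k _
      have hP1 : SmT q k (X × X) (prodGr p p) (B ×ˢ univ) (P ∘ LinearMap.fst ℝ X X) :=
        ih (hp.prod hp) hp hPk hfst (fun z hz => hz.1)
      exact ih (hp.prod hp) (hq.prod hq) g3 (SmT.pair (hp.prod hp) hP1 h3)
        (fun z hz => ⟨hm hz.1, mem_univ _⟩)

/-- Infinitely often differentiable with tame tangent maps. -/
def SmTame (q : ℕ → Y → ℝ) (p : ℕ → X → ℝ) (B : Set X) (P : X → Y) : Prop :=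
  ∀ k, SmT q k X p B P

lemma SmTame.comp (hp : IsGr p) (hq : IsGr q)
    {B : Set X} {C : Set Y} {P : X → Y} {G : Y → Z} (hG : SmTame r q C G)
    (hP : SmTame q p B P) (hm : MapsTo P B C) : SmTame r p B (G ∘ P) :=
  fun k => SmT.comp hp hq (hG k) (hP k) hm

lemma SmTame.exists_deriv [T2Space Y]
    {B : Set X} (hB : IsOpen B) {P : X → Y} (h : SmTame q p B P) :
    ∃ P' : X × X → Y, HasHD B P P' ∧ SmTame q (prodGr p p) (B ×ˢ univ) P' := by
  obtain ⟨-, P', h2, -⟩ := h 1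
  refine ⟨P', h2, fun k => ?_⟩
  obtain ⟨-, P'', g2, g3⟩ := h (k + 1)
  exact g3.congr (hB.prod isOpen_univ) (h2.unique g2)

lemma SmTame.of_linear (hp : IsGr p)
    (L : X →ₗ[ℝ] Y) (hL : Continuous L)
    (hb : ∃ s : ℕ, ∀ n, ∃ C : ℝ, ∀ x, q n (L x) ≤ C * p (n + s) x) (B : Set X) :
    SmTame q p B L := fun k => SmT.linear hp L hL hb k B

lemma SmTame.of_linear_le (hp : IsGr p)
    (L : X →ₗ[ℝ] Y) (hL : Continuous L) (hb : ∀ n x, q n (L x) ≤ p n x) (B : Set X) :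
    SmTame q p B L :=
  SmTame.of_linear hp L hL ⟨0, fun n => ⟨1, fun x => by rw [one_mul]; exact hb n x⟩⟩ B

variable [IsTopologicalAddGroup Y] [ContinuousSMul ℝ Y] [IsTopologicalAddGroup Z]
  [ContinuousSMul ℝ Z]

lemma SmTame.fst (hp : IsGr p) (hq : IsGr q) (B : Set (X × Y)) :
    SmTame p (prodGr p q) B Prod.fst :=
  SmTame.of_linear_le (hp.prod hq) (LinearMap.fst ℝ X Y) continuous_fst
    (fun _ _ => le_add_of_nonneg_right (hq.nonneg _ _)) B

lemma SmTame.snd (hp : IsGr p) (hq : IsGr q) (B : Set (X × Y)) :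
    SmTame q (prodGr p q) B Prod.snd :=
  SmTame.of_linear_le (hp.prod hq) (LinearMap.snd ℝ X Y) continuous_snd
    (fun _ _ => le_add_of_nonneg_left (hp.nonneg _ _)) B

lemma SmTame.congr {B : Set X} (hB : IsOpen B)
    {P P₂ : X → Y} (h : SmTame q p B P) (he : EqOn P₂ P B) : SmTame q p B P₂ :=
  fun k => SmT.congr hB (h k) he

lemma SmTame.add_fst_snd (hr : IsGr r) :
    SmTame r (prodGr r r) univ (fun z : Z × Z => z.1 + z.2) :=
  SmTame.of_linear_le (hr.prod hr) (LinearMap.fst ℝ Z Z + LinearMap.snd ℝ Z Z)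
    (continuous_fst.add continuous_snd) (fun n z => hr.add_le n z.1 z.2) univ

lemma SmT.add (hp : IsGr p) (hr : IsGr r) {k : ℕ} {B : Set X} {P Q : X → Z}
    (hP : SmT r k X p B P) (hQ : SmT r k X p B Q) : SmT r k X p B (fun x => P x + Q x) :=
  SmT.comp hp (hr.prod hr) (SmTame.add_fst_snd hr k) (SmT.pair hp hP hQ) (mapsTo_univ _ _)

lemma SmT.const_smul (hp : IsGr p) (hr : IsGr r) (hs : ∀ (c : ℝ) n z, r n (c • z) = |c| * r n z)
    {k : ℕ} {B : Set X} {P : X → Z} (hP : SmT r k X p B P) (c : ℝ) :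
    SmT r k X p B (fun x => c • P x) :=
  SmT.comp hp hr (SmT.linear hr (c • LinearMap.id) (continuous_const_smul c)
    ⟨0, fun n => ⟨|c|, fun z => (hs c n z).le⟩⟩ k univ) hP (mapsTo_univ _ _)

lemma SmT.const (hp : IsGr p)
    (hq : ∀ n, q n 0 = 0) (y : Y) (k : ℕ) (B : Set X) : SmT q k X p B fun _ => y := by
  have hT : TameMap p q B fun _ => y :=
    ⟨continuousOn_const, fun u _ => ⟨univ, univ_mem, 0, fun n => ⟨|q n y|, fun u _ =>
      (le_abs_self _).trans (le_mul_of_one_le_right (abs_nonneg _)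
        (le_add_of_nonneg_left (hp.nonneg _ _)))⟩⟩⟩
  cases k with
  | zero => exact hT
  | succ k =>
    refine ⟨hT, fun _ => 0, fun u _ w => ?_, ?_⟩
    · simp only [sub_self, smul_zero]
      exact tendsto_const_nhds
    · exact SmT.linear (hp.prod hp) (0 : X × X →ₗ[ℝ] Y) continuous_const
        ⟨0, fun n => ⟨0, fun x => by simp [hq]⟩⟩ k _

/-- Bounded bilinear maps are smooth tame. -/
lemma SmTame.bilinear (hp : IsGr p) (hq : IsGr q) (hr : IsGr r) (b : X →ₗ[ℝ] Y →ₗ[ℝ] Z)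
    (hb : Continuous fun z : X × Y => b z.1 z.2)
    (hb' : ∀ n, ∃ C : ℝ, ∀ x y, r n (b x y) ≤ C * (p n x * q 0 y + p 0 x * q n y)) :
    SmTame r (prodGr p q) univ (fun z : X × Y => b z.1 z.2) := by
  have hpq := hp.prod hq
  have tame : TameMap (prodGr p q) r univ (fun z : X × Y => b z.1 z.2) := by
    refine ⟨hb.continuousOn, fun z _ => ?_⟩
    refine ⟨{w : X × Y | prodGr p q 0 w < prodGr p q 0 z + 1},
      (isOpen_lt (hpq.cont 0) continuous_const).mem_nhds (by simp), 0, fun n => ?_⟩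
    obtain ⟨C, hC⟩ := hb' n
    refine ⟨|C| * (prodGr p q 0 z + 1), fun w hw => (hC w.1 w.2).trans ?_⟩
    have h1 : prodGr p q 0 w < prodGr p q 0 z + 1 := hw.1
    have n1 := hp.nonneg n w.1
    have n2 := hq.nonneg n w.2
    have n3 := hp.nonneg 0 w.1
    have n4 := hq.nonneg 0 w.2
    simp only [prodGr] at h1 ⊢
    have e : p n w.1 * q 0 w.2 + p 0 w.1 * q n w.2 ≤
        (p 0 z.1 + q 0 z.2 + 1) * (p n w.1 + q n w.2 + 1) := by nlinarith
    have e0 : 0 ≤ p n w.1 * q 0 w.2 + p 0 w.1 * q n w.2 := by positivity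
    calc _ ≤ |C| * (p n w.1 * q 0 w.2 + p 0 w.1 * q n w.2) := by gcongr; exact le_abs_self C
      _ ≤ |C| * ((p 0 z.1 + q 0 z.2 + 1) * (p n w.1 + q n w.2 + 1)) := by gcongr
      _ = _ := by ring_nf
  intro k
  induction k with
  | zero => exact tame
  | succ k ih =>
    refine ⟨tame, fun z => b z.1.1 z.2.2 + b z.2.1 z.1.2, fun u _ w => ?_, ?_⟩
    · have hc : Continuous fun z : ℝ × (X × Y) =>
          b u.1 z.2.2 + b z.2.1 u.2 + z.1 • b z.2.1 z.2.2 := by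
        have c1 : Continuous fun z : ℝ × (X × Y) => b u.1 z.2.2 :=
          hb.comp (continuous_const.prodMk (continuous_snd.comp continuous_snd))
        have c2 : Continuous fun z : ℝ × (X × Y) => b z.2.1 u.2 :=
          hb.comp ((continuous_fst.comp continuous_snd).prodMk continuous_const)
        have c3 : Continuous fun z : ℝ × (X × Y) => b z.2.1 z.2.2 := hb.comp continuous_snd
        exact (c1.add c2).add (continuous_fst.smul c3)
      have h : Tendsto (fun z : ℝ × (X × Y) =>
          b u.1 z.2.2 + b z.2.1 u.2 + z.1 • b z.2.1 z.2.2) (𝓝[≠] 0 ×ˢ 𝓝 w)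
          (𝓝 (b u.1 w.2 + b w.1 u.2)) := by
        have := hc.tendsto ((0 : ℝ), w)
        rw [zero_smul, add_zero, nhds_prod_eq] at this
        exact this.mono_left (prod_mono_left _ nhdsWithin_le_nhds)
      refine h.congr' ?_
      have : ∀ᶠ z : ℝ × (X × Y) in 𝓝[≠] 0 ×ˢ 𝓝 w, z.1 ≠ 0 :=
        tendsto_fst.eventually (self_mem_nhdsWithin : {(0 : ℝ)}ᶜ ∈ 𝓝[≠] (0 : ℝ))
      filter_upwards [this] with z hz
      simp only [Prod.fst_add, Prod.snd_add, Prod.smul_fst, Prod.smul_snd, map_add, map_smul,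
        LinearMap.add_apply, LinearMap.smul_apply]
      rw [eq_inv_smul_iff₀ hz]
      simp only [smul_add]
      abel
    · have A : ∀ L : ((X × Y) × (X × Y)) →ₗ[ℝ] X × Y, Continuous L →
          (∀ n z, prodGr p q n (L z) ≤ prodGr (prodGr p q) (prodGr p q) n z) →
          SmT r k _ (prodGr (prodGr p q) (prodGr p q)) univ
            ((fun z : X × Y => b z.1 z.2) ∘ L) := fun L hL hn =>
        SmT.comp (hpq.prod hpq) hpq ih (SmT.linear (hpq.prod hpq) L hL
          ⟨0, fun n => ⟨1, fun z => by rw [one_mul]; exact hn n z⟩⟩ k univ) (mapsTo_univ _ _)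
      have nn : ∀ n (z : (X × Y) × (X × Y)), 0 ≤ p n z.1.1 ∧ 0 ≤ p n z.2.1 ∧ 0 ≤ q n z.1.2 ∧
          0 ≤ q n z.2.2 := fun n z => ⟨hp.nonneg _ _, hp.nonneg _ _, hq.nonneg _ _, hq.nonneg _ _⟩
      have A1 := A ((LinearMap.fst ℝ X Y ∘ₗ LinearMap.fst ℝ _ _).prod
        (LinearMap.snd ℝ X Y ∘ₗ LinearMap.snd ℝ _ _))
        ((continuous_fst.comp continuous_fst).prodMk (continuous_snd.comp continuous_snd))
        (fun n z => by
          have := nn n z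
          change p n z.1.1 + q n z.2.2 ≤ p n z.1.1 + q n z.1.2 + (p n z.2.1 + q n z.2.2)
          linarith)
      have A2 := A ((LinearMap.fst ℝ X Y ∘ₗ LinearMap.snd ℝ _ _).prod
        (LinearMap.snd ℝ X Y ∘ₗ LinearMap.fst ℝ _ _))
        ((continuous_fst.comp continuous_snd).prodMk (continuous_snd.comp continuous_fst))
        (fun n z => by
          have := nn n z
          change p n z.2.1 + q n z.1.2 ≤ p n z.1.1 + q n z.1.2 + (p n z.2.1 + q n z.2.2)
          linarith)
      have := SmT.comp (hpq.prod hpq) (hr.prod hr) (SmTame.add_fst_snd hr k) (SmT.pair (hpq.prod hpq) A1 A2)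
        (mapsTo_univ _ _)
      exact this.mono (subset_univ _)

/-! ### Successive directional derivatives -/

/-- The successive directional derivatives, as iterated limits. -/
def iterGateaux (P : X → Y) : ∀ k : ℕ, X → (Fin k → X) → Y
  | 0, u, _ => P u
  | k + 1, u, v => @limUnder _ _ _ ⟨P u⟩ (𝓝[≠] (0 : ℝ)) fun t : ℝ =>
      t⁻¹ • (iterGateaux P k (u + t • v (Fin.last k)) (fun i => v i.castSucc)
        - iterGateaux P k u (fun i => v i.castSucc))

lemma iterGateaux_succ_of_tendsto [T2Space Y] (P : X → Y) (k : ℕ) (u : X) (v : Fin (k + 1) → X)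
    {y : Y} (h : Tendsto (fun t : ℝ =>
      t⁻¹ • (iterGateaux P k (u + t • v (Fin.last k)) (fun i => v i.castSucc)
        - iterGateaux P k u (fun i => v i.castSucc))) (𝓝[≠] 0) (𝓝 y)) :
    iterGateaux P (k + 1) u v = y := by
  simp only [iterGateaux]
  exact @Tendsto.limUnder_eq _ _ _ _ _ _ _ _ h

lemma iterGateaux_smTame [T2Space Y]
    (hp : IsGr p) {B : Set X} (hB : IsOpen B) {P : X → Y} (h : SmTame q p B P)
    (k : ℕ) :
    SmTame q (prodGr p (powGr p k)) (B ×ˢ univ)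
      (fun z : X × (Fin k → X) => iterGateaux P k z.1 z.2) ∧
    ∀ u ∈ B, ∀ (v : Fin k → X) (w : X),
      Tendsto (fun t : ℝ => t⁻¹ • (iterGateaux P k (u + t • w) v - iterGateaux P k u v)) (𝓝[≠] 0)
        (𝓝 (iterGateaux P (k + 1) u (Fin.snoc (α := fun _ => X) v w))) := by
  have step : ∀ k, SmTame q (prodGr p (powGr p k)) (B ×ˢ univ)
      (fun z : X × (Fin k → X) => iterGateaux P k z.1 z.2) → ∃ F' : (X × (Fin k → X)) ×
        (X × (Fin k → X)) → Y, SmTame q (prodGr (prodGr p (powGr p k)) (prodGr p (powGr p k)))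
        ((B ×ˢ univ) ×ˢ univ) F' ∧ (∀ u ∈ B, ∀ (v : Fin k → X) (w : X),
      Tendsto (fun t : ℝ => t⁻¹ • (iterGateaux P k (u + t • w) v - iterGateaux P k u v)) (𝓝[≠] 0)
        (𝓝 (F' ((u, v), (w, 0))))) := fun k hk => by
    obtain ⟨F', h1, h2⟩ := hk.exists_deriv (hB.prod isOpen_univ)
    refine ⟨F', h2, fun u hu v w => ?_⟩
    have := h1.gateaux (u := (u, v)) ⟨hu, mem_univ _⟩ (w, 0)
    simpa using this
  have main : ∀ k, SmTame q (prodGr p (powGr p k)) (B ×ˢ univ)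
      (fun z : X × (Fin k → X) => iterGateaux P k z.1 z.2) := fun k => by
    induction k with
    | zero => exact h.comp (hp.prod (hp.pow 0)) hp (SmTame.fst hp (hp.pow 0) _) (fun z hz => hz.1)
    | succ k ih =>
      obtain ⟨F', h1, h2⟩ := step k ih
      let L : (X × (Fin (k + 1) → X)) →ₗ[ℝ] (X × (Fin k → X)) × (X × (Fin k → X)) :=
        { toFun := fun z => ((z.1, fun i => z.2 i.castSucc), (z.2 (Fin.last k), 0))
          map_add' := fun x y => by ext <;> simp
          map_smul' := fun c x => by ext <;> simp }
      have hL : Continuous L := by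
        refine (continuous_fst.prodMk ?_).prodMk (Continuous.prodMk ?_ continuous_const)
        · exact continuous_pi fun i => (continuous_apply _).comp continuous_snd
        · exact (continuous_apply _).comp continuous_snd
      have hLt := SmTame.of_linear_le (q := prodGr (prodGr p (powGr p k)) (prodGr p (powGr p k)))
        (hp.prod (hp.pow (k + 1))) L hL (fun n z => by
          have e : powGr p (k + 1) n z.2 =
              powGr p k n (fun i => z.2 i.castSucc) + p n (z.2 (Fin.last k)) :=
            Fin.sum_univ_castSucc _
          have e2 : powGr p k n 0 = 0 := (hp.pow k).zero n
          change p n z.1 + powGr p k n (fun i => z.2 i.castSucc) +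
            (p n (z.2 (Fin.last k)) + powGr p k n 0) ≤ p n z.1 + powGr p (k + 1) n z.2
          rw [e, e2]
          linarith) (B ×ˢ univ)
      refine (h1.comp (hp.prod (hp.pow _)) ((hp.prod (hp.pow k)).prod (hp.prod (hp.pow k)))
        hLt (fun z hz => ⟨⟨hz.1, mem_univ _⟩, mem_univ _⟩)).congr (hB.prod isOpen_univ) ?_
      rintro ⟨u, v⟩ ⟨hu, -⟩
      exact iterGateaux_succ_of_tendsto P k u v (h2 u hu _ _)
  refine ⟨main k, fun u hu v w => ?_⟩
  obtain ⟨F', -, h2⟩ := step k (main k)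
  rw [iterGateaux_succ_of_tendsto P k u (Fin.snoc (α := fun _ => X) v w)
    (y := F' ((u, v), (w, 0)))]
  · exact h2 u hu v w
  · simpa using h2 u hu v w

/-- A map that is smooth tame near every point of an open set with respect to gradings dominated
by `p'` is smooth tame there. -/
lemma isSmoothTameOn_of_local [T2Space Y]
    {p' : ℕ → X → ℝ≥0∞} {q' : ℕ → Y → ℝ≥0∞} (hq' : ∀ n y, q' n y ≤ ENNReal.ofReal (q n y))
    {B : Set X} (hB : IsOpen B) {P : X → Y}
    (h : ∀ u₀ ∈ B, ∃ O ⊆ B, IsOpen O ∧ u₀ ∈ O ∧ ∃ p : ℕ → X → ℝ, IsGr p ∧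
      (∃ s : ℕ, ∀ n, ∃ C : ℝ≥0, ∀ x, ENNReal.ofReal (p n x) ≤ C * p' (n + s) x) ∧
      SmTame q p O P) :
    IsSmoothTameOn p' q' B P (iterGateaux P) where
  isOpen := hB
  zero _ _ _ := rfl
  deriv k u hu v w := by
    obtain ⟨O, -, hO, huO, p, hp, -, hs⟩ := h u hu
    exact (iterGateaux_smTame hp hO hs k).2 u huO v w
  tame k := by
    refine ⟨fun z hz => ?_, fun z hz => ?_⟩
    · obtain ⟨O, -, hO, huO, p, hp, -, hs⟩ := h z.1 hz.1
      have := ((iterGateaux_smTame hp hO hs k).1 0).tameMap.continuousOn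
      exact (this.continuousAt ((hO.prod isOpen_univ).mem_nhds ⟨huO, mem_univ _⟩)).continuousWithinAt
    · obtain ⟨O, -, hO, huO, p, hp, ⟨s, hps⟩, hs⟩ := h z.1 hz.1
      have ht := ((iterGateaux_smTame hp hO hs k).1 0).tameMap
      obtain ⟨V, hV, r, H⟩ := ht.estimate z ⟨huO, mem_univ _⟩
      refine ⟨V ∩ O ×ˢ univ, inter_mem hV ((hO.prod isOpen_univ).mem_nhds ⟨huO, mem_univ _⟩),
        r + s, 0, fun n _ => ?_⟩
      obtain ⟨C, hC⟩ := H n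
      obtain ⟨K, hK⟩ := hps (n + r)
      refine ⟨Real.toNNReal |C| * (K + 1), fun x hx => ?_⟩
      have h1 := hC x ⟨hx.1.1, hx.1.2⟩
      have n1 := hp.nonneg (n + r)
      have n2 := (hp.pow k).nonneg (n + r)
      have h2 : q n (iterGateaux P k x.1 x.2) ≤
          |C| * (p (n + r) x.1 + powGr p k (n + r) x.2 + 1) := by
        refine h1.trans ?_
        have := n1 x.1
        have := n2 x.2
        simp only [prodGr]
        gcongr
        exact le_abs_self C
      refine (hq' n _).trans ((ENNReal.ofReal_le_ofReal h2).trans ?_)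
      have e1 : ENNReal.ofReal (powGr p k (n + r) x.2) ≤ K * powGrading p' k (n + (r + s)) x.2 := by
        unfold powGr powGrading
        rw [ENNReal.ofReal_sum_of_nonneg fun i _ => n1 _, Finset.mul_sum]
        exact Finset.sum_le_sum fun i _ => by rw [← add_assoc]; exact hK _
      have e0 : ENNReal.ofReal (p (n + r) x.1) ≤ K * p' (n + (r + s)) x.1 := by
        rw [← add_assoc]; exact hK _
      rw [ENNReal.ofReal_mul (abs_nonneg C), ENNReal.ofReal_add (add_nonneg (n1 _) (n2 _))
        zero_le_one, ENNReal.ofReal_add (n1 _) (n2 _), ENNReal.ofReal_one]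
      push_cast
      rw [mul_assoc]
      refine mul_le_mul' le_rfl ?_
      unfold prodGrading
      calc ENNReal.ofReal (p (n + r) x.1) + ENNReal.ofReal (powGr p k (n + r) x.2) + 1
          ≤ K * p' (n + (r + s)) x.1 + K * powGrading p' k (n + (r + s)) x.2 + 1 := by gcongr
        _ ≤ K * (p' (n + (r + s)) x.1 + powGrading p' k (n + (r + s)) x.2 + 1)
            + (p' (n + (r + s)) x.1 + powGrading p' k (n + (r + s)) x.2 + 1) := by
            rw [mul_add, mul_add]
            exact add_le_add le_self_add le_add_self
        _ = _ := by ring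

end Framework

/-! ### The Fréchet space of smooth functions on a compact body -/

/-- A compact set on which derivatives are determined by the values. -/
class GoodBody {E : Type*} [NormedAddCommGroup E] [NormedSpace ℝ E] (K : Set E) : Prop where
  compact : IsCompact K
  uniqueDiff : UniqueDiffOn ℝ K

namespace CInf

variable {E : Type*} [NormedAddCommGroup E] [NormedSpace ℝ E] {K : Set E}

lemma eq_zero_of_notMem (f : CInf K) {x : E} (hx : x ∉ K) : f x = 0 := f.2.1 x hx

lemma exists_ext (f : CInf K) : ∃ F : E → ℝ, C∞ F ∧ EqOn f F K := f.2.2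

lemma ext' {f g : CInf K} (h : ∀ x ∈ K, f x = g x) : f = g := by
  refine Subtype.ext (funext fun x => ?_)
  by_cases hx : x ∈ K
  · exact h x hx
  · rw [f.eq_zero_of_notMem hx, g.eq_zero_of_notMem hx]

open Classical in
/-- The restriction of a smooth function to `K`. -/
def mk' (K : Set E) (F : E → ℝ) (hF : C∞ F) : CInf K :=
  ⟨K.indicator F, fun _ hx => indicator_of_notMem hx _, F, hF, eqOn_indicator⟩

lemma mk'_apply {F : E → ℝ} (hF : C∞ F) {x : E} (hx : x ∈ K) :
    mk' K F hF x = F x := indicator_of_mem hx _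

@[simp] lemma add_apply (f g : CInf K) (x : E) : (f + g) x = f x + g x := rfl
@[simp] lemma sub_apply (f g : CInf K) (x : E) : (f - g) x = f x - g x := rfl
@[simp] lemma smul_apply (c : ℝ) (f : CInf K) (x : E) : (c • f) x = c * f x := rfl

lemma contDiffOn (f : CInf K) : ContDiffOn ℝ (⊤ : ℕ∞) f K := by
  obtain ⟨F, hF, h⟩ := f.exists_ext
  exact hF.contDiffOn.congr h

lemma contDiffWithinAt (f : CInf K) {n : ℕ} {x : E} (hx : x ∈ K) : ContDiffWithinAt ℝ n f K x :=
  (f.contDiffOn x hx).of_le (by exact_mod_cast le_top)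

lemma continuousOn (f : CInf K) : ContinuousOn f K := f.contDiffOn.continuousOn

/-- The real-valued `C^n` norm. -/
def sN (n : ℕ) (f : CInf K) : ℝ := (supNorm K n f).toReal

lemma sN_nonneg (n : ℕ) (f : CInf K) : 0 ≤ sN n f := ENNReal.toReal_nonneg

lemma supNorm_le {n : ℕ} {f : E → ℝ} {A : ℝ}
    (h : ∀ j ≤ n, ∀ x ∈ K, ‖iteratedFDerivWithin ℝ j f K x‖ ≤ A) :
    supNorm K n f ≤ ENNReal.ofReal A := by
  refine iSup₂_le fun j hj => iSup₂_le fun x hx => ?_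
  rw [← ofReal_norm]
  exact ENNReal.ofReal_le_ofReal (h j (by simpa [Nat.lt_succ_iff] using hj) x hx)

lemma sN_le {n : ℕ} {f : CInf K} {A : ℝ} (hA : 0 ≤ A)
    (h : ∀ j ≤ n, ∀ x ∈ K, ‖iteratedFDerivWithin ℝ j f K x‖ ≤ A) : sN n f ≤ A :=
  ENNReal.toReal_le_of_le_ofReal hA (supNorm_le h)

variable [hK : GoodBody K]

lemma supNorm_ne_top (n : ℕ) (f : CInf K) : supNorm K n f ≠ ⊤ := by
  have h : ∀ j : ℕ, ∃ C, ∀ x ∈ K, ‖iteratedFDerivWithin ℝ j f K x‖ ≤ C := fun j =>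
    hK.compact.exists_bound_of_continuousOn
      (f.contDiffOn.continuousOn_iteratedFDerivWithin (by exact_mod_cast le_top) hK.uniqueDiff)
  choose C hC using h
  refine ne_top_of_le_ne_top ENNReal.ofReal_ne_top
    (supNorm_le (A := ∑ j ∈ Finset.range (n + 1), |C j|) fun j hj x hx => ?_)
  refine (hC j x hx).trans ((le_abs_self _).trans ?_)
  exact Finset.single_le_sum (f := fun j => |C j|) (fun i _ => abs_nonneg _)
    (by simpa [Nat.lt_succ_iff] using hj)

lemma norm_le_sN {n j : ℕ} (hj : j ≤ n) (f : CInf K) {x : E} (hx : x ∈ K) :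
    ‖iteratedFDerivWithin ℝ j f K x‖ ≤ sN n f := by
  rw [sN, ← ENNReal.ofReal_le_iff_le_toReal (supNorm_ne_top n f), ofReal_norm]
  exact le_iSup₂_of_le j (by simpa [Nat.lt_succ_iff] using hj)
    (le_iSup₂_of_le x hx le_rfl)

lemma abs_le_sN (n : ℕ) (f : CInf K) {x : E} (hx : x ∈ K) : |f x| ≤ sN n f := by
  simpa using norm_le_sN (Nat.zero_le n) f hx

lemma sN_mono (f : CInf K) : Monotone fun n => sN n f := fun _ _ h =>
  sN_le (sN_nonneg _ _) fun _ hj _ hx => norm_le_sN (hj.trans h) f hx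

lemma iteratedFDerivWithin_add' (f g : CInf K) (j : ℕ) {x : E} (hx : x ∈ K) :
    iteratedFDerivWithin ℝ j (f + g : CInf K) K x =
      iteratedFDerivWithin ℝ j f K x + iteratedFDerivWithin ℝ j g K x :=
  iteratedFDerivWithin_add_apply (f.contDiffWithinAt hx) (g.contDiffWithinAt hx)
    hK.uniqueDiff hx

lemma iteratedFDerivWithin_smul' (c : ℝ) (f : CInf K) (j : ℕ) {x : E} (hx : x ∈ K) :
    iteratedFDerivWithin ℝ j (c • f : CInf K) K x = c • iteratedFDerivWithin ℝ j f K x :=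
  iteratedFDerivWithin_const_smul_apply (f.contDiffWithinAt hx) hK.uniqueDiff hx

lemma iteratedFDerivWithin_sub' (f g : CInf K) (j : ℕ) {x : E} (hx : x ∈ K) :
    iteratedFDerivWithin ℝ j (f - g : CInf K) K x =
      iteratedFDerivWithin ℝ j f K x - iteratedFDerivWithin ℝ j g K x := by
  have : f - g = f + (-1 : ℝ) • g := by rw [neg_one_smul, sub_eq_add_neg]
  rw [this, iteratedFDerivWithin_add' _ _ _ hx, iteratedFDerivWithin_smul' _ _ _ hx,
    neg_one_smul, sub_eq_add_neg]

lemma sN_add_le (n : ℕ) (f g : CInf K) : sN n (f + g) ≤ sN n f + sN n g :=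
  sN_le (add_nonneg (sN_nonneg _ _) (sN_nonneg _ _)) fun j hj x hx => by
    rw [iteratedFDerivWithin_add' f g j hx]
    exact (norm_add_le _ _).trans (add_le_add (norm_le_sN hj f hx) (norm_le_sN hj g hx))

lemma sN_smul_le (n : ℕ) (c : ℝ) (f : CInf K) : sN n (c • f) ≤ |c| * sN n f :=
  sN_le (mul_nonneg (abs_nonneg _) (sN_nonneg _ _)) fun j hj x hx => by
    rw [iteratedFDerivWithin_smul' c f j hx, norm_smul]
    exact mul_le_mul_of_nonneg_left (norm_le_sN hj f hx) (abs_nonneg _)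

lemma sN_neg (n : ℕ) (f : CInf K) : sN n (-f) = sN n f := by
  have h : ∀ f : CInf K, sN n (-f) ≤ sN n f := fun f => by
    have := sN_smul_le n (-1) f
    simpa using this
  exact le_antisymm (h f) (by simpa using h (-f))

lemma sN_sub_le (n : ℕ) (f g : CInf K) : sN n (f - g) ≤ sN n f + sN n g := by
  rw [sub_eq_add_neg, ← sN_neg n g]; exact sN_add_le _ _ _

lemma sN_sub_comm (n : ℕ) (f g : CInf K) : sN n (f - g) = sN n (g - f) := by
  rw [← sN_neg, neg_sub]

lemma tendsto_iff {ι : Type*} {l : Filter ι} {F : ι → CInf K} {f : CInf K} :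
    Tendsto F l (𝓝 f) ↔ ∀ n, Tendsto (fun i => sN n (F i - f)) l (𝓝 0) := by
  have h1 : Tendsto F l (𝓝 f) ↔ ∀ j : ℕ, TendstoUniformly
      (fun i (x : K) => iteratedFDerivWithin ℝ j (F i) K x)
      (fun x : K => iteratedFDerivWithin ℝ j f K x) l := by
    rw [nhds_iInf, tendsto_iInf]
    refine forall_congr' fun j => ?_
    rw [nhds_induced, tendsto_comap_iff]
    exact UniformFun.tendsto_iff_tendstoUniformly
  rw [h1]
  constructor
  · intro h n
    rw [Metric.tendsto_nhds]
    intro ε hε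
    have : ∀ j ∈ Finset.range (n + 1), ∀ᶠ i in l, ∀ x : K,
        dist (iteratedFDerivWithin ℝ j f K x) (iteratedFDerivWithin ℝ j (F i) K x) < ε / 2 :=
      fun j _ => Metric.tendstoUniformly_iff.1 (h j) _ (half_pos hε)
    filter_upwards [(Filter.eventually_all_finset _).2 this] with i hi
    rw [Real.dist_0_eq_abs, abs_of_nonneg (sN_nonneg _ _)]
    refine lt_of_le_of_lt (sN_le (half_pos hε).le fun j hj x hx => ?_) (half_lt_self hε)
    rw [iteratedFDerivWithin_sub' _ _ _ hx, ← dist_eq_norm, dist_comm]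
    exact (hi j (by simpa [Nat.lt_succ_iff] using hj) ⟨x, hx⟩).le
  · intro h j
    rw [Metric.tendstoUniformly_iff]
    intro ε hε
    filter_upwards [Metric.tendsto_nhds.1 (h j) ε hε] with i hi x
    rw [Real.dist_0_eq_abs, abs_of_nonneg (sN_nonneg _ _)] at hi
    rw [dist_comm, dist_eq_norm, ← iteratedFDerivWithin_sub' _ _ _ x.2]
    exact (norm_le_sN le_rfl _ x.2).trans_lt hi

lemma tendsto_sN_sub (n : ℕ) (f : CInf K) : Tendsto (fun g => sN n (g - f)) (𝓝 f) (𝓝 0) :=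
  tendsto_iff.1 tendsto_id n

lemma continuous_of_le_sN {p : CInf K → ℝ} (hadd : ∀ f g, p (f + g) ≤ p f + p g)
    {n : ℕ} {C : ℝ} (h : ∀ f, p f ≤ C * sN n f) : Continuous p := by
  refine continuous_iff_continuousAt.2 fun f => ?_
  rw [ContinuousAt, tendsto_iff_norm_sub_tendsto_zero]
  have h2 : Tendsto (fun g => C * sN n (g - f)) (𝓝 f) (𝓝 0) := by
    simpa using (tendsto_sN_sub n f).const_mul C
  refine squeeze_zero (fun _ => norm_nonneg _) (fun g => ?_) h2
  rw [Real.norm_eq_abs, abs_sub_le_iff]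
  have a1 := hadd (g - f) f
  have a2 := hadd (f - g) g
  rw [sub_add_cancel] at a1 a2
  have b1 := h (g - f)
  have b2 := h (f - g)
  rw [sN_sub_comm] at b2
  constructor <;> linarith

lemma continuous_sN (n : ℕ) : Continuous (sN n : CInf K → ℝ) :=
  continuous_of_le_sN (sN_add_le n) (n := n) (C := 1) fun f => by rw [one_mul]

instance : IsTopologicalAddGroup (CInf K) where
  continuous_add := continuous_iff_continuousAt.2 fun z => tendsto_iff.2 fun n => by
    have h1 : Tendsto (fun w : CInf K × CInf K => sN n (w.1 - z.1)) (𝓝 z) (𝓝 0) :=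
      (tendsto_sN_sub n z.1).comp (continuous_fst.tendsto z)
    have h2 : Tendsto (fun w : CInf K × CInf K => sN n (w.2 - z.2)) (𝓝 z) (𝓝 0) :=
      (tendsto_sN_sub n z.2).comp (continuous_snd.tendsto z)
    refine squeeze_zero (fun _ => sN_nonneg _ _) (fun w => ?_) (by simpa using h1.add h2)
    rw [add_sub_add_comm]
    exact sN_add_le _ _ _
  continuous_neg := continuous_iff_continuousAt.2 fun z => tendsto_iff.2 fun n => by
    refine squeeze_zero (fun _ => sN_nonneg _ _) (fun w => ?_) (tendsto_sN_sub n z)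
    rw [neg_sub_neg, sN_sub_comm]

instance : ContinuousSMul ℝ (CInf K) where
  continuous_smul := continuous_iff_continuousAt.2 fun z => tendsto_iff.2 fun n => by
    have h1 : Tendsto (fun w : ℝ × CInf K => |w.1| * sN n (w.2 - z.2)) (𝓝 z) (𝓝 (|z.1| * 0)) :=
      (continuous_fst.abs.tendsto z).mul ((tendsto_sN_sub n z.2).comp (continuous_snd.tendsto z))
    have h2 : Tendsto (fun w : ℝ × CInf K => |w.1 - z.1| * sN n z.2) (𝓝 z)
        (𝓝 (|z.1 - z.1| * sN n z.2)) := Continuous.tendsto (by fun_prop) z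
    refine squeeze_zero (fun _ => sN_nonneg _ _) (fun w => ?_) (by simpa using h1.add h2)
    have : w.1 • w.2 - z.1 • z.2 = w.1 • (w.2 - z.2) + (w.1 - z.1) • z.2 := by
      rw [smul_sub, sub_smul]; abel
    rw [this]
    exact (sN_add_le _ _ _).trans (add_le_add (sN_smul_le _ _ _) (sN_smul_le _ _ _))

instance : T2Space (CInf K) := by
  refine t2_iff_nhds.2 fun {f g} h => ext' fun x hx => ?_
  by_contra hne
  have hF : Tendsto id (𝓝 f ⊓ 𝓝 g) (𝓝 f) := inf_le_left
  have hG : Tendsto id (𝓝 f ⊓ 𝓝 g) (𝓝 g) := inf_le_right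
  have h1 := (tendsto_iff.1 hF 0).add (tendsto_iff.1 hG 0)
  have hpos : 0 < |f x - g x| := abs_pos.2 (sub_ne_zero.2 hne)
  obtain ⟨k, hk⟩ := (((add_zero (0 : ℝ)) ▸ h1).eventually (gt_mem_nhds hpos)).exists
  have e1 := abs_le_sN 0 (k - f) hx
  have e2 := abs_le_sN 0 (k - g) hx
  have e3 := abs_sub_le (f x) (k x) (g x)
  simp only [sub_apply, id] at e1 e2 hk
  rw [abs_sub_comm] at e1
  linarith

lemma exists_nhds_sN_lt (n : ℕ) (f : CInf K) {ε : ℝ} (hε : 0 < ε) :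
    {g | sN n (g - f) < ε} ∈ 𝓝 f := (tendsto_sN_sub n f).eventually (gt_mem_nhds hε)

/-! ### Products -/

/-- The product of smooth functions. -/
def mul (f g : CInf K) : CInf K :=
  ⟨fun x => f x * g x, fun x hx => by
      show f x * g x = 0
      rw [f.eq_zero_of_notMem hx, zero_mul], by
    obtain ⟨F, hF, h⟩ := f.exists_ext
    obtain ⟨G, hG, h'⟩ := g.exists_ext
    exact ⟨fun x => F x * G x, hF.mul hG, fun x hx => by
      show f x * g x = F x * G x
      rw [h hx, h' hx]⟩⟩

@[simp] lemma mul_apply (f g : CInf K) (x : E) : mul f g x = f x * g x := rfl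

/-- The product as a bilinear map. -/
def mulB : CInf K →ₗ[ℝ] CInf K →ₗ[ℝ] CInf K :=
  LinearMap.mk₂ ℝ mul (fun _ _ _ => ext' fun _ _ => by simp [add_mul])
    (fun _ _ _ => ext' fun _ _ => by simp [mul_assoc])
    (fun _ _ _ => ext' fun _ _ => by simp [mul_add])
    (fun _ _ _ => ext' fun _ _ => by simp [mul_left_comm])

lemma sN_mul_le (n : ℕ) (f g : CInf K) : sN n (mul f g) ≤ 2 ^ n * (sN n f * sN n g) := by
  have p1 := sN_nonneg n f
  have p2 := sN_nonneg n g
  refine sN_le (by positivity) fun j hj x hx => ?_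
  refine (norm_iteratedFDerivWithin_mul_le f.contDiffOn g.contDiffOn hK.uniqueDiff hx
    (n := j) (by exact_mod_cast le_top)).trans ?_
  calc _ ≤ ∑ i ∈ Finset.range (j + 1), (j.choose i : ℝ) * (sN n f * sN n g) := by
        refine Finset.sum_le_sum fun i hi => ?_
        rw [mul_assoc]
        have hi' : i ≤ j := by simpa [Nat.lt_succ_iff] using hi
        gcongr
        · exact norm_le_sN (by omega) f hx
        · exact norm_le_sN (by omega) g hx
    _ = 2 ^ j * (sN n f * sN n g) := by
        rw [← Finset.sum_mul]
        congr 1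
        exact_mod_cast congrArg Nat.cast (Nat.sum_range_choose j)
    _ ≤ _ := by gcongr; norm_num

lemma continuous_mul' : Continuous fun z : CInf K × CInf K => mul z.1 z.2 :=
  continuous_iff_continuousAt.2 fun z => tendsto_iff.2 fun n => by
    have h1 : Tendsto (fun w : CInf K × CInf K => sN n (w.1 - z.1)) (𝓝 z) (𝓝 0) :=
      (tendsto_sN_sub n z.1).comp (continuous_fst.tendsto z)
    have h2 : Tendsto (fun w : CInf K × CInf K => sN n (w.2 - z.2)) (𝓝 z) (𝓝 0) :=
      (tendsto_sN_sub n z.2).comp (continuous_snd.tendsto z)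
    have h3 : Tendsto (fun w : CInf K × CInf K => sN n w.1) (𝓝 z) (𝓝 (sN n z.1)) :=
      ((continuous_sN n).comp continuous_fst).tendsto z
    have h4 := (((h3.mul h2).add (h1.mul_const (sN n z.2))).const_mul (2 ^ n : ℝ))
    refine squeeze_zero (fun _ => sN_nonneg _ _) (fun w => ?_) (by simpa using h4)
    have : mul w.1 w.2 - mul z.1 z.2 = mul w.1 (w.2 - z.2) + mul (w.1 - z.1) z.2 :=
      ext' fun x _ => by simp; ring
    rw [this, mul_add]
    exact (sN_add_le _ _ _).trans (add_le_add (sN_mul_le _ _ _) (sN_mul_le _ _ _))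

/-! ### Composition with functions of one variable -/

/-- The composition with a smooth function. -/
def comp (g : ℝ → ℝ) (hg : C∞ g) (f : CInf K) : CInf K :=
  mk' K (g ∘ f.exists_ext.choose) (hg.comp f.exists_ext.choose_spec.1)

lemma comp_apply (g : ℝ → ℝ) (hg : C∞ g) (f : CInf K) {x : E} (hx : x ∈ K) :
    comp g hg f x = g (f x) := by
  rw [comp, mk'_apply _ hx, Function.comp_apply, ← f.exists_ext.choose_spec.2 hx]

lemma exists_sN_comp_le (g : ℝ → ℝ) (hg : C∞ g) (n : ℕ) (A : ℝ) : ∃ C : ℝ,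
    ∀ f : CInf K, sN n f ≤ A → sN n (comp g hg f) ≤ C := by
  have h : ∀ j : ℕ, ∃ C, ∀ x ∈ Icc (-A) A, ‖iteratedFDerivWithin ℝ j g univ x‖ ≤ C := fun j =>
    isCompact_Icc.exists_bound_of_continuousOn
      (hg.contDiffOn.continuousOn_iteratedFDerivWithin (n := (⊤ : ℕ∞)) (by exact_mod_cast le_top)
        uniqueDiffOn_univ |>.mono (subset_univ _))
  choose C hC using h
  set M := ∑ j ∈ Finset.range (n + 1), |C j|
  have hM : ∀ j ≤ n, ∀ x ∈ Icc (-A) A, ‖iteratedFDerivWithin ℝ j g univ x‖ ≤ M :=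
    fun j hj x hx => (hC j x hx).trans ((le_abs_self _).trans
      (Finset.single_le_sum (f := fun j => |C j|) (fun i _ => abs_nonneg _)
      (by simpa [Nat.lt_succ_iff] using hj)))
  have hM0 : 0 ≤ M := Finset.sum_nonneg fun _ _ => abs_nonneg _
  refine ⟨n.factorial * M * (1 + |A|) ^ n, fun f hf => ?_⟩
  refine sN_le (by positivity) fun j hj x hx => ?_
  have e : EqOn (comp g hg f) (g ∘ f) K := fun x hx => comp_apply g hg f hx
  rw [iteratedFDerivWithin_congr e hx]
  have hfx := abs_le.1 ((abs_le_sN n f hx).trans hf)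
  refine (norm_iteratedFDerivWithin_comp_le (N := (⊤ : ℕ∞)) (t := univ) hg.contDiffOn f.contDiffOn
    (by exact_mod_cast le_top) uniqueDiffOn_univ hK.uniqueDiff (mapsTo_univ _ _) hx
    (C := M) (D := 1 + |A|) (fun i hi => hM i (hi.trans hj) _ hfx) (fun i hi hi' => ?_)).trans ?_
  · calc _ ≤ A := (norm_le_sN (hi'.trans hj) f hx).trans hf
      _ ≤ 1 + |A| := by linarith [le_abs_self A]
      _ ≤ _ := le_self_pow₀ (by linarith [abs_nonneg A]) (by omega)
  · have : (1 : ℝ) ≤ 1 + |A| := by linarith [abs_nonneg A]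
    gcongr

end CInf

/-- A smooth function that is the identity on `[c, ∞)` and at least `c / 2` everywhere. -/
def cutId (c x : ℝ) : ℝ := c / 2 + (x - c / 2) * Real.smoothTransition ((x - c / 2) / (c / 2))

lemma contDiff_cutId (c : ℝ) : C∞ (cutId c) := by
  unfold cutId
  have : C∞ Real.smoothTransition := Real.smoothTransition.contDiff
  exact contDiff_const.add ((contDiff_id.sub contDiff_const).mul
    (this.comp ((contDiff_id.sub contDiff_const).div_const _)))

lemma cutId_eq {c x : ℝ} (hc : 0 < c) (hx : c ≤ x) : cutId c x = x := by
  unfold cutId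
  rw [Real.smoothTransition.one_of_one_le]
  · ring
  · rw [le_div_iff₀ (by linarith)]; linarith

lemma le_cutId {c : ℝ} (hc : 0 < c) (x : ℝ) : c / 2 ≤ cutId c x := by
  unfold cutId
  rcases le_total x (c / 2) with h | h
  · rw [Real.smoothTransition.zero_of_nonpos]
    · linarith
    · exact div_nonpos_of_nonpos_of_nonneg (by linarith) (by linarith)
  · have := mul_nonneg (sub_nonneg.2 h) (Real.smoothTransition.nonneg ((x - c / 2) / (c / 2)))
    linarith

namespace CInf

variable {E : Type*} [NormedAddCommGroup E] [NormedSpace ℝ E] {K : Set E} [hK : GoodBody K]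

lemma contDiff_inv_cutId {c : ℝ} (hc : 0 < c) : C∞ fun x => (cutId c x)⁻¹ :=
  (contDiff_cutId c).inv fun x => by linarith [le_cutId hc x]

lemma contDiff_sqrt_cutId {c : ℝ} (hc : 0 < c) : C∞ fun x => √(cutId c x) :=
  (contDiff_cutId c).sqrt fun x => by linarith [le_cutId hc x]

/-- The functions with a positive lower bound. -/
def Pos (K : Set E) : Set (CInf K) := {f | ∃ c > 0, ∀ x ∈ K, c ≤ f x}

open Classical in
/-- The reciprocal of a positive function. -/
def inv (f : CInf K) : CInf K :=
  if h : f ∈ Pos K then comp _ (contDiff_inv_cutId h.choose_spec.1) f else 0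

open Classical in
/-- The square root of a positive function. -/
def sqrt (f : CInf K) : CInf K :=
  if h : f ∈ Pos K then comp _ (contDiff_sqrt_cutId h.choose_spec.1) f else 0

lemma inv_apply {f : CInf K} (h : f ∈ Pos K) {x : E} (hx : x ∈ K) : inv f x = (f x)⁻¹ := by
  rw [inv, dif_pos h, comp_apply _ _ _ hx, cutId_eq h.choose_spec.1 (h.choose_spec.2 x hx)]

lemma sqrt_apply {f : CInf K} (h : f ∈ Pos K) {x : E} (hx : x ∈ K) : sqrt f x = √(f x) := by
  rw [sqrt, dif_pos h, comp_apply _ _ _ hx, cutId_eq h.choose_spec.1 (h.choose_spec.2 x hx)]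

lemma inv_eq_comp {c : ℝ} (hc : 0 < c) {f : CInf K} (h : ∀ x ∈ K, c ≤ f x) :
    inv f = comp _ (contDiff_inv_cutId hc) f := ext' fun x hx => by
  rw [inv_apply ⟨c, hc, h⟩ hx, comp_apply _ _ _ hx, cutId_eq hc (h x hx)]

lemma sqrt_eq_comp {c : ℝ} (hc : 0 < c) {f : CInf K} (h : ∀ x ∈ K, c ≤ f x) :
    sqrt f = comp _ (contDiff_sqrt_cutId hc) f := ext' fun x hx => by
  rw [sqrt_apply ⟨c, hc, h⟩ hx, comp_apply _ _ _ hx, cutId_eq hc (h x hx)]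

lemma sqrt_mem_Pos {f : CInf K} (h : f ∈ Pos K) : sqrt f ∈ Pos K := by
  obtain ⟨c, hc, h'⟩ := id h
  exact ⟨√c, Real.sqrt_pos.2 hc, fun x hx => by
    rw [sqrt_apply h hx]; exact Real.sqrt_le_sqrt (h' x hx)⟩

lemma add_mem_Pos {f g : CInf K} (hf : f ∈ Pos K) (hg : g ∈ Pos K) : f + g ∈ Pos K := by
  obtain ⟨c, hc, h⟩ := hf
  obtain ⟨d, hd, h'⟩ := hg
  exact ⟨c + d, by positivity, fun x hx => add_le_add (h x hx) (h' x hx)⟩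

lemma eventually_le {f : CInf K} {c : ℝ} (hc : 0 < c) (h : ∀ x ∈ K, c ≤ f x) :
    ∀ᶠ g in 𝓝 f, ∀ x ∈ K, c / 2 ≤ g x := by
  filter_upwards [exists_nhds_sN_lt 0 f (half_pos hc)] with g hg x hx
  have h1 := abs_le.1 (abs_le_sN 0 (g - f) hx)
  rw [sub_apply] at h1
  linarith [h x hx, show sN 0 (g - f) < c / 2 from hg]

lemma isOpen_Pos : IsOpen (Pos K) := isOpen_iff_mem_nhds.2 fun f ⟨c, hc, h⟩ =>
  (eventually_le hc h).mono fun _ hg => ⟨c / 2, half_pos hc, hg⟩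

lemma eventually_sN_le (n : ℕ) (f : CInf K) : ∀ᶠ g in 𝓝 f, sN n g ≤ sN n f + 1 :=
  ((continuous_sN n).tendsto f).eventually (ge_mem_nhds (by linarith))

lemma inv_sub_inv {f g : CInf K} (hg : g ∈ Pos K) (hf : f ∈ Pos K) :
    inv g - inv f = mul (g - f) ((-1 : ℝ) • mul (inv g) (inv f)) := ext' fun x hx => by
  have h1 : g x ≠ 0 := by obtain ⟨c, hc, h⟩ := hg; linarith [h x hx]
  have h2 : f x ≠ 0 := by obtain ⟨c, hc, h⟩ := hf; linarith [h x hx]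
  simp only [sub_apply, mul_apply, smul_apply, inv_apply hg hx, inv_apply hf hx]
  field_simp
  ring

lemma sqrt_sub_sqrt {f g : CInf K} (hg : g ∈ Pos K) (hf : f ∈ Pos K) :
    sqrt g - sqrt f = mul (g - f) (inv (sqrt g + sqrt f)) := ext' fun x hx => by
  have h1 : 0 < g x := by obtain ⟨c, hc, h⟩ := hg; linarith [h x hx]
  have h2 : 0 < f x := by obtain ⟨c, hc, h⟩ := hf; linarith [h x hx]
  have h3 := Real.sqrt_pos.2 h1
  rw [mul_apply, inv_apply (add_mem_Pos (sqrt_mem_Pos hg) (sqrt_mem_Pos hf)) hx, add_apply,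
    sub_apply, sqrt_apply hg hx, sqrt_apply hf hx, eq_mul_inv_iff_mul_eq₀ (by positivity), sub_apply]
  linear_combination Real.mul_self_sqrt h1.le - Real.mul_self_sqrt h2.le

lemma continuousAt_of_sub_eq_mul {P R : CInf K → CInf K} {f : CInf K}
    (h : ∀ᶠ g in 𝓝 f, P g - P f = mul (g - f) (R g))
    (hR : ∀ n, ∃ C, ∀ᶠ g in 𝓝 f, sN n (R g) ≤ C) : ContinuousAt P f := tendsto_iff.2 fun n => by
  obtain ⟨C, hC⟩ := hR n
  have h4 := ((tendsto_sN_sub n f).mul_const C).const_mul (2 ^ n)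
  rw [zero_mul, mul_zero] at h4
  refine squeeze_zero' (Eventually.of_forall fun _ => sN_nonneg _ _) ?_ h4
  filter_upwards [h, hC] with g hg hgC
  rw [hg]
  have := sN_nonneg n (g - f)
  exact (sN_mul_le _ _ _).trans (by gcongr)

lemma continuousOn_inv : ContinuousOn (inv : CInf K → CInf K) (Pos K) := by
  refine fun f hf => ContinuousAt.continuousWithinAt (continuousAt_of_sub_eq_mul
    ((isOpen_Pos.eventually_mem hf).mono fun g hg => inv_sub_inv hg hf) fun n => ?_)
  obtain ⟨c, hc, h⟩ := id hf
  obtain ⟨C, hC⟩ := exists_sN_comp_le (K := K) _ (contDiff_inv_cutId (half_pos hc)) n (sN n f + 1)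
  refine ⟨|(-1 : ℝ)| * (2 ^ n * (C * sN n (inv f))), ?_⟩
  filter_upwards [eventually_le hc h, eventually_sN_le n f] with g hg hg'
  have hb : sN n (inv g) ≤ C := by rw [inv_eq_comp (half_pos hc) hg]; exact hC g hg'
  have := sN_nonneg n (inv f)
  exact (sN_smul_le _ _ _).trans (mul_le_mul_of_nonneg_left ((sN_mul_le _ _ _).trans (by gcongr))
    (abs_nonneg _))

lemma continuousOn_sqrt : ContinuousOn (sqrt : CInf K → CInf K) (Pos K) := by
  refine fun f hf => ContinuousAt.continuousWithinAt (continuousAt_of_sub_eq_mul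
    ((isOpen_Pos.eventually_mem hf).mono fun g hg => sqrt_sub_sqrt hg hf) fun n => ?_)
  obtain ⟨c, hc, h⟩ := id hf
  have hs : 0 < √(c / 2) := Real.sqrt_pos.2 (half_pos hc)
  obtain ⟨C, hC⟩ := exists_sN_comp_le (K := K) _ (contDiff_sqrt_cutId (half_pos hc)) n (sN n f + 1)
  obtain ⟨D, hD⟩ := exists_sN_comp_le (K := K) _ (contDiff_inv_cutId hs) n (C + sN n (sqrt f))
  refine ⟨D, ?_⟩
  filter_upwards [eventually_le hc h, eventually_sN_le n f] with g hg hg'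
  have hP : ∀ x ∈ K, √(c / 2) ≤ (sqrt g + sqrt f) x := fun x hx => by
    rw [add_apply, sqrt_apply ⟨_, half_pos hc, hg⟩ hx, sqrt_apply hf hx]
    exact le_add_of_le_of_nonneg (Real.sqrt_le_sqrt (hg x hx)) (Real.sqrt_nonneg _)
  rw [inv_eq_comp hs hP]
  refine hD _ ((sN_add_le _ _ _).trans (add_le_add ?_ le_rfl))
  rw [sqrt_eq_comp (half_pos hc) hg]
  exact hC g hg'

/-! ### Directional derivatives -/

/-- The derivative in the direction `e`. -/
def pderiv (e : E) : CInf K →ₗ[ℝ] CInf K where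
  toFun f := mk' K (fun x => fderiv ℝ f.exists_ext.choose x e)
    ((f.exists_ext.choose_spec.1.fderiv_right (by simp)).clm_apply contDiff_const)
  map_add' f g := ext' fun x hx => by
    have key : ∀ f : CInf K, fderiv ℝ f.exists_ext.choose x = fderivWithin ℝ f K x := fun f => by
      rw [fderivWithin_congr f.exists_ext.choose_spec.2 (f.exists_ext.choose_spec.2 hx)]
      exact ((f.exists_ext.choose_spec.1.differentiable (by simp) x).fderivWithin
        (hK.uniqueDiff x hx)).symm
    rw [add_apply, mk'_apply _ hx, mk'_apply _ hx, mk'_apply _ hx, key, key, key]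
    have := fderivWithin_add (hK.uniqueDiff x hx)
      ((f.contDiffWithinAt (n := 1) hx).differentiableWithinAt (by simp))
      ((g.contDiffWithinAt (n := 1) hx).differentiableWithinAt (by simp))
    exact congrArg (fun L => L e) this
  map_smul' c f := ext' fun x hx => by
    have key : ∀ f : CInf K, fderiv ℝ f.exists_ext.choose x = fderivWithin ℝ f K x := fun f => by
      rw [fderivWithin_congr f.exists_ext.choose_spec.2 (f.exists_ext.choose_spec.2 hx)]
      exact ((f.exists_ext.choose_spec.1.differentiable (by simp) x).fderivWithin
        (hK.uniqueDiff x hx)).symm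
    rw [RingHom.id_apply, smul_apply, mk'_apply _ hx, mk'_apply _ hx, key, key]
    have := fderivWithin_const_smul (hK.uniqueDiff x hx)
      ((f.contDiffWithinAt (n := 1) hx).differentiableWithinAt (by simp)) c
    exact congrArg (fun L => L e) this

lemma pderiv_apply (e : E) (f : CInf K) {x : E} (hx : x ∈ K) :
    pderiv e f x = fderivWithin ℝ f K x e := by
  change mk' K (fun x => fderiv ℝ f.exists_ext.choose x e)
    ((f.exists_ext.choose_spec.1.fderiv_right (by simp)).clm_apply contDiff_const) x = _
  rw [mk'_apply _ hx, fderivWithin_congr f.exists_ext.choose_spec.2 (f.exists_ext.choose_spec.2 hx)]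
  rw [(f.exists_ext.choose_spec.1.differentiable (by simp) x).fderivWithin (hK.uniqueDiff x hx)]

lemma iteratedFDerivWithin_pderiv (e : E) (f : CInf K) (j : ℕ) {x : E} (hx : x ∈ K) :
    iteratedFDerivWithin ℝ j (pderiv e f) K x =
      (ContinuousLinearMap.apply ℝ ℝ e).compContinuousMultilinearMap
        (iteratedFDerivWithin ℝ j (fderivWithin ℝ f K) K x) := by
  have h : EqOn (pderiv e f) ((ContinuousLinearMap.apply ℝ ℝ e) ∘ fderivWithin ℝ f K) K :=
    fun x hx => pderiv_apply e f hx
  rw [iteratedFDerivWithin_congr h hx]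
  have hd : ContDiffOn ℝ (⊤ : ℕ∞) (fderivWithin ℝ f K) K :=
    f.contDiffOn.fderivWithin hK.uniqueDiff (by simp)
  exact ContinuousLinearMap.iteratedFDerivWithin_comp_left _ ((hd x hx).of_le
    (by exact_mod_cast le_top : ((j : ℕ∞) : WithTop ℕ∞) ≤ _)) hK.uniqueDiff hx le_rfl

lemma norm_apply_le {e : E} (he : ‖e‖ ≤ 1) : ‖ContinuousLinearMap.apply ℝ ℝ e‖ ≤ 1 :=
  ContinuousLinearMap.opNorm_le_bound _ zero_le_one fun L => by
    rw [ContinuousLinearMap.apply_apply, one_mul]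
    exact (L.le_opNorm e).trans (mul_le_of_le_one_right (norm_nonneg _) he)

lemma sN_pderiv_le {e : E} (he : ‖e‖ ≤ 1) (n : ℕ) (f : CInf K) :
    sN n (pderiv e f) ≤ sN (n + 1) f :=
  sN_le (sN_nonneg _ _) fun j hj x hx => by
    rw [iteratedFDerivWithin_pderiv e f j hx]
    refine (ContinuousLinearMap.norm_compContinuousMultilinearMap_le _ _).trans ?_
    rw [norm_iteratedFDerivWithin_fderivWithin hK.uniqueDiff hx]
    calc _ ≤ 1 * ‖iteratedFDerivWithin ℝ (j + 1) f K x‖ := by gcongr; exact norm_apply_le he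
      _ ≤ _ := by rw [one_mul]; exact norm_le_sN (by omega) f hx

lemma continuous_pderiv {e : E} (he : ‖e‖ ≤ 1) : Continuous (pderiv e : CInf K → CInf K) :=
  continuous_iff_continuousAt.2 fun f => tendsto_iff.2 fun n => by
    refine squeeze_zero (fun _ => sN_nonneg _ _) (fun g => ?_) (tendsto_sN_sub (n + 1) f)
    rw [← map_sub]
    exact sN_pderiv_le he n _

end CInf

lemma exists_hN_comp_left {α : ℝ} (h0 : 0 ≤ α) (h1 : α ≤ 1) {g : ℝ → ℝ} (hg : C∞ g)
    {ℓ : ℝ} (hℓ : 0 < ℓ) (K : ℝ) (n : ℕ) : ∃ C : ℝ, 1 ≤ C ∧ ∀ {p q : ℝ}, ℓ ≤ q - p →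
      ∀ {f : ℝ → ℝ}, Sm p q f → hN α p q 1 f ≤ K → hN α p q n (g ∘ f) ≤ C * (hN α p q n f + 1) := by
  set A := max 1 K + ℓ
  have hA : 1 ≤ max 1 K := le_max_left 1 K
  obtain ⟨C, hC1, hC⟩ := exists_hN_comp hℓ hA n
  have g0 := hN_nonneg α (-A) A n g
  have g1 := hN_nonneg α (-A) A 1 g
  refine ⟨C * (1 + hN α (-A) A n g + hN α (-A) A 1 g), one_le_mul_of_one_le_of_one_le hC1 (by linarith),
    fun {p q} hpq f hf hK => ?_⟩
  have hm : MapsTo f (Icc p q) (Icc (-A) A) := fun x hx => abs_le.1 <|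
    ((hf.holderFin (by linarith) h1).abs_le hx).trans <| (hB_le_hN _ _ _ 1 _).trans <|
      hK.trans <| (le_max_right 1 K).trans (le_add_of_nonneg_right hℓ.le)
  refine (hC h0 h1 (by simp only [A]; linarith) hpq (hg.sm _ _) hf hm
    (hK.trans (le_max_right _ _))).trans ?_
  rw [mul_assoc]
  have := hN_nonneg α p q n f
  gcongr
  nlinarith

lemma exists_hN_inv {α : ℝ} (h0 : 0 ≤ α) (h1 : α ≤ 1) {ℓ c : ℝ} (hℓ : 0 < ℓ) (hc : 0 < c) (K : ℝ)
    (n : ℕ) : ∃ C : ℝ, 1 ≤ C ∧ ∀ {p q : ℝ}, ℓ ≤ q - p → ∀ {f : ℝ → ℝ}, Sm p q f →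
      (∀ x ∈ Icc p q, c ≤ f x) → hN α p q 1 f ≤ K → hN α p q n f⁻¹ ≤ C * (hN α p q n f + 1) := by
  obtain ⟨C, hC1, hC⟩ := exists_hN_comp_left h0 h1 (CInf.contDiff_inv_cutId hc) hℓ K n
  refine ⟨C, hC1, fun hpq _ hf hfc hK => ?_⟩
  rw [hN_congr n fun x hx => by rw [Pi.inv_apply, ← cutId_eq hc (hfc x hx)]]
  exact hC hpq hf hK

/-! ### Gradings by Hölder norms along curves -/

/-- A family of smooth curves in `K`, parametrized by an interval `[0, hi]`. -/
structure CurveFam {E : Type} [NormedAddCommGroup E] [NormedSpace ℝ E] (K : Set E) where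
  A : Type
  nonempty : Nonempty A
  hi : ℝ
  pos : 0 < hi
  γ : A → ℝ → E
  smooth : ∀ a, C∞ (γ a)
  maps : ∀ a, MapsTo (γ a) (Icc 0 hi) K
  bound : ∀ n, ∃ C : ℝ, 0 ≤ C ∧ ∀ (f : CInf K) a, hN 0 0 hi n (f ∘ γ a) ≤ C * CInf.sN n f

namespace CurveFam

variable {E : Type} [NormedAddCommGroup E] [NormedSpace ℝ E] {K : Set E} (Γ : CurveFam K)

/-- The Hölder norms along the curves of the family. -/
def gr (α : ℝ) (n : ℕ) (f : CInf K) : ℝ := ⨆ a : Γ.A, hN α 0 Γ.hi n (f ∘ Γ.γ a)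

lemma sm (f : CInf K) (a : Γ.A) : Sm 0 Γ.hi (f ∘ Γ.γ a) :=
  f.contDiffOn.comp (Γ.smooth a).contDiffOn (Γ.maps a)

lemma lt : (0 : ℝ) < Γ.hi := Γ.pos

lemma sub_pos' : 0 < Γ.hi - 0 := by simpa using Γ.pos

variable {Γ} {α : ℝ}

lemma exists_hN_le_sN (h1 : α ≤ 1) (n : ℕ) : ∃ C : ℝ, 0 ≤ C ∧ ∀ (f : CInf K) a,
    hN α 0 Γ.hi n (f ∘ Γ.γ a) ≤ C * CInf.sN (n + 1) f := by
  obtain ⟨C, hC0, hC⟩ := Γ.bound (n + 1)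
  have h : 0 ≤ 1 + (Γ.hi - 0) ^ (1 - α) := by
    have := Real.rpow_nonneg Γ.sub_pos'.le (1 - α); linarith
  refine ⟨(1 + (Γ.hi - 0) ^ (1 - α)) * C, by positivity, fun f a => ?_⟩
  rw [mul_assoc]
  exact (hN_le_hN_zero_exp Γ.lt h1 n (Γ.sm f a)).trans (mul_le_mul_of_nonneg_left (hC f a) h)

lemma hN_le_gr (h1 : α ≤ 1) (n : ℕ) (f : CInf K) (a : Γ.A) :
    hN α 0 Γ.hi n (f ∘ Γ.γ a) ≤ Γ.gr α n f := by
  obtain ⟨C, -, hC⟩ := Γ.exists_hN_le_sN h1 n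
  exact le_ciSup (f := fun a => hN α 0 Γ.hi n (f ∘ Γ.γ a)) ⟨_, by rintro _ ⟨a, rfl⟩; exact hC f a⟩ a

lemma gr_le {n : ℕ} {f : CInf K} {A : ℝ} (h : ∀ a, hN α 0 Γ.hi n (f ∘ Γ.γ a) ≤ A) :
    Γ.gr α n f ≤ A :=
  haveI := Γ.nonempty
  ciSup_le h

lemma gr_nonneg (n : ℕ) (f : CInf K) : 0 ≤ Γ.gr α n f := Real.iSup_nonneg fun _ => hN_nonneg _ _ _ _ _

variable [hK : GoodBody K]

lemma exists_gr_le_sN (h1 : α ≤ 1) (n : ℕ) :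
    ∃ C : ℝ, 0 ≤ C ∧ ∀ f : CInf K, Γ.gr α n f ≤ C * CInf.sN (n + 1) f := by
  obtain ⟨C, hC0, hC⟩ := Γ.exists_hN_le_sN h1 n
  exact ⟨C, hC0, fun f => gr_le (hC f)⟩

lemma gr_add_le (h1 : α ≤ 1) (n : ℕ) (f g : CInf K) :
    Γ.gr α n (f + g) ≤ Γ.gr α n f + Γ.gr α n g := gr_le fun a =>
  (hN_add_le Γ.lt h1 n (Γ.sm f a) (Γ.sm g a)).trans
    (add_le_add (hN_le_gr h1 n f a) (hN_le_gr h1 n g a))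

lemma gr_smul (c : ℝ) (n : ℕ) (f : CInf K) :
    Γ.gr α n (c • f) = |c| * Γ.gr α n f := by
  unfold gr
  rw [Real.mul_iSup_of_nonneg (abs_nonneg c)]
  exact congrArg _ (funext fun a => hN_const_mul Γ.lt n (Γ.sm f a) c)

lemma isGr (h1 : α ≤ 1) : IsGr (Γ.gr α) where
  nonneg := gr_nonneg
  mono f n m h := gr_le fun a => (hN_mono α 0 Γ.hi (f ∘ Γ.γ a) h).trans (hN_le_gr h1 m f a)
  add_le := gr_add_le h1
  cont n := by
    obtain ⟨C, -, hC⟩ := Γ.exists_gr_le_sN h1 n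
    exact CInf.continuous_of_le_sN (gr_add_le h1 n) hC
  zero n := by
    have := gr_smul (Γ := Γ) (α := α) 0 n 0
    simpa using this

lemma exists_gr_mul_le (h0 : 0 ≤ α) (h1 : α ≤ 1) (n : ℕ) : ∃ C : ℝ, ∀ f g : CInf K,
    Γ.gr α n (CInf.mul f g) ≤ C * (Γ.gr α n f * Γ.gr α 0 g + Γ.gr α 0 f * Γ.gr α n g) := by
  obtain ⟨C, hC1, hC⟩ := exists_hN_mul Γ.sub_pos' n
  refine ⟨C, fun f g => gr_le fun a => ?_⟩
  refine (hC h0 h1 le_rfl (Γ.sm f a) (Γ.sm g a)).trans ?_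
  have := hN_le_gr (Γ := Γ) h1 n f a
  have := hN_le_gr (Γ := Γ) h1 0 f a
  have := hN_le_gr (Γ := Γ) h1 n g a
  have := hN_le_gr (Γ := Γ) h1 0 g a
  have := hN_nonneg α 0 Γ.hi n (f ∘ Γ.γ a)
  have := hN_nonneg α 0 Γ.hi 0 (f ∘ Γ.γ a)
  have := hN_nonneg α 0 Γ.hi n (g ∘ Γ.γ a)
  have := hN_nonneg α 0 Γ.hi 0 (g ∘ Γ.γ a)
  have := gr_nonneg (Γ := Γ) (α := α) n f
  have := gr_nonneg (Γ := Γ) (α := α) 0 f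
  gcongr

lemma smTame_mul (h0 : 0 ≤ α) (h1 : α ≤ 1) :
    SmTame (Γ.gr α) (prodGr (Γ.gr α) (Γ.gr α)) univ (fun z : CInf K × CInf K => CInf.mul z.1 z.2) :=
  SmTame.bilinear (isGr h1) (isGr h1) (isGr h1) CInf.mulB CInf.continuous_mul'
    (fun n => exists_gr_mul_le h0 h1 n)

lemma exists_gr_comp_le (h0 : 0 ≤ α) (h1 : α ≤ 1) {g : ℝ → ℝ} (hg : C∞ g) (A : ℝ)
    (n : ℕ) : ∃ C : ℝ, 1 ≤ C ∧ ∀ f : CInf K, Γ.gr α 1 f ≤ A →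
      Γ.gr α n (CInf.comp g hg f) ≤ C * (Γ.gr α n f + 1) := by
  obtain ⟨C, hC1, hC⟩ := exists_hN_comp_left h0 h1 hg Γ.sub_pos' A n
  refine ⟨C, hC1, fun f hA => gr_le fun a => ?_⟩
  have e : EqOn (CInf.comp g hg f ∘ Γ.γ a) (g ∘ f ∘ Γ.γ a) (Icc 0 Γ.hi) := fun s hs =>
    CInf.comp_apply g hg f (Γ.maps a hs)
  rw [hN_congr n e]
  refine (hC le_rfl (Γ.sm f a) ((hN_le_gr h1 1 f a).trans hA)).trans ?_
  have := hN_le_gr (Γ := Γ) h1 n f a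
  gcongr

lemma tameMap_of_eq_comp {P : CInf K → CInf K} (h0 : 0 ≤ α) (h1 : α ≤ 1)
    (hP : ContinuousOn P (CInf.Pos K)) (h : ∀ c > 0, ∃ (g : ℝ → ℝ) (hg : C∞ g),
      ∀ f : CInf K, (∀ x ∈ K, c ≤ f x) → P f = CInf.comp g hg f) :
    TameMap (Γ.gr α) (Γ.gr α) (CInf.Pos K) P where
  continuousOn := hP
  estimate f hf := by
    obtain ⟨c, hc, hfc⟩ := hf
    obtain ⟨g, hg, hPg⟩ := h (c / 2) (half_pos hc)
    refine ⟨_, inter_mem (CInf.eventually_le hc hfc) (((isGr (Γ := Γ) h1).cont 1).tendsto f |>.eventually (ge_mem_nhds (lt_add_one _))), 0,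
      fun n => ?_⟩
    obtain ⟨C, hC1, hC⟩ := exists_gr_comp_le (Γ := Γ) h0 h1 hg (Γ.gr α 1 f + 1) n
    exact ⟨C, fun u hu => by
      rw [hPg u hu.1.1]; exact hC u hu.1.2⟩

lemma hasHD_of_sub_eq_mul {B : Set (CInf K)} (hB : IsOpen B) {P : CInf K → CInf K}
    {R : CInf K → CInf K → CInf K} (h : ∀ g ∈ B, ∀ f ∈ B, P g - P f = CInf.mul (g - f) (R g f))
    (hR : ∀ f ∈ B, ContinuousAt (fun g => R g f) f) :
    HasHD B P fun z => CInf.mul z.2 (R z.1 z.1) := by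
  intro f hf w
  have hT := tendsto_add_smul f w
  refine ((CInf.continuous_mul'.tendsto (w, _)).comp
    (tendsto_snd.prodMk_nhds ((hR f hf).tendsto.comp hT))).congr' ?_
  have hne : ∀ᶠ z : ℝ × CInf K in 𝓝[≠] 0 ×ˢ 𝓝 w, z.1 ≠ 0 :=
    tendsto_fst.eventually (eventually_mem_nhdsWithin)
  filter_upwards [hT.eventually (hB.mem_nhds hf), hne] with z hz hz0
  rw [h _ hz _ hf]
  refine CInf.ext' fun x hx => ?_
  simp only [Function.comp_apply, CInf.mul_apply, CInf.smul_apply, add_sub_cancel_left]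
  field_simp

lemma hasHD_inv : HasHD (CInf.Pos K) (CInf.inv : CInf K → CInf K)
    (fun z => CInf.mul z.2 ((-1 : ℝ) • CInf.mul (CInf.inv z.1) (CInf.inv z.1))) :=
  hasHD_of_sub_eq_mul CInf.isOpen_Pos (fun _ hg _ hf => CInf.inv_sub_inv hg hf) fun f hf =>
    (((CInf.continuous_mul'.tendsto (CInf.inv f, CInf.inv f)).comp
      ((CInf.continuousOn_inv.continuousAt (CInf.isOpen_Pos.mem_nhds hf)).tendsto.prodMk_nhds
        tendsto_const_nhds)).const_smul (-1 : ℝ) :)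

lemma hasHD_sqrt : HasHD (CInf.Pos K) (CInf.sqrt : CInf K → CInf K)
    (fun z => CInf.mul z.2 (CInf.inv (CInf.sqrt z.1 + CInf.sqrt z.1))) :=
  hasHD_of_sub_eq_mul CInf.isOpen_Pos (fun _ hg _ hf => CInf.sqrt_sub_sqrt hg hf) fun f hf =>
    (CInf.continuousOn_inv.continuousAt (CInf.isOpen_Pos.mem_nhds (CInf.add_mem_Pos
      (CInf.sqrt_mem_Pos hf) (CInf.sqrt_mem_Pos hf)))).tendsto.comp
      ((CInf.continuousOn_sqrt.continuousAt (CInf.isOpen_Pos.mem_nhds hf)).tendsto.add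
        tendsto_const_nhds)

lemma SmT_bilin {X : Type} [AddCommGroup X] [Module ℝ X] [TopologicalSpace X]
    [IsTopologicalAddGroup X] [ContinuousSMul ℝ X] {p : ℕ → X → ℝ} (hp : IsGr p)
    (h0 : 0 ≤ α) (h1 : α ≤ 1) {k : ℕ} {B : Set X} {P Q : X → CInf K}
    (hP : SmT (Γ.gr α) k X p B P) (hQ : SmT (Γ.gr α) k X p B Q) :
    SmT (Γ.gr α) k X p B (fun x => CInf.mul (P x) (Q x)) :=
  SmT.comp hp ((isGr h1).prod (isGr h1)) (smTame_mul h0 h1 k) (SmT.pair hp hP hQ)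
    (mapsTo_univ _ _)

lemma smTame_inv (h0 : 0 ≤ α) (h1 : α ≤ 1) :
    SmTame (Γ.gr α) (Γ.gr α) (CInf.Pos K) (CInf.inv : CInf K → CInf K) := by
  have hg := isGr (Γ := Γ) h1
  have hT : TameMap (Γ.gr α) (Γ.gr α) (CInf.Pos K) (CInf.inv : CInf K → CInf K) :=
    tameMap_of_eq_comp h0 h1 CInf.continuousOn_inv fun _ hc => ⟨_, _, fun _ => CInf.inv_eq_comp hc⟩
  intro k
  induction k with
  | zero => exact hT
  | succ k ih =>
    refine ⟨hT, _, hasHD_inv, ?_⟩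
    have hi : SmT (Γ.gr α) k (CInf K × CInf K) (prodGr (Γ.gr α) (Γ.gr α))
        (CInf.Pos K ×ˢ univ) (fun z => CInf.inv z.1) :=
      SmT.comp (hg.prod hg) hg ih (SmTame.fst hg hg _ k) (fun z hz => hz.1)
    exact SmT_bilin (Γ := Γ) (hg.prod hg) h0 h1 (SmTame.snd hg hg _ k)
      (SmT.const_smul (hg.prod hg) hg (fun c n z => gr_smul (Γ := Γ) c n z)
        (SmT_bilin (Γ := Γ) (hg.prod hg) h0 h1 hi hi) (-1))

lemma smTame_sqrt (h0 : 0 ≤ α) (h1 : α ≤ 1) :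
    SmTame (Γ.gr α) (Γ.gr α) (CInf.Pos K) (CInf.sqrt : CInf K → CInf K) := by
  have hg := isGr (Γ := Γ) h1
  have hT : TameMap (Γ.gr α) (Γ.gr α) (CInf.Pos K) (CInf.sqrt : CInf K → CInf K) :=
    tameMap_of_eq_comp h0 h1 CInf.continuousOn_sqrt fun _ hc => ⟨_, _, fun _ => CInf.sqrt_eq_comp hc⟩
  intro k
  induction k with
  | zero => exact hT
  | succ k ih =>
    refine ⟨hT, _, hasHD_sqrt, ?_⟩
    have hi : SmT (Γ.gr α) k (CInf K × CInf K) (prodGr (Γ.gr α) (Γ.gr α))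
        (CInf.Pos K ×ˢ univ) (fun z => CInf.sqrt z.1) :=
      SmT.comp (hg.prod hg) hg ih (SmTame.fst hg hg _ k) (fun z hz => hz.1)
    have h2 := SmT.comp (hg.prod hg) hg (smTame_inv (Γ := Γ) h0 h1 k)
      (SmT.add (hg.prod hg) hg hi hi)
      (fun z hz => CInf.add_mem_Pos (CInf.sqrt_mem_Pos hz.1) (CInf.sqrt_mem_Pos hz.1))
    exact SmT_bilin (Γ := Γ) (hg.prod hg) h0 h1 (SmTame.snd hg hg _ k) h2

end CurveFam

/-! ### Smooth dependence on parameters -/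

section Parametric

variable {H : Type} [NormedAddCommGroup H] [NormedSpace ℝ H] [FiniteDimensional ℝ H]

lemma hasFDerivAt_intervalIntegral {G : Type} [NormedAddCommGroup G] [NormedSpace ℝ G]
    [CompleteSpace G] {F : H × ℝ → G} (hF : ContDiff ℝ 1 F) (a b : ℝ) (x₀ : H) :
    HasFDerivAt (fun x => ∫ θ in a..b, F (x, θ))
      (∫ θ in a..b, (fderiv ℝ F (x₀, θ)).comp (ContinuousLinearMap.inl ℝ H ℝ)) x₀ := by
  have hcont : Continuous fun z : H × ℝ =>
      (fderiv ℝ F z).comp (ContinuousLinearMap.inl ℝ H ℝ) :=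
    (hF.continuous_fderiv one_ne_zero).clm_comp continuous_const
  haveI : ProperSpace H := FiniteDimensional.proper ℝ H
  obtain ⟨C, hC⟩ := ((isCompact_closedBall x₀ 1).prod (isCompact_uIcc (a := a) (b := b))
    ).exists_bound_of_continuousOn hcont.continuousOn
  refine intervalIntegral.hasFDerivAt_integral_of_dominated_of_fderiv_le
    (F' := fun x θ => (fderiv ℝ F (x, θ)).comp (ContinuousLinearMap.inl ℝ H ℝ))
    (bound := fun _ => C) (Metric.ball_mem_nhds x₀ one_pos)
    (Eventually.of_forall fun x => ?_) ?_ ?_ ?_ ?_ ?_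
  · exact (hF.continuous.comp (by fun_prop : Continuous fun θ : ℝ => (x, θ))).aestronglyMeasurable
  · exact (hF.continuous.comp (by fun_prop : Continuous fun θ : ℝ => (x₀, θ))).intervalIntegrable _ _
  · exact (hcont.comp (by fun_prop : Continuous fun θ : ℝ => (x₀, θ))).aestronglyMeasurable
  · exact Eventually.of_forall fun θ hθ x hx =>
      hC (x, θ) ⟨Metric.ball_subset_closedBall hx, uIoc_subset_uIcc hθ⟩
  · exact intervalIntegrable_const
  · refine Eventually.of_forall fun θ _ x _ => ?_
    have h1 : HasFDerivAt F (fderiv ℝ F (x, θ)) (x, θ) :=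
      (hF.differentiable one_ne_zero (x, θ)).hasFDerivAt
    have h2 : HasFDerivAt (fun y : H => (y, θ)) (ContinuousLinearMap.inl ℝ H ℝ) x :=
      hasFDerivAt_prodMk_left x θ
    exact h1.comp x h2

lemma contDiff_intervalIntegral_nat (n : ℕ) {G : Type} [NormedAddCommGroup G] [NormedSpace ℝ G]
    [CompleteSpace G] {F : H × ℝ → G} (hF : ContDiff ℝ n F) (a b : ℝ) :
    ContDiff ℝ n (fun x => ∫ θ in a..b, F (x, θ)) := by
  induction n generalizing G with
  | zero =>
    rw [Nat.cast_zero, contDiff_zero] at *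
    exact intervalIntegral.continuous_parametric_intervalIntegral_of_continuous'
      (f := fun x θ => F (x, θ)) hF a b
  | succ n ih =>
    push_cast at hF ⊢
    rw [contDiff_succ_iff_hasFDerivAt]
    refine ⟨_, ih (F := fun z => (fderiv ℝ F z).comp (ContinuousLinearMap.inl ℝ H ℝ)) ?_,
      hasFDerivAt_intervalIntegral (hF.of_le (by norm_cast; omega)) a b⟩
    exact (hF.fderiv_right le_rfl).clm_comp contDiff_const

lemma contDiff_intervalIntegral {G : Type} [NormedAddCommGroup G] [NormedSpace ℝ G]
    [CompleteSpace G] {F : H × ℝ → G} (hF : C∞ F) (a b : ℝ) :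
    C∞ (fun x => ∫ θ in a..b, F (x, θ)) :=
  contDiff_infty.2 fun n => contDiff_intervalIntegral_nat n (contDiff_infty.1 hF n) a b

lemma contDiff_primitive {F : H × ℝ → ℝ} (hF : C∞ F) :
    C∞ (fun z : H × ℝ => ∫ θ in (0 : ℝ)..z.2, F (z.1, θ)) := by
  have e : (fun z : H × ℝ => ∫ θ in (0 : ℝ)..z.2, F (z.1, θ)) =
      fun z => z.2 * ∫ θ in (0 : ℝ)..1, F (z.1, z.2 * θ) := by
    funext z
    have := intervalIntegral.smul_integral_comp_mul_left (a := 0) (b := 1)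
      (fun θ => F (z.1, θ)) z.2
    rw [smul_eq_mul, mul_zero, mul_one] at this
    exact this.symm
  rw [e]
  refine contDiff_snd.mul (contDiff_intervalIntegral (F := fun w : (H × ℝ) × ℝ =>
    F (w.1.1, w.1.2 * w.2)) (hF.comp ?_) 0 1)
  fun_prop

lemma hasDerivAt_primitive {F : H × ℝ → ℝ} (hF : Continuous F) (x : H) (s : ℝ) :
    HasDerivAt (fun s => ∫ θ in (0 : ℝ)..s, F (x, θ)) (F (x, s)) s := by
  have hc : Continuous fun θ : ℝ => F (x, θ) := by fun_prop
  exact intervalIntegral.integral_hasDerivAt_right (hc.intervalIntegrable _ _)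
    (hc.stronglyMeasurableAtFilter _ _) hc.continuousAt

/-- The smooth fibrewise inverse of a function that is uniformly increasing in its last variable. -/
theorem exists_contDiff_fiberInverse {V V' : H × ℝ → ℝ} (hV : C∞ V)
    (hV' : ∀ x s, HasDerivAt (fun s => V (x, s)) (V' (x, s)) s) {c : ℝ} (hc : 0 < c)
    (hcV : ∀ z, c ≤ V' z) :
    ∃ σ : H × ℝ → ℝ, C∞ σ ∧ (∀ x l, V (x, σ (x, l)) = l) ∧
      ∀ x s, σ (x, V (x, s)) = s := by
  have hmono : ∀ x s t, s ≤ t → c * (t - s) ≤ V (x, t) - V (x, s) := fun x s t hst => by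
    have hd : Differentiable ℝ fun s => V (x, s) := fun s => (hV' x s).differentiableAt
    exact mul_sub_le_image_sub_of_le_deriv hd
      (fun s => by rw [(hV' x s).deriv]; exact hcV _) hst
  have habs : ∀ x s t, c * |t - s| ≤ |V (x, t) - V (x, s)| := fun x s t => by
    rcases le_total s t with h | h
    · rw [abs_of_nonneg (sub_nonneg.2 h)]
      exact (hmono x s t h).trans (le_abs_self _)
    · rw [abs_sub_comm, abs_of_nonneg (sub_nonneg.2 h), abs_sub_comm]
      exact (hmono x t s h).trans (le_abs_self _)
  have hsurj : ∀ x l, ∃ s, V (x, s) = l := fun x l => by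
    have hcont : Continuous fun s => V (x, s) := hV.continuous.comp (by fun_prop)
    set R := |l - V (x, 0)| / c
    have hR : 0 ≤ R := by positivity
    have hcR : c * R = |l - V (x, 0)| := by simp only [R]; field_simp
    have h1 := hmono x 0 R hR
    have h2 := hmono x (-R) 0 (by linarith)
    rw [sub_zero, hcR] at h1
    rw [sub_neg_eq_add, zero_add, hcR] at h2
    have := le_abs_self (l - V (x, 0))
    have := neg_abs_le (l - V (x, 0))
    obtain ⟨s, -, hs⟩ := intermediate_value_Icc (by linarith : -R ≤ R) hcont.continuousOn
      (show l ∈ Icc (V (x, -R)) (V (x, R)) from ⟨by linarith, by linarith⟩)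
    exact ⟨s, hs⟩
  choose τ hτ using hsurj
  have hinj : ∀ x s t, V (x, s) = V (x, t) → s = t := fun x s t h => by
    have := habs x s t
    rw [h, sub_self, abs_zero] at this
    have h0 : |t - s| ≤ 0 := by
      by_contra! hp
      have := mul_pos hc hp
      linarith
    exact (sub_eq_zero.1 (abs_nonpos_iff.1 h0)).symm
  set σ : H × ℝ → ℝ := fun z => τ z.1 z.2 with hσ
  have hcontσ : Continuous σ := by
    refine continuous_iff_continuousAt.2 fun z => ?_
    rw [ContinuousAt, tendsto_iff_norm_sub_tendsto_zero]
    have h1 : Tendsto (fun w : H × ℝ => |w.2 - V (w.1, σ z)| / c) (𝓝 z)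
        (𝓝 (|z.2 - V (z.1, σ z)| / c)) := by
      have := hV.continuous
      exact Continuous.tendsto (by fun_prop) z
    rw [show V (z.1, σ z) = z.2 from hτ z.1 z.2, sub_self, abs_zero, zero_div] at h1
    refine squeeze_zero (fun _ => norm_nonneg _) (fun w => ?_) h1
    rw [le_div_iff₀ hc, mul_comm, Real.norm_eq_abs]
    have := habs w.1 (σ z) (σ w)
    rwa [show V (w.1, σ w) = w.2 from hτ w.1 w.2] at this
  let f : H × ℝ ≃ₜ H × ℝ :=
    { toFun := fun z => (z.1, V z)
      invFun := fun z => (z.1, σ z)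
      left_inv := fun z => by
        ext
        · rfl
        · exact hinj z.1 _ _ (hτ z.1 (V z))
      right_inv := fun z => by
        ext
        · rfl
        · exact hτ z.1 z.2
      continuous_toFun := continuous_fst.prodMk hV.continuous
      continuous_invFun := continuous_fst.prodMk hcontσ }
  have hu : ∀ z, V' z ≠ 0 := fun z => by linarith [hcV z]
  let f' : ∀ z : H × ℝ, (H × ℝ) ≃L[ℝ] (H × ℝ) := fun z =>
    (ContinuousLinearEquiv.refl ℝ H).skewProd
      (ContinuousLinearEquiv.unitsEquivAut ℝ (Units.mk0 (V' z) (hu z)))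
      ((fderiv ℝ V z).comp (ContinuousLinearMap.inl ℝ H ℝ))
  have hf' : ∀ z, HasFDerivAt f (f' z : H × ℝ →L[ℝ] H × ℝ) z := fun z => by
    have h1 : HasFDerivAt V (fderiv ℝ V z) z := (hV.differentiable (by simp) z).hasFDerivAt
    have h2 : HasFDerivAt f ((ContinuousLinearMap.fst ℝ H ℝ).prod (fderiv ℝ V z)) z :=
      hasFDerivAt_fst.prodMk h1
    have e : (f' z : H × ℝ →L[ℝ] H × ℝ) =
        (ContinuousLinearMap.fst ℝ H ℝ).prod (fderiv ℝ V z) := by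
      ext w
      · simp [f']
      · simp [f']
      · simp [f']
      · have h3 : HasDerivAt (fun s => V (z.1, s)) (fderiv ℝ V z (0, 1)) z.2 := by
          have h4 : HasFDerivAt V (fderiv ℝ V z) (z.1, z.2) := h1
          have h5 : HasDerivAt (fun s : ℝ => (z.1, s)) ((0 : H), (1 : ℝ)) z.2 :=
            (hasDerivAt_const z.2 z.1).prodMk (hasDerivAt_id z.2)
          exact h4.comp_hasDerivAt z.2 h5
        have := h3.unique (hV' z.1 z.2)
        have h0 : fderiv ℝ V z (0, 0) = 0 := map_zero _
        simp [f', this, h0]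
    rw [e]
    exact h2
  have hs := f.contDiff_symm hf' (contDiff_fst.prodMk hV)
  exact ⟨σ, contDiff_snd.comp hs, fun x l => hτ x l, fun x s => hinj x _ _ (hτ x _)⟩

end Parametric

/-! ### Iterated derivatives in the last variable -/

/-- The derivative of a function on `H × ℝ` in its last variable. -/
def dSnd {H : Type} [NormedAddCommGroup H] [NormedSpace ℝ H] (F : H × ℝ → ℝ) : H × ℝ → ℝ :=
  fun z => fderiv ℝ F z (0, 1)

section dSnd

variable {H : Type} [NormedAddCommGroup H] [NormedSpace ℝ H]

lemma contDiff_dSnd {F : H × ℝ → ℝ} (hF : C∞ F) :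
    C∞ (dSnd F) :=
  (hF.fderiv_right (by simp)).clm_apply contDiff_const

lemma hasDerivAt_dSnd {F : H × ℝ → ℝ} (hF : C∞ F) (x : H) (s : ℝ) :
    HasDerivAt (fun s => F (x, s)) (dSnd F (x, s)) s := by
  have h4 : HasFDerivAt F (fderiv ℝ F (x, s)) (x, s) :=
    (hF.differentiable (by simp) (x, s)).hasFDerivAt
  have h5 : HasDerivAt (fun s : ℝ => (x, s)) ((0 : H), (1 : ℝ)) s :=
    (hasDerivAt_const s x).prodMk (hasDerivAt_id s)
  exact h4.comp_hasDerivAt s h5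

lemma contDiff_dSnd_iterate {F : H × ℝ → ℝ} (hF : C∞ F) (j : ℕ) :
    C∞ (dSnd^[j] F) := by
  induction j generalizing F with
  | zero => exact hF
  | succ j ih => exact ih (contDiff_dSnd hF)

lemma dI_iterate_eq_dSnd {F : H × ℝ → ℝ} (hF : C∞ F) {p q : ℝ} (hpq : p < q)
    (x : H) (j : ℕ) :
    EqOn ((dI p q)^[j] (fun s => F (x, s))) (fun s => dSnd^[j] F (x, s)) (Icc p q) := by
  have hcongr : ∀ j : ℕ, ∀ {f g : ℝ → ℝ}, EqOn f g (Icc p q) →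
      EqOn ((dI p q)^[j] f) ((dI p q)^[j] g) (Icc p q) := fun j => by
    induction j with
    | zero => exact fun h => h
    | succ j ih => exact fun h => ih (dI_congr h)
  induction j generalizing F with
  | zero => exact fun _ _ => rfl
  | succ j ih =>
    rw [Function.iterate_succ_apply, Function.iterate_succ_apply]
    refine (hcongr j fun s hs => ?_).trans (ih (contDiff_dSnd hF))
    exact dI_eq hpq hs (hasDerivAt_dSnd hF x s).hasDerivWithinAt

lemma exists_hN_le_of_compact {F : H × ℝ → ℝ} (hF : C∞ F) {p q : ℝ}
    (hpq : p < q) {S : Set H} (hS : IsCompact S) {α : ℝ} (h1 : α ≤ 1) (n : ℕ) :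
    ∃ C : ℝ, 0 ≤ C ∧ ∀ x ∈ S, hN α p q n (fun s => F (x, s)) ≤ C := by
  have h : ∀ j : ℕ, ∃ C, ∀ z ∈ S ×ˢ Icc p q, ‖dSnd^[j] F z‖ ≤ C := fun j =>
    (hS.prod isCompact_Icc).exists_bound_of_continuousOn
      (contDiff_dSnd_iterate hF j).continuous.continuousOn
  choose C hC using h
  set M := ∑ j ∈ Finset.range (n + 2), |C j|
  have hM0 : 0 ≤ M := Finset.sum_nonneg fun _ _ => abs_nonneg _
  have hq : 0 ≤ 1 + (q - p) ^ (1 - α) := by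
    have := Real.rpow_nonneg (sub_nonneg.2 hpq.le) (1 - α); linarith
  refine ⟨(1 + (q - p) ^ (1 - α)) * (3 * ((n + 1 : ℕ) + 1) * M), by positivity, fun x hx => ?_⟩
  have hsm : Sm p q fun s => F (x, s) :=
    (hF.comp (by fun_prop : C∞ fun s : ℝ => (x, s))).sm p q
  refine (hN_le_hN_zero_exp hpq h1 n hsm).trans (mul_le_mul_of_nonneg_left
    (hN_zero_exp_le hM0 fun j hj s hs => ?_) hq)
  rw [dI_iterate_eq_dSnd hF hpq x j hs]
  refine (hC j (x, s) ⟨hx, hs⟩).trans ((le_abs_self _).trans ?_)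
  exact Finset.single_le_sum (f := fun j => |C j|) (fun i _ => abs_nonneg _)
    (Finset.mem_range.2 (by omega))

end dSnd

/-! ### Curves and maps with values in spaces of smooth functions -/

namespace CInf

section General

variable {E : Type*} [NormedAddCommGroup E] [NormedSpace ℝ E] {K : Set E} [hK : GoodBody K]

/-- The mean value inequality for curves in the space of smooth functions. -/
lemma sN_sub_sub_le {f f' : ℝ → CInf K} {t : ℝ} {n : ℕ} {y : CInf K} {ε : ℝ}
    (hf : ∀ s ∈ uIcc 0 t, Tendsto (fun k : ℝ => k⁻¹ • (f (s + k) - f s)) (𝓝[≠] 0) (𝓝 (f' s)))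
    (hε : 0 ≤ ε) (hy : ∀ s ∈ uIcc 0 t, sN n (f' s - y) ≤ ε) :
    sN n (f t - f 0 - t • y) ≤ ε * |t| := by
  refine sN_le (by positivity) fun j hj x hx => ?_
  have hd : ∀ s ∈ uIcc 0 t, HasDerivWithinAt
      (fun s => iteratedFDerivWithin ℝ j (f s - s • y : CInf K) K x)
      (iteratedFDerivWithin ℝ j (f' s - y : CInf K) K x) (uIcc 0 t) s := fun s hs => by
    refine HasDerivAt.hasDerivWithinAt ?_
    rw [hasDerivAt_iff_tendsto_slope_zero, tendsto_iff_norm_sub_tendsto_zero]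
    have h1 := tendsto_iff.1 (hf s hs) n
    refine squeeze_zero' (Eventually.of_forall fun _ => norm_nonneg _) ?_ h1
    filter_upwards [eventually_mem_nhdsWithin] with k hk
    have e : (k⁻¹ • (f (s + k) - f s) - f' s : CInf K) =
        k⁻¹ • ((f (s + k) - (s + k) • y) - (f s - s • y)) - (f' s - y) := by
      have : ((f (s + k) - (s + k) • y) - (f s - s • y)) = (f (s + k) - f s) - k • y := by
        rw [add_smul]; abel
      rw [this, smul_sub k⁻¹ _ (k • y), smul_smul, inv_mul_cancel₀ hk, one_smul]
      abel
    rw [← iteratedFDerivWithin_sub' _ _ _ hx, ← iteratedFDerivWithin_smul' _ _ _ hx,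
      ← iteratedFDerivWithin_sub' _ _ _ hx, ← e]
    exact norm_le_sN hj _ hx
  have := (convex_uIcc (0 : ℝ) t).norm_image_sub_le_of_norm_hasDerivWithin_le hd
    (fun s hs => (norm_le_sN hj _ hx).trans (hy s hs)) left_mem_uIcc right_mem_uIcc
  rw [← iteratedFDerivWithin_sub' _ _ _ hx, Real.norm_eq_abs, sub_zero] at this
  have e : f t - f 0 - t • y = f t - t • y - (f 0 - (0 : ℝ) • y) := by
    rw [zero_smul, sub_zero]; abel
  rw [e]
  exact this

variable {X : Type*} [AddCommGroup X] [Module ℝ X] [TopologicalSpace X] [IsTopologicalAddGroup X]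
  [ContinuousSMul ℝ X]

lemma eventually_segment {u w : X} {Q : X × X → Prop} (h : ∀ᶠ z in 𝓝 (u, w), Q z) :
    ∀ᶠ z : ℝ × X in 𝓝 (0, w), ∀ τ ∈ Icc (0 : ℝ) 1, Q (u + (τ * z.1) • z.2, z.2) := by
  refine isCompact_Icc.eventually_forall_of_forall_eventually fun τ _ => ?_
  have hc : Tendsto (fun z : (ℝ × X) × ℝ => (u + (z.2 * z.1.1) • z.1.2, z.1.2)) (𝓝 ((0, w), τ))
      (𝓝 (u + (τ * 0) • w, w)) := Continuous.tendsto (by fun_prop) ((0, w), τ)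
  rw [mul_zero, zero_smul, add_zero] at hc
  exact hc.eventually h

lemma tendsto_of_gateaux {B : Set X} {P : X → CInf K} {G : X × X → CInf K}
    (hd : ∀ u ∈ B, ∀ w, Tendsto (fun t : ℝ => t⁻¹ • (P (u + t • w) - P u)) (𝓝[≠] 0) (𝓝 (G (u, w))))
    {u w : X} (s : ℝ) (h : u + s • w ∈ B) :
    Tendsto (fun k : ℝ => k⁻¹ • (P (u + (s + k) • w) - P (u + s • w))) (𝓝[≠] 0)
      (𝓝 (G (u + s • w, w))) := by
  convert hd _ h w using 5
  rw [add_smul, add_assoc]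

/-- A map that is differentiable along lines is differentiable in the sense of Hadamard as soon as
the derivative is continuous. -/
lemma hasHD_of_gateaux {B : Set X} (hB : IsOpen B) {P : X → CInf K} {G : X × X → CInf K}
    (hd : ∀ u ∈ B, ∀ w, Tendsto (fun t : ℝ => t⁻¹ • (P (u + t • w) - P u)) (𝓝[≠] 0) (𝓝 (G (u, w))))
    (hG : ContinuousOn G (B ×ˢ univ)) : HasHD B P G := by
  intro u hu w
  refine tendsto_iff.2 fun n => Metric.tendsto_nhds.2 fun ε hε => ?_
  have hGc : Tendsto G (𝓝 (u, w)) (𝓝 (G (u, w))) :=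
    hG.continuousAt ((hB.prod isOpen_univ).mem_nhds ⟨hu, mem_univ _⟩)
  have h1 : ∀ᶠ z in 𝓝 (u, w), z.1 ∈ B ∧ sN n (G z - G (u, w)) < ε / 2 :=
    (continuous_fst.tendsto (u, w) |>.eventually (hB.mem_nhds hu)).and
      ((tendsto_iff.1 hGc n).eventually (gt_mem_nhds (half_pos hε)))
  have h2 := eventually_segment h1
  rw [nhds_prod_eq] at h2
  have h3 := h2.filter_mono (prod_mono_left (𝓝 w) (nhdsWithin_le_nhds (s := {0}ᶜ)))
  have hne : ∀ᶠ z : ℝ × X in 𝓝[≠] 0 ×ˢ 𝓝 w, z.1 ≠ 0 :=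
    tendsto_fst.eventually (eventually_mem_nhdsWithin)
  filter_upwards [h3, hne] with z hz hz0
  have hseg : ∀ s ∈ uIcc 0 z.1, ∃ τ ∈ Icc (0 : ℝ) 1, s = τ * z.1 := fun s hs => by
    refine ⟨s / z.1, ?_, by field_simp⟩
    rcases mem_uIcc.1 hs with h | h
    · have : 0 < z.1 := lt_of_le_of_ne (h.1.trans h.2) hz0.symm
      exact ⟨div_nonneg h.1 this.le, (div_le_one this).2 h.2⟩
    · have : z.1 < 0 := lt_of_le_of_ne (h.1.trans h.2) hz0
      exact ⟨div_nonneg_of_nonpos h.2 this.le, (div_le_one_of_neg this).2 h.1⟩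
  have key := sN_sub_sub_le (n := n) (f := fun s => P (u + s • z.2))
    (f' := fun s => G (u + s • z.2, z.2)) (t := z.1) (y := G (u, w)) (ε := ε / 2)
    (fun s hs => by
      obtain ⟨τ, hτ, rfl⟩ := hseg s hs
      exact tendsto_of_gateaux hd _ (hz τ hτ).1) (half_pos hε).le
    (fun s hs => by
      obtain ⟨τ, hτ, rfl⟩ := hseg s hs
      exact (hz τ hτ).2.le)
  rw [Real.dist_0_eq_abs, abs_of_nonneg (sN_nonneg _ _)]
  have e : z.1⁻¹ • (P (u + z.1 • z.2) - P u) - G (u, w) =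
      z.1⁻¹ • (P (u + z.1 • z.2) - P (u + (0 : ℝ) • z.2) - z.1 • G (u, w)) := by
    rw [zero_smul, add_zero, smul_sub _ _ (z.1 • _), smul_smul, inv_mul_cancel₀ hz0, one_smul]
  rw [e]
  calc _ ≤ |z.1⁻¹| * (ε / 2 * |z.1|) :=
        (sN_smul_le _ _ _).trans (mul_le_mul_of_nonneg_left key (abs_nonneg _))
    _ = ε / 2 := by rw [abs_inv]; field_simp [abs_pos.2 hz0]
    _ < ε := half_lt_self hε

end General

section Interval

variable {L : ℝ}

lemma goodBody_Icc (hL : 0 < L) : GoodBody (Icc 0 L) := ⟨isCompact_Icc, uniqueDiffOn_Icc hL⟩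

lemma sm (f : CInf (Icc 0 L)) : Sm 0 L f := f.contDiffOn

lemma sN_le_hN (hL : 0 < L) {α : ℝ} (h1 : α ≤ 1) (n : ℕ) (f : CInf (Icc 0 L)) :
    sN n f ≤ hN α 0 L n f :=
  ENNReal.toReal_le_of_le_ofReal (hN_nonneg _ _ _ _ _)
    ((le_add_right le_rfl).trans (holderNorm_Icc_le hL h1 n f.sm))

lemma hN_le_sN (hL : 0 < L) (n : ℕ) (f : CInf (Icc 0 L)) :
    hN 0 0 L n f ≤ 3 * (n + 1) * sN n f := by
  haveI := goodBody_Icc hL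
  refine hN_zero_exp_le (sN_nonneg _ _) fun j hj x hx => ?_
  rw [← iteratedDerivWithin_eq_dI f j hx, ← Real.norm_eq_abs,
    ← norm_iteratedFDerivWithin_eq_norm_iteratedDerivWithin]
  exact norm_le_sN hj f hx

lemma exists_sN_sq_le (hL : 0 < L) (n : ℕ) : ∃ C : ℝ, 0 ≤ C ∧ ∀ f : CInf (Icc 0 L),
    sN n f ^ 2 ≤ C * (sN (n + n) f * sN 0 f) := by
  haveI := goodBody_Icc hL
  obtain ⟨C, hC1, hC⟩ := exists_hN_mul_le (sub_pos.2 hL) (n + n)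
  refine ⟨C * 2 * (3 * ((n + n : ℕ) + 1) * 3), by positivity, fun f => ?_⟩
  have h := hC le_rfl zero_le_one le_rfl le_rfl f.sm f.sm 0 0 n n rfl
  simp only [zero_add] at h
  have h1 := sN_le_hN hL zero_le_one n f
  have h2 := hN_le_sN hL (n + n) f
  have h3 := hN_le_sN hL 0 f
  simp only [Nat.cast_zero, zero_add, mul_one] at h3
  have n1 := sN_nonneg n f
  have n2 := sN_nonneg (n + n) f
  have n3 := sN_nonneg 0 f
  have n4 := hN_nonneg 0 0 L (n + n) f
  have n5 := hN_nonneg 0 0 L 0 f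
  calc sN n f ^ 2 = sN n f * sN n f := sq _
    _ ≤ hN 0 0 L n f * hN 0 0 L n f := mul_le_mul h1 h1 n1 (n1.trans h1)
    _ ≤ C * (hN 0 0 L (n + n) f * hN 0 0 L 0 f + hN 0 0 L 0 f * hN 0 0 L (n + n) f) := h
    _ = C * 2 * (hN 0 0 L (n + n) f * hN 0 0 L 0 f) := by ring
    _ ≤ C * 2 * ((3 * ((n + n : ℕ) + 1) * sN (n + n) f) * (3 * sN 0 f)) := by gcongr
    _ = _ := by ring

variable {X : Type*} [AddCommGroup X] [Module ℝ X] [TopologicalSpace X] [IsTopologicalAddGroup X]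
  [ContinuousSMul ℝ X]

/-- A locally bounded map that is differentiable along lines with a derivative that is small in
the supremum norm in small directions is continuous. -/
lemma continuousOn_of_gateaux (hL : 0 < L) {B : Set X} (hB : IsOpen B) {P : X → CInf (Icc 0 L)}
    {G : X × X → CInf (Icc 0 L)}
    (hd : ∀ u ∈ B, ∀ w, Tendsto (fun t : ℝ => t⁻¹ • (P (u + t • w) - P u)) (𝓝[≠] 0) (𝓝 (G (u, w))))
    (hb : ∀ u ∈ B, ∃ V ∈ 𝓝 u, ∃ π : X → ℝ, Continuous π ∧ π 0 = 0 ∧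
      ∀ u' ∈ V ∩ B, ∀ w, sN 0 (G (u', w)) ≤ π w)
    (hn : ∀ u ∈ B, ∀ n, ∃ V ∈ 𝓝 u, ∃ A : ℝ, ∀ u' ∈ V ∩ B, sN n (P u') ≤ A) :
    ContinuousOn P B := by
  haveI := goodBody_Icc hL
  intro u hu
  refine ContinuousAt.continuousWithinAt (tendsto_iff.2 ?_)
  have hBu := hB.mem_nhds hu
  have h0 : Tendsto (fun u' => sN 0 (P u' - P u)) (𝓝 u) (𝓝 0) := by
    obtain ⟨V, hV, π, hπ, hπ0, hG⟩ := hb u hu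
    have h1 : ∀ᶠ z : X × X in 𝓝 (u, 0), z.1 ∈ V ∩ B :=
      continuous_fst.tendsto (u, 0) |>.eventually (inter_mem hV hBu)
    have h2 : ∀ᶠ w in 𝓝 (0 : X), ∀ τ ∈ Icc (0 : ℝ) 1, u + τ • w ∈ V ∩ B := by
      refine isCompact_Icc.eventually_forall_of_forall_eventually fun τ _ => ?_
      have hc : Tendsto (fun z : X × ℝ => u + z.2 • z.1) (𝓝 (0, τ)) (𝓝 (u + τ • 0)) :=
        Continuous.tendsto (by fun_prop) (0, τ)
      rw [smul_zero, add_zero] at hc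
      exact hc.eventually (inter_mem hV hBu)
    have h3 : Tendsto (fun u' => u' - u) (𝓝 u) (𝓝 0) := by
      have : Tendsto (fun u' => u' - u) (𝓝 u) (𝓝 (u - u)) := Continuous.tendsto (by fun_prop) u
      rwa [sub_self] at this
    have h4 : Tendsto (fun u' => π (u' - u)) (𝓝 u) (𝓝 0) := by
      have := (hπ.tendsto 0).comp h3
      rwa [hπ0] at this
    refine squeeze_zero' (Eventually.of_forall fun _ => sN_nonneg _ _) ?_ h4
    filter_upwards [h3.eventually h2] with u' hu'
    have huIcc : uIcc (0 : ℝ) 1 = Icc 0 1 := uIcc_of_le zero_le_one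
    have hpi : 0 ≤ π (u' - u) := (sN_nonneg 0 _).trans
      (hG _ (hu' 0 (left_mem_Icc.2 zero_le_one)) (u' - u))
    have key := sN_sub_sub_le (n := 0) (f := fun s => P (u + s • (u' - u)))
      (f' := fun s => G (u + s • (u' - u), u' - u)) (t := 1) (y := 0) (ε := π (u' - u))
      (fun s hs => tendsto_of_gateaux hd _ (hu' s (huIcc ▸ hs)).2) hpi
      (fun s hs => by rw [sub_zero]; exact hG _ (hu' s (huIcc ▸ hs)) _)
    simpa using key
  intro n
  obtain ⟨V, hV, A, hA⟩ := hn u hu (n + n)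
  obtain ⟨C, hC0, hC⟩ := exists_sN_sq_le hL n
  have h2 : Tendsto (fun u' => √(C * ((A + sN (n + n) (P u)) * sN 0 (P u' - P u)))) (𝓝 u) (𝓝 0) := by
    have := ((h0.const_mul (A + sN (n + n) (P u))).const_mul C).sqrt
    simpa using this
  refine squeeze_zero' (Eventually.of_forall fun _ => sN_nonneg _ _) ?_ h2
  filter_upwards [inter_mem hV hBu] with u' hu'
  refine Real.le_sqrt_of_sq_le ((hC _).trans ?_)
  have := sN_nonneg 0 (P u' - P u)
  gcongr
  exact (sN_sub_le _ _ _).trans (add_le_add (hA u' hu') le_rfl)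

/-- The difference quotients of a family of functions that depends smoothly on a parameter converge
in the space of smooth functions. -/
lemma tendsto_diffQuot (hL : 0 < L) {F : ℝ × ℝ → ℝ} (hF : C∞ F)
    {f : ℝ → CInf (Icc 0 L)} (hf : ∀ᶠ t in 𝓝 (0 : ℝ), ∀ m ∈ Icc 0 L, f t m = F (t, m))
    {g : CInf (Icc 0 L)} (hg : ∀ m ∈ Ioo 0 L, HasDerivAt (fun t => F (t, m)) (g m) 0) :
    Tendsto (fun t : ℝ => t⁻¹ • (f t - f 0)) (𝓝[≠] 0) (𝓝 g) := by
  haveI := goodBody_Icc hL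
  set F₁ : ℝ × ℝ → ℝ := fun z => fderiv ℝ F z (1, 0)
  have hF₁ : C∞ F₁ := (hF.fderiv_right (by simp)).clm_apply contDiff_const
  have hd : ∀ t m, HasDerivAt (fun t => F (t, m)) (F₁ (t, m)) t := fun t m => by
    have h4 : HasFDerivAt F (fderiv ℝ F (t, m)) (t, m) :=
      (hF.differentiable (by simp) (t, m)).hasFDerivAt
    have h5 : HasDerivAt (fun t : ℝ => (t, m)) ((1 : ℝ), (0 : ℝ)) t :=
      (hasDerivAt_id t).prodMk (hasDerivAt_const t m)
    exact h4.comp_hasDerivAt t h5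
  set D : ℝ × ℝ → ℝ := fun z => ∫ τ in (0 : ℝ)..1, (F₁ (z.1 * τ, z.2) - F₁ (0, z.2))
  have hD : C∞ D := by
    refine contDiff_intervalIntegral (F := fun w : (ℝ × ℝ) × ℝ =>
      F₁ (w.1.1 * w.2, w.1.2) - F₁ (0, w.1.2)) ((hF₁.comp ?_).sub (hF₁.comp ?_)) 0 1 <;> fun_prop
  have hcont1 : ∀ m, Continuous fun t => F₁ (t, m) := fun m => hF₁.continuous.comp (by fun_prop)
  have hDt : ∀ t m, t ≠ 0 → D (t, m) = t⁻¹ * (F (t, m) - F (0, m)) - F₁ (0, m) := fun t m ht => by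
    have hc : Continuous fun τ => F₁ (t * τ, m) := (hcont1 m).comp (by fun_prop)
    simp only [D]
    rw [intervalIntegral.integral_sub (hc.intervalIntegrable _ _) intervalIntegrable_const,
      intervalIntegral.integral_const, sub_zero, one_smul]
    congr 1
    have h2 := intervalIntegral.smul_integral_comp_mul_left (a := 0) (b := 1)
      (fun τ => F₁ (τ, m)) t
    rw [smul_eq_mul, mul_zero, mul_one, intervalIntegral.integral_eq_sub_of_hasDerivAt
      (fun x _ => hd x m) ((hcont1 m).intervalIntegrable _ _)] at h2
    rw [← h2]
    field_simp
  have hgF : ∀ m ∈ Icc 0 L, g m = F₁ (0, m) := by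
    have h1 : EqOn g (fun m => F₁ (0, m)) (Ioo 0 L) := fun m hm => (hg m hm).unique (hd 0 m)
    have h2 : ContinuousOn (fun m => F₁ (0, m)) (Icc 0 L) :=
      (hF₁.continuous.comp (by fun_prop : Continuous fun m : ℝ => ((0 : ℝ), m))).continuousOn
    exact h1.of_subset_closure g.continuousOn h2 Ioo_subset_Icc_self
      (by rw [closure_Ioo hL.ne])
  have hD0 : ∀ m, D (0, m) = 0 := fun m => by simp [D]
  have hz : ∀ j m, dSnd^[j] D (0, m) = 0 := fun j => by
    have h : ∀ {F : ℝ × ℝ → ℝ}, C∞ F → (∀ m, F (0, m) = 0) →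
        ∀ m, dSnd F (0, m) = 0 := fun hF h m => by
      have h1 := hasDerivAt_dSnd hF 0 m
      simp only [h] at h1
      exact h1.unique (hasDerivAt_const m 0)
    have : ∀ {F : ℝ × ℝ → ℝ}, C∞ F → (∀ m, F (0, m) = 0) →
        ∀ m, dSnd^[j] F (0, m) = 0 := by
      induction j with
      | zero => exact fun _ h => h
      | succ j ih => exact fun hF h0 => ih (contDiff_dSnd hF) (h hF h0)
    exact this hD hD0
  refine tendsto_iff.2 fun n => Metric.tendsto_nhds.2 fun ε hε => ?_
  set ε' := ε / (3 * (n + 1) * 2) with hε'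
  have hε'0 : 0 < ε' := by positivity
  have h1 : ∀ j ∈ Finset.range (n + 1), ∀ᶠ t in 𝓝 (0 : ℝ), ∀ m ∈ Icc 0 L, |dSnd^[j] D (t, m)| < ε' :=
    fun j _ => by
      refine isCompact_Icc.eventually_forall_of_forall_eventually fun m _ => ?_
      have := (contDiff_dSnd_iterate hD j).continuous.abs.tendsto (0, m)
      rw [hz, abs_zero] at this
      exact this.eventually (gt_mem_nhds hε'0)
  have h2 := (Filter.eventually_all_finset _).2 h1
  filter_upwards [nhdsWithin_le_nhds h2, nhdsWithin_le_nhds hf, eventually_mem_nhdsWithin]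
    with t ht hft ht0
  rw [Real.dist_0_eq_abs, abs_of_nonneg (sN_nonneg _ _)]
  have e : EqOn (t⁻¹ • (f t - f 0) - g : CInf (Icc 0 L)) (fun m => D (t, m)) (Icc 0 L) :=
    fun m hm => by
      show t⁻¹ * (f t m - f 0 m) - g m = D (t, m)
      rw [hDt t m ht0, hft m hm, hf.self_of_nhds m hm, hgF m hm]
  calc _ ≤ hN 0 0 L n (t⁻¹ • (f t - f 0) - g : CInf (Icc 0 L)) := sN_le_hN hL zero_le_one n _
    _ = hN 0 0 L n (fun m => D (t, m)) := hN_congr n e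
    _ ≤ 3 * (n + 1) * ε' := hN_zero_exp_le hε'0.le fun j hj m hm => by
        rw [dI_iterate_eq_dSnd hD hL t j hm]
        exact (ht j (Finset.mem_range.2 (by omega)) m hm).le
    _ = ε / 2 := by rw [hε']; field_simp
    _ < ε := half_lt_self hε

end Interval

end CInf

/-! ### Superposition operators on spaces of continuous functions -/

section Superposition

variable {I : Type} [TopologicalSpace I] [CompactSpace I] {E F : Type} [NormedAddCommGroup E]
  [NormedSpace ℝ E] [NormedAddCommGroup F] [NormedSpace ℝ F]

/-- The superposition operator `γ ↦ f ∘ γ`. -/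
def superpos (f : C(E, F)) (γ : C(I, E)) : C(I, F) := f.comp γ

/-- Pointwise evaluation of operator-valued functions. -/
def pointwiseEval : C(I, E →L[ℝ] F) →L[ℝ] C(I, E) →L[ℝ] C(I, F) :=
  LinearMap.mkContinuous₂
    (LinearMap.mk₂ ℝ (fun (A : C(I, E →L[ℝ] F)) (h : C(I, E)) =>
        (⟨fun t => A t (h t), A.continuous.clm_apply h.continuous⟩ : C(I, F)))
      (fun _ _ _ => rfl) (fun _ _ _ => rfl) (fun _ _ _ => by ext; simp)
      (fun _ _ _ => by ext; simp)) 1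
    (fun A h => by
      rw [one_mul]
      refine (ContinuousMap.norm_le _ (by positivity)).2 fun t => ?_
      exact ((A t).le_opNorm _).trans (mul_le_mul (A.norm_coe_le_norm t) (h.norm_coe_le_norm t)
        (norm_nonneg _) (by positivity)))

lemma pointwiseEval_apply (A : C(I, E →L[ℝ] F)) (h : C(I, E)) (t : I) :
    pointwiseEval A h t = A t (h t) := rfl

lemma hasFDerivAt_superpos {f : C(E, F)} {f' : C(E, E →L[ℝ] F)}
    (hf : ∀ x, HasFDerivAt f (f' x) x) (γ : C(I, E)) :
    HasFDerivAt (superpos f) (pointwiseEval (superpos f' γ)) γ := by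
  rw [hasFDerivAt_iff_isLittleO_nhds_zero, Asymptotics.isLittleO_iff]
  intro ε hε
  have hc : Tendsto (superpos f' : C(I, E) → C(I, E →L[ℝ] F)) (𝓝 γ) (𝓝 (superpos f' γ)) :=
    (ContinuousMap.continuous_postcomp f').tendsto γ
  obtain ⟨δ, hδ, H⟩ := Metric.tendsto_nhds_nhds.1 hc ε hε
  filter_upwards [Metric.ball_mem_nhds (0 : C(I, E)) hδ] with h hh
  rw [mem_ball_zero_iff] at hh
  refine (ContinuousMap.norm_le _ (by positivity)).2 fun t => ?_
  have hb : ∀ z ∈ Metric.ball (γ t) δ, ‖f' z - f' (γ t)‖ ≤ ε := fun z hz => by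
    have h1 := @H (γ + ContinuousMap.const I (z - γ t)) (by
      rw [dist_eq_norm, add_sub_cancel_left]
      refine ((ContinuousMap.norm_le _ (norm_nonneg (z - γ t))).2 fun s => ?_).trans_lt
        (mem_ball_iff_norm.1 hz)
      rfl)
    have h2 := (ContinuousMap.dist_apply_le_dist (f := superpos f' (γ + ContinuousMap.const I
      (z - γ t))) (g := superpos f' γ) t).trans h1.le
    rw [dist_eq_norm] at h2
    simpa [superpos] using h2
  have := (convex_ball (γ t) δ).norm_image_sub_le_of_norm_hasFDerivWithin_le'
    (fun z _ => (hf z).hasFDerivWithinAt) hb (Metric.mem_ball_self hδ)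
    (show γ t + h t ∈ Metric.ball (γ t) δ by
      rw [mem_ball_iff_norm, add_sub_cancel_left]
      exact (h.norm_coe_le_norm t).trans_lt hh)
  rw [add_sub_cancel_left] at this
  exact this.trans (mul_le_mul_of_nonneg_left (h.norm_coe_le_norm t) hε.le)

lemma contDiff_superpos (n : ℕ) {F : Type} [NormedAddCommGroup F] [NormedSpace ℝ F] (f : C(E, F))
    (hf : ContDiff ℝ n f) : ContDiff ℝ n (superpos f : C(I, E) → C(I, F)) := by
  induction n generalizing F with
  | zero =>
    rw [Nat.cast_zero, contDiff_zero]
    exact ContinuousMap.continuous_postcomp f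
  | succ n ih =>
    push_cast at hf ⊢
    rw [contDiff_succ_iff_hasFDerivAt] at hf ⊢
    obtain ⟨f', hf', hd⟩ := hf
    exact ⟨_, pointwiseEval.contDiff.comp (ih ⟨f', hf'.continuous⟩ hf'),
      hasFDerivAt_superpos (f' := ⟨f', hf'.continuous⟩) hd⟩

end Superposition

/-! ### Volterra operators -/

section Volterra

variable {E : Type} [NormedAddCommGroup E] [NormedSpace ℝ E] [CompleteSpace E]

/-- The extension of a function on the unit interval by constants. -/
def extendI (g : C(unitInterval, E)) : ℝ → E := IccExtend zero_le_one g

lemma continuous_extendI (g : C(unitInterval, E)) : Continuous (extendI g) :=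
  g.continuous.Icc_extend'

lemma extendI_apply (g : C(unitInterval, E)) (t : unitInterval) : extendI g t = g t :=
  IccExtend_val _ _ t

lemma norm_extendI_le (g : C(unitInterval, E)) (t : ℝ) : ‖extendI g t‖ ≤ ‖g‖ :=
  g.norm_coe_le_norm _

/-- The primitive that vanishes at `0`. -/
def primitiveCLM : C(unitInterval, E) →L[ℝ] C(unitInterval, E) :=
  LinearMap.mkContinuous
    { toFun := fun g => ⟨fun t => ∫ s in (0 : ℝ)..t, extendI g s,
        (intervalIntegral.continuous_primitive
          (fun _ _ => (continuous_extendI g).intervalIntegrable _ _) 0).comp continuous_subtype_val⟩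
      map_add' := fun g h => by
        ext t
        exact intervalIntegral.integral_add ((continuous_extendI g).intervalIntegrable _ _)
          ((continuous_extendI h).intervalIntegrable _ _)
      map_smul' := fun c g => by
        ext t
        exact intervalIntegral.integral_smul c _ }
    1 (fun g => by
      refine (ContinuousMap.norm_le _ (by positivity)).2 fun t => ?_
      refine (intervalIntegral.norm_integral_le_of_norm_le_const
        (fun s _ => norm_extendI_le g s)).trans ?_
      rw [sub_zero, abs_of_nonneg t.2.1, mul_comm]
      exact mul_le_mul_of_nonneg_right t.2.2 (norm_nonneg _))

lemma primitiveCLM_apply (g : C(unitInterval, E)) (t : unitInterval) :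
    primitiveCLM g t = ∫ s in (0 : ℝ)..t, extendI g s := rfl

lemma norm_volterra_pow_apply_le (A : C(unitInterval, E →L[ℝ] E)) (n : ℕ) (h : C(unitInterval, E))
    (t : unitInterval) : ‖((primitiveCLM.comp (pointwiseEval A)) ^ n) h t‖ ≤
      ‖A‖ ^ n * (t : ℝ) ^ n / n.factorial * ‖h‖ := by
  induction n generalizing t with
  | zero => simpa using h.norm_coe_le_norm t
  | succ n ih =>
    set B := primitiveCLM.comp (pointwiseEval A)
    rw [pow_succ', mul_apply_eq_comp, ContinuousLinearMap.comp_apply,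
      primitiveCLM_apply]
    have hb : ∀ s ∈ Ioc (0 : ℝ) t, ‖extendI (pointwiseEval A ((B ^ n) h)) s‖ ≤
        ‖A‖ ^ (n + 1) * ‖h‖ / n.factorial * s ^ n := fun s hs => by
      have hs1 : s ∈ unitInterval := ⟨hs.1.le, hs.2.trans t.2.2⟩
      rw [show s = ((⟨s, hs1⟩ : unitInterval) : ℝ) from rfl, extendI_apply, pointwiseEval_apply]
      refine ((A _).le_opNorm _).trans ((mul_le_mul (A.norm_coe_le_norm _) (ih _) (norm_nonneg _)
        (norm_nonneg _)).trans (le_of_eq ?_))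
      ring
    refine (intervalIntegral.norm_integral_le_of_norm_le t.2.1
      (Eventually.of_forall fun s hs => hb s hs)
      ((continuous_const.mul (continuous_pow n)).intervalIntegrable _ _)).trans (le_of_eq ?_)
    rw [intervalIntegral.integral_const_mul, integral_pow, Nat.factorial_succ]
    push_cast
    field_simp
    ring

lemma isUnit_one_sub_volterra (A : C(unitInterval, E →L[ℝ] E)) :
    IsUnit (1 - primitiveCLM.comp (pointwiseEval A)) := by
  set B := primitiveCLM.comp (pointwiseEval A)
  have h1 : Tendsto (fun n : ℕ => ‖A‖ ^ n / n.factorial) atTop (𝓝 0) :=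
    FloorSemiring.tendsto_pow_div_factorial_atTop _
  obtain ⟨n, hn⟩ := (h1.eventually (gt_mem_nhds one_pos)).exists
  have hB : ‖B ^ n‖ < 1 := by
    refine lt_of_le_of_lt (ContinuousLinearMap.opNorm_le_bound _ (by positivity) fun h => ?_) hn
    refine (ContinuousMap.norm_le _ (by positivity)).2 fun t =>
      (norm_volterra_pow_apply_le A n h t).trans ?_
    have : (t : ℝ) ^ n ≤ 1 := pow_le_one₀ t.2.1 t.2.2
    gcongr
    exact mul_le_of_le_one_right (by positivity) this
  have hu : IsUnit (1 - B ^ n) := (Units.oneSub (B ^ n) hB).isUnit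
  rw [← mul_neg_geom_sum] at hu
  have hc : Commute (1 - B) (∑ i ∈ Finset.range n, B ^ i) :=
    Commute.sum_right _ _ _ fun i _ => ((Commute.one_left _).sub_left ((Commute.refl B).pow_right i))
  exact (hc.isUnit_mul_iff.1 hu).1

end Volterra

/-! ### Smooth flows of compactly supported vector fields -/

section Flow

variable {E : Type} [NormedAddCommGroup E] [NormedSpace ℝ E] [FiniteDimensional ℝ E]

/-- `γ` solves `γ' = Y(γ)` on `[0, 1]`. -/
def IsSol (Y : E → E) (γ : ℝ → E) : Prop :=
  ∀ t ∈ Icc (0 : ℝ) 1, HasDerivWithinAt γ (Y (γ t)) (Icc 0 1) t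

lemma IsSol.eqOn {Y : E → E} {k : ℝ≥0} (hY : LipschitzWith k Y) {γ η : ℝ → E} (hγ : IsSol Y γ)
    (hη : IsSol Y η) (h : γ 0 = η 0) : EqOn γ η (Icc 0 1) := by
  have aux : ∀ {γ : ℝ → E}, IsSol Y γ → ContinuousOn γ (Icc 0 1) ∧
      ∀ t ∈ Ico (0 : ℝ) 1, HasDerivWithinAt γ (Y (γ t)) (Ici t) t := fun hγ =>
    ⟨fun t ht => (hγ t ht).continuousWithinAt, fun t ht =>
      (hγ t ⟨ht.1, ht.2.le⟩).mono_of_mem_nhdsWithin (mem_of_superset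
        (Icc_mem_nhdsGE ht.2) (Icc_subset_Icc_left ht.1))⟩
  exact ODE_solution_unique (v := fun _ => Y) (fun _ => hY) (aux hγ).1 (aux hγ).2 (aux hη).1
    (aux hη).2 h

lemma isSol_of_integral {Y : E → E} (hY : Continuous Y) {g : C(unitInterval, E)} {x : E}
    (hg : ∀ t : unitInterval, g t = x + ∫ s in (0 : ℝ)..t, Y (extendI g s)) :
    IsSol Y (extendI g) := fun t ht => by
  have hc : Continuous fun s => Y (extendI g s) := hY.comp (continuous_extendI g)
  have h1 : HasDerivAt (fun t => x + ∫ s in (0 : ℝ)..t, Y (extendI g s)) (Y (extendI g t)) t :=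
    (intervalIntegral.integral_hasDerivAt_right (hc.intervalIntegrable _ _)
      (hc.stronglyMeasurableAtFilter _ _) hc.continuousAt).const_add x
  exact h1.hasDerivWithinAt.congr_of_mem
    (fun s hs => (extendI_apply g ⟨s, hs⟩).trans (hg ⟨s, hs⟩)) ht

lemma IsSol.integral {Y : E → E} (hY : Continuous Y) {γ : ℝ → E} (hγ : IsSol Y γ) {t : ℝ}
    (ht : t ∈ Icc (0 : ℝ) 1) : γ t = γ 0 + ∫ s in (0 : ℝ)..t, Y (γ s) := by
  have hc : ContinuousOn γ (Icc 0 1) := fun t ht => (hγ t ht).continuousWithinAt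
  have hsub : Icc 0 t ⊆ Icc (0 : ℝ) 1 := Icc_subset_Icc_right ht.2
  have h := intervalIntegral.integral_eq_sub_of_hasDeriv_right_of_le (f := γ)
    (f' := fun s => Y (γ s)) ht.1 (hc.mono hsub) (fun s hs =>
      (hγ s (hsub (Ioo_subset_Icc_self hs))).mono_of_mem_nhdsWithin (mem_of_superset
        (Ioo_mem_nhdsGT (hs.2.trans_le ht.2)) fun r hr => ⟨hs.1.le.trans hr.1.le, hr.2.le⟩))
    ((hY.comp_continuousOn (hc.mono hsub)).intervalIntegrable_of_Icc ht.1)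
  rw [h]; abel

/-- The time-one map of a smooth compactly supported vector field is smooth. -/
theorem exists_contDiff_timeOne {Y : E → E} (hY : C∞ Y)
    (hc : HasCompactSupport Y) {k : ℝ≥0} (hk : LipschitzWith k Y) :
    ∃ Θ : E → E, C∞ Θ ∧ ∀ x, ∃ γ : ℝ → E, γ 0 = x ∧ γ 1 = Θ x ∧ IsSol Y γ := by
  obtain ⟨M, hM⟩ := hY.continuous.bounded_above_of_compact_support hc
  have hex : ∀ x, ∃ γ : ℝ → E, γ 0 = x ∧ IsSol Y γ := fun x => by
    have hP : IsPicardLindelof (fun _ => Y) (tmin := 0) (tmax := 1) ⟨0, by simp⟩ x M.toNNReal 0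
        M.toNNReal k :=
      { lipschitzOnWith := fun _ _ => hk.lipschitzOnWith
        continuousOn := fun _ _ => continuousOn_const
        norm_le := fun _ _ y _ => (hM y).trans (Real.le_coe_toNNReal M)
        mul_max_le := by simp }
    exact hP.exists_eq_forall_mem_Icc_hasDerivWithinAt₀
  choose γ hγ0 hγ using hex
  refine ⟨fun x => γ x 1, contDiff_iff_contDiffAt.2 fun x => ?_, fun x => ⟨γ x, hγ0 x, rfl, hγ x⟩⟩
  let Yc : C(E, E) := ⟨Y, hY.continuous⟩
  let Y' : C(E, E →L[ℝ] E) := ⟨fderiv ℝ Y, hY.continuous_fderiv (by simp)⟩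
  let T : C(unitInterval, E) → C(unitInterval, E) := fun g => g - primitiveCLM (superpos Yc g)
  have hT : C∞ T := contDiff_id.sub (primitiveCLM.contDiff.comp
    (contDiff_infty.2 fun n => contDiff_superpos n Yc (contDiff_infty.1 hY n)))
  have hγc : ∀ y, ContinuousOn (γ y) (Icc 0 1) := fun y t ht => (hγ y t ht).continuousWithinAt
  let g : C(unitInterval, E) := ⟨fun t => γ x t, (hγc x).comp_continuous continuous_subtype_val
    (fun t => t.2)⟩
  have hgT : T g = ContinuousMap.const _ x := by
    ext t
    have h1 := (hγ x).integral hY.continuous t.2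
    have h2 : ∫ s in (0 : ℝ)..t, extendI (superpos Yc g) s = ∫ s in (0 : ℝ)..t, Y (γ x s) := by
      refine intervalIntegral.integral_congr fun s hs => ?_
      rw [uIcc_of_le t.2.1] at hs
      exact extendI_apply (superpos Yc g) ⟨s, hs.1, hs.2.trans t.2.2⟩
    show γ x t - ∫ s in (0 : ℝ)..t, extendI (superpos Yc g) s = x
    rw [h2, h1, hγ0]; abel
  obtain ⟨u, hu⟩ := isUnit_one_sub_volterra (superpos Y' g)
  let e : C(unitInterval, E) ≃L[ℝ] C(unitInterval, E) := ContinuousLinearEquiv.ofUnit u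
  have hTd : HasFDerivAt T (e : C(unitInterval, E) →L[ℝ] C(unitInterval, E)) g := by
    have h1 : HasFDerivAt T (ContinuousLinearMap.id ℝ _ -
        primitiveCLM.comp (pointwiseEval (superpos Y' g))) g :=
      (hasFDerivAt_id g).sub (HasFDerivAt.comp (g := fun f => primitiveCLM f) (f := superpos Yc) g
        (primitiveCLM (E := E)).hasFDerivAt (hasFDerivAt_superpos (f := Yc) (f' := Y')
          (fun x => (hY.differentiable (by simp) x).hasFDerivAt) g))
    have h2 : (e : C(unitInterval, E) →L[ℝ] C(unitInterval, E)) = u := rfl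
    rw [h2, hu]
    exact h1
  have hn : ((⊤ : ℕ∞) : WithTop ℕ∞) ≠ 0 := by simp
  have hS := hT.contDiffAt.to_localInverse hTd hn
  set S := hT.contDiffAt.localInverse hTd hn
  have hr : ∀ᶠ f in 𝓝 (T g), T (S f) = f :=
    (hT.contDiffAt.hasStrictFDerivAt' hTd hn).eventually_right_inverse
  rw [hgT] at hS hr
  let cst : E →L[ℝ] C(unitInterval, E) := LinearMap.mkContinuous
    { toFun := ContinuousMap.const _, map_add' := fun _ _ => rfl, map_smul' := fun _ _ => rfl } 1
    (fun y => (ContinuousMap.norm_le _ (by positivity)).2 fun t => (one_mul ‖y‖).ge)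
  let ev : C(unitInterval, E) →L[ℝ] E := ContinuousMap.evalCLM ℝ (1 : unitInterval)
  have h1 : ContDiffAt ℝ (⊤ : ℕ∞) (fun y => ev (S (cst y))) x :=
    ev.contDiff.contDiffAt.comp x (ContDiffAt.comp (g := S) (f := cst) x hS cst.contDiff.contDiffAt)
  refine h1.congr_of_eventuallyEq ?_
  have h2 : ∀ᶠ y in 𝓝 x, T (S (cst y)) = cst y := cst.continuous.continuousAt.eventually hr
  filter_upwards [h2] with y hy
  have h3 : IsSol Y (extendI (S (cst y))) := by
    refine isSol_of_integral hY.continuous (x := y) fun t => ?_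
    have h4 := congrArg (fun f => f t) hy
    change S (cst y) t - ∫ s in (0 : ℝ)..t, Y (extendI (S (cst y)) s) = y at h4
    exact sub_eq_iff_eq_add.1 h4
  have h5 : extendI (S (cst y)) 0 = y := by
    have h4 := congrArg (fun f => f 0) hy
    change S (cst y) 0 - ∫ s in (0 : ℝ)..((0 : unitInterval) : ℝ), _ = y at h4
    rw [show ((0 : unitInterval) : ℝ) = 0 from rfl, intervalIntegral.integral_same, sub_zero] at h4
    exact (extendI_apply _ 0).trans h4
  have h6 := IsSol.eqOn hk (hγ y) h3 ((hγ0 y).trans h5.symm) (right_mem_Icc.2 zero_le_one)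
  exact h6.trans (extendI_apply _ 1)

/-- A smooth compactly supported vector field has a smooth flow. -/
theorem exists_contDiff_flow {X : E → E} (hX : C∞ X) (hc : HasCompactSupport X) :
    ∃ φ : ℝ × E → E, C∞ φ ∧ (∀ x, φ (0, x) = x) ∧
      ∀ t ∈ Icc (-2 : ℝ) 2, ∀ x, HasDerivAt (fun t => φ (t, x)) (X (φ (t, x))) t := by
  obtain ⟨kX, hkX⟩ := hX.lipschitzWith_of_hasCompactSupport hc (by simp)
  let b : ContDiffBump (0 : ℝ) := ⟨2, 3, by norm_num, by norm_num⟩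
  let κ : ℝ → ℝ := fun s => b s * s
  have hκ : C∞ κ := b.contDiff.mul contDiff_id
  have hκc : HasCompactSupport κ := b.hasCompactSupport.mul_right
  have hκ2 : ∀ s ∈ Icc (-2 : ℝ) 2, κ s = s := fun s hs => by
    have : b s = 1 := b.one_of_mem_closedBall (by
      rw [Metric.mem_closedBall, dist_zero_right, Real.norm_eq_abs]; exact abs_le.2 hs)
    simp only [κ, this, one_mul]
  let Y : ℝ × E → ℝ × E := fun z => (0, κ z.1 • X z.2)
  have hY : C∞ Y :=
    contDiff_const.prodMk ((hκ.comp contDiff_fst).smul (hX.comp contDiff_snd))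
  have hYc : HasCompactSupport Y := by
    refine HasCompactSupport.intro (hκc.prod hc) fun z hz => ?_
    rw [mem_prod, not_and_or] at hz
    rcases hz with hz | hz
    · simp [Y, image_eq_zero_of_notMem_tsupport hz]
    · simp [Y, image_eq_zero_of_notMem_tsupport hz]
  obtain ⟨kY, hkY⟩ := hY.lipschitzWith_of_hasCompactSupport hYc (by simp)
  obtain ⟨Θ, hΘ, hsol⟩ := exists_contDiff_timeOne hY hYc hkY
  choose γ hγ0 hγ1 hγ using hsol
  set φ : ℝ × E → E := fun z => (Θ z).2
  have hfst : ∀ s x, ∀ t ∈ Icc (0 : ℝ) 1, (γ (s, x) t).1 = s := fun s x t ht => by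
    have h1 : ∀ t ∈ Icc (0 : ℝ) 1, HasDerivWithinAt (fun t => (γ (s, x) t).1) 0 (Icc 0 1) t :=
      fun t ht => ((hγ (s, x) t ht).hasFDerivWithinAt.fst).hasDerivWithinAt.congr_deriv (by simp [Y])
    have h2 := (convex_Icc (0 : ℝ) 1).norm_image_sub_le_of_norm_hasDerivWithin_le h1
      (fun t _ => (norm_zero (E := ℝ)).le) (left_mem_Icc.2 zero_le_one) ht
    rw [zero_mul, norm_le_zero_iff, sub_eq_zero, hγ0] at h2
    exact h2
  have hsnd : ∀ s ∈ Icc (-2 : ℝ) 2, ∀ x, IsSol (fun y => s • X y) (fun t => (γ (s, x) t).2) :=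
    fun s hs x t ht => by
      have h1 := ((hγ (s, x) t ht).hasFDerivWithinAt.snd).hasDerivWithinAt
      refine h1.congr_deriv ?_
      simp [Y, hfst s x t ht, hκ2 s hs]
  have hscale : ∀ s ∈ Icc (-2 : ℝ) 2, ∀ x, ∀ τ ∈ Icc (0 : ℝ) 1,
      φ (s * τ, x) = (γ (s, x) τ).2 := fun s hs x τ hτ => by
    have hsτ : s * τ ∈ Icc (-2 : ℝ) 2 := by
      constructor <;> nlinarith [hs.1, hs.2, hτ.1, hτ.2]
    have h1 : IsSol (fun y => (s * τ) • X y) (fun t => (γ (s, x) (τ * t)).2) := fun t ht => by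
      have hm : MapsTo (fun t => τ * t) (Icc (0 : ℝ) 1) (Icc 0 1) := fun t ht =>
        ⟨mul_nonneg hτ.1 ht.1, mul_le_one₀ hτ.2 ht.1 ht.2⟩
      have h2 := (hsnd s hs x (τ * t) (hm ht)).scomp t
        (((hasDerivAt_id t).const_mul τ).hasDerivWithinAt) hm
      refine h2.congr_deriv ?_
      simp [smul_smul, mul_comm]
    have h2 : LipschitzWith (‖s * τ‖₊ * kX) (fun y => (s * τ) • X y) :=
      (lipschitzWith_smul (s * τ)).comp hkX
    have h3 := IsSol.eqOn h2 h1 (hsnd _ hsτ x) (by simp [hγ0]) (right_mem_Icc.2 zero_le_one)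
    simp only [mul_one] at h3
    rw [h3, hγ1]
  have hφ : C∞ φ := contDiff_snd.comp hΘ
  have hdir : ∀ x t, DifferentiableAt ℝ (fun t => φ (t, x)) t := fun x t =>
    ((hφ.comp (by fun_prop : C∞ fun t : ℝ => (t, x))).differentiable
      (by simp)) t
  refine ⟨φ, hφ, fun x => ?_, fun t ht x => ?_⟩
  · have := hscale 0 (by simp) x 0 (by simp)
    rw [mul_zero, hγ0] at this
    exact this
  · have key : ∀ s ∈ Icc (-2 : ℝ) 2, s ≠ 0 → ∀ τ ∈ Icc (0 : ℝ) 1, t = s * τ →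
        HasDerivAt (fun t => φ (t, x)) (X (φ (t, x))) t := fun s hs hs0 τ hτ hst => by
      have h1 : HasDerivWithinAt (fun τ => φ (s * τ, x)) (s • X (φ (s * τ, x))) (Icc 0 1) τ := by
        rw [hscale s hs x τ hτ]
        exact (hsnd s hs x τ hτ).congr_of_mem (fun τ hτ => hscale s hs x τ hτ) hτ
      have h2 : HasDerivAt (fun τ => φ (s * τ, x)) (s • deriv (fun t => φ (t, x)) (s * τ)) τ := by
        have := (hdir x (s * τ)).hasDerivAt.scomp τ ((hasDerivAt_id τ).const_mul s)
        rwa [mul_one] at this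
      have h3 := (uniqueDiffOn_Icc zero_lt_one τ hτ).eq_deriv _ h1 h2.hasDerivWithinAt
      have h4 := smul_right_injective E hs0 h3
      rw [hst]
      show HasDerivAt _ (X (φ (s * τ, x))) _
      rw [h4]
      exact (hdir x _).hasDerivAt
    rcases le_total 0 t with h | h
    · exact key 2 (by norm_num) two_ne_zero (t / 2) ⟨by linarith, by linarith [ht.2]⟩ (by ring)
    · exact key (-2) (by norm_num) (by norm_num) (-t / 2) ⟨by linarith, by linarith [ht.1]⟩
        (by ring)

end Flow

/-! ### Arc length and the one-dimensional Hausdorff measure -/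

section ArcLength

variable {E : Type} [NormedAddCommGroup E] [NormedSpace ℝ E] [MeasurableSpace E] [BorelSpace E]

lemma hausdorff_image_near {c c' : ℝ → E} (hc : ∀ θ, HasDerivAt c (c' θ) θ) {J S : Set ℝ}
    (hJ : Convex ℝ J) (hS : S ⊆ J) (hSm : MeasurableSet S) {θ₀ : ℝ} {ε : ℝ≥0}
    (hε : ∀ θ ∈ J, ‖c' θ - c' θ₀‖ ≤ ε) (hk : (ε : ℝ) < ‖c' θ₀‖) :
    (Measure.hausdorffMeasure 1 : Measure E) (c '' S) ≤ ∫⁻ θ in S, ‖c' θ‖ₑ + 2 * ε ∧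
      ∫⁻ θ in S, ‖c' θ‖ₑ ≤ (Measure.hausdorffMeasure 1 : Measure E) (c '' S) + 2 * ε * volume S := by
  have hmvt : ∀ x ∈ J, ∀ y ∈ J, ‖c y - c x - (y - x) • c' θ₀‖ ≤ ε * |y - x| := fun x hx y hy => by
    have h := hJ.norm_image_sub_le_of_norm_hasDerivWithin_le
      (f := fun θ => c θ - θ • c' θ₀) (f' := fun θ => c' θ - c' θ₀)
      (fun θ _ => by
        have := (hc θ).sub ((hasDerivAt_id θ).smul_const (c' θ₀))
        rw [one_smul] at this
        exact this.hasDerivWithinAt) hε hx hy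
    rw [Real.norm_eq_abs] at h
    convert h using 2
    rw [sub_smul]; abel
  set k : ℝ≥0 := ‖c' θ₀‖₊
  have hk' : ε < k := hk
  have hup : ∀ x ∈ J, ∀ y ∈ J, ‖c y - c x‖ ≤ (k + ε) * |y - x| := fun x hx y hy => by
    have h1 := hmvt x hx y hy
    have h2 := norm_add_le (c y - c x - (y - x) • c' θ₀) ((y - x) • c' θ₀)
    rw [sub_add_cancel, norm_smul, Real.norm_eq_abs] at h2
    have : (k : ℝ) = ‖c' θ₀‖ := rfl
    rw [this]; linarith
  have hlow : ∀ x ∈ J, ∀ y ∈ J, (k - ε) * |y - x| ≤ ‖c y - c x‖ := fun x hx y hy => by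
    have h1 := hmvt x hx y hy
    have h2 := norm_sub_norm_le ((y - x) • c' θ₀) (-(c y - c x - (y - x) • c' θ₀))
    rw [norm_neg, norm_smul, Real.norm_eq_abs, sub_neg_eq_add, add_sub_cancel] at h2
    have : (k : ℝ) = ‖c' θ₀‖ := rfl
    rw [this]; linarith
  have hL : LipschitzOnWith (k + ε) c S := LipschitzOnWith.of_dist_le_mul fun x hx y hy => by
    rw [dist_eq_norm, Real.dist_eq]
    push_cast
    exact hup y (hS hy) x (hS hx)
  have hkε : 0 < k - ε := tsub_pos_of_lt hk'
  have hkc : ((k - ε : ℝ≥0) : ℝ) = k - ε := NNReal.coe_sub hk'.le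
  have hinj : InjOn c S := fun x hx y hy hxy => by
    have := hlow x (hS hx) y (hS hy)
    rw [hxy, sub_self, norm_zero, ← hkc] at this
    have h0 : |y - x| ≤ 0 := by
      by_contra! h
      have := mul_pos (NNReal.coe_pos.2 hkε) h
      linarith
    linarith [abs_nonpos_iff.1 h0]
  have hg : ∀ x ∈ S, Function.invFunOn c S (c x) = x := fun x hx => hinj.leftInvOn_invFunOn hx
  have hL' : LipschitzOnWith (k - ε)⁻¹ (Function.invFunOn c S) (c '' S) :=
    LipschitzOnWith.of_dist_le_mul fun a ha b hb => by
      obtain ⟨x, hx, rfl⟩ := ha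
      obtain ⟨y, hy, rfl⟩ := hb
      rw [hg x hx, hg y hy, dist_eq_norm (c x), Real.dist_eq, NNReal.coe_inv,
        le_inv_mul_iff₀ (NNReal.coe_pos.2 hkε), hkc]
      exact hlow y (hS hy) x (hS hx)
  have e1 := hL.hausdorffMeasure_image_le zero_le_one
  have e2 := hL'.hausdorffMeasure_image_le zero_le_one
  have himg : Function.invFunOn c S '' (c '' S) = S := by
    rw [image_image]
    exact (image_congr hg).trans (image_id' S)
  rw [himg] at e2
  rw [hausdorffMeasure_real, ENNReal.rpow_one] at e1 e2
  have e3 : ((k - ε : ℝ≥0) : ℝ≥0∞) * volume S ≤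
      (Measure.hausdorffMeasure 1 : Measure E) (c '' S) := by
    rw [ENNReal.coe_inv hkε.ne'] at e2
    calc _ ≤ ((k - ε : ℝ≥0) : ℝ≥0∞) * (((k - ε : ℝ≥0) : ℝ≥0∞)⁻¹ * _) := by gcongr
      _ = _ := by
        rw [← mul_assoc, ENNReal.mul_inv_cancel (by exact_mod_cast hkε.ne') ENNReal.coe_ne_top,
          one_mul]
  have b1 : ∀ θ ∈ S, ((k - ε : ℝ≥0) : ℝ≥0∞) ≤ ‖c' θ‖ₑ := fun θ hθ => by
    rw [enorm_eq_nnnorm, ENNReal.coe_le_coe, ← NNReal.coe_le_coe, hkc]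
    have h1 := hε θ (hS hθ)
    have h2 := norm_sub_norm_le (c' θ₀) (c' θ)
    rw [norm_sub_rev] at h2
    show ‖c' θ₀‖ - ε ≤ ‖c' θ‖
    linarith
  have b2 : ∀ θ ∈ S, ‖c' θ‖ₑ ≤ ((k + ε : ℝ≥0) : ℝ≥0∞) := fun θ hθ => by
    rw [enorm_eq_nnnorm, ENNReal.coe_le_coe, ← NNReal.coe_le_coe, NNReal.coe_add]
    have h1 := hε θ (hS hθ)
    have h2 := norm_sub_norm_le (c' θ) (c' θ₀)
    show ‖c' θ‖ ≤ ‖c' θ₀‖ + ε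
    linarith
  have hsum : ((k + ε : ℝ≥0) : ℝ≥0∞) = ((k - ε : ℝ≥0) : ℝ≥0∞) + 2 * ε := by
    have : k + ε = (k - ε) + 2 * ε := by
      rw [two_mul, ← add_assoc, tsub_add_cancel_of_le hk'.le]
    rw [this]; push_cast; rfl
  constructor
  · refine e1.trans ?_
    rw [← setLIntegral_const, hsum]
    exact setLIntegral_mono' hSm fun θ hθ => add_le_add (b1 θ hθ) le_rfl
  · calc ∫⁻ θ in S, ‖c' θ‖ₑ ≤ ∫⁻ _ in S, ((k + ε : ℝ≥0) : ℝ≥0∞) := setLIntegral_mono' hSm b2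
      _ = ((k - ε : ℝ≥0) : ℝ≥0∞) * volume S + 2 * ε * volume S := by
        rw [setLIntegral_const, hsum, add_mul]
      _ ≤ _ := by gcongr

/-- The length of an injective curve is its one-dimensional Hausdorff measure. -/
theorem hausdorffMeasure_image_eq_lintegral {c c' : ℝ → E} (hc : ∀ θ, HasDerivAt c (c' θ) θ)
    (hcont : Continuous c') {T : ℝ} (h0 : ∀ θ ∈ Icc 0 T, c' θ ≠ 0) {S : Set ℝ}
    (hS : S ⊆ Ico 0 T) (hSm : MeasurableSet S) (hinj : InjOn c S) :
    (Measure.hausdorffMeasure 1 : Measure E) (c '' S) = ∫⁻ θ in S, ‖c' θ‖ₑ := by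
  have hcc : Continuous c := continuous_iff_continuousAt.2 fun θ => (hc θ).continuousAt
  have hvol : volume S ≠ ⊤ := ne_top_of_le_ne_top (by simp) (measure_mono hS)
  obtain ⟨κ, hκ, hκ'⟩ : ∃ κ > 0, ∀ θ ∈ Icc 0 T, κ ≤ ‖c' θ‖ := by
    rcases (Icc 0 T).eq_empty_or_nonempty with h | h
    · exact ⟨1, one_pos, by simp [h]⟩
    · obtain ⟨θ, hθ, hm⟩ := isCompact_Icc.exists_isMinOn h hcont.norm.continuousOn
      exact ⟨_, norm_pos_iff.2 (h0 θ hθ), hm⟩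
  have key : ∀ ε : ℝ≥0, 0 < ε → (ε : ℝ) < κ →
      (Measure.hausdorffMeasure 1 : Measure E) (c '' S) ≤ ∫⁻ θ in S, ‖c' θ‖ₑ + 2 * ε ∧
      ∫⁻ θ in S, ‖c' θ‖ₑ ≤
        (Measure.hausdorffMeasure 1 : Measure E) (c '' S) + 2 * ε * volume S := by
    intro ε hε hεκ
    obtain ⟨δ, hδ, hu⟩ := Metric.uniformContinuousOn_iff.1
      (isCompact_Icc.uniformContinuousOn_of_continuous (hcont.continuousOn (s := Icc 0 T))) ε
      (NNReal.coe_pos.2 hε)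
    set P : ℤ → Set ℝ := fun n => Ico (n • δ) ((n + 1) • δ)
    have hP : ⋃ n, P n = univ := iUnion_Ico_zsmul hδ
    have hdisj : Pairwise (Function.onFun Disjoint fun n => S ∩ P n) := fun m n hmn =>
      (pairwise_disjoint_Ico_zsmul δ hmn).mono inter_subset_right inter_subset_right
    have hSP : S = ⋃ n, S ∩ P n := by rw [← inter_iUnion, hP, inter_univ]
    have hmeas : ∀ n, MeasurableSet (S ∩ P n) := fun n => hSm.inter measurableSet_Ico
    have hcS : c '' S = ⋃ n, c '' (S ∩ P n) := by rw [← image_iUnion, ← hSP]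
    have hcm : ∀ n, MeasurableSet (c '' (S ∩ P n)) := fun n =>
      (hmeas n).image_of_continuousOn_injOn hcc.continuousOn (hinj.mono inter_subset_left)
    have hcd : Pairwise (Function.onFun Disjoint fun n => c '' (S ∩ P n)) := fun m n hmn => by
      refine disjoint_left.2 ?_
      rintro _ ⟨x, hx, rfl⟩ ⟨y, hy, hxy⟩
      have := hinj hy.1 hx.1 hxy
      subst this
      exact disjoint_left.1 (hdisj hmn) hx hy
    have hpiece : ∀ n, (Measure.hausdorffMeasure 1 : Measure E) (c '' (S ∩ P n)) ≤
        ∫⁻ θ in S ∩ P n, ‖c' θ‖ₑ + 2 * ε ∧ ∫⁻ θ in S ∩ P n, ‖c' θ‖ₑ ≤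
        (Measure.hausdorffMeasure 1 : Measure E) (c '' (S ∩ P n)) + 2 * ε * volume (S ∩ P n) := by
      intro n
      rcases (S ∩ P n).eq_empty_or_nonempty with h | ⟨θ₀, hθ₀⟩
      · simp [h]
      · have hI : ∀ θ ∈ S, θ ∈ Icc 0 T := fun θ hθ => Ico_subset_Icc_self (hS hθ)
        refine hausdorff_image_near hc (J := Icc 0 T ∩ P n)
          ((convex_Icc 0 T).inter (convex_Ico _ _))
          (fun θ hθ => ⟨hI θ hθ.1, hθ.2⟩) (hmeas n) (θ₀ := θ₀) (fun θ hθ => ?_)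
          (hεκ.trans_le (hκ' θ₀ (hI _ hθ₀.1)))
        rw [← dist_eq_norm]
        refine (hu θ hθ.1 θ₀ (hI _ hθ₀.1) ?_).le
        have h1 := hθ.2
        have h2 := hθ₀.2
        simp only [P, mem_Ico, add_smul, one_smul] at h1 h2
        rw [Real.dist_eq, abs_lt]
        constructor <;> linarith [h1.1, h1.2, h2.1, h2.2]
    have hI1 : ∀ f : ℝ → ℝ≥0∞, ∫⁻ θ in S, f θ = ∑' n, ∫⁻ θ in S ∩ P n, f θ := fun f => by
      conv_lhs => rw [hSP]
      exact lintegral_iUnion hmeas hdisj f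
    have hH : (Measure.hausdorffMeasure 1 : Measure E) (c '' S) =
        ∑' n, (Measure.hausdorffMeasure 1 : Measure E) (c '' (S ∩ P n)) := by
      rw [hcS]; exact measure_iUnion hcd hcm
    have hV : volume S = ∑' n, volume (S ∩ P n) := by
      conv_lhs => rw [hSP]
      exact measure_iUnion hdisj hmeas
    constructor
    · rw [hH, hI1]
      exact ENNReal.tsum_le_tsum fun n => (hpiece n).1
    · rw [hH, hI1, hV, ← ENNReal.tsum_mul_left, ← ENNReal.tsum_add]
      exact ENNReal.tsum_le_tsum fun n => (hpiece n).2
  have hlim : Tendsto (fun ε : ℝ≥0 => 2 * (ε : ℝ≥0∞) * volume S) (𝓝[>] 0) (𝓝 0) := by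
    have h1 : Tendsto (fun ε : ℝ≥0 => 2 * (ε : ℝ≥0∞)) (𝓝[>] 0) (𝓝 (2 * ((0 : ℝ≥0) : ℝ≥0∞))) :=
      (ENNReal.Tendsto.const_mul (ENNReal.continuous_coe.tendsto 0) (Or.inr (by simp))).mono_left
        nhdsWithin_le_nhds
    have := ENNReal.Tendsto.mul_const h1 (Or.inr hvol)
    simpa using this
  have hev : ∀ᶠ ε : ℝ≥0 in 𝓝[>] 0, 0 < ε ∧ (ε : ℝ) < κ := by
    refine eventually_mem_nhdsWithin.and (nhdsWithin_le_nhds ?_)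
    exact (NNReal.continuous_coe.tendsto 0).eventually (gt_mem_nhds hκ)
  refine le_antisymm ?_ ?_
  · have h2 := hlim.const_add (∫⁻ θ in S, ‖c' θ‖ₑ)
    rw [add_zero] at h2
    refine ge_of_tendsto h2 (hev.mono fun ε hε => ((key ε hε.1 hε.2).1).trans (le_of_eq ?_))
    rw [lintegral_add_right _ measurable_const, setLIntegral_const]
  · have h2 := hlim.const_add ((Measure.hausdorffMeasure 1 : Measure E) (c '' S))
    rw [add_zero] at h2
    exact ge_of_tendsto h2 (hev.mono fun ε hε => (key ε hε.1 hε.2).2)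

/-- Integration over an injective curve with respect to arc length. -/
theorem setIntegral_hausdorffMeasure_image {c c' : ℝ → E} (hc : ∀ θ, HasDerivAt c (c' θ) θ)
    (hcont : Continuous c') {T : ℝ} (h0 : ∀ θ ∈ Icc 0 T, c' θ ≠ 0) (hinj : InjOn c (Ico 0 T))
    {f : E → ℝ} (hf : Measurable f) :
    ∫ x in c '' Ico 0 T, f x ∂(Measure.hausdorffMeasure 1) = ∫ θ in Ico 0 T, ‖c' θ‖ * f (c θ) := by
  have hcc : Continuous c := continuous_iff_continuousAt.2 fun θ => (hc θ).continuousAt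
  have hm : Measurable fun θ => ‖c' θ‖₊ := hcont.nnnorm.measurable
  have e : (Measure.hausdorffMeasure 1 : Measure E).restrict (c '' Ico 0 T) =
      ((volume.restrict (Ico 0 T)).withDensity fun θ => (‖c' θ‖₊ : ℝ≥0∞)).map c := by
    ext B hB
    have hcB : MeasurableSet (c ⁻¹' B) := hcc.measurable hB
    rw [Measure.restrict_apply hB, Measure.map_apply hcc.measurable hB, withDensity_apply _ hcB,
      Measure.restrict_restrict hcB, inter_comm B, ← image_inter_preimage, inter_comm _ (c ⁻¹' B)]
    exact hausdorffMeasure_image_eq_lintegral hc hcont h0 inter_subset_right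
      (hcB.inter measurableSet_Ico) (hinj.mono inter_subset_right)
  rw [e, integral_map hcc.measurable.aemeasurable hf.aestronglyMeasurable,
    integral_withDensity_eq_integral_smul hm]
  rfl

end ArcLength

/-! ### The geometry of annular domains -/

/-- The unit vector with polar angle `θ`. -/
def circ (θ : ℝ) : Plane := !₂[Real.cos θ, Real.sin θ]

/-- The derivative of `circ`. -/
def circ' (θ : ℝ) : Plane := !₂[-Real.sin θ, Real.cos θ]

lemma circ_eq (θ : ℝ) : circ θ = Real.cos θ • EuclideanSpace.single 0 1 +
    Real.sin θ • EuclideanSpace.single 1 1 := by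
  ext i; fin_cases i <;> simp [circ]

lemma contDiff_circ : C∞ circ := by
  rw [funext circ_eq]
  exact (Real.contDiff_cos.smul contDiff_const).add (Real.contDiff_sin.smul contDiff_const)

lemma hasDerivAt_circ (θ : ℝ) : HasDerivAt circ (circ' θ) θ := by
  rw [funext circ_eq]
  refine (((Real.hasDerivAt_cos θ).smul_const _).add
    ((Real.hasDerivAt_sin θ).smul_const _)).congr_deriv ?_
  ext i; fin_cases i <;> simp [circ']

lemma norm_circ (θ : ℝ) : ‖circ θ‖ = 1 := by
  rw [EuclideanSpace.norm_eq, Fin.sum_univ_two]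
  simp [circ]

lemma circ'_ne_zero (θ : ℝ) : circ' θ ≠ 0 := fun h => by
  have h0 := congrArg (fun v : Plane => v 0) h
  have h1 := congrArg (fun v : Plane => v 1) h
  simp only [circ', PiLp.zero_apply, Matrix.cons_val_zero, Matrix.cons_val_one,
    neg_eq_zero, PiLp.toLp_apply] at h0 h1
  have := Real.sin_sq_add_cos_sq θ
  rw [h0, h1] at this
  norm_num at this

lemma exists_circ_eq {x : Plane} (hx : ‖x‖ = 1) : ∃ θ ∈ Ico 0 (2 * Real.pi), circ θ = x := by
  set z : ℂ := ⟨x 0, x 1⟩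
  have hz : ‖z‖ = 1 := by
    rw [← hx, Complex.norm_eq_sqrt_sq_add_sq, EuclideanSpace.norm_eq, Fin.sum_univ_two]
    simp [z]
  have hz0 : z ≠ 0 := fun h => by rw [h] at hz; simp at hz
  have h1 := Complex.cos_arg hz0
  have h2 := Complex.sin_arg z
  rw [hz, div_one] at h1 h2
  have hc : circ z.arg = x := by
    ext i
    fin_cases i
    · simpa [circ] using h1
    · simpa [circ] using h2
  have ha := Complex.neg_pi_lt_arg z
  have hb := Complex.arg_le_pi z
  rcases le_or_gt 0 z.arg with h | h
  · exact ⟨z.arg, ⟨h, by linarith [Real.pi_pos]⟩, hc⟩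
  · refine ⟨z.arg + 2 * Real.pi, ⟨by linarith, by linarith⟩, ?_⟩
    rw [← hc]
    simp [circ]

lemma circ_injOn : InjOn circ (Ico 0 (2 * Real.pi)) := fun θ hθ θ' hθ' h => by
  have h0 : Real.cos θ = Real.cos θ' := by simpa [circ] using congrArg (fun v : Plane => v 0) h
  have h1 : Real.sin θ = Real.sin θ' := by simpa [circ] using congrArg (fun v : Plane => v 1) h
  have h2 : Real.cos (θ - θ') = 1 := by
    rw [Real.cos_sub, h0, h1]
    have := Real.sin_sq_add_cos_sq θ'
    nlinarith
  rw [Real.cos_eq_one_iff_of_lt_of_lt (by linarith [hθ.1, hθ'.2]) (by linarith [hθ.2, hθ'.1])] at h2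
  linarith

lemma circ_periodic (θ : ℝ) : circ (θ + 2 * Real.pi) = circ θ := by simp [circ]

/-- The closed annulus. -/
def annulus : Set Plane := {x | 1 ≤ ‖x‖ ∧ ‖x‖ ≤ 2}

lemma isCompact_annulus : IsCompact annulus :=
  (isCompact_closedBall (0 : Plane) 2).of_isClosed_subset
    ((isClosed_le continuous_const continuous_norm).inter
      (isClosed_le continuous_norm continuous_const)) fun x hx => by simpa using hx.2

lemma annulus_subset_closure : annulus ⊆ closure {x : Plane | 1 < ‖x‖ ∧ ‖x‖ < 2} := by
  intro x hx
  have hx0 : 0 < ‖x‖ := by linarith [hx.1]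
  have hc : Tendsto (fun t : ℝ => ((1 - t) + t * (3 / 2) / ‖x‖) • x) (𝓝[>] 0) (𝓝 x) := by
    have : Tendsto (fun t : ℝ => ((1 - t) + t * (3 / 2) / ‖x‖) • x) (𝓝 0)
        (𝓝 (((1 - 0) + 0 * (3 / 2) / ‖x‖) • x)) := Continuous.tendsto (by fun_prop) 0
    simp only [sub_zero, zero_mul, zero_div, add_zero, one_smul] at this
    exact this.mono_left nhdsWithin_le_nhds
  refine mem_closure_of_tendsto hc ?_
  filter_upwards [Ioo_mem_nhdsGT one_pos] with t ht
  have h1 : ‖((1 - t) + t * (3 / 2) / ‖x‖) • x‖ = (1 - t) * ‖x‖ + t * (3 / 2) := by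
    rw [norm_smul, Real.norm_eq_abs, abs_of_nonneg]
    · field_simp
    · have := ht.1; have := ht.2
      have : 0 ≤ t * (3 / 2) / ‖x‖ := by positivity
      linarith
  show 1 < ‖_‖ ∧ ‖_‖ < 2
  rw [h1]
  constructor <;> nlinarith [ht.1, ht.2, hx.1, hx.2]

lemma uniqueDiffOn_annulus : UniqueDiffOn ℝ annulus := by
  intro x hx
  rcases lt_or_ge ‖x‖ 2 with h | h
  · have h1 : UniqueDiffWithinAt ℝ {y : Plane | ‖x‖ ^ 2 ≤ inner ℝ x y} x := by
      refine uniqueDiffWithinAt_convex ?_ ?_ (subset_closure ?_)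
      · exact convex_halfSpace_ge (f := fun y => inner ℝ x y)
          ⟨fun y z => inner_add_right _ _ _, fun c y => real_inner_smul_right _ _ _⟩ _
      · refine ⟨(2 : ℝ) • x, mem_interior.2 ⟨{y : Plane | ‖x‖ ^ 2 < inner ℝ x y},
          fun y (hy : ‖x‖ ^ 2 < inner ℝ x y) => show ‖x‖ ^ 2 ≤ inner ℝ x y from hy.le, isOpen_lt continuous_const (by fun_prop), ?_⟩⟩
        rw [mem_ofPred_eq, real_inner_smul_right, real_inner_self_eq_norm_sq]
        nlinarith [hx.1]
      · rw [mem_ofPred_eq, real_inner_self_eq_norm_sq]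
    refine (h1.inter (Metric.isOpen_ball.mem_nhds (by simpa using h :
      x ∈ Metric.ball (0 : Plane) 2))).mono fun y hy => ?_
    have h2 : ‖x‖ ^ 2 ≤ ‖x‖ * ‖y‖ := le_trans hy.1 (real_inner_le_norm x y)
    have h3 : ‖y‖ < 2 := by simpa using hy.2
    refine ⟨?_, h3.le⟩
    nlinarith [hx.1, norm_nonneg y]
  · have h1 : UniqueDiffWithinAt ℝ (Metric.closedBall (0 : Plane) 2) x :=
      uniqueDiffOn_convex (convex_closedBall _ _)
        ⟨0, by rw [interior_closedBall _ two_ne_zero]; simp⟩ x (by simpa using hx.2)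
    refine (h1.inter ((isOpen_lt continuous_const continuous_norm).mem_nhds
      (show (1 : ℝ) < ‖x‖ by linarith))).mono fun y hy => ⟨le_of_lt hy.2, by simpa using hy.1⟩

/-- The consequences of the definition of an annular domain that are used below. -/
structure AnnularData (Ω Γi Γo : Set Plane) : Prop where
  isOpen : IsOpen Ω
  nonempty : Ω.Nonempty
  body : GoodBody (closure Ω)
  cover : closure Ω = Ω ∪ Γi ∪ Γo
  disjoint_i : Disjoint Γi Ω
  disjoint_o : Disjoint Γo Ω
  inner_curve : ∃ c c' : ℝ → Plane, C∞ c ∧ (∀ θ, HasDerivAt c (c' θ) θ) ∧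
    (∀ θ, c' θ ≠ 0) ∧ InjOn c (Ico 0 (2 * Real.pi)) ∧ (∀ θ, c θ ∈ Γi) ∧
    (∀ x ∈ Γi, ∃ θ ∈ Ico 0 (2 * Real.pi), c θ = x) ∧ ∀ θ, c (θ + 2 * Real.pi) = c θ
  outer_curve : ∃ c : ℝ → Plane, C∞ c ∧ (∀ θ, c θ ∈ Γo) ∧ ∀ x ∈ Γo, ∃ θ, c θ = x

lemma IsAnnularDomain.data {Ω Γi Γo : Set Plane} (h : IsAnnularDomain Ω Γi Γo) :
    AnnularData Ω Γi Γo := by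
  obtain ⟨Φ, hsrc, hΦ, hΦ', hΩ, hi, ho⟩ := h.exists_diffeo
  change annulus ⊆ Φ.source at hsrc
  have hcl : closure Ω = Φ '' annulus := by
    refine Subset.antisymm (closure_minimal ?_
      (isCompact_annulus.image_of_continuousOn (Φ.continuousOn.mono hsrc)).isClosed) ?_
    · rw [← hΩ]
      exact image_mono fun x hx => ⟨hx.1.le, hx.2.le⟩
    · rintro _ ⟨x, hx, rfl⟩
      rw [← hΩ]
      exact (Φ.continuousAt (hsrc hx)).continuousWithinAt.mem_closure_image
        (annulus_subset_closure hx)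
  have hopen : IsOpen Ω := by
    rw [← hΩ]
    refine Φ.isOpen_image_of_subset_source ((isOpen_lt continuous_const continuous_norm).inter
      (isOpen_lt continuous_norm continuous_const)) fun x hx => hsrc ⟨hx.1.le, hx.2.le⟩
  have hdΦ : ∀ x ∈ Φ.source, HasFDerivAt Φ (fderiv ℝ Φ x) x := fun x hx =>
    ((hΦ.contDiffAt (Φ.open_source.mem_nhds hx)).differentiableAt (by simp)).hasFDerivAt
  have hinv : ∀ x ∈ Φ.source, ∃ A : Plane →L[ℝ] Plane,
      A.comp (fderiv ℝ Φ x) = ContinuousLinearMap.id ℝ _ := fun x hx => by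
    have h1 : HasFDerivAt Φ.symm (fderiv ℝ Φ.symm (Φ x)) (Φ x) :=
      ((hΦ'.contDiffAt (Φ.open_target.mem_nhds (Φ.map_source hx))).differentiableAt
        (by simp)).hasFDerivAt
    refine ⟨_, (h1.comp x (hdΦ x hx)).unique ?_⟩
    refine (hasFDerivAt_id x).congr_of_eventuallyEq ?_
    filter_upwards [Φ.open_source.mem_nhds hx] with y hy using Φ.left_inv hy
  have hinj : ∀ x ∈ Φ.source, Function.Injective (fderiv ℝ Φ x) := fun x hx v w hvw => by
    obtain ⟨A, hA⟩ := hinv x hx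
    have h1 := congrArg (fun L => L v) hA
    have h2 := congrArg (fun L => L w) hA
    simp only [ContinuousLinearMap.comp_apply, ContinuousLinearMap.id_apply] at h1 h2
    rw [← h1, hvw, h2]
  have hbody : GoodBody (closure Ω) := by
    rw [hcl]
    refine ⟨isCompact_annulus.image_of_continuousOn (Φ.continuousOn.mono hsrc),
      uniqueDiffOn_annulus.image (f' := fun x => fderiv ℝ Φ x)
        (fun x hx => (hdΦ x (hsrc hx)).hasFDerivWithinAt) fun x hx => ?_⟩
    exact (LinearMap.injective_iff_surjective (f := (fderiv ℝ Φ x : Plane →ₗ[ℝ] Plane)).1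
      (hinj x (hsrc hx))).denseRange
  have hcurve : ∀ R : ℝ, 1 ≤ R → R ≤ 2 →
      C∞ (fun θ => Φ (R • circ θ)) ∧ (∀ θ, R • circ θ ∈ annulus) ∧
      ∀ x ∈ Metric.sphere (0 : Plane) R, ∃ θ ∈ Ico 0 (2 * Real.pi), R • circ θ = x := fun R h1 h2 => by
    have hm : ∀ θ, R • circ θ ∈ annulus := fun θ => by
      simp only [annulus, mem_ofPred_eq, norm_smul, norm_circ, Real.norm_eq_abs, mul_one,
        abs_of_nonneg (zero_le_one.trans h1), h1, h2, and_self]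
    refine ⟨contDiff_iff_contDiffAt.2 fun θ => ContDiffAt.comp (g := Φ) (f := fun θ => R • circ θ) θ
      (hΦ.contDiffAt (Φ.open_source.mem_nhds (hsrc (hm θ))))
      (show C∞ (fun θ => R • circ θ) from
        contDiff_circ.const_smul R).contDiffAt, hm, fun x hx => ?_⟩
    have hR : R ≠ 0 := by linarith
    have hx' : ‖x‖ = R := by simpa using hx
    obtain ⟨θ, hθ, hθx⟩ := exists_circ_eq (x := R⁻¹ • x) (by
      rw [norm_smul, hx', Real.norm_eq_abs, abs_of_nonneg (by positivity), inv_mul_cancel₀ hR])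
    exact ⟨θ, hθ, by rw [hθx, smul_smul, mul_inv_cancel₀ hR, one_smul]⟩
  have hdisj : ∀ R : ℝ, (R = 1 ∨ R = 2) → Disjoint (Φ '' Metric.sphere 0 R) Ω := fun R hR => by
    rw [← hΩ]
    refine disjoint_left.2 ?_
    rintro _ ⟨x, hx, rfl⟩ ⟨y, hy, hxy⟩
    have hx' : ‖x‖ = R := by simpa using hx
    have hxA : x ∈ annulus := by
      rw [annulus, mem_ofPred_eq, hx']; rcases hR with rfl | rfl <;> norm_num
    have := Φ.injOn (hsrc ⟨hy.1.le, hy.2.le⟩) (hsrc hxA) hxy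
    rw [this, mem_ofPred_eq, hx'] at hy
    rcases hR with rfl | rfl
    · exact lt_irrefl _ hy.1
    · exact lt_irrefl _ hy.2
  refine ⟨hopen, ?_, hbody, ?_, hi ▸ hdisj 1 (Or.inl rfl), ho ▸ hdisj 2 (Or.inr rfl), ?_, ?_⟩
  · rw [← hΩ]
    refine Nonempty.image _ ⟨(3 / 2 : ℝ) • circ 0, ?_⟩
    rw [mem_ofPred_eq, norm_smul, norm_circ]
    norm_num
  · rw [hcl, ← hΩ, ← hi, ← ho, ← image_union, ← image_union]
    congr 1
    ext x
    simp only [annulus, mem_ofPred_eq, mem_union, mem_sphere_zero_iff_norm]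
    constructor
    · rintro ⟨h1, h2⟩
      rcases h1.eq_or_lt with h1 | h1
      · exact Or.inl (Or.inr h1.symm)
      · rcases h2.eq_or_lt with h2 | h2
        · exact Or.inr h2
        · exact Or.inl (Or.inl ⟨h1, h2⟩)
    · rintro ((h | h) | h)
      · exact ⟨h.1.le, h.2.le⟩
      · rw [h]; norm_num
      · rw [h]; norm_num
  · obtain ⟨h1, h2, h3⟩ := hcurve 1 le_rfl one_le_two
    simp only [one_smul] at h1 h2 h3
    refine ⟨fun θ => Φ (circ θ), fun θ => fderiv ℝ Φ (circ θ) (circ' θ), h1, fun θ => ?_, fun θ h => ?_,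
      fun θ hθ θ' hθ' h => ?_, fun θ => ?_, fun x hx => ?_, fun θ => by
      show Φ (circ (θ + 2 * Real.pi)) = _
      rw [circ_periodic]⟩
    · exact (hdΦ _ (hsrc (h2 θ))).comp_hasDerivAt θ (hasDerivAt_circ θ)
    · exact circ'_ne_zero θ (hinj _ (hsrc (h2 θ)) (h.trans (map_zero _).symm))
    · exact circ_injOn hθ hθ' (Φ.injOn (hsrc (h2 θ)) (hsrc (h2 θ')) h)
    · rw [← hi]
      exact mem_image_of_mem _ (by simp [norm_circ])
    · rw [← hi] at hx
      obtain ⟨y, hy, rfl⟩ := hx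
      obtain ⟨θ, hθ, rfl⟩ := h3 y hy
      exact ⟨θ, hθ, rfl⟩
  · obtain ⟨h1, h2, h3⟩ := hcurve 2 one_le_two le_rfl
    refine ⟨_, h1, fun θ => ?_, fun x hx => ?_⟩
    · rw [← ho]
      exact mem_image_of_mem _ (by simp [norm_smul, norm_circ])
    · rw [← ho] at hx
      obtain ⟨y, hy, rfl⟩ := hx
      obtain ⟨θ, hθ, rfl⟩ := h3 y hy
      exact ⟨θ, rfl⟩

namespace AnnularData

variable {Ω Γi Γo : Set Plane} (hA : AnnularData Ω Γi Γo)
include hA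

lemma mem_closure_i {x : Plane} (hx : x ∈ Γi) : x ∈ closure Ω := by
  rw [hA.cover]; exact Or.inl (Or.inr hx)

lemma mem_closure_o {x : Plane} (hx : x ∈ Γo) : x ∈ closure Ω := by
  rw [hA.cover]; exact Or.inr hx

lemma mem_frontier_i {x : Plane} (hx : x ∈ Γi) : x ∈ frontier Ω :=
  ⟨hA.mem_closure_i hx, fun h => disjoint_left.1 hA.disjoint_i hx (interior_subset h)⟩

lemma mem_frontier_o {x : Plane} (hx : x ∈ Γo) : x ∈ frontier Ω :=
  ⟨hA.mem_closure_o hx, fun h => disjoint_left.1 hA.disjoint_o hx (interior_subset h)⟩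

lemma const_of_curve {c : ℝ → Plane} (hc : C∞ c) (hcΩ : ∀ θ, c θ ∈ frontier Ω)
    (ω : calF Ω) (θ θ' : ℝ) : ω.1 (c θ) = ω.1 (c θ') := by
  have h := ω.2 c hc hcΩ
  exact is_const_of_deriv_eq_zero (fun s => (h s).differentiableAt) (fun s => (h s).deriv) θ θ'

lemma exists_eq_i (ω : calF Ω) : ∃ a, ∀ x ∈ Γi, ω.1 x = a := by
  obtain ⟨c, c', h1, -, -, -, h2, h3, -⟩ := hA.inner_curve
  refine ⟨ω.1 (c 0), fun x hx => ?_⟩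
  obtain ⟨θ, -, rfl⟩ := h3 x hx
  exact hA.const_of_curve h1 (fun θ => hA.mem_frontier_i (h2 θ)) ω θ 0

lemma exists_eq_o (ω : calF Ω) : ∃ b, ∀ x ∈ Γo, ω.1 x = b := by
  obtain ⟨c, h1, h2, h3⟩ := hA.outer_curve
  refine ⟨ω.1 (c 0), fun x hx => ?_⟩
  obtain ⟨θ, rfl⟩ := h3 x hx
  exact hA.const_of_curve h1 (fun θ => hA.mem_frontier_o (h2 θ)) ω θ 0

end AnnularData

/-! ### The chart of an annular domain given by the gradient flow of a function in `𝓕₊` -/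

lemma eq_add_of_deriv_eq_one {E : Type*} [TopologicalSpace E] {C U : Set E} (hC : IsClosed C)
    (hU : IsOpen U) (hUC : U ⊆ C) {f : E → ℝ} (hf : Continuous f)
    (hfU : ∀ x ∈ C, f x ∈ Ioo (0 : ℝ) 1 → x ∈ U) {h : ℝ → E} (hh : Continuous h) {l : ℝ}
    (hl : l ∈ Ioo (0 : ℝ) 1) (h0 : h 0 ∈ U) (hl0 : f (h 0) = l)
    (hd : ∀ t ∈ Icc (-2 : ℝ) 2, h t ∈ U → HasDerivAt (fun t => f (h t)) 1 t) {t : ℝ}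
    (ht : t ∈ Icc 0 (1 - l)) : h t ∈ C ∧ f (h t) = l + t := by
  have hfh := hf.comp hh
  have key : Icc 0 (1 - l) ⊆ {t | h t ∈ C ∧ f (h t) = l + t} := by
    refine IsClosed.Icc_subset_of_forall_exists_gt (IsClosed.inter ((hC.preimage hh).inter
      (isClosed_eq hfh (by fun_prop))) isClosed_Icc) ⟨hUC h0, by rw [hl0, add_zero]⟩ ?_
    rintro t ⟨⟨htC, htf⟩, ht0, ht1⟩ y hy
    have htU : h t ∈ U := hfU _ htC (by rw [htf]; exact ⟨by linarith [hl.1], by linarith⟩)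
    obtain ⟨ε, hε, hεU⟩ := Metric.isOpen_iff.1 (hU.preimage hh) t htU
    set ε' := min ε 1 with hε'
    have hε'0 : 0 < ε' := lt_min hε one_pos
    have hd' : ∀ τ ∈ Metric.ball t ε', HasDerivAt (fun t => f (h t) - t) 0 τ := fun τ hτ => by
      have h1 : |τ - t| < 1 := lt_of_lt_of_le hτ (min_le_right _ _)
      rw [abs_lt] at h1
      have := (hd τ ⟨by linarith, by linarith [hl.1]⟩
        (hεU (Metric.ball_subset_ball (min_le_left _ _) hτ))).sub (hasDerivAt_id τ)
      rw [sub_self] at this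
      exact this
    set τ := min y (t + ε' / 2)
    have h1 : t < τ := lt_min hy (by linarith)
    have h2 : τ ∈ Metric.ball t ε' := by
      rw [Metric.mem_ball, Real.dist_eq, abs_lt]
      have : τ ≤ t + ε' / 2 := min_le_right _ _
      constructor <;> linarith
    have h3 := Metric.isOpen_ball.is_const_of_deriv_eq_zero (convex_ball t ε').isPreconnected
      (fun τ hτ => (hd' τ hτ).differentiableAt.differentiableWithinAt)
      (fun τ hτ => (hd' τ hτ).deriv) h2 (Metric.mem_ball_self hε'0)
    refine ⟨τ, ⟨hUC (hεU (Metric.ball_subset_ball (min_le_left _ _) h2)), ?_⟩, h1, min_le_left _ _⟩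
    linarith
  exact key ht

lemma flow_comp {E : Type*} [NormedAddCommGroup E] [NormedSpace ℝ E] {X : E → E} {k : ℝ≥0}
    (hX : LipschitzWith k X) {φ : ℝ × E → E} (h0 : ∀ x, φ (0, x) = x)
    (hφ : ∀ t ∈ Icc (-2 : ℝ) 2, ∀ x, HasDerivAt (fun t => φ (t, x)) (X (φ (t, x))) t) (x : E)
    {s t : ℝ} (hs : s ∈ Icc (-1 : ℝ) 1) (ht : t ∈ Icc (-1 : ℝ) 1) :
    φ (t, φ (s, x)) = φ (t + s, x) := by
  rcases eq_or_ne s 0 with rfl | hs0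
  · rw [h0, add_zero]
  have hs2 : |s| ≤ 1 := abs_le.2 hs
  have key : ∀ τ ∈ Icc (-1 : ℝ) 1, |τ + s| ≤ 2 := fun τ hτ =>
    (abs_add_le _ _).trans (by linarith [abs_le.2 hτ])
  have := ODE_solution_unique_of_mem_Icc (v := fun _ => X) (s := fun _ => univ) (K := k)
    (f := fun t => φ (t, φ (s, x))) (g := fun t => φ (t + s, x)) (a := -1) (b := 1) (t₀ := 0)
    (fun _ _ => hX.lipschitzOnWith) (by norm_num)
    (fun τ hτ => (hφ τ ⟨by linarith [hτ.1], by linarith [hτ.2]⟩ _).continuousAt.continuousWithinAt)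
    (fun τ hτ => hφ τ ⟨by linarith [hτ.1], by linarith [hτ.2]⟩ _) (fun _ _ => mem_univ _)
    (fun τ hτ => ((hφ (τ + s) (abs_le.1 (key τ hτ)) x).comp_add_const τ
      s).continuousAt.continuousWithinAt)
    (fun τ hτ => (hφ (τ + s) (abs_le.1 (key τ ⟨hτ.1.le, hτ.2.le⟩)) x).comp_add_const τ s)
    (fun _ _ => mem_univ _) (by simp only [h0, zero_add])
  exact this ht

/-- The functional determinant of a map from `ℝ × ℝ` to the plane. -/
def jac (g : ℝ × ℝ → Plane) (z : ℝ × ℝ) : ℝ :=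
  fderiv ℝ g z (1, 0) 0 * fderiv ℝ g z (0, 1) 1 - fderiv ℝ g z (1, 0) 1 * fderiv ℝ g z (0, 1) 0

/-- A smooth parametrization of the closure of `Ω` by `[0, 1] × ℝ`, which is periodic in the second
variable, and whose first variable is an affine function of `ω₀`. -/
structure AnnChart (Ω Γi Γo : Set Plane) (ω₀ : CInf (closure Ω)) where
  g : ℝ × ℝ → Plane
  smooth : C∞ g
  maps : ∀ s ∈ Icc (0 : ℝ) 1, ∀ θ, g (s, θ) ∈ closure Ω
  interior : ∀ s ∈ Ioo (0 : ℝ) 1, ∀ θ, g (s, θ) ∈ Ω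
  inner_mem : ∀ θ, g (0, θ) ∈ Γi
  outer_mem : ∀ θ, g (1, θ) ∈ Γo
  surj : ∀ x ∈ closure Ω, ∃ s ∈ Icc (0 : ℝ) 1, ∃ θ ∈ Ico 0 (2 * Real.pi), g (s, θ) = x
  inj : InjOn g (Icc (0 : ℝ) 1 ×ˢ Ico 0 (2 * Real.pi))
  jac_ne : ∀ s ∈ Icc (0 : ℝ) 1, ∀ θ, jac g (s, θ) ≠ 0
  a : ℝ
  b : ℝ
  lt : a < b
  value : ∀ s ∈ Icc (0 : ℝ) 1, ∀ θ, ω₀ (g (s, θ)) = a + s * (b - a)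

lemma CInf.gradientWithin_eq {K : Set Plane} [GoodBody K] (f : CInf K) {F : Plane → ℝ}
    (hF : C∞ F) (hfF : EqOn f F K) {x : Plane} (hx : x ∈ K) :
    gradientWithin f K x = gradient F x := by
  rw [gradientWithin, gradient, fderivWithin_congr hfF (hfF hx),
    (hF.differentiable (by simp) x).fderivWithin (GoodBody.uniqueDiff x hx)]

theorem AnnularData.exists_chart {Ω Γi Γo : Set Plane} (hA : AnnularData Ω Γi Γo)
    {ω : calF Ω} (hω : ω ∈ calFPlus Ω Γi Γo) : Nonempty (AnnChart Ω Γi Γo ω.1) := by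
  haveI := hA.body
  obtain ⟨a, ha⟩ := hA.exists_eq_i ω
  obtain ⟨b, hb⟩ := hA.exists_eq_o ω
  obtain ⟨c, c', hc, hc', hc0, hcinj, hcm, hcs, -⟩ := hA.inner_curve
  obtain ⟨co, -, hom, -⟩ := hA.outer_curve
  have hab : a < b := by
    have := hω.2 _ (hcm 0) _ (hom 0)
    rwa [ha _ (hcm 0), hb _ (hom 0)] at this
  obtain ⟨F₀, hF₀, hωF₀⟩ := CInf.exists_ext ω.1
  set F : Plane → ℝ := fun x => (F₀ x - a) / (b - a) with hFdef
  have hba : b - a ≠ 0 := by linarith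
  have hF : C∞ F := (hF₀.sub contDiff_const).div_const _
  have hFx : ∀ x ∈ closure Ω, F x = (ω.1 x - a) / (b - a) := fun x hx => by
    rw [hFdef, hωF₀ hx]
  have hFi : ∀ x ∈ Γi, F x = 0 := fun x hx => by
    rw [hFx x (hA.mem_closure_i hx), ha x hx, sub_self, zero_div]
  have hFo : ∀ x ∈ Γo, F x = 1 := fun x hx => by
    rw [hFx x (hA.mem_closure_o hx), hb x hx, div_self hba]
  have hdF : ∀ x, HasFDerivAt F (fderiv ℝ F x) x := fun x =>
    (hF.differentiable (by simp) x).hasFDerivAt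
  have hgrad : ∀ x ∈ closure Ω, gradient F x ≠ 0 := fun x hx h => by
    refine hω.1 x hx ?_
    rw [CInf.gradientWithin_eq ω.1 hF₀ hωF₀ hx]
    have h1 : fderiv ℝ F x = 0 := by
      have := congrArg (InnerProductSpace.toDual ℝ Plane) h
      simpa [gradient] using this
    have h2 : F₀ = fun x => (b - a) * F x + a := funext fun x => by
      simp only [hFdef]; field_simp; ring
    have h3 : HasFDerivAt F₀ (0 : Plane →L[ℝ] ℝ) x := by
      have := ((hdF x).const_mul (b - a)).add_const a
      rw [h1, smul_zero, ← h2] at this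
      exact this
    rw [gradient, h3.fderiv, map_zero]
  have hbody : IsCompact (closure Ω) := GoodBody.compact
  have hne : (closure Ω).Nonempty := hA.nonempty.mono subset_closure
  have hcrit : ∀ x ∈ Ω, ¬ IsLocalExtr F x := fun x hx h => by
    refine hgrad x (subset_closure hx) ?_
    rw [gradient, h.fderiv_eq_zero, map_zero]
  have hbd : ∀ x ∈ closure Ω, x ∉ Ω → F x = 0 ∨ F x = 1 := fun x hx hxΩ => by
    rw [hA.cover] at hx
    rcases hx with (hx | hx) | hx
    · exact absurd hx hxΩ
    · exact Or.inl (hFi x hx)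
    · exact Or.inr (hFo x hx)
  have hmin : ∀ x ∈ closure Ω, 0 ≤ F x := fun x hx => by
    obtain ⟨y, hy, hmy⟩ := hbody.exists_isMinOn hne hF.continuous.continuousOn
    refine le_trans ?_ (hmy hx)
    by_cases hyΩ : y ∈ Ω
    · exact absurd (Or.inl (hmy.isLocalMin (mem_of_superset (hA.isOpen.mem_nhds hyΩ)
        subset_closure))) (hcrit y hyΩ)
    · rcases hbd y hy hyΩ with h | h <;> rw [h]; exact zero_le_one
  have hmax : ∀ x ∈ closure Ω, F x ≤ 1 := fun x hx => by
    obtain ⟨y, hy, hmy⟩ := hbody.exists_isMaxOn hne hF.continuous.continuousOn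
    refine le_trans (hmy hx) ?_
    by_cases hyΩ : y ∈ Ω
    · exact absurd (Or.inr (hmy.isLocalMax (mem_of_superset (hA.isOpen.mem_nhds hyΩ)
        subset_closure))) (hcrit y hyΩ)
    · rcases hbd y hy hyΩ with h | h <;> rw [h]; exact zero_le_one
  have hmem : ∀ x ∈ Ω, F x ∈ Ioo (0 : ℝ) 1 := fun x hx => by
    have hΩn := mem_of_superset (hA.isOpen.mem_nhds hx) subset_closure
    refine ⟨(hmin x (subset_closure hx)).lt_of_ne fun h => hcrit x hx (Or.inl ?_),
      (hmax x (subset_closure hx)).lt_of_ne fun h => hcrit x hx (Or.inr ?_)⟩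
    · exact mem_of_superset hΩn fun y hy => by
        show F x ≤ F y
        rw [← h]; exact hmin y hy
    · exact mem_of_superset hΩn fun y hy => by
        show F y ≤ F x
        rw [h]; exact hmax y hy
  have hmemΩ : ∀ x ∈ closure Ω, F x ∈ Ioo (0 : ℝ) 1 → x ∈ Ω := fun x hx h => by
    by_contra hxΩ
    rcases hbd x hx hxΩ with h' | h' <;> rw [h'] at h
    · exact lt_irrefl _ h.1
    · exact lt_irrefl _ h.2
  -- the vector field and its flow
  have hgF : C∞ (gradient F) :=
    (InnerProductSpace.toDual ℝ Plane).symm.contDiff.comp (hF.fderiv_right (by simp))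
  obtain ⟨κ, hκ, hκF⟩ : ∃ κ > 0, ∀ x ∈ closure Ω, κ ≤ ‖gradient F x‖ ^ 2 := by
    obtain ⟨y, hy, hmy⟩ := hbody.exists_isMinOn hne
      (f := fun x => ‖gradient F x‖ ^ 2) (hgF.continuous.norm.pow 2).continuousOn
    exact ⟨_, by have := norm_pos_iff.2 (hgrad y hy); positivity, fun x hx => hmy hx⟩
  obtain ⟨r, hr, hrΩ⟩ := hbody.isBounded.subset_closedBall_lt 0 0
  let χ : ContDiffBump (0 : Plane) := ⟨r, r + 1, hr, by linarith⟩
  set X : Plane → Plane := fun x =>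
    (χ x * (cutId κ (‖gradient F x‖ ^ 2))⁻¹) • gradient F x with hXdef
  have hX : C∞ X :=
    (χ.contDiff.mul ((CInf.contDiff_inv_cutId hκ).comp (hgF.norm_sq ℝ))).smul hgF
  have hXc : HasCompactSupport X := (χ.hasCompactSupport.mul_right).smul_right
  have hXF : ∀ x ∈ closure Ω, fderiv ℝ F x (X x) = 1 := fun x hx => by
    have h1 : fderiv ℝ F x (gradient F x) = ‖gradient F x‖ ^ 2 := by
      rw [← real_inner_self_eq_norm_sq, gradient, InnerProductSpace.toDual_symm_apply]
    have h2 : ‖gradient F x‖ ^ 2 ≠ 0 := (hκ.trans_le (hκF x hx)).ne'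
    simp only [hXdef, map_smul, smul_eq_mul, h1, χ.one_of_mem_closedBall (hrΩ hx),
      cutId_eq hκ (hκF x hx), one_mul]
    exact inv_mul_cancel₀ h2
  obtain ⟨φ, hφ, hφ0, hφd⟩ := exists_contDiff_flow hX hXc
  obtain ⟨kX, hkX⟩ := hX.lipschitzWith_of_hasCompactSupport hXc (by simp)
  have hφc : Continuous φ := hφ.continuous
  have hFφ : ∀ t ∈ Icc (-2 : ℝ) 2, ∀ x, φ (t, x) ∈ closure Ω →
      HasDerivAt (fun t => F (φ (t, x))) 1 t := fun t ht x hx => by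
    have := (hdF (φ (t, x))).comp_hasDerivAt t (hφd t ht x)
    rwa [hXF _ hx] at this
  have hflowΩ : ∀ x ∈ Ω, ∀ s ∈ Icc (0 : ℝ) 1,
      φ (s - F x, x) ∈ closure Ω ∧ F (φ (s - F x, x)) = s := fun x hx s hs => by
    have hl := hmem x hx
    rcases le_total (F x) s with h | h
    · have := eq_add_of_deriv_eq_one isClosed_closure hA.isOpen subset_closure hF.continuous hmemΩ
        (h := fun t => φ (t, x)) (by fun_prop) hl (by simpa only [hφ0] using hx)
        (by simp only [hφ0]) (fun t ht hU => hFφ t ht x (subset_closure hU))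
        (t := s - F x) ⟨by linarith, by linarith [hs.2]⟩
      exact ⟨this.1, by rw [this.2]; ring⟩
    · have := eq_add_of_deriv_eq_one isClosed_closure hA.isOpen subset_closure
        (f := fun x => 1 - F x) (continuous_const.sub hF.continuous)
        (fun y hy h => hmemΩ y hy ⟨by linarith [h.2], by linarith [h.1]⟩)
        (h := fun t => φ (-t, x)) (l := 1 - F x) (by fun_prop)
        ⟨by linarith [hl.2], by linarith [hl.1]⟩ (by simpa only [neg_zero, hφ0] using hx)
        (by simp only [neg_zero, hφ0]) (fun t ht hU => by
          have h1 := hFφ (-t) ⟨by linarith [ht.2], by linarith [ht.1]⟩ x (subset_closure hU)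
          have h2 := (h1.scomp t (hasDerivAt_neg t)).const_sub 1
          simpa using h2)
        (t := F x - s) ⟨by linarith, by linarith [hs.1]⟩
      rw [neg_sub] at this
      exact ⟨this.1, by linarith [this.2]⟩
  have hflow : ∀ x ∈ closure Ω, ∀ s ∈ Icc (0 : ℝ) 1,
      φ (s - F x, x) ∈ closure Ω ∧ F (φ (s - F x, x)) = s := fun x hx s hs => by
    have hcl : IsClosed {x | φ (s - F x, x) ∈ closure Ω ∧ F (φ (s - F x, x)) = s} := by
      have : Continuous fun x => φ (s - F x, x) :=
        hφc.comp ((continuous_const.sub hF.continuous).prodMk continuous_id)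
      exact (isClosed_closure.preimage this).inter (isClosed_eq (hF.continuous.comp this)
        continuous_const)
    exact closure_minimal (fun x hx => hflowΩ x hx s hs) hcl hx
  have hg : ∀ s ∈ Icc (0 : ℝ) 1, ∀ θ, φ (s, c θ) ∈ closure Ω ∧ F (φ (s, c θ)) = s :=
    fun s hs θ => by
      have := hflow (c θ) (hA.mem_closure_i (hcm θ)) s hs
      rwa [hFi _ (hcm θ), sub_zero] at this
  have hback : ∀ x, ∀ s ∈ Icc (0 : ℝ) 1, φ (-s, φ (s, x)) = x := fun x s hs => by
    rw [flow_comp hkX hφ0 hφd x (s := s) (t := -s) ⟨by linarith [hs.1], hs.2⟩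
      ⟨by linarith [hs.2], by linarith [hs.1]⟩, neg_add_cancel, hφ0]
  have hclass : ∀ x ∈ closure Ω, (F x = 0 → x ∈ Γi) ∧ (F x = 1 → x ∈ Γo) := fun x hx => by
    have hx' := hx
    rw [hA.cover] at hx'
    rcases hx' with (h | h) | h
    · have := hmem x h
      exact ⟨fun h' => absurd h' this.1.ne', fun h' => absurd h' this.2.ne⟩
    · exact ⟨fun _ => h, fun h' => absurd ((hFi x h).symm.trans h') zero_ne_one⟩
    · exact ⟨fun h' => absurd (h'.symm.trans (hFo x h)) zero_ne_one, fun _ => h⟩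
  set g : ℝ × ℝ → Plane := fun z => φ (z.1, c z.2) with hgdef
  have hgs : C∞ g := hφ.comp (contDiff_fst.prodMk (hc.comp contDiff_snd))
  have hdg : ∀ z, HasFDerivAt g (fderiv ℝ g z) z := fun z =>
    (hgs.differentiable (by simp) z).hasFDerivAt
  have h01 : (0 : ℝ) ∈ Icc (0 : ℝ) 1 := ⟨le_rfl, zero_le_one⟩
  have h11 : (1 : ℝ) ∈ Icc (0 : ℝ) 1 := ⟨zero_le_one, le_rfl⟩
  refine ⟨⟨g, hgs, fun s hs θ => (hg s hs θ).1, fun s hs θ => ?_, fun θ => ?_, fun θ => ?_,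
    fun x hx => ?_, ?_, fun s hs θ => ?_, a, b, hab, fun s hs θ => ?_⟩⟩
  · have h := hg s ⟨hs.1.le, hs.2.le⟩ θ
    exact hmemΩ _ h.1 (by rw [h.2]; exact hs)
  · exact (hclass _ (hg 0 h01 θ).1).1 (hg 0 h01 θ).2
  · exact (hclass _ (hg 1 h11 θ).1).2 (hg 1 h11 θ).2
  · have h1 := hflow x hx 0 h01
    rw [zero_sub] at h1
    obtain ⟨θ, hθ, hθx⟩ := hcs _ ((hclass _ h1.1).1 h1.2)
    refine ⟨F x, ⟨hmin x hx, hmax x hx⟩, θ, hθ, ?_⟩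
    simp only [hgdef, hθx]
    rw [flow_comp hkX hφ0 hφd x ⟨by linarith [hmax x hx], by linarith [hmin x hx]⟩
      ⟨by linarith [hmin x hx], hmax x hx⟩, add_neg_cancel, hφ0]
  · rintro ⟨s, θ⟩ ⟨hs, hθ⟩ ⟨s', θ'⟩ ⟨hs', hθ'⟩ h
    simp only [hgdef] at h hs hs' hθ hθ'
    have h1 : s = s' := by rw [← (hg s hs θ).2, h, (hg s' hs' θ').2]
    subst h1
    have h2 : c θ = c θ' := by rw [← hback (c θ) s hs, h, hback (c θ') s hs]
    rw [hcinj hθ hθ' h2]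
  · intro hj
    have e1 : HasDerivAt (fun s => g (s, θ)) (fderiv ℝ g (s, θ) (1, 0)) s :=
      HasFDerivAt.comp_hasDerivAt (l := g) s (hdg (s, θ)) ((hasDerivAt_id s).prodMk (hasDerivAt_const s θ))
    have e2 : HasDerivAt (fun θ => g (s, θ)) (fderiv ℝ g (s, θ) (0, 1)) θ :=
      HasFDerivAt.comp_hasDerivAt (l := g) θ (hdg (s, θ)) ((hasDerivAt_const θ s).prodMk (hasDerivAt_id θ))
    have e1' : fderiv ℝ g (s, θ) (1, 0) = X (g (s, θ)) :=
      e1.unique (hφd s ⟨by linarith [hs.1], by linarith [hs.2]⟩ (c θ))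
    have f1 : fderiv ℝ F (g (s, θ)) (fderiv ℝ g (s, θ) (1, 0)) = 1 := by
      rw [e1', hXF _ (hg s hs θ).1]
    have f2 : fderiv ℝ F (g (s, θ)) (fderiv ℝ g (s, θ) (0, 1)) = 0 := by
      refine ((hdF (g (s, θ))).comp_hasDerivAt θ e2).unique ?_
      refine (hasDerivAt_const θ s).congr_of_eventuallyEq (Eventually.of_forall fun θ => ?_)
      exact (hg s hs θ).2
    have f3 : fderiv ℝ g (s, θ) (0, 1) ≠ 0 := fun h0 => by
      have hdφ : HasFDerivAt (fun x => φ (-s, x)) (fderiv ℝ (fun x => φ (-s, x)) (g (s, θ)))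
          (g (s, θ)) := ((hφ.comp (contDiff_const.prodMk contDiff_id)).differentiable
            (by simp) _).hasFDerivAt
      have h1 := hdφ.comp_hasDerivAt θ e2
      rw [h0, map_zero] at h1
      refine hc0 θ ((hc' θ).unique (h1.congr_of_eventuallyEq (Eventually.of_forall fun θ => ?_)))
      exact (hback (c θ) s hs).symm
    set v := fderiv ℝ g (s, θ) (1, 0)
    set w := fderiv ℝ g (s, θ) (0, 1)
    have hbasis : ∀ u : Plane, u = u 0 • EuclideanSpace.single 0 1 +
        u 1 • EuclideanSpace.single 1 1 := fun u => by ext i; fin_cases i <;> simp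
    have hj' : v 0 * w 1 - v 1 * w 0 = 0 := hj
    rw [hbasis v, map_add, map_smul, map_smul, smul_eq_mul, smul_eq_mul] at f1
    rw [hbasis w, map_add, map_smul, map_smul, smul_eq_mul, smul_eq_mul] at f2
    refine f3 ?_
    ext i
    fin_cases i
    · show w 0 = 0
      linear_combination (-w 0) * f1 + v 0 * f2 -
        fderiv ℝ F (g (s, θ)) (EuclideanSpace.single 1 1) * hj'
    · show w 1 = 0
      linear_combination (-w 1) * f1 + v 1 * f2 +
        fderiv ℝ F (g (s, θ)) (EuclideanSpace.single 0 1) * hj'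
  · have h := hg s hs θ
    rw [hFx _ h.1] at h
    have := h.2
    rw [div_eq_iff hba] at this
    show ω.1 (φ (s, c θ)) = _
    linarith

/-! ### Areas and level sets in a chart -/

lemma norm_mul_inner_eq {G v c : Plane} (h : inner ℝ G c = 0) :
    ‖c‖ * |inner ℝ G v| = |v 0 * c 1 - v 1 * c 0| * ‖G‖ := by
  have hi : ∀ x y : Plane, inner ℝ x y = x 0 * y 0 + x 1 * y 1 := fun x y => by
    rw [PiLp.inner_apply, Fin.sum_univ_two]; simp [mul_comm]
  rw [hi] at h ⊢
  refine (pow_left_inj₀ (by positivity) (by positivity) two_ne_zero).1 ?_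
  rw [mul_pow, mul_pow, sq_abs, sq_abs, EuclideanSpace.norm_sq_eq, EuclideanSpace.norm_sq_eq,
    Fin.sum_univ_two, Fin.sum_univ_two]
  simp only [Real.norm_eq_abs, sq_abs]
  have h0 : (G 0 * v 0 + G 1 * v 1) * c 0 = -(G 1 * (v 0 * c 1 - v 1 * c 0)) := by
    linear_combination v 0 * h
  have h1 : (G 0 * v 0 + G 1 * v 1) * c 1 = G 0 * (v 0 * c 1 - v 1 * c 0) := by
    linear_combination v 1 * h
  linear_combination ((G 0 * v 0 + G 1 * v 1) * c 0 - G 1 * (v 0 * c 1 - v 1 * c 0)) * h0 +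
    ((G 0 * v 0 + G 1 * v 1) * c 1 + G 0 * (v 0 * c 1 - v 1 * c 0)) * h1

lemma volume_image_eq_lintegral_jac {g : ℝ × ℝ → Plane} (hg : C∞ g)
    {D : Set (ℝ × ℝ)} (hD : MeasurableSet D) (hinj : InjOn g D) :
    volume (g '' D) = ∫⁻ z in D, ENNReal.ofReal |jac g z| := by
  let e : Plane ≃L[ℝ] ℝ × ℝ := (EuclideanSpace.equiv (Fin 2) ℝ).trans
    (ContinuousLinearEquiv.finTwoArrow ℝ ℝ)
  have he : MeasurePreserving e volume volume :=
    (volume_preserving_finTwoArrow ℝ).comp (PiLp.volume_preserving_ofLp (Fin 2))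
  have hdet : ∀ z, (((e : Plane →L[ℝ] ℝ × ℝ).comp (fderiv ℝ g z)).det : ℝ) = jac g z := fun z => by
    rw [ContinuousLinearMap.det, ← LinearMap.det_toMatrix (Module.Basis.finTwoProd ℝ),
      Matrix.det_fin_two]
    simp [LinearMap.toMatrix_apply, e, jac]
    ring
  have h1 : volume (g '' D) = volume ((e ∘ g) '' D) := by
    rw [image_comp, ← he.measure_preimage_emb e.toHomeomorph.measurableEmbedding,
      preimage_image_eq _ e.injective]
  rw [h1, ← lintegral_abs_det_fderiv_eq_addHaar_image volume hD
    (f' := fun z => (e : Plane →L[ℝ] ℝ × ℝ).comp (fderiv ℝ g z)) (fun z _ =>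
      (e.hasFDerivAt.comp z (hg.differentiable (by simp) z).hasFDerivAt).hasFDerivWithinAt)
    (e.injective.comp_injOn hinj)]
  simp only [hdet]

namespace AnnChart

variable {Ω Γi Γo : Set Plane} {ω₀ : CInf (closure Ω)} (χ : AnnChart Ω Γi Γo ω₀)

lemma hasDerivAt_fst (s θ : ℝ) :
    HasDerivAt (fun s => χ.g (s, θ)) (fderiv ℝ χ.g (s, θ) (1, 0)) s :=
  HasFDerivAt.comp_hasDerivAt (l := χ.g) s (χ.smooth.differentiable (by simp) _).hasFDerivAt
    ((hasDerivAt_id s).prodMk (hasDerivAt_const s θ))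

lemma hasDerivAt_comp {σ : ℝ → ℝ} {σ' θ : ℝ} (h : HasDerivAt σ σ' θ) :
    HasDerivAt (fun θ => χ.g (σ θ, θ))
      (σ' • fderiv ℝ χ.g (σ θ, θ) (1, 0) + fderiv ℝ χ.g (σ θ, θ) (0, 1)) θ := by
  refine (HasFDerivAt.comp_hasDerivAt (l := χ.g) θ
    (χ.smooth.differentiable (by simp) _).hasFDerivAt (h.prodMk (hasDerivAt_id θ))).congr_deriv ?_
  rw [← map_smul, ← map_add]
  simp

/-- The increasing functions in the chart: those with a positive derivative in the first
variable that are constant on the boundary. -/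
structure Incr (F : Plane → ℝ) (W' : ℝ → ℝ → ℝ) (p q : ℝ) : Prop where
  smooth : C∞ F
  deriv : ∀ s θ, HasDerivAt (fun s => F (χ.g (s, θ))) (W' s θ) s
  pos : ∀ s ∈ Icc (0 : ℝ) 1, ∀ θ ∈ Icc 0 (2 * Real.pi), 0 < W' s θ
  left : ∀ θ, F (χ.g (0, θ)) = p
  right : ∀ θ, F (χ.g (1, θ)) = q

variable {χ} {F : Plane → ℝ} {W' : ℝ → ℝ → ℝ} {p q : ℝ}

lemma Incr.strictMonoOn (h : χ.Incr F W' p q) {θ : ℝ} (hθ : θ ∈ Icc 0 (2 * Real.pi)) :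
    StrictMonoOn (fun s => F (χ.g (s, θ))) (Icc 0 1) := by
  refine strictMonoOn_of_deriv_pos (convex_Icc 0 1)
    (fun s _ => (h.deriv s θ).continuousAt.continuousWithinAt) fun s hs => ?_
  rw [interior_Icc] at hs
  rw [(h.deriv s θ).deriv]
  exact h.pos s ⟨hs.1.le, hs.2.le⟩ θ hθ

lemma Incr.image_eq (h : χ.Incr F W' p q) : F '' closure Ω = Icc p q := by
  have hm := h.strictMonoOn (θ := 0) ⟨le_rfl, by positivity⟩
  refine Subset.antisymm ?_ fun l hl => ?_
  · rintro _ ⟨x, hx, rfl⟩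
    obtain ⟨s, hs, θ, hθ, rfl⟩ := χ.surj x hx
    have hm := (h.strictMonoOn (θ := θ) ⟨hθ.1, hθ.2.le⟩).monotoneOn
    rw [← h.left θ, ← h.right θ]
    exact ⟨hm ⟨le_rfl, zero_le_one⟩ hs hs.1, hm hs ⟨zero_le_one, le_rfl⟩ hs.2⟩
  · rw [← h.left 0, ← h.right 0] at hl
    obtain ⟨s, hs, rfl⟩ := intermediate_value_Icc zero_le_one
      (fun s _ => (h.deriv s 0).continuousAt.continuousWithinAt) hl
    exact mem_image_of_mem _ (χ.maps s hs 0)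

lemma Incr.lt (h : χ.Incr F W' p q) : p < q := by
  rw [← h.left 0, ← h.right 0]
  exact h.strictMonoOn (θ := 0) ⟨le_rfl, by positivity⟩ ⟨le_rfl, zero_le_one⟩ ⟨zero_le_one, le_rfl⟩
    one_pos

/-- `σ` parametrizes the level set `{F = l}` in the chart. -/
structure Level (χ : AnnChart Ω Γi Γo ω₀) (F : Plane → ℝ) (l : ℝ) (σ : ℝ → ℝ) : Prop where
  smooth : C∞ σ
  maps : ∀ θ ∈ Icc 0 (2 * Real.pi), σ θ ∈ Icc (0 : ℝ) 1
  value : ∀ θ ∈ Icc 0 (2 * Real.pi), F (χ.g (σ θ, θ)) = l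

lemma Incr.distFun_eq (hA : AnnularData Ω Γi Γo) (h : χ.Incr F W' p q) {ω : CInf (closure Ω)}
    (hF : EqOn ω F (closure Ω)) {l : ℝ} {σ : ℝ → ℝ} (hσ : Level χ F l σ) :
    distFun Ω ω l = ∫ θ in (0 : ℝ)..2 * Real.pi, ∫ s in (0 : ℝ)..σ θ, |jac χ.g (s, θ)| := by
  set D : Set (ℝ × ℝ) := {z | z.2 ∈ Ico 0 (2 * Real.pi) ∧ 0 < z.1 ∧ z.1 < σ z.2}
  have hσc := hσ.smooth.continuous
  have hD : MeasurableSet D := (measurable_snd measurableSet_Ico).inter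
    ((measurableSet_lt measurable_const measurable_fst).inter
      (measurableSet_lt measurable_fst (hσc.measurable.comp measurable_snd)))
  have hmem : ∀ z ∈ D, z.1 ∈ Ioo (0 : ℝ) 1 := fun z hz =>
    ⟨hz.2.1, hz.2.2.trans_le (hσ.maps _ ⟨hz.1.1, hz.1.2.le⟩).2⟩
  have hDsub : D ⊆ Icc (0 : ℝ) 1 ×ˢ Ico 0 (2 * Real.pi) := fun z hz =>
    ⟨⟨(hmem z hz).1.le, (hmem z hz).2.le⟩, hz.1⟩
  have himg : {x | x ∈ Ω ∧ ω x < l} = χ.g '' D := by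
    ext x
    constructor
    · rintro ⟨hx, hxl⟩
      obtain ⟨s, hs, θ, hθ, rfl⟩ := χ.surj x (subset_closure hx)
      have hθ' : θ ∈ Icc 0 (2 * Real.pi) := ⟨hθ.1, hθ.2.le⟩
      rw [hF (χ.maps s hs θ), ← hσ.value θ hθ'] at hxl
      refine ⟨(s, θ), ⟨hθ, hs.1.lt_of_ne fun h0 => ?_,
        ((h.strictMonoOn hθ').lt_iff_lt hs (hσ.maps θ hθ')).1 hxl⟩, rfl⟩
      subst h0
      exact disjoint_left.1 hA.disjoint_i (χ.inner_mem θ) hx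
    · rintro ⟨⟨s, θ⟩, hz, rfl⟩
      have hθ' : θ ∈ Icc 0 (2 * Real.pi) := ⟨hz.1.1, hz.1.2.le⟩
      have hs : s ∈ Icc (0 : ℝ) 1 := ⟨(hmem _ hz).1.le, (hmem _ hz).2.le⟩
      refine ⟨χ.interior s (hmem _ hz) θ, ?_⟩
      rw [hF (χ.maps s hs θ), ← hσ.value θ hθ']
      exact h.strictMonoOn hθ' hs (hσ.maps θ hθ') hz.2.2
  have hj : Continuous fun z => |jac χ.g z| := by
    have := χ.smooth.continuous_fderiv (by simp)
    unfold jac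
    fun_prop
  have hint : IntegrableOn (fun z => |jac χ.g z|) D :=
    (hj.continuousOn.integrableOn_compact (isCompact_Icc.prod isCompact_Icc)).mono_set
      (hDsub.trans (prod_mono_right Ico_subset_Icc_self))
  rw [distFun, himg, Measure.real, volume_image_eq_lintegral_jac χ.smooth hD (χ.inj.mono hDsub),
    ← integral_eq_lintegral_of_nonneg_ae (Eventually.of_forall fun _ => abs_nonneg _)
      hj.aestronglyMeasurable, ← integral_indicator hD, Measure.volume_eq_prod,
    integral_prod_symm _ ((integrable_indicator_iff hD).2 hint),
    intervalIntegral.integral_of_le (by positivity), ← integral_Ico_eq_integral_Ioc,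
    ← integral_indicator measurableSet_Ico]
  congr 1
  funext θ
  by_cases hθ : θ ∈ Ico 0 (2 * Real.pi)
  · rw [indicator_of_mem hθ, intervalIntegral.integral_of_le (hσ.maps θ ⟨hθ.1, hθ.2.le⟩).1,
      integral_Ioc_eq_integral_Ioo, ← integral_indicator measurableSet_Ioo]
    congr 1
    funext s
    by_cases hs : s ∈ Ioo 0 (σ θ)
    · rw [indicator_of_mem hs, indicator_of_mem (show (s, θ) ∈ D from ⟨hθ, hs⟩)]
    · rw [indicator_of_notMem hs, indicator_of_notMem fun h' : (s, θ) ∈ D => hs h'.2]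
  · rw [indicator_of_notMem hθ]
    refine (integral_congr_ae (Eventually.of_forall fun s => ?_)).trans (integral_zero _ _)
    exact indicator_of_notMem (fun h' : (s, θ) ∈ D => hθ h'.1) _

lemma Incr.levelInt_eq [GoodBody (closure Ω)] (h : χ.Incr F W' p q) {ω : CInf (closure Ω)}
    (hF : EqOn ω F (closure Ω)) {l : ℝ} {σ : ℝ → ℝ} (hσ : Level χ F l σ) {f U : Plane → ℝ}
    (hU : Continuous U) (hf : EqOn f U (closure Ω)) :
    levelInt Ω ω (fun x => f x / gradNorm Ω ω x) l = ∫ θ in (0 : ℝ)..2 * Real.pi,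
      |jac χ.g (σ θ, θ)| * U (χ.g (σ θ, θ)) / W' (σ θ) θ := by
  have hT : (0 : ℝ) < 2 * Real.pi := by positivity
  have hσc := hσ.smooth.continuous
  have hdσ : ∀ θ, HasDerivAt σ (_root_.deriv σ θ) θ := fun θ =>
    (hσ.smooth.differentiable (by simp) θ).hasDerivAt
  set c : ℝ → Plane := fun θ => χ.g (σ θ, θ) with hcdef
  set c' : ℝ → Plane := fun θ => _root_.deriv σ θ • fderiv ℝ χ.g (σ θ, θ) (1, 0) +
    fderiv ℝ χ.g (σ θ, θ) (0, 1) with hc'def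
  have hc : ∀ θ, HasDerivAt c (c' θ) θ := fun θ => χ.hasDerivAt_comp (hdσ θ)
  have hc'c : Continuous c' := by
    have h1 := χ.smooth.continuous_fderiv (by simp)
    have h2 := hσ.smooth.continuous_deriv (by simp)
    simp only [hc'def]
    fun_prop
  have hjac : ∀ θ, jac χ.g (σ θ, θ) = fderiv ℝ χ.g (σ θ, θ) (1, 0) 0 * c' θ 1 -
      fderiv ℝ χ.g (σ θ, θ) (1, 0) 1 * c' θ 0 := fun θ => by
    simp only [jac, hc'def, PiLp.add_apply, PiLp.smul_apply, smul_eq_mul]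
    ring
  have hc0 : ∀ θ ∈ Icc 0 (2 * Real.pi), c' θ ≠ 0 := fun θ hθ h0 => by
    refine χ.jac_ne _ (hσ.maps θ hθ) θ ?_
    rw [hjac, h0]
    simp
  have hinj : InjOn c (Ico 0 (2 * Real.pi)) := fun θ hθ θ' hθ' h' => by
    have := @inj _ _ _ _ χ (σ θ, θ) ⟨hσ.maps θ ⟨hθ.1, hθ.2.le⟩, hθ⟩ (σ θ', θ')
      ⟨hσ.maps θ' ⟨hθ'.1, hθ'.2.le⟩, hθ'⟩ h'
    exact congrArg Prod.snd this
  have hset : {x | x ∈ closure Ω ∧ ω x = l} = c '' Ico 0 (2 * Real.pi) := by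
    ext x
    constructor
    · rintro ⟨hx, hxl⟩
      obtain ⟨s, hs, θ, hθ, rfl⟩ := χ.surj x hx
      have hθ' : θ ∈ Icc 0 (2 * Real.pi) := ⟨hθ.1, hθ.2.le⟩
      refine ⟨θ, hθ, ?_⟩
      rw [hF hx, ← hσ.value θ hθ'] at hxl
      simp only [hcdef]
      rw [(h.strictMonoOn hθ').injOn (hσ.maps θ hθ') hs hxl.symm]
    · rintro ⟨θ, hθ, rfl⟩
      have hθ' : θ ∈ Icc 0 (2 * Real.pi) := ⟨hθ.1, hθ.2.le⟩
      have := χ.maps _ (hσ.maps θ hθ') θ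
      exact ⟨this, (hF this).trans (hσ.value θ hθ')⟩
  have hclosed : IsClosed {x | x ∈ closure Ω ∧ ω x = l} := by
    have : {x | x ∈ closure Ω ∧ ω x = l} = closure Ω ∩ {x | F x = l} := by
      ext x; exact and_congr_right fun hx => by rw [hF hx]; rfl
    rw [this]
    exact isClosed_closure.inter (isClosed_eq h.smooth.continuous continuous_const)
  have hgF : Continuous (gradient F) := (InnerProductSpace.toDual ℝ Plane).symm.continuous.comp
    (h.smooth.continuous_fderiv (by simp))
  have e1 : levelInt Ω ω (fun x => f x / gradNorm Ω ω x) l =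
      ∫ x in {x | x ∈ closure Ω ∧ ω x = l}, U x / ‖gradient F x‖ ∂(Measure.hausdorffMeasure 1) :=
    setIntegral_congr_fun hclosed.measurableSet fun x hx => by
      simp only [gradNorm]
      rw [hf hx.1, CInf.gradientWithin_eq ω h.smooth hF hx.1]
  rw [e1, hset, setIntegral_hausdorffMeasure_image hc hc'c hc0 hinj
    (f := fun x => U x / ‖gradient F x‖) (hU.measurable.div hgF.norm.measurable), intervalIntegral.integral_of_le hT.le,
    ← integral_Ico_eq_integral_Ioc]
  refine setIntegral_congr_fun measurableSet_Ico fun θ hθ => ?_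
  have hθ' : θ ∈ Icc 0 (2 * Real.pi) := ⟨hθ.1, hθ.2.le⟩
  have hdF : HasFDerivAt F (fderiv ℝ F (c θ)) (c θ) :=
    (h.smooth.differentiable (by simp) _).hasFDerivAt
  have hin : ∀ v, inner ℝ (gradient F (c θ)) v = fderiv ℝ F (c θ) v := fun v => by
    rw [gradient, InnerProductSpace.toDual_symm_apply]
  have h1 : inner ℝ (gradient F (c θ)) (c' θ) = 0 := by
    rw [hin]
    refine UniqueDiffWithinAt.eq_deriv (Icc 0 (2 * Real.pi)) (uniqueDiffOn_Icc hT θ hθ')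
      (hdF.comp_hasDerivAt θ (hc θ)).hasDerivWithinAt ?_
    exact (hasDerivWithinAt_const θ _ l).congr (fun θ hθ => hσ.value θ hθ) (hσ.value θ hθ')
  have h2 : inner ℝ (gradient F (c θ)) (fderiv ℝ χ.g (σ θ, θ) (1, 0)) = W' (σ θ) θ := by
    rw [hin]
    exact (hdF.comp_hasDerivAt (σ θ) (χ.hasDerivAt_fst (σ θ) θ)).unique (h.deriv (σ θ) θ)
  have hW := h.pos _ (hσ.maps θ hθ') θ hθ'
  have h3 := norm_mul_inner_eq (v := fderiv ℝ χ.g (σ θ, θ) (1, 0)) h1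
  rw [h2, abs_of_pos hW, ← hjac] at h3
  have hG : ‖gradient F (c θ)‖ ≠ 0 := fun h0 => by
    rw [norm_eq_zero.1 h0, inner_zero_left] at h2
    exact hW.ne h2
  show ‖c' θ‖ * (U (c θ) / ‖gradient F (c θ)‖) = _
  rw [mul_div_assoc', div_eq_div_iff hG hW.ne']
  linear_combination (U (c θ)) * h3

end AnnChart

/-! ### One-parameter families of increasing functions in a chart -/

lemma cutId_le (c x : ℝ) : cutId c x ≤ max x (c / 2) := by
  unfold cutId
  have h0 := Real.smoothTransition.nonneg ((x - c / 2) / (c / 2))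
  have h1 := Real.smoothTransition.le_one ((x - c / 2) / (c / 2))
  rcases le_total x (c / 2) with h | h
  · rw [max_eq_right h]; nlinarith
  · rw [max_eq_left h]; nlinarith

/-- A smooth function with values in a compact subset of the positive reals that is the identity
on `[c, K]`. -/
def clampId (c K x : ℝ) : ℝ := 3 * K - cutId (2 * K) (3 * K - cutId c x)

lemma contDiff_clampId (c K : ℝ) : C∞ (clampId c K) :=
  contDiff_const.sub ((contDiff_cutId _).comp (contDiff_const.sub (contDiff_cutId _)))

lemma clampId_eq {c K x : ℝ} (hc : 0 < c) (h1 : c ≤ x) (h2 : x ≤ K) : clampId c K x = x := by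
  rw [clampId, cutId_eq hc h1, cutId_eq (by linarith) (by linarith)]
  ring

lemma le_clampId {c K : ℝ} (hc : 0 < c) (hK : c ≤ K) (x : ℝ) : c / 2 ≤ clampId c K x := by
  have h1 := cutId_le (2 * K) (3 * K - cutId c x)
  have h2 := le_cutId hc x
  rw [clampId]
  rcases le_total (3 * K - cutId c x) (2 * K / 2) with h | h
  · rw [max_eq_right h] at h1; linarith
  · rw [max_eq_left h] at h1; linarith

lemma clampId_le {c K : ℝ} (hK : 0 < K) (x : ℝ) : clampId c K x ≤ 2 * K := by
  have := le_cutId (c := 2 * K) (by linarith) (3 * K - cutId c x)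
  rw [clampId]; linarith

lemma hasDerivAt_intervalIntegral_param {Φ : ℝ × ℝ → ℝ} (hΦ : C∞ Φ) {a b x₀ : ℝ}
    {φ' : ℝ → ℝ} (h : ∀ θ ∈ uIcc a b, HasDerivAt (fun x => Φ (x, θ)) (φ' θ) x₀) :
    HasDerivAt (fun x => ∫ θ in a..b, Φ (x, θ)) (∫ θ in a..b, φ' θ) x₀ := by
  have h1 := (hasFDerivAt_intervalIntegral (hΦ.of_le (by simp)) a b x₀).hasDerivAt
  refine h1.congr_deriv ?_
  have hc : Continuous fun θ => (fderiv ℝ Φ (x₀, θ)).comp (ContinuousLinearMap.inl ℝ ℝ ℝ) :=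
    ((hΦ.continuous_fderiv (by simp)).comp (by fun_prop)).clm_comp continuous_const
  rw [ContinuousLinearMap.intervalIntegral_apply (hc.intervalIntegrable _ _)]
  refine intervalIntegral.integral_congr fun θ hθ => ?_
  refine HasDerivAt.unique ?_ (h θ hθ)
  exact HasFDerivAt.comp_hasDerivAt (l := Φ) x₀ (hΦ.differentiable (by simp) _).hasFDerivAt
    ((hasDerivAt_id x₀).prodMk (hasDerivAt_const x₀ θ))

lemma hasDerivAt_dSnd_fst {G : ℝ × ℝ → ℝ} (hG : C∞ G) {k : ℝ → ℝ} {t l k' : ℝ}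
    (h : ∀ᶠ l' in 𝓝 l, HasDerivAt (fun t => G (t, l')) (k l') t) (hk : HasDerivAt k k' l) :
    HasDerivAt (fun t => dSnd G (t, l)) k' t := by
  have hG' : ∀ z, HasFDerivAt (fderiv ℝ G) (fderiv ℝ (fderiv ℝ G) z) z := fun z =>
    ((hG.fderiv_right (m := (⊤ : ℕ∞)) (by simp)).differentiable (by simp) z).hasFDerivAt
  have hG1 : ∀ z, HasFDerivAt G (fderiv ℝ G z) z := fun z =>
    (hG.differentiable (by simp) z).hasFDerivAt
  have hsymm := second_derivative_symmetric hG1 (hG' (t, l)) (1, 0) (0, 1)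
  have e1 : HasDerivAt (fun t => fderiv ℝ G (t, l)) (fderiv ℝ (fderiv ℝ G) (t, l) (1, 0)) t :=
    HasFDerivAt.comp_hasDerivAt (l := fderiv ℝ G) t (hG' (t, l))
      ((hasDerivAt_id t).prodMk (hasDerivAt_const t l))
  have e2 : HasDerivAt (fun l => fderiv ℝ G (t, l)) (fderiv ℝ (fderiv ℝ G) (t, l) (0, 1)) l :=
    HasFDerivAt.comp_hasDerivAt (l := fderiv ℝ G) l (hG' (t, l))
      ((hasDerivAt_const l t).prodMk (hasDerivAt_id l))
  have e3 := (e1.clm_apply (hasDerivAt_const t ((0 : ℝ), (1 : ℝ))))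
  have e4 := (e2.clm_apply (hasDerivAt_const l ((1 : ℝ), (0 : ℝ))))
  simp only [map_zero, add_zero] at e3 e4
  refine e3.congr_deriv (hsymm.trans (e4.unique (hk.congr_of_eventuallyEq ?_)))
  filter_upwards [h] with l' hl'
  refine HasDerivAt.unique ?_ hl'
  exact HasFDerivAt.comp_hasDerivAt (l := G) t (hG1 (t, l'))
    ((hasDerivAt_id t).prodMk (hasDerivAt_const t l'))

namespace AnnChart

variable {Ω Γi Γo : Set Plane} {ω₀ : CInf (closure Ω)} (χ : AnnChart Ω Γi Γo ω₀)

/-- A smooth positive extension of the absolute value of the functional determinant. -/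
structure Density where
  ρ : ℝ × ℝ → ℝ
  smooth : C∞ ρ
  κ : ℝ
  pos : 0 < κ
  le : ∀ z, κ ≤ ρ z
  eq : ∀ s ∈ Icc (0 : ℝ) 1, ∀ θ ∈ Icc 0 (2 * Real.pi), ρ (θ, s) = |jac χ.g (s, θ)|

lemma contDiff_jac : C∞ (jac χ.g) := by
  have h := χ.smooth.fderiv_right (m := (⊤ : ℕ∞)) (by simp)
  have h1 : ∀ v : ℝ × ℝ, ∀ i : Fin 2, C∞ fun z => fderiv ℝ χ.g z v i := fun v i =>
    (EuclideanSpace.proj (𝕜 := ℝ) i).contDiff.comp (h.clm_apply contDiff_const)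
  exact ((h1 _ 0).mul (h1 _ 1)).sub ((h1 _ 1).mul (h1 _ 0))

lemma exists_density : Nonempty χ.Density := by
  have hj := χ.contDiff_jac
  obtain ⟨y, hy, hmy⟩ := (isCompact_Icc.prod isCompact_Icc :
    IsCompact (Icc (0 : ℝ) 1 ×ˢ Icc 0 (2 * Real.pi))).exists_isMinOn
    ⟨(0, 0), ⟨le_rfl, zero_le_one⟩, le_rfl, by positivity⟩
    (f := fun z => jac χ.g z ^ 2) (hj.continuous.pow 2).continuousOn
  have hκ : 0 < jac χ.g y ^ 2 := by
    have := χ.jac_ne y.1 hy.1 y.2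
    positivity
  refine ⟨⟨fun z => √(cutId (jac χ.g y ^ 2) (jac χ.g (z.2, z.1) ^ 2)),
    (CInf.contDiff_sqrt_cutId hκ).comp ((hj.comp (contDiff_snd.prodMk contDiff_fst)).pow 2),
    √(jac χ.g y ^ 2 / 2), Real.sqrt_pos.2 (half_pos hκ),
    fun z => Real.sqrt_le_sqrt (le_cutId hκ _), fun s hs θ hθ => ?_⟩⟩
  show √(cutId _ (jac χ.g (s, θ) ^ 2)) = _
  rw [cutId_eq hκ (hmy (show (s, θ) ∈ Icc (0 : ℝ) 1 ×ˢ Icc 0 (2 * Real.pi) from ⟨hs, hθ⟩)),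
    Real.sqrt_sq_eq_abs]

/-- The family `F + t N` in the chart, as a function of `((t, θ), s)`. -/
def line (F N : Plane → ℝ) (z : (ℝ × ℝ) × ℝ) : ℝ :=
  F (χ.g (z.2, z.1.2)) + z.1.1 * N (χ.g (z.2, z.1.2))

variable {χ} {F N : Plane → ℝ}

lemma contDiff_line (hF : C∞ F) (hN : C∞ N) :
    C∞ (χ.line F N) := by
  have hg := χ.smooth
  have h : C∞ fun z : (ℝ × ℝ) × ℝ => χ.g (z.2, z.1.2) := by fun_prop
  exact (hF.comp h).add (contDiff_fst.fst.mul (hN.comp h))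

variable (χ) in
/-- A family `F + t N`, extended from the chart to a family of functions that are uniformly
increasing in the first variable, together with its fibrewise inverse. -/
structure Fam (F N : Plane → ℝ) where
  smoothF : C∞ F
  smoothN : C∞ N
  V : (ℝ × ℝ) × ℝ → ℝ
  V' : (ℝ × ℝ) × ℝ → ℝ
  σ : (ℝ × ℝ) × ℝ → ℝ
  smooth : C∞ V
  smooth' : C∞ V'
  smoothσ : C∞ σ
  deriv : ∀ x s, HasDerivAt (fun s => V (x, s)) (V' (x, s)) s
  c : ℝ
  K : ℝ
  pos : 0 < c
  le : ∀ z, c ≤ V' z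
  ge : ∀ z, V' z ≤ K
  right_inv : ∀ x l, V (x, σ (x, l)) = l
  left_inv : ∀ x s, σ (x, V (x, s)) = s
  eq : ∀ᶠ t in 𝓝 (0 : ℝ), ∀ s ∈ Icc (0 : ℝ) 1, ∀ θ ∈ Icc 0 (2 * Real.pi),
    V ((t, θ), s) = χ.line F N ((t, θ), s) ∧ V' ((t, θ), s) = dSnd (χ.line F N) ((t, θ), s)

lemma exists_fam (hF : C∞ F) (hN : C∞ N) {c K : ℝ} (hc : 0 < c)
    (h : ∀ s ∈ Icc (0 : ℝ) 1, ∀ θ ∈ Icc 0 (2 * Real.pi),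
      dSnd (χ.line F N) ((0, θ), s) ∈ Ioo c K) : Nonempty (χ.Fam F N) := by
  have hw := contDiff_line (χ := χ) hF hN
  have hcK : c ≤ K := by
    have := h 0 ⟨le_rfl, zero_le_one⟩ 0 ⟨le_rfl, by positivity⟩
    linarith [this.1, this.2]
  set V' : (ℝ × ℝ) × ℝ → ℝ := fun z => clampId c K (dSnd (χ.line F N) z) with hV'def
  have hV' : C∞ V' := (contDiff_clampId c K).comp (contDiff_dSnd hw)
  set V : (ℝ × ℝ) × ℝ → ℝ := fun z => χ.line F N (z.1, 0) + ∫ s in (0 : ℝ)..z.2, V' (z.1, s)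
  have hV : C∞ V :=
    (hw.comp (contDiff_fst.prodMk contDiff_const)).add (contDiff_primitive hV')
  have hd : ∀ x s, HasDerivAt (fun s => V (x, s)) (V' (x, s)) s := fun x s =>
    (hasDerivAt_primitive hV'.continuous x s).const_add (χ.line F N (x, 0))
  have hle : ∀ z, c / 2 ≤ V' z := fun z => le_clampId hc hcK _
  obtain ⟨σ, hσ, h1, h2⟩ := exists_contDiff_fiberInverse hV hd (half_pos hc) hle
  refine ⟨⟨hF, hN, V, V', σ, hV, hV', hσ, hd, c / 2, 2 * K, half_pos hc, hle,
    fun z => clampId_le (hc.trans_le hcK) _, h1, h2, ?_⟩⟩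
  have h3 : ∀ᶠ t in 𝓝 (0 : ℝ), ∀ y ∈ Icc 0 (2 * Real.pi) ×ˢ Icc (0 : ℝ) 1,
      dSnd (χ.line F N) ((t, y.1), y.2) ∈ Ioo c K := by
    refine (isCompact_Icc.prod isCompact_Icc).eventually_forall_of_forall_eventually fun y hy => ?_
    have : Continuous fun p : ℝ × (ℝ × ℝ) => dSnd (χ.line F N) ((p.1, p.2.1), p.2.2) :=
      (contDiff_dSnd hw).continuous.comp (by fun_prop)
    exact this.tendsto (0, y) |>.eventually (isOpen_Ioo.mem_nhds (h _ hy.2 _ hy.1))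
  filter_upwards [h3] with t ht s hs θ hθ
  have hV'eq : ∀ s ∈ Icc (0 : ℝ) 1, V' ((t, θ), s) = dSnd (χ.line F N) ((t, θ), s) := fun s hs =>
    clampId_eq hc (ht (θ, s) ⟨hθ, hs⟩).1.le (ht (θ, s) ⟨hθ, hs⟩).2.le
  refine ⟨?_, hV'eq s hs⟩
  have e : ∫ τ in (0 : ℝ)..s, V' ((t, θ), τ) = ∫ τ in (0 : ℝ)..s, dSnd (χ.line F N) ((t, θ), τ) := by
    refine intervalIntegral.integral_congr fun τ hτ => hV'eq τ ?_
    rw [uIcc_of_le hs.1] at hτ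
    exact ⟨hτ.1, hτ.2.trans hs.2⟩
  show χ.line F N ((t, θ), 0) + ∫ τ in (0 : ℝ)..s, V' ((t, θ), τ) = _
  rw [e, intervalIntegral.integral_eq_sub_of_hasDerivAt
    (fun τ _ => hasDerivAt_dSnd hw (t, θ) τ)
    (((contDiff_dSnd hw).continuous.comp (by fun_prop)).intervalIntegrable _ _)]
  ring

namespace Fam

variable (Φ : χ.Fam F N) (d : χ.Density)

lemma strictMono (x : ℝ × ℝ) : StrictMono fun s => Φ.V (x, s) :=
  strictMono_of_deriv_pos fun s => by rw [(Φ.deriv x s).deriv]; exact Φ.pos.trans_le (Φ.le _)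

lemma hasDerivAt_σ (x : ℝ × ℝ) (l : ℝ) :
    HasDerivAt (fun l => Φ.σ (x, l)) (Φ.V' (x, Φ.σ (x, l)))⁻¹ l :=
  HasDerivAt.of_local_left_inverse (Φ.smoothσ.continuous.comp (by fun_prop)).continuousAt
    (Φ.deriv x _) (Φ.pos.trans_le (Φ.le _)).ne' (Eventually.of_forall fun l => Φ.right_inv x l)

lemma hasDerivAt_σ_fst {θ l : ℝ} (hθ : θ ∈ Icc 0 (2 * Real.pi))
    (hl : Φ.σ ((0, θ), l) ∈ Icc (0 : ℝ) 1) :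
    HasDerivAt (fun t => Φ.σ ((t, θ), l))
      (-(N (χ.g (Φ.σ ((0, θ), l), θ)) / Φ.V' ((0, θ), Φ.σ ((0, θ), l)))) 0 := by
  set s := Φ.σ ((0, θ), l)
  have hV : HasFDerivAt Φ.V (fderiv ℝ Φ.V ((0, θ), s)) ((0, θ), s) :=
    (Φ.smooth.differentiable (by simp) _).hasFDerivAt
  have hσd : HasDerivAt (fun t => Φ.σ ((t, θ), l)) (_root_.deriv (fun t => Φ.σ ((t, θ), l)) 0) 0 :=
    ((Φ.smoothσ.differentiable (by simp)).comp (by fun_prop :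
      Differentiable ℝ fun t : ℝ => ((t, θ), l)) 0).hasDerivAt
  set σ' := _root_.deriv (fun t => Φ.σ ((t, θ), l)) 0
  have hp : HasDerivAt (fun t : ℝ => (t, θ)) ((1 : ℝ), (0 : ℝ)) 0 :=
    (hasDerivAt_id 0).prodMk (hasDerivAt_const 0 θ)
  have e1 : fderiv ℝ Φ.V ((0, θ), s) ((1, 0), 0) = N (χ.g (s, θ)) := by
    refine (HasFDerivAt.comp_hasDerivAt (l := Φ.V) (f := fun t : ℝ => ((t, θ), s)) 0 hV
      (hp.prodMk (hasDerivAt_const 0 s))).unique ?_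
    have : HasDerivAt (fun t : ℝ => F (χ.g (s, θ)) + t * N (χ.g (s, θ))) (N (χ.g (s, θ))) 0 := by
      simpa using ((hasDerivAt_id (0 : ℝ)).mul_const (N (χ.g (s, θ)))).const_add (F (χ.g (s, θ)))
    refine this.congr_of_eventuallyEq ?_
    filter_upwards [Φ.eq] with t ht using (ht s hl θ hθ).1
  have e2 : fderiv ℝ Φ.V ((0, θ), s) ((0, 0), 1) = Φ.V' ((0, θ), s) :=
    (HasFDerivAt.comp_hasDerivAt (l := Φ.V) (f := fun s : ℝ => (((0 : ℝ), θ), s)) s hV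
      ((hasDerivAt_const s ((0 : ℝ), θ)).prodMk (hasDerivAt_id s))).unique (Φ.deriv (0, θ) s)
  have e3 : fderiv ℝ Φ.V ((0, θ), s) ((1, 0), σ') = 0 := by
    refine (HasFDerivAt.comp_hasDerivAt (l := Φ.V) (f := fun t : ℝ => ((t, θ), Φ.σ ((t, θ), l)))
      0 hV (hp.prodMk hσd)).unique ?_
    exact (hasDerivAt_const (0 : ℝ) l).congr_of_eventuallyEq
      (Eventually.of_forall fun t => Φ.right_inv _ _)
  have e4 : (((1 : ℝ), (0 : ℝ)), σ') = ((1, 0), 0) + σ' • ((0, 0), (1 : ℝ)) := by simp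
  rw [e4, map_add, map_smul, e1, e2, smul_eq_mul] at e3
  have hne : Φ.V' ((0, θ), s) ≠ 0 := (Φ.pos.trans_le (Φ.le _)).ne'
  refine hσd.congr_deriv ?_
  rw [← neg_div, eq_div_iff hne]
  linarith

/-- The integral of `U` over the sublevel sets. -/
def I (U : Plane → ℝ) (z : ℝ × ℝ) : ℝ :=
  ∫ θ in (0 : ℝ)..2 * Real.pi, ∫ s in (0 : ℝ)..Φ.σ ((z.1, θ), z.2), d.ρ (θ, s) * U (χ.g (s, θ))

variable {U : Plane → ℝ}

lemma contDiff_integrand (hU : C∞ U) :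
    C∞ fun z : ℝ × ℝ => d.ρ z * U (χ.g (z.2, z.1)) := by
  have hg := χ.smooth
  have hρ := d.smooth
  fun_prop

lemma contDiff_I_integrand (hU : C∞ U) : C∞
    fun w : (ℝ × ℝ) × ℝ => ∫ s in (0 : ℝ)..Φ.σ ((w.1.1, w.2), w.1.2),
      d.ρ (w.2, s) * U (χ.g (s, w.2)) := by
  have hσ := Φ.smoothσ
  have h : C∞ fun w : (ℝ × ℝ) × ℝ => (w.2, Φ.σ ((w.1.1, w.2), w.1.2)) := by
    fun_prop
  exact (contDiff_primitive (contDiff_integrand d hU)).comp h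

lemma contDiff_I (hU : C∞ U) : C∞ (Φ.I d U) :=
  contDiff_intervalIntegral (Φ.contDiff_I_integrand d hU) _ _

/-- The integral of `U / |∇|` over the level sets. -/
def J (U : Plane → ℝ) : ℝ × ℝ → ℝ := dSnd (Φ.I d U)

lemma contDiff_J (hU : C∞ U) : C∞ (Φ.J d U) :=
  contDiff_dSnd (Φ.contDiff_I d hU)

lemma hasDerivAt_I (hU : C∞ U) (t l : ℝ) :
    HasDerivAt (fun l => Φ.I d U (t, l)) (Φ.J d U (t, l)) l :=
  hasDerivAt_dSnd (Φ.contDiff_I d hU) t l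

lemma J_eq (hU : C∞ U) (t l : ℝ) : Φ.J d U (t, l) =
    ∫ θ in (0 : ℝ)..2 * Real.pi, d.ρ (θ, Φ.σ ((t, θ), l)) * U (χ.g (Φ.σ ((t, θ), l), θ)) /
      Φ.V' ((t, θ), Φ.σ ((t, θ), l)) := by
  refine (Φ.hasDerivAt_I d hU t l).unique (hasDerivAt_intervalIntegral_param
    (Φ := fun w : ℝ × ℝ => ∫ s in (0 : ℝ)..Φ.σ ((t, w.2), w.1), d.ρ (w.2, s) * U (χ.g (s, w.2)))
    ((Φ.contDiff_I_integrand d hU).comp (by fun_prop :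
      C∞ fun w : ℝ × ℝ => ((t, w.1), w.2))) fun θ _ => ?_)
  exact (hasDerivAt_primitive (contDiff_integrand d hU).continuous θ _).comp l
    (Φ.hasDerivAt_σ (t, θ) l)

lemma hasDerivAt_I_fst (hU : C∞ U) {l : ℝ}
    (hl : ∀ θ ∈ Icc 0 (2 * Real.pi), Φ.σ ((0, θ), l) ∈ Icc (0 : ℝ) 1) :
    HasDerivAt (fun t => Φ.I d U (t, l)) (-Φ.J d (fun x => U x * N x) (0, l)) 0 := by
  rw [Φ.J_eq d (hU.mul Φ.smoothN), ← intervalIntegral.integral_neg]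
  refine hasDerivAt_intervalIntegral_param
    (Φ := fun w : ℝ × ℝ => ∫ s in (0 : ℝ)..Φ.σ ((w.1, w.2), l), d.ρ (w.2, s) * U (χ.g (s, w.2)))
    ((Φ.contDiff_I_integrand d hU).comp (by fun_prop :
      C∞ fun w : ℝ × ℝ => ((w.1, l), w.2))) fun θ hθ => ?_
  rw [uIcc_of_le (by positivity)] at hθ
  refine ((hasDerivAt_primitive (contDiff_integrand d hU).continuous θ _).comp 0
    (Φ.hasDerivAt_σ_fst hθ (hl θ hθ))).congr_deriv ?_
  ring

lemma le_J_one (z : ℝ × ℝ) : 2 * Real.pi * (d.κ / Φ.K) ≤ Φ.J d (fun _ => 1) z := by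
  have hK : 0 < Φ.K := Φ.pos.trans_le ((Φ.le 0).trans (Φ.ge 0))
  have hσ := Φ.smoothσ.continuous
  have hV' := Φ.smooth'.continuous
  have hρ := d.smooth.continuous
  rw [← Prod.mk.eta (p := z), Φ.J_eq d contDiff_const]
  have := intervalIntegral.integral_mono_on (a := 0) (b := 2 * Real.pi) (μ := volume)
    (f := fun _ => d.κ / Φ.K) (g := fun θ => d.ρ (θ, Φ.σ ((z.1, θ), z.2)) * 1 /
      Φ.V' ((z.1, θ), Φ.σ ((z.1, θ), z.2))) (by positivity) intervalIntegrable_const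
    (Continuous.intervalIntegrable (Continuous.div (by fun_prop) (by fun_prop)
      fun θ => (Φ.pos.trans_le (Φ.le _)).ne') _ _) fun θ _ => by
        rw [mul_one]
        exact div_le_div₀ (d.pos.le.trans (d.le _)) (d.le _) (Φ.pos.trans_le (Φ.le _)) (Φ.ge _)
  rwa [intervalIntegral.integral_const, sub_zero, smul_eq_mul] at this

lemma J_one_pos (z : ℝ × ℝ) : 0 < Φ.J d (fun _ => 1) z := by
  have hK : 0 < Φ.K := Φ.pos.trans_le ((Φ.le 0).trans (Φ.ge 0))
  have := d.pos
  exact lt_of_lt_of_le (by positivity) (Φ.le_J_one d z)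

/-- The inverse of the area function. -/
structure AreaInv where
  Q : ℝ × ℝ → ℝ
  smooth : C∞ Q
  right_inv : ∀ t m, Φ.I d (fun _ => 1) (t, Q (t, m)) = m
  left_inv : ∀ t l, Q (t, Φ.I d (fun _ => 1) (t, l)) = l

lemma exists_areaInv : Nonempty (Φ.AreaInv d) := by
  have hK : 0 < Φ.K := Φ.pos.trans_le ((Φ.le 0).trans (Φ.ge 0))
  have := d.pos
  obtain ⟨Q, h1, h2, h3⟩ := exists_contDiff_fiberInverse (Φ.contDiff_I d (U := fun _ => 1)
    contDiff_const) (Φ.hasDerivAt_I d contDiff_const) (c := 2 * Real.pi * (d.κ / Φ.K))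
    (by positivity) (Φ.le_J_one d)
  exact ⟨⟨Q, h1, h2, h3⟩⟩

variable {Φ d} (R : Φ.AreaInv d)

lemma hasDerivAt_Q (t m : ℝ) :
    HasDerivAt (fun m => R.Q (t, m)) (Φ.J d (fun _ => 1) (t, R.Q (t, m)))⁻¹ m :=
  HasDerivAt.of_local_left_inverse (R.smooth.continuous.comp (by fun_prop)).continuousAt
    (Φ.hasDerivAt_I d contDiff_const t _) (Φ.J_one_pos d _).ne'
    (Eventually.of_forall fun m => R.right_inv t m)

lemma strictMono_I (t : ℝ) : StrictMono fun l => Φ.I d (fun _ => 1) (t, l) :=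
  strictMono_of_deriv_pos fun l => by
    rw [(Φ.hasDerivAt_I d contDiff_const t l).deriv]; exact Φ.J_one_pos d _

lemma strictMono_Q (t : ℝ) : StrictMono fun m => R.Q (t, m) :=
  strictMono_of_deriv_pos fun m => by
    rw [(hasDerivAt_Q R t m).deriv]; exact inv_pos.2 (Φ.J_one_pos d _)

end Fam

end AnnChart

/-! ### Distribution functions and integrals over level sets along a family -/

namespace AnnChart.Fam

variable {Ω Γi Γo : Set Plane} {ω₀ : CInf (closure Ω)} {χ : AnnChart Ω Γi Γo ω₀}
  {F N : Plane → ℝ} (Φ : χ.Fam F N) {d : χ.Density} (R : Φ.AreaInv d)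

/-- The parameters for which the extended family agrees with `F + t N`, with the values `p` and `q`
on the boundary. -/
structure Good (t p q : ℝ) : Prop where
  eq : ∀ s ∈ Icc (0 : ℝ) 1, ∀ θ ∈ Icc 0 (2 * Real.pi),
    Φ.V ((t, θ), s) = χ.line F N ((t, θ), s) ∧ Φ.V' ((t, θ), s) = dSnd (χ.line F N) ((t, θ), s)
  left : ∀ θ, χ.line F N ((t, θ), 0) = p
  right : ∀ θ, χ.line F N ((t, θ), 1) = q

namespace Good

variable {Φ} {t p q : ℝ} (h : Φ.Good t p q)
include h

lemma incr : χ.Incr (fun x => F x + t * N x) (fun s θ => dSnd (χ.line F N) ((t, θ), s)) p q where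
  smooth := Φ.smoothF.add (contDiff_const.mul Φ.smoothN)
  deriv s θ := hasDerivAt_dSnd (contDiff_line Φ.smoothF Φ.smoothN) (t, θ) s
  pos s hs θ hθ := by
    rw [← (h.eq s hs θ hθ).2]
    exact Φ.pos.trans_le (Φ.le _)
  left := h.left
  right := h.right

lemma V_zero {θ : ℝ} (hθ : θ ∈ Icc 0 (2 * Real.pi)) : Φ.V ((t, θ), 0) = p := by
  rw [(h.eq 0 ⟨le_rfl, zero_le_one⟩ θ hθ).1, h.left]

lemma V_one {θ : ℝ} (hθ : θ ∈ Icc 0 (2 * Real.pi)) : Φ.V ((t, θ), 1) = q := by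
  rw [(h.eq 1 ⟨zero_le_one, le_rfl⟩ θ hθ).1, h.right]

lemma σ_mem {θ : ℝ} (hθ : θ ∈ Icc 0 (2 * Real.pi)) {l : ℝ} (hl : l ∈ Icc p q) :
    Φ.σ ((t, θ), l) ∈ Icc (0 : ℝ) 1 := by
  rw [← Φ.right_inv (t, θ) l, ← h.V_zero hθ, ← h.V_one hθ] at hl
  exact ⟨(Φ.strictMono (t, θ)).le_iff_le.1 hl.1, (Φ.strictMono (t, θ)).le_iff_le.1 hl.2⟩

lemma level {l : ℝ} (hl : l ∈ Icc p q) :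
    Level χ (fun x => F x + t * N x) l (fun θ => Φ.σ ((t, θ), l)) where
  smooth := Φ.smoothσ.comp (by fun_prop : C∞ fun θ : ℝ => ((t, θ), l))
  maps θ hθ := h.σ_mem hθ hl
  value θ hθ := ((h.eq _ (h.σ_mem hθ hl) θ hθ).1.symm.trans (Φ.right_inv _ _) :)

variable {ω : CInf (closure Ω)} (hω : EqOn ω (fun x => F x + t * N x) (closure Ω))
include hω

lemma distFun_eq (hA : AnnularData Ω Γi Γo) {l : ℝ} (hl : l ∈ Icc p q) :
    distFun Ω ω l = Φ.I d (fun _ => 1) (t, l) := by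
  rw [h.incr.distFun_eq hA hω (h.level hl)]
  refine intervalIntegral.integral_congr fun θ hθ => intervalIntegral.integral_congr fun s hs => ?_
  rw [uIcc_of_le (by positivity)] at hθ
  rw [uIcc_of_le (h.σ_mem hθ hl).1] at hs
  simp only [mul_one]
  exact (d.eq s ⟨hs.1, hs.2.trans (h.σ_mem hθ hl).2⟩ θ hθ).symm

lemma levelInt_eq [GoodBody (closure Ω)] {l : ℝ} (hl : l ∈ Icc p q) {f U : Plane → ℝ}
    (hU : C∞ U) (hf : EqOn f U (closure Ω)) :
    levelInt Ω ω (fun x => f x / gradNorm Ω ω x) l = Φ.J d U (t, l) := by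
  rw [h.incr.levelInt_eq hω (h.level hl) hU.continuous hf, Φ.J_eq d hU]
  refine intervalIntegral.integral_congr fun θ hθ => ?_
  rw [uIcc_of_le (by positivity)] at hθ
  rw [d.eq _ (h.σ_mem hθ hl) θ hθ, (h.eq _ (h.σ_mem hθ hl) θ hθ).2]

lemma image_eq : ω '' closure Ω = Icc p q := by
  rw [hω.image_eq, h.incr.image_eq]

lemma I_left (hA : AnnularData Ω Γi Γo) : Φ.I d (fun _ => 1) (t, p) = 0 := by
  rw [← h.distFun_eq hω hA ⟨le_rfl, h.incr.lt.le⟩, distFun]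
  convert measureReal_empty
  refine eq_empty_of_forall_notMem fun x hx => ?_
  have := (h.image_eq hω).subset (mem_image_of_mem _ (subset_closure hx.1))
  exact absurd hx.2 (not_lt.2 this.1)

lemma I_right (hA : AnnularData Ω Γi Γo) : Φ.I d (fun _ => 1) (t, q) = area Ω := by
  rw [← h.distFun_eq hω hA ⟨h.incr.lt.le, le_rfl⟩, distFun, area]
  congr 1
  ext x
  refine ⟨fun hx => hx.1, fun hx => ⟨hx, ?_⟩⟩
  obtain ⟨s, hs, θ, hθ, rfl⟩ := χ.surj x (subset_closure hx)
  rw [hω (subset_closure hx), ← h.incr.right θ]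
  refine h.incr.strictMonoOn ⟨hθ.1, hθ.2.le⟩ hs ⟨zero_le_one, le_rfl⟩ (hs.2.lt_of_ne ?_)
  rintro rfl
  exact disjoint_left.1 hA.disjoint_o (χ.outer_mem θ) hx

lemma Q_zero (hA : AnnularData Ω Γi Γo) : R.Q (t, 0) = p := by
  rw [← h.I_left (d := d) hω hA, R.left_inv]

lemma Q_area (hA : AnnularData Ω Γi Γo) : R.Q (t, area Ω) = q := by
  rw [← h.I_right (d := d) hω hA, R.left_inv]

lemma Q_mem (hA : AnnularData Ω Γi Γo) {m : ℝ} (hm : m ∈ Icc 0 (area Ω)) :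
    R.Q (t, m) ∈ Icc p q := by
  rw [← h.Q_zero R hω hA, ← h.Q_area R hω hA]
  exact ⟨(strictMono_Q R t).monotone hm.1, (strictMono_Q R t).monotone hm.2⟩

lemma bijOn_distFun (hA : AnnularData Ω Γi Γo) :
    BijOn (distFun Ω ω) (ω '' closure Ω) (Icc 0 (area Ω)) := by
  obtain ⟨d⟩ := χ.exists_density
  obtain ⟨R⟩ := Φ.exists_areaInv d
  have e : EqOn (distFun Ω ω) (fun l => Φ.I d (fun _ => 1) (t, l)) (Icc p q) :=
    fun l hl => h.distFun_eq hω hA hl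
  rw [h.image_eq hω, e.bijOn_iff]
  refine ⟨fun l hl => ?_, (strictMono_I t).injective.injOn, fun m hm => ?_⟩
  · rw [← h.I_left (d := d) hω hA, ← h.I_right (d := d) hω hA]
    exact ⟨(strictMono_I t).monotone hl.1, (strictMono_I t).monotone hl.2⟩
  · exact ⟨R.Q (t, m), h.Q_mem R hω hA hm, R.right_inv t m⟩

lemma distInv_eq (hA : AnnularData Ω Γi Γo) {m : ℝ} (hm : m ∈ Icc 0 (area Ω)) :
    distInv Ω ω m = R.Q (t, m) := by
  have h1 := h.Q_mem R hω hA hm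
  have h2 : distFun Ω ω (R.Q (t, m)) = m := by
    rw [h.distFun_eq (d := d) hω hA h1, R.right_inv]
  have h3 := (h.bijOn_distFun hω hA).injOn.leftInvOn_invFunOn
  rw [distInv]
  nth_rw 1 [← h2]
  exact h3 (by rw [h.image_eq hω]; exact h1)

lemma area_pos (hA : AnnularData Ω Γi Γo) : 0 < area Ω := by
  obtain ⟨d⟩ := χ.exists_density
  rw [← h.I_left (d := d) hω hA, ← h.I_right (d := d) hω hA]
  exact strictMono_I t h.incr.lt

end Good

variable {R}

lemma hasDerivAt_Q_fst {p q : ℝ} (h : Φ.Good 0 p q) {m : ℝ} (hm : R.Q (0, m) ∈ Icc p q) :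
    HasDerivAt (fun t => R.Q (t, m)) (Φ.J d N (0, R.Q (0, m)) /
      Φ.J d (fun _ => 1) (0, R.Q (0, m))) 0 := by
  have hI := Φ.contDiff_I d (U := fun _ => 1) contDiff_const
  set l := R.Q (0, m)
  have hd : HasFDerivAt (Φ.I d fun _ => 1) (fderiv ℝ (Φ.I d fun _ => 1) (0, l)) (0, l) :=
    (hI.differentiable (by simp) _).hasFDerivAt
  have hQ : HasDerivAt (fun t => R.Q (t, m)) (_root_.deriv (fun t => R.Q (t, m)) 0) 0 :=
    ((R.smooth.differentiable (by simp)).comp (by fun_prop :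
      Differentiable ℝ fun t : ℝ => (t, m)) 0).hasDerivAt
  set Q' := _root_.deriv (fun t => R.Q (t, m)) 0
  have e1 : fderiv ℝ (Φ.I d fun _ => 1) (0, l) (1, 0) = -Φ.J d N (0, l) := by
    refine (HasFDerivAt.comp_hasDerivAt (l := Φ.I d fun _ => 1) (f := fun t : ℝ => (t, l)) 0 hd
      ((hasDerivAt_id 0).prodMk (hasDerivAt_const 0 l))).unique ?_
    have := Φ.hasDerivAt_I_fst d (U := fun _ => 1) contDiff_const
      fun θ hθ => h.σ_mem hθ hm
    simp only [one_mul] at this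
    exact this
  have e3 : fderiv ℝ (Φ.I d fun _ => 1) (0, l) (1, Q') = 0 := by
    refine (HasFDerivAt.comp_hasDerivAt (l := Φ.I d fun _ => 1) (f := fun t : ℝ => (t, R.Q (t, m)))
      0 hd ((hasDerivAt_id 0).prodMk hQ)).unique ?_
    exact (hasDerivAt_const (0 : ℝ) m).congr_of_eventuallyEq
      (Eventually.of_forall fun t => R.right_inv t m)
  have e4 : ((1 : ℝ), Q') = (1, 0) + Q' • ((0 : ℝ), (1 : ℝ)) := by simp
  have e2 : fderiv ℝ (Φ.I d fun _ => 1) (0, l) (0, 1) = Φ.J d (fun _ => 1) (0, l) := rfl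
  rw [e4, map_add, map_smul, e1, e2, smul_eq_mul] at e3
  refine hQ.congr_deriv ?_
  rw [eq_div_iff (Φ.J_one_pos d _).ne']
  linarith

variable (R)

/-- The integral of `U / |∇|` over the level sets, as a function of the area. -/
def E (U : Plane → ℝ) (z : ℝ × ℝ) : ℝ := Φ.J d U (z.1, R.Q z)

variable {U U' : Plane → ℝ}

lemma contDiff_E (hU : C∞ U) : C∞ (Φ.E R U) :=
  (Φ.contDiff_J d hU).comp (contDiff_fst.prodMk R.smooth)

lemma hasDerivAt_E_fst {p q : ℝ} (h : Φ.Good 0 p q) (hU : C∞ U) {m : ℝ}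
    (hm : R.Q (0, m) ∈ Ioo p q) :
    HasDerivAt (fun t => Φ.E R U (t, m)) (Φ.E R N (0, m) * dSnd (Φ.E R U) (0, m) -
      Φ.E R (fun _ => 1) (0, m) * dSnd (Φ.E R fun x => U x * N x) (0, m)) 0 := by
  have hJ := Φ.contDiff_J d hU
  set l := R.Q (0, m)
  have hd : HasFDerivAt (Φ.J d U) (fderiv ℝ (Φ.J d U) (0, l)) (0, l) :=
    (hJ.differentiable (by simp) _).hasFDerivAt
  have hsnd : ∀ {U : Plane → ℝ}, C∞ U →
      dSnd (Φ.E R U) (0, m) = dSnd (Φ.J d U) (0, l) * (Φ.J d (fun _ => 1) (0, l))⁻¹ := fun {U} hU =>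
    (hasDerivAt_dSnd (Φ.contDiff_E R hU) 0 m).unique
      (HasDerivAt.comp (h₂ := fun l => Φ.J d U (0, l)) m
        (hasDerivAt_dSnd (Φ.contDiff_J d hU) 0 l) (hasDerivAt_Q R 0 m))
  have hQ := Φ.hasDerivAt_Q_fst (R := R) h ⟨hm.1.le, hm.2.le⟩
  set Q' := Φ.J d N (0, l) / Φ.J d (fun _ => 1) (0, l)
  have e1 : fderiv ℝ (Φ.J d U) (0, l) (1, 0) = -dSnd (Φ.J d fun x => U x * N x) (0, l) := by
    refine (HasFDerivAt.comp_hasDerivAt (l := Φ.J d U) (f := fun t : ℝ => (t, l)) 0 hd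
      ((hasDerivAt_id 0).prodMk (hasDerivAt_const 0 l))).unique ?_
    refine hasDerivAt_dSnd_fst (Φ.contDiff_I d hU)
      (k := fun l => -Φ.J d (fun x => U x * N x) (0, l)) ?_
      (hasDerivAt_dSnd (Φ.contDiff_J d (hU.mul Φ.smoothN)) 0 l).neg
    filter_upwards [isOpen_Ioo.mem_nhds hm] with l' hl'
    exact Φ.hasDerivAt_I_fst d hU fun θ hθ => h.σ_mem hθ ⟨hl'.1.le, hl'.2.le⟩
  have e2 : fderiv ℝ (Φ.J d U) (0, l) (0, 1) = dSnd (Φ.J d U) (0, l) := rfl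
  have e3 := HasFDerivAt.comp_hasDerivAt (l := Φ.J d U) (f := fun t : ℝ => (t, R.Q (t, m)))
      0 hd ((hasDerivAt_id 0).prodMk hQ)
  have e4 : ((1 : ℝ), Q') = (1, 0) + Q' • ((0 : ℝ), (1 : ℝ)) := by simp
  rw [e4, map_add, map_smul, e1, e2, smul_eq_mul] at e3
  refine e3.congr_deriv ?_
  have hne := (Φ.J_one_pos d (0, l)).ne'
  rw [hsnd hU, hsnd (hU.mul Φ.smoothN)]
  show _ = Φ.J d N (0, l) * _ - Φ.J d (fun _ => 1) (0, l) * _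
  simp only [Q']
  field_simp
  ring

end AnnChart.Fam

/-! ### Hölder norms along the curves of a chart -/

section HolderNorm

variable {E : Type*} [NormedAddCommGroup E] [NormedSpace ℝ E] {K : Set E} [hK : GoodBody K]

lemma edist_iteratedFDerivWithin_pderiv_le {e : E} (he : ‖e‖ ≤ 1) (f : CInf K) (j : ℕ) {x y : E}
    (hx : x ∈ K) (hy : y ∈ K) :
    edist (iteratedFDerivWithin ℝ j (CInf.pderiv e f) K x)
      (iteratedFDerivWithin ℝ j (CInf.pderiv e f) K y) ≤
    edist (iteratedFDerivWithin ℝ (j + 1) f K x) (iteratedFDerivWithin ℝ (j + 1) f K y) := by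
  rw [CInf.iteratedFDerivWithin_pderiv e f j hx, CInf.iteratedFDerivWithin_pderiv e f j hy,
    iteratedFDerivWithin_succ_eq_comp_right hK.uniqueDiff hx,
    iteratedFDerivWithin_succ_eq_comp_right hK.uniqueDiff hy, Function.comp_apply,
    Function.comp_apply, LinearIsometryEquiv.edist_map, edist_eq_enorm_sub, edist_eq_enorm_sub,
    enorm_le_iff_norm_le]
  set A := ContinuousLinearMap.apply ℝ ℝ e
  set M₁ := iteratedFDerivWithin ℝ j (fderivWithin ℝ f K) K x
  set M₂ := iteratedFDerivWithin ℝ j (fderivWithin ℝ f K) K y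
  have h : A.compContinuousMultilinearMap M₁ - A.compContinuousMultilinearMap M₂ =
      A.compContinuousMultilinearMap (M₁ - M₂) := by
    ext v; simp
  rw [h]
  refine (ContinuousLinearMap.norm_compContinuousMultilinearMap_le _ _).trans ?_
  exact mul_le_of_le_one_left (norm_nonneg _) (CInf.norm_apply_le he)

lemma holderNorm_pderiv_le {e : E} (he : ‖e‖ ≤ 1) (α : ℝ) (n : ℕ) (f : CInf K) :
    holderNorm K α n (CInf.pderiv e f) ≤ holderNorm K α (n + 1) f := by
  refine add_le_add ?_ ?_
  · refine iSup₂_le fun j hj => iSup₂_le fun x hx => ?_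
    refine le_iSup₂_of_le (j + 1) (by simp at hj ⊢; omega) (le_iSup₂_of_le x hx ?_)
    rw [enorm_le_iff_norm_le, CInf.iteratedFDerivWithin_pderiv e f j hx,
      ← norm_iteratedFDerivWithin_fderivWithin hK.uniqueDiff hx]
    refine (ContinuousLinearMap.norm_compContinuousMultilinearMap_le _ _).trans ?_
    exact mul_le_of_le_one_left (norm_nonneg _) (CInf.norm_apply_le he)
  · rw [Finset.sum_range_succ' _ (n + 1)]
    refine le_add_right (Finset.sum_le_sum fun j _ => ?_)
    refine iSup₂_le fun x hx => iSup₂_le fun y hy => iSup_le fun hxy => ?_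
    refine le_iSup₂_of_le x hx (le_iSup₂_of_le y hy (le_iSup_of_le hxy ?_))
    gcongr
    exact edist_iteratedFDerivWithin_pderiv_le he f j hx hy

lemma holderNorm_mono (α : ℝ) {n m : ℕ} (h : n ≤ m) (f : E → ℝ) :
    holderNorm K α n f ≤ holderNorm K α m f := by
  have hr : Finset.range (n + 1) ⊆ Finset.range (m + 1) := Finset.range_subset_range.2 (by omega)
  exact add_le_add (biSup_mono fun j hj => hr hj) (Finset.sum_le_sum_of_subset hr)

lemma abs_le_holderNorm (α : ℝ) {f : E → ℝ} (hf : holderNorm K α 0 f ≠ ⊤) :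
    (∀ x ∈ K, |f x| ≤ (supNorm K 0 f).toReal) ∧
    (∀ x ∈ K, ∀ y ∈ K, x ≠ y → |f x - f y| ≤
      (holderSeminorm K α (iteratedFDerivWithin ℝ 0 f K)).toReal * ‖x - y‖ ^ α) := by
  rw [holderNorm, zero_add, Finset.sum_range_one, ENNReal.add_ne_top] at hf
  refine ⟨fun x hx => ?_, fun x hx y hy hxy => ?_⟩
  · rw [← Real.norm_eq_abs, ← ENNReal.ofReal_le_iff_le_toReal hf.1, ofReal_norm]
    refine le_iSup₂_of_le 0 (by simp) (le_iSup₂_of_le x hx ?_)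
    rw [enorm_le_iff_norm_le, norm_iteratedFDerivWithin_zero]
  · have h0 : 0 < ‖x - y‖ := norm_pos_iff.2 (sub_ne_zero.2 hxy)
    rw [← div_le_iff₀ (Real.rpow_pos_of_pos h0 α), ← ENNReal.ofReal_le_iff_le_toReal hf.2]
    refine le_iSup₂_of_le x hx (le_iSup₂_of_le y hy (le_iSup_of_le hxy ?_))
    rw [ENNReal.ofReal_div_of_pos (Real.rpow_pos_of_pos h0 α), iteratedFDerivWithin_zero_eq_comp,
      Function.comp_apply, Function.comp_apply, LinearIsometryEquiv.edist_map, edist_dist, edist_dist,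
      Real.dist_eq, dist_eq_norm, ENNReal.ofReal_rpow_of_pos h0]

end HolderNorm

namespace AnnChart

variable {Ω Γi Γo : Set Plane} {ω₀ : CInf (closure Ω)} (χ : AnnChart Ω Γi Γo ω₀)

/-- The first coordinate curves of the chart. -/
def ray (θ s : ℝ) : Plane := χ.g (s, θ)

lemma contDiff_ray (θ : ℝ) : C∞ (χ.ray θ) :=
  χ.smooth.comp (by fun_prop : C∞ fun s : ℝ => (s, θ))

/-- The coordinates of the velocity of the rays. -/
def vel (i : Fin 2) (z : ℝ × ℝ) : ℝ := fderiv ℝ χ.g (z.2, z.1) (1, 0) i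

lemma contDiff_vel (i : Fin 2) : C∞ (χ.vel i) :=
  (EuclideanSpace.proj (𝕜 := ℝ) i).contDiff.comp (((χ.smooth.fderiv_right (m := (⊤ : ℕ∞))
    (by simp)).comp (contDiff_snd.prodMk contDiff_fst)).clm_apply contDiff_const)

lemma sm_vel (i : Fin 2) (θ : ℝ) : Sm 0 1 fun s => χ.vel i (θ, s) :=
  ((χ.contDiff_vel i).comp (by fun_prop : C∞ fun s : ℝ => (θ, s))).sm 0 1

lemma sm_ray (f : CInf (closure Ω)) (θ : ℝ) : Sm 0 1 (f ∘ χ.ray θ) :=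
  f.contDiffOn.comp (χ.contDiff_ray θ).contDiffOn fun _ hs => χ.maps _ hs θ

lemma dI_comp_ray [GoodBody (closure Ω)] (f : CInf (closure Ω)) (θ : ℝ) {s : ℝ}
    (hs : s ∈ Icc (0 : ℝ) 1) : dI 0 1 (f ∘ χ.ray θ) s =
      (CInf.pderiv (EuclideanSpace.single 0 1) f ∘ χ.ray θ * (fun s => χ.vel 0 (θ, s)) +
      CInf.pderiv (EuclideanSpace.single 1 1) f ∘ χ.ray θ * fun s => χ.vel 1 (θ, s)) s := by
  have hx := χ.maps s hs θ
  refine dI_eq one_pos hs ?_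
  have h1 : HasFDerivWithinAt f (fderivWithin ℝ f (closure Ω) (χ.ray θ s)) (closure Ω)
      (χ.ray θ s) := ((f.contDiffWithinAt (n := 1) hx).differentiableWithinAt
        (by simp)).hasFDerivWithinAt
  refine (h1.comp_hasDerivWithinAt s (χ.hasDerivAt_fst s θ).hasDerivWithinAt
    fun s hs => χ.maps s hs θ).congr_deriv ?_
  simp only [Pi.add_apply, Pi.mul_apply, Function.comp_apply, CInf.pderiv_apply _ _ hx, ray, vel]
  have hbasis : ∀ u : Plane, u = u 0 • EuclideanSpace.single 0 1 +
      u 1 • EuclideanSpace.single 1 1 := fun u => by ext i; fin_cases i <;> simp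
  conv_lhs => rw [hbasis (fderiv ℝ χ.g (s, θ) (1, 0))]
  rw [map_add, map_smul, map_smul, smul_eq_mul, smul_eq_mul]
  ring

lemma exists_hN_comp_ray_le [GoodBody (closure Ω)] {α : ℝ} (h0 : 0 ≤ α) (h1 : α ≤ 1)
    {M : ℕ → CInf (closure Ω) → ℝ≥0∞} (hM : ∀ n f, M 0 f ≤ M (n + 1) f)
    (hd : ∀ n f (e : Plane), ‖e‖ ≤ 1 → M n (CInf.pderiv e f) ≤ M (n + 1) f)
    (hb : ∃ C : ℝ, 0 ≤ C ∧ ∀ f : CInf (closure Ω), ∀ θ ∈ Icc 0 (2 * Real.pi),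
      ENNReal.ofReal (hB α (Icc 0 1) (f ∘ χ.ray θ)) ≤ ENNReal.ofReal C * M 0 f) (n : ℕ) :
    ∃ C : ℝ, 0 ≤ C ∧ ∀ f : CInf (closure Ω), ∀ θ ∈ Icc 0 (2 * Real.pi),
      ENNReal.ofReal (hN α 0 1 n (f ∘ χ.ray θ)) ≤ ENNReal.ofReal C * M n f := by
  induction n with
  | zero => exact hb
  | succ n ih =>
    obtain ⟨C₀, hC₀, hC₀'⟩ := hb
    obtain ⟨C, hC, hC'⟩ := ih
    obtain ⟨D, hD1, hD⟩ := exists_hN_mul (sub_pos.2 (zero_lt_one' ℝ)) n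
    have hvel : ∀ i : Fin 2, ∃ B : ℝ, 0 ≤ B ∧ ∀ θ ∈ Icc 0 (2 * Real.pi),
        hN α 0 1 n (fun s => χ.vel i (θ, s)) ≤ B := fun i =>
      exists_hN_le_of_compact (χ.contDiff_vel i) one_pos isCompact_Icc h1 n
    choose B hB0 hBv using hvel
    have key : ∀ (f : CInf (closure Ω)) (i : Fin 2), ∀ θ ∈ Icc 0 (2 * Real.pi),
        hN α 0 1 n (f ∘ χ.ray θ * fun s => χ.vel i (θ, s)) ≤
          2 * D * B i * hN α 0 1 n (f ∘ χ.ray θ) := fun f i θ hθ => by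
      refine (hD h0 h1 le_rfl (χ.sm_ray f θ) (χ.sm_vel i θ)).trans ?_
      have a1 := hN_mono α 0 1 (f ∘ χ.ray θ) (Nat.zero_le n)
      have a2 := (hN_mono α 0 1 (fun s => χ.vel i (θ, s)) (Nat.zero_le n)).trans (hBv i θ hθ)
      have a3 := hBv i θ hθ
      have a4 := hN_nonneg α 0 1 n (f ∘ χ.ray θ)
      have a5 := hN_nonneg α 0 1 n fun s => χ.vel i (θ, s)
      simp only at a1 a2
      calc _ ≤ D * (hN α 0 1 n (f ∘ χ.ray θ) * B i + hN α 0 1 n (f ∘ χ.ray θ) * B i) := by gcongr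
        _ = _ := by ring
    have hnorm : ∀ i : Fin 2, ‖(EuclideanSpace.single i (1 : ℝ) : Plane)‖ ≤ 1 := fun i => by simp
    refine ⟨C₀ + (2 * D * B 0 * C + 2 * D * B 1 * C), by have := hB0 0; have := hB0 1; positivity,
      fun f θ hθ => ?_⟩
    have s1 : ∀ i : Fin 2, Sm 0 1 (CInf.pderiv (EuclideanSpace.single i 1) f ∘ χ.ray θ *
        fun s => χ.vel i (θ, s)) := fun i => (χ.sm_ray _ θ).mul (χ.sm_vel i θ)
    have e1 : hN α 0 1 (n + 1) (f ∘ χ.ray θ) ≤ hB α (Icc 0 1) (f ∘ χ.ray θ) +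
        (2 * D * B 0 * hN α 0 1 n (CInf.pderiv (EuclideanSpace.single 0 1) f ∘ χ.ray θ) +
        2 * D * B 1 * hN α 0 1 n (CInf.pderiv (EuclideanSpace.single 1 1) f ∘ χ.ray θ)) := by
      rw [hN_succ, hN_congr n fun s hs => χ.dI_comp_ray f θ hs]
      exact add_le_add le_rfl ((hN_add_le one_pos h1 n (s1 0) (s1 1)).trans
        (add_le_add (key _ 0 θ hθ) (key _ 1 θ hθ)))
    have e2 : ∀ i : Fin 2, ENNReal.ofReal (2 * D * B i *
        hN α 0 1 n (CInf.pderiv (EuclideanSpace.single i 1) f ∘ χ.ray θ)) ≤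
        ENNReal.ofReal (2 * D * B i * C) * M (n + 1) f := fun i => by
      have := hB0 i
      rw [ENNReal.ofReal_mul (p := 2 * D * B i) (by positivity),
        ENNReal.ofReal_mul (p := 2 * D * B i) (by positivity)]
      refine (mul_le_mul_right ((hC' _ θ hθ).trans (mul_le_mul_right (hd n f _ (hnorm i)) _)) _).trans
        (mul_assoc _ _ _).symm.le
    have hB2 : ∀ i, 0 ≤ 2 * D * B i * C := fun i => by have := hB0 i; positivity
    refine (ENNReal.ofReal_le_ofReal e1).trans ?_
    refine ENNReal.ofReal_add_le.trans ?_
    rw [ENNReal.ofReal_add hC₀ (add_nonneg (hB2 0) (hB2 1)), ENNReal.ofReal_add (hB2 0) (hB2 1),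
      add_mul, add_mul]
    refine add_le_add ((hC₀' f θ hθ).trans (mul_le_mul_right (hM n f) _)) ?_
    exact ENNReal.ofReal_add_le.trans (add_le_add (e2 0) (e2 1))

lemma exists_lipschitz_ray : ∃ C : ℝ, 1 ≤ C ∧ ∀ θ ∈ Icc 0 (2 * Real.pi), ∀ s ∈ Icc (0 : ℝ) 1,
    ∀ t ∈ Icc (0 : ℝ) 1, ‖χ.ray θ s - χ.ray θ t‖ ≤ C * |s - t| := by
  have hc : Continuous fun z : ℝ × ℝ => fderiv ℝ χ.g z (1, 0) :=
    (χ.smooth.continuous_fderiv (by simp)).clm_apply continuous_const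
  obtain ⟨C, hC⟩ := ((isCompact_Icc (a := (0 : ℝ)) (b := 1)).prod (isCompact_Icc (a := (0 : ℝ))
    (b := 2 * Real.pi))).exists_bound_of_continuousOn hc.continuousOn
  refine ⟨max C 1, le_max_right _ _, fun θ hθ s hs t ht => ?_⟩
  exact (convex_Icc (0 : ℝ) 1).norm_image_sub_le_of_norm_hasDerivWithin_le
    (fun s _ => (χ.hasDerivAt_fst s θ).hasDerivWithinAt)
    (fun s hs => (hC (s, θ) ⟨hs, hθ⟩).trans (le_max_left _ _)) ht hs

/-- The rays of the chart as a family of curves. -/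
def rays [GoodBody (closure Ω)] : CurveFam (closure Ω) where
  A := Icc 0 (2 * Real.pi)
  nonempty := ⟨0, le_rfl, by positivity⟩
  hi := 1
  pos := one_pos
  γ θ := χ.ray θ
  smooth θ := χ.contDiff_ray θ
  maps θ s hs := χ.maps s hs θ
  bound n := by
    obtain ⟨C, hC0, hC⟩ := χ.exists_hN_comp_ray_le le_rfl zero_le_one
      (M := fun n f => ENNReal.ofReal (CInf.sN n f))
      (fun n f => ENNReal.ofReal_le_ofReal (CInf.sN_mono f (Nat.zero_le _)))
      (fun n f e he => ENNReal.ofReal_le_ofReal (CInf.sN_pderiv_le he n f))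
      ⟨3, by norm_num, fun f θ hθ => by
        rw [← ENNReal.ofReal_mul (by norm_num)]
        refine ENNReal.ofReal_le_ofReal ((hB_le (CInf.sN_nonneg 0 f) (H := 2 * CInf.sN 0 f)
          (by have := CInf.sN_nonneg 0 f; positivity)
          (fun s hs => CInf.abs_le_sN 0 f (χ.maps s hs θ)) fun s hs t ht => ?_).trans (by linarith))
        rw [Real.rpow_zero, mul_one, two_mul]
        exact (abs_sub _ _).trans (add_le_add (CInf.abs_le_sN 0 f (χ.maps s hs θ))
          (CInf.abs_le_sN 0 f (χ.maps t ht θ)))⟩ n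
    refine ⟨C, hC0, fun f θ => ?_⟩
    have := hC f θ.1 θ.2
    rwa [← ENNReal.ofReal_mul hC0, ENNReal.ofReal_le_ofReal_iff
      (mul_nonneg hC0 (CInf.sN_nonneg _ _))] at this

lemma exists_gr_rays_le [GoodBody (closure Ω)] {α : ℝ} (h0 : 0 ≤ α) (h1 : α ≤ 1) (n : ℕ) :
    ∃ C : ℝ, 0 ≤ C ∧ ∀ f : CInf (closure Ω),
      ENNReal.ofReal (χ.rays.gr α n f) ≤ ENNReal.ofReal C * holderNorm (closure Ω) α n f := by
  obtain ⟨Λ, hΛ1, hΛ⟩ := χ.exists_lipschitz_ray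
  have hΛα : 1 ≤ Λ ^ α := Real.one_le_rpow hΛ1 h0
  obtain ⟨C, hC0, hC⟩ := χ.exists_hN_comp_ray_le h0 h1
    (M := fun n f => holderNorm (closure Ω) α n f)
    (fun n f => holderNorm_mono α (Nat.zero_le _) f)
    (fun n f e he => holderNorm_pderiv_le he α n f)
    ⟨Λ ^ α, by positivity, fun f θ hθ => by
      by_cases hf : holderNorm (closure Ω) α 0 f = ⊤
      · rw [hf, ENNReal.mul_top (by rw [ENNReal.ofReal_ne_zero_iff]; positivity)]
        exact le_top
      obtain ⟨h2, h3⟩ := abs_le_holderNorm α hf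
      set S := (supNorm (closure Ω) 0 f).toReal with hS
      set H := (holderSeminorm (closure Ω) α (iteratedFDerivWithin ℝ 0 f (closure Ω))).toReal with hH
      have hS0 : 0 ≤ S := ENNReal.toReal_nonneg
      have hH0 : 0 ≤ H := ENNReal.toReal_nonneg
      have e1 : hB α (Icc 0 1) (f ∘ χ.ray θ) ≤ S + H * Λ ^ α := by
        refine hB_le hS0 (by positivity) (fun s hs => h2 _ (χ.maps s hs θ)) fun s hs t ht => ?_
        rcases eq_or_ne (χ.ray θ s) (χ.ray θ t) with he | he
        · rw [Function.comp_apply, Function.comp_apply, he, sub_self, abs_zero]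
          positivity
        · refine (h3 _ (χ.maps s hs θ) _ (χ.maps t ht θ) he).trans ?_
          rw [mul_assoc, ← Real.mul_rpow (by linarith) (abs_nonneg _)]
          gcongr
          exact hΛ θ hθ s hs t ht
      have hf' := hf
      rw [holderNorm, zero_add, Finset.sum_range_one] at hf' ⊢
      rw [← ne_eq, ENNReal.add_ne_top] at hf'
      rw [← ENNReal.ofReal_toReal hf'.1, ← ENNReal.ofReal_toReal hf'.2, ← hS, ← hH,
        ← ENNReal.ofReal_add hS0 hH0, ← ENNReal.ofReal_mul (by positivity)]
      refine ENNReal.ofReal_le_ofReal (e1.trans ?_)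
      rw [mul_add]
      have : S ≤ Λ ^ α * S := le_mul_of_one_le_left hS0 hΛα
      linarith⟩ n
  refine ⟨C, hC0, fun f => ?_⟩
  by_cases hf : ENNReal.ofReal C * holderNorm (closure Ω) α n f = ⊤
  · rw [hf]; exact le_top
  rw [ENNReal.ofReal_le_iff_le_toReal hf]
  refine CurveFam.gr_le fun θ => ?_
  rw [← ENNReal.ofReal_le_iff_le_toReal hf]
  exact hC f θ.1 θ.2

end AnnChart

/-! ### Hölder estimates for integrals over level sets -/

lemma hB_comp_lipschitz_le {α Λ L : ℝ} (h0 : 0 ≤ α) (h1 : α ≤ 1) (hΛ : 1 ≤ Λ)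
    {f g : ℝ → ℝ} (hf : Sm 0 1 f) (hm : MapsTo g (Icc 0 L) (Icc 0 1))
    (hg : ∀ x ∈ Icc 0 L, ∀ y ∈ Icc 0 L, |g x - g y| ≤ Λ * |x - y|) :
    hB α (Icc 0 L) (f ∘ g) ≤ Λ * hB α (Icc 0 1) f := by
  have hh := hf.holderFin one_pos h1
  have n1 := holOn_nonneg α (Icc 0 1) f
  have n2 := supOn_nonneg (Icc 0 1) f
  refine (hB_le n2 (H := holOn α (Icc 0 1) f * Λ) (by positivity)
    (fun x hx => hh.abs_le_supOn (hm hx)) fun x hx y hy => ?_).trans ?_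
  · refine (hh.sub_le_holOn (hm hx) (hm hy)).trans ?_
    rw [mul_assoc]
    gcongr
    calc |g x - g y| ^ α ≤ (Λ * |x - y|) ^ α := by gcongr; exact hg x hx y hy
      _ = Λ ^ α * |x - y| ^ α := Real.mul_rpow (by linarith) (abs_nonneg _)
      _ ≤ Λ ^ (1 : ℝ) * |x - y| ^ α := by gcongr
      _ = _ := by rw [Real.rpow_one]
  · unfold hB
    nlinarith

lemma contDiff_integral_fst {T : ℝ} {f : ℝ × ℝ → ℝ} (hf : C∞ f) :
    C∞ fun m => ∫ θ in (0 : ℝ)..T, f (θ, m) :=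
  contDiff_intervalIntegral (F := fun w : ℝ × ℝ => f (w.2, w.1)) (hf.comp (by fun_prop)) 0 T

lemma hN_integral_le {T L α A : ℝ} (hT : 0 ≤ T) (hL : 0 < L) (h1 : α ≤ 1) (n : ℕ) {f : ℝ × ℝ → ℝ}
    (hf : C∞ f) (h : ∀ θ ∈ Icc 0 T, hN α 0 L n (fun m => f (θ, m)) ≤ A) :
    hN α 0 L n (fun m => ∫ θ in (0 : ℝ)..T, f (θ, m)) ≤ 2 * T * (n + 1) * A := by
  have hA : 0 ≤ A := (hN_nonneg _ _ _ _ _).trans (h 0 ⟨le_rfl, hT⟩)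
  have hs : ∀ {f : ℝ × ℝ → ℝ}, C∞ f → ∀ θ, Sm 0 L fun m => f (θ, m) :=
    fun hf θ => (hf.comp (by fun_prop : C∞ fun m : ℝ => (θ, m))).sm 0 L
  have hB' : ∀ {f : ℝ × ℝ → ℝ}, C∞ f →
      (∀ θ ∈ Icc 0 T, hB α (Icc 0 L) (fun m => f (θ, m)) ≤ A) →
      hB α (Icc 0 L) (fun m => ∫ θ in (0 : ℝ)..T, f (θ, m)) ≤ 2 * T * A := fun {f} hf h => by
    have hc : ∀ m, Continuous fun θ => f (θ, m) := fun m => hf.continuous.comp (by fun_prop)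
    have key : ∀ (g : ℝ → ℝ) (D : ℝ), (∀ θ ∈ Icc 0 T, |g θ| ≤ D) →
        |∫ θ in (0 : ℝ)..T, g θ| ≤ D * T := fun g D hD => by
      have := intervalIntegral.norm_integral_le_of_norm_le_const (a := 0) (b := T) (f := g) (C := D)
        fun θ hθ => hD θ (by rw [uIoc_of_le hT] at hθ; exact ⟨hθ.1.le, hθ.2⟩)
      rwa [sub_zero, abs_of_nonneg hT] at this
    refine (hB_le (A := A * T) (H := A * T) (by positivity) (by positivity) (fun m hm =>
      key _ _ fun θ hθ => (((hs hf θ).holderFin hL h1).abs_le hm).trans (h θ hθ))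
      fun x hx y hy => ?_).trans (by linarith)
    rw [← intervalIntegral.integral_sub ((hc x).intervalIntegrable _ _)
      ((hc y).intervalIntegrable _ _)]
    refine (key _ (A * |x - y| ^ α) fun θ hθ => ?_).trans (by linarith)
    refine (((hs hf θ).holderFin hL h1).sub_le_holOn hx hy).trans ?_
    gcongr
    exact (le_add_of_nonneg_left (supOn_nonneg _ _)).trans (h θ hθ)
  induction n generalizing f with
  | zero => exact (hB' hf h).trans_eq (by push_cast; ring)
  | succ n ih =>
    have e : EqOn (dI 0 L fun m => ∫ θ in (0 : ℝ)..T, f (θ, m))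
        (fun m => ∫ θ in (0 : ℝ)..T, dSnd f (θ, m)) (Icc 0 L) := fun m hm =>
      dI_eq hL hm (hasDerivAt_intervalIntegral_param (Φ := fun w : ℝ × ℝ => f (w.2, w.1))
        (hf.comp (by fun_prop)) fun θ _ => hasDerivAt_dSnd hf θ m).hasDerivWithinAt
    rw [hN_succ, hN_congr n e]
    have h2 := hB' hf fun θ hθ => (hB_le_hN _ _ _ (n + 1) _).trans (h θ hθ)
    have h3 := ih (contDiff_dSnd hf) fun θ hθ => by
      rw [← hN_congr n fun m hm => dI_eq hL hm (hasDerivAt_dSnd hf θ m).hasDerivWithinAt]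
      exact (hN_deriv_le _ _ _ _ _).trans (h θ hθ)
    push_cast
    linarith

/-- A family of functions `W θ` on `[0, 1]`, with bounds `y n` for their Hölder norms, and
parametrizations `ζ (θ, ·)` whose derivatives are given by the integral `E 1` over the level sets. -/
structure LevelData (ρ : ℝ × ℝ → ℝ) (T L α c M : ℝ) where
  W : ℝ → ℝ → ℝ
  ζ : ℝ × ℝ → ℝ
  v : ℝ × ℝ → ℝ
  y : ℕ → ℝ
  sm : ∀ θ ∈ Icc 0 T, Sm 0 1 (W θ)
  le : ∀ θ ∈ Icc 0 T, ∀ s ∈ Icc (0 : ℝ) 1, c ≤ dI 0 1 (W θ) s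
  bound : ∀ n, ∀ θ ∈ Icc 0 T, hN α 0 1 n (W θ) ≤ y n
  mono : Monotone y
  bound_two : y 2 ≤ M
  smoothζ : C∞ ζ
  smoothv : C∞ v
  pos : ∀ z, 0 < v z
  eq : ∀ θ ∈ Icc 0 T, ∀ s ∈ Icc (0 : ℝ) 1, v (θ, s) = dI 0 1 (W θ) s
  maps : ∀ θ ∈ Icc 0 T, ∀ m ∈ Icc 0 L, ζ (θ, m) ∈ Icc (0 : ℝ) 1
  deriv : ∀ θ ∈ Icc 0 T, ∀ m ∈ Icc 0 L, HasDerivAt (fun m => ζ (θ, m))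
    (v (θ, ζ (θ, m)) * ∫ θ in (0 : ℝ)..T, ρ (θ, ζ (θ, m)) * 1 / v (θ, ζ (θ, m)))⁻¹ m

/-- The assumptions on the parameters of `LevelData`. -/
structure LevelHyp (ρ : ℝ × ℝ → ℝ) (κ T L α c : ℝ) : Prop where
  hρ : C∞ ρ
  hκ : 0 < κ
  hκρ : ∀ z, κ ≤ ρ z
  hT : 0 < T
  hL : 0 < L
  h0 : 0 ≤ α
  h1 : α ≤ 1
  hc : 0 < c

namespace LevelData

variable {ρ : ℝ × ℝ → ℝ} {T L α c M : ℝ}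

/-- The integral of `h` over the level sets. -/
def E (D : LevelData ρ T L α c M) (h : ℝ × ℝ → ℝ) (m : ℝ) : ℝ :=
  ∫ θ in (0 : ℝ)..T, ρ (θ, D.ζ (θ, m)) * h (θ, D.ζ (θ, m)) / D.v (θ, D.ζ (θ, m))

lemma contDiff_integrand (D : LevelData ρ T L α c M) (hρ : C∞ ρ)
    {h : ℝ × ℝ → ℝ} (hh : C∞ h) : C∞ fun z : ℝ × ℝ =>
      ρ (z.1, D.ζ z) * h (z.1, D.ζ z) / D.v (z.1, D.ζ z) := by
  have h1 : C∞ fun z : ℝ × ℝ => (z.1, D.ζ z) := contDiff_fst.prodMk D.smoothζ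
  exact ((hρ.comp h1).mul (hh.comp h1)).div (D.smoothv.comp h1) fun z => (D.pos _).ne'

lemma contDiff_E (D : LevelData ρ T L α c M) (hρ : C∞ ρ)
    {h : ℝ × ℝ → ℝ} (hh : C∞ h) : C∞ (D.E h) :=
  contDiff_integral_fst (D.contDiff_integrand hρ hh)

variable {κ : ℝ} (H : LevelHyp ρ κ T L α c)
include H

lemma sm_inv (D : LevelData ρ T L α c M) {θ : ℝ} (hθ : θ ∈ Icc 0 T) :
    Sm 0 1 (dI 0 1 (D.W θ))⁻¹ :=
  ((D.sm θ hθ).deriv one_pos).inv fun s hs => (H.hc.trans_le (D.le θ hθ s hs)).ne'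

lemma exists_hN_inv_le (n : ℕ) : ∃ C : ℝ, 1 ≤ C ∧ ∀ (D : LevelData ρ T L α c M), ∀ θ ∈ Icc 0 T,
    hN α 0 1 n (dI 0 1 (D.W θ))⁻¹ ≤ C * (D.y (n + 1) + 1) := by
  obtain ⟨C, hC1, hC⟩ := exists_hN_inv H.h0 H.h1 (sub_pos.2 (zero_lt_one' ℝ)) H.hc M n
  refine ⟨C, hC1, fun D θ hθ => (hC le_rfl ((D.sm θ hθ).deriv one_pos) (D.le θ hθ) ?_).trans ?_⟩
  · exact (hN_deriv_le _ _ _ 1 _).trans ((D.bound 2 θ hθ).trans D.bound_two)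
  · have := (hN_deriv_le _ _ _ n _).trans (D.bound (n + 1) θ hθ)
    gcongr

/-- The product of the density with the reciprocal of the derivative. -/
lemma exists_hN_weight_le (n : ℕ) : ∃ C : ℝ, 1 ≤ C ∧ ∀ (D : LevelData ρ T L α c M), ∀ θ ∈ Icc 0 T,
    ∀ f, Sm 0 1 f → Sm 0 1 ((fun s => ρ (θ, s)) * (f * (dI 0 1 (D.W θ))⁻¹)) ∧
    hN α 0 1 n ((fun s => ρ (θ, s)) * (f * (dI 0 1 (D.W θ))⁻¹)) ≤
      C * (hN α 0 1 n f + (D.y (n + 1) + 1) * hN α 0 1 0 f) := by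
  obtain ⟨C, hC1, hC⟩ := exists_hN_mul (sub_pos.2 (zero_lt_one' ℝ)) n
  obtain ⟨R, hR0, hR⟩ := exists_hN_le_of_compact H.hρ one_pos (isCompact_Icc (a := 0) (b := T)) H.h1 n
  obtain ⟨K, hK1, hK⟩ := exists_hN_inv_le (M := M) H n
  obtain ⟨K₀, hK₀1, hK₀⟩ := exists_hN_inv_le (M := M) H 0
  refine ⟨1 + C * (2 * R) * (C * (K + K₀ * (|M| + 1))), by
    have : 0 ≤ C * (2 * R) * (C * (K + K₀ * (|M| + 1))) := by positivity
    linarith, fun D θ hθ f hf => ?_⟩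
  have hψ := sm_inv H D hθ
  have hr : Sm 0 1 fun s => ρ (θ, s) :=
    (H.hρ.comp (by fun_prop : C∞ fun s : ℝ => (θ, s))).sm 0 1
  refine ⟨hr.mul (hf.mul hψ), ?_⟩
  have a1 := hR θ hθ
  have a2 := (hN_mono α 0 1 (fun s => ρ (θ, s)) (Nat.zero_le n)).trans a1
  have a3 := hN_mono α 0 1 (f * (dI 0 1 (D.W θ))⁻¹) (Nat.zero_le n)
  have a4 := hN_nonneg α 0 1 n (f * (dI 0 1 (D.W θ))⁻¹)
  have a5 := hN_nonneg α 0 1 0 f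
  have a6 := hN_nonneg α 0 1 n f
  have a7 := hK D θ hθ
  have a8 : hN α 0 1 0 (dI 0 1 (D.W θ))⁻¹ ≤ K₀ * (|M| + 1) := (hK₀ D θ hθ).trans (by
    have : D.y (0 + 1) ≤ |M| := (D.mono one_le_two).trans (D.bound_two.trans (le_abs_self M))
    gcongr)
  have a9 : 0 ≤ D.y (n + 1) := (hN_nonneg _ _ _ _ _).trans (D.bound (n + 1) θ hθ)
  have a10 := hN_nonneg α 0 1 0 (f * (dI 0 1 (D.W θ))⁻¹)
  simp only at a2 a3
  calc _ ≤ C * (hN α 0 1 n (fun s => ρ (θ, s)) * hN α 0 1 0 (f * (dI 0 1 (D.W θ))⁻¹) +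
        hN α 0 1 0 (fun s => ρ (θ, s)) * hN α 0 1 n (f * (dI 0 1 (D.W θ))⁻¹)) :=
        hC H.h0 H.h1 le_rfl hr (hf.mul hψ)
    _ ≤ C * (R * hN α 0 1 n (f * (dI 0 1 (D.W θ))⁻¹) +
        R * hN α 0 1 n (f * (dI 0 1 (D.W θ))⁻¹)) := by gcongr
    _ = C * (2 * R) * hN α 0 1 n (f * (dI 0 1 (D.W θ))⁻¹) := by ring
    _ ≤ C * (2 * R) * (C * (hN α 0 1 n f * (K₀ * (|M| + 1)) +
        hN α 0 1 0 f * (K * (D.y (n + 1) + 1)))) := by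
        gcongr
        refine (hC H.h0 H.h1 le_rfl hf hψ).trans ?_
        gcongr
    _ ≤ C * (2 * R) * (C * (hN α 0 1 n f * (K + K₀ * (|M| + 1)) +
        hN α 0 1 0 f * ((K + K₀ * (|M| + 1)) * (D.y (n + 1) + 1)))) := by
        have : 0 ≤ K₀ * (|M| + 1) := by positivity
        gcongr <;> linarith
    _ = C * (2 * R) * (C * (K + K₀ * (|M| + 1))) *
        (hN α 0 1 n f + (D.y (n + 1) + 1) * hN α 0 1 0 f) := by ring
    _ ≤ _ := by
        gcongr
        linarith

lemma integrand_eq (D : LevelData ρ T L α c M) {θ : ℝ} (hθ : θ ∈ Icc 0 T) (h : ℝ × ℝ → ℝ) :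
    EqOn (fun m => ρ (θ, D.ζ (θ, m)) * h (θ, D.ζ (θ, m)) / D.v (θ, D.ζ (θ, m)))
      (((fun s => ρ (θ, s)) * ((fun s => h (θ, s)) * (dI 0 1 (D.W θ))⁻¹)) ∘
        fun m => D.ζ (θ, m)) (Icc 0 L) := fun m hm => by
  simp only [Function.comp_apply, Pi.mul_apply, Pi.inv_apply, D.eq θ hθ _ (D.maps θ hθ m hm)]
  ring

lemma exists_le_E_one : ∃ e > 0, ∀ (D : LevelData ρ T L α c M), ∀ m ∈ Icc 0 L,
    e ≤ D.E (fun _ => 1) m := by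
  have hT := H.hT
  have hκ := H.hκ
  refine ⟨T * (κ / (|M| + 1)), by positivity, fun D m hm => ?_⟩
  have hcont := (D.contDiff_integrand H.hρ (h := fun _ => 1) contDiff_const).continuous
  have := intervalIntegral.integral_mono_on (a := 0) (b := T) (μ := volume)
    (f := fun _ => κ / (|M| + 1)) (g := fun θ => ρ (θ, D.ζ (θ, m)) * 1 / D.v (θ, D.ζ (θ, m)))
    H.hT.le intervalIntegrable_const
    ((hcont.comp (by fun_prop : Continuous fun θ : ℝ => (θ, m))).intervalIntegrable _ _)
    fun θ hθ => by
      rw [mul_one]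
      refine div_le_div₀ (H.hκ.le.trans (H.hκρ _)) (H.hκρ _) (D.pos _) ?_
      have hs := D.maps θ hθ m hm
      rw [D.eq θ hθ _ hs]
      have := ((((D.sm θ hθ).deriv one_pos).holderFin one_pos H.h1).abs_le hs).trans
        ((hN_deriv_le _ _ _ 0 _).trans ((D.bound 1 θ hθ).trans ((D.mono one_le_two).trans
          (D.bound_two.trans (le_abs_self M)))))
      linarith [le_abs_self (dI 0 1 (D.W θ) (D.ζ (θ, m)))]
  rwa [intervalIntegral.integral_const, sub_zero, smul_eq_mul] at this

lemma sm_ζ (D : LevelData ρ T L α c M) (θ : ℝ) : Sm 0 L fun m => D.ζ (θ, m) :=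
  (D.smoothζ.comp (by fun_prop : C∞ fun m : ℝ => (θ, m))).sm 0 L

lemma dI_ζ (D : LevelData ρ T L α c M) {θ : ℝ} (hθ : θ ∈ Icc 0 T) :
    EqOn (dI 0 L fun m => D.ζ (θ, m)) ((dI 0 1 (D.W θ))⁻¹ ∘ (fun m => D.ζ (θ, m)) *
      (D.E fun _ => 1)⁻¹) (Icc 0 L) := fun m hm => by
  rw [dI_eq H.hL hm (D.deriv θ hθ m hm).hasDerivWithinAt, D.eq θ hθ _ (D.maps θ hθ m hm), mul_inv]
  rfl

/-- A uniform bound for the derivatives of the parametrizations. -/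
lemma exists_ζ_one_le : ∃ K : ℝ, 1 ≤ K ∧ ∀ (D : LevelData ρ T L α c M), ∀ θ ∈ Icc 0 T,
    hN α 0 L 1 (fun m => D.ζ (θ, m)) ≤ K ∧ hN α 0 L 0 (D.E fun _ => 1) ≤ K := by
  obtain ⟨e, he, hE⟩ := exists_le_E_one (M := M) H
  obtain ⟨K₀, hK₀1, hK₀⟩ := exists_hN_inv_le (M := M) H 0
  obtain ⟨K₁, hK₁1, hK₁⟩ := exists_hN_weight_le (M := M) H 0
  have hT := H.hT
  have hc := H.hc
  have h0 := H.h0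
  have hL := H.hL
  set Λ : ℝ := max 1 (c * e)⁻¹
  have hΛ1 : 1 ≤ Λ := le_max_left _ _
  set w : ℝ := hN α 0 1 0 fun _ => (1 : ℝ)
  have hw : 0 ≤ w := hN_nonneg _ _ _ _ _
  set i : ℝ := hN α 0 1 0 id
  have hi : 0 ≤ i := hN_nonneg _ _ _ _ _
  set A := K₀ * (|M| + 1)
  set B := 2 * T * (Λ * (K₁ * (w + (|M| + 1) * w)))
  have hB0 : 0 ≤ B := by positivity
  refine ⟨1 + B + (Λ * i + Λ * A * (1 / e + 1 / e ^ 2 * B)), by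
    have : 0 ≤ Λ * i + Λ * A * (1 / e + 1 / e ^ 2 * B) := by positivity
    linarith, fun D => ?_⟩
  have hy : D.y (0 + 1) + 1 ≤ |M| + 1 := by
    rw [zero_add]
    linarith [(D.mono one_le_two).trans (D.bound_two.trans (le_abs_self M))]
  have hy0 : 0 ≤ D.y (0 + 1) + 1 :=
    add_nonneg ((hN_nonneg _ _ _ _ _).trans (D.bound (0 + 1) 0 ⟨le_rfl, hT.le⟩)) zero_le_one
  have hlip : ∀ θ ∈ Icc 0 T, ∀ x ∈ Icc 0 L, ∀ y ∈ Icc 0 L,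
      |D.ζ (θ, x) - D.ζ (θ, y)| ≤ Λ * |x - y| := fun θ hθ x hx y hy =>
    (sm_ζ H D θ).lipschitz (fun m hm => by
      rw [dI_ζ H D hθ hm, Pi.mul_apply, Pi.inv_apply, Function.comp_apply,
        Pi.inv_apply, ← mul_inv]
      have h2 := D.le θ hθ _ (D.maps θ hθ m hm)
      have h3 := hE D m hm
      have h4 := H.hc.le.trans h2
      rw [abs_of_nonneg (inv_nonneg.2 (mul_nonneg (H.hc.le.trans h2) (he.le.trans h3)))]
      refine le_trans ?_ (le_max_right _ _)
      gcongr) hx hy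
  have hEB : hN α 0 L 0 (D.E fun _ => 1) ≤ B := by
    have := hN_integral_le (α := α) hT.le H.hL H.h1 0
      (D.contDiff_integrand H.hρ (h := fun _ => 1) contDiff_const)
      (A := Λ * (K₁ * (w + (|M| + 1) * w))) fun θ hθ => by
        obtain ⟨g1, g2⟩ := hK₁ D θ hθ (fun _ => 1) (contDiff_const.sm 0 1)
        rw [hN_congr 0 (integrand_eq H D hθ fun _ => 1), hN_zero]
        refine (hB_comp_lipschitz_le H.h0 H.h1 hΛ1 g1 (fun m hm => D.maps θ hθ m hm)
          (hlip θ hθ)).trans ?_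
        gcongr
        refine g2.trans ?_
        gcongr
    exact this.trans_eq (by push_cast; ring)
  intro θ hθ
  refine ⟨?_, by have : 0 ≤ Λ * i + Λ * A * (1 / e + 1 / e ^ 2 * B) := by positivity
                 linarith⟩
  have sE : Sm 0 L (D.E fun _ => 1) := (D.contDiff_E H.hρ contDiff_const).sm 0 L
  have hψ := sm_inv H D hθ
  have hm : MapsTo (fun m => D.ζ (θ, m)) (Icc 0 L) (Icc 0 1) := fun m hm => D.maps θ hθ m hm
  rw [hN_succ, hN_congr 0 (dI_ζ H D hθ)]
  have b1 : hB α (Icc 0 L) (fun m => D.ζ (θ, m)) ≤ Λ * i :=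
    hB_comp_lipschitz_le (f := id) H.h0 H.h1 hΛ1 (contDiff_id.sm 0 1) hm (hlip θ hθ)
  have b2 : hB α (Icc 0 L) ((dI 0 1 (D.W θ))⁻¹ ∘ fun m => D.ζ (θ, m)) ≤ Λ * A := by
    refine (hB_comp_lipschitz_le H.h0 H.h1 hΛ1 hψ hm (hlip θ hθ)).trans ?_
    gcongr
    refine (hK₀ D θ hθ).trans ?_
    simp only [A]
    gcongr
  have b3 := hN_zero_inv_le he H.h1 H.hL sE fun m hm => hE D m hm
  have b4 : hB α (Icc 0 L) (D.E fun _ => 1)⁻¹ ≤ 1 / e + 1 / e ^ 2 * B :=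
    b3.trans (by gcongr)
  have b5 := hB_mul_le ((hψ.comp (sm_ζ H D θ) hm).holderFin H.hL H.h1)
    ((sE.inv fun m hm => (he.trans_le (hE D m hm)).ne').holderFin H.hL H.h1)
  have b6 := hB_nonneg α (Icc 0 L) (D.E fun _ => 1)⁻¹
  have b7 : hN α 0 L 0 ((dI 0 1 (D.W θ))⁻¹ ∘ (fun m => D.ζ (θ, m)) * (D.E fun _ => 1)⁻¹) ≤
      Λ * A * (1 / e + 1 / e ^ 2 * B) := b5.trans (by gcongr)
  linarith

end LevelData

namespace LevelData

variable {ρ : ℝ × ℝ → ℝ} {T L α c M : ℝ}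
  {κ : ℝ} (H : LevelHyp ρ κ T L α c)
include H

lemma le_y (D : LevelData ρ T L α c M) (n : ℕ) : c ≤ D.y (n + 1) := by
  have h : (0 : ℝ) ∈ Icc 0 T := ⟨le_rfl, H.hT.le⟩
  refine (D.le 0 h 0 ⟨le_rfl, zero_le_one⟩).trans ((le_abs_self _).trans
    (((((D.sm 0 h).deriv one_pos).holderFin one_pos H.h1).abs_le ⟨le_rfl, zero_le_one⟩).trans
      ((hN_deriv_le _ _ _ 0 _).trans ((D.bound 1 0 h).trans (D.mono (by omega))))))

lemma y_nonneg (D : LevelData ρ T L α c M) (n : ℕ) : 0 ≤ D.y n :=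
  (hN_nonneg _ _ _ _ _).trans (D.bound n 0 ⟨le_rfl, H.hT.le⟩)

/-- The Hölder norms of the integrals over the level sets, given those of the parametrizations. -/
lemma exists_hN_E_le_of (n : ℕ) (hn : ∃ C : ℝ, 1 ≤ C ∧ ∀ (D : LevelData ρ T L α c M),
    ∀ θ ∈ Icc 0 T, hN α 0 L n (fun m => D.ζ (θ, m)) ≤ C * (D.y n + 1)) :
    ∃ C : ℝ, 1 ≤ C ∧ ∀ (D : LevelData ρ T L α c M) (h : ℝ × ℝ → ℝ) (a b : ℝ),
      C∞ h → (∀ θ ∈ Icc 0 T, hN α 0 1 n (fun s => h (θ, s)) ≤ a) →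
      (∀ θ ∈ Icc 0 T, hN α 0 1 1 (fun s => h (θ, s)) ≤ b) →
      hN α 0 L n (D.E h) ≤ C * (a + D.y (n + 1) * b) := by
  obtain ⟨Z, hZ1, hZ⟩ := hn
  obtain ⟨K, hK1, hK⟩ := exists_ζ_one_le (M := M) H
  obtain ⟨B, hB1, hB⟩ := exists_hN_weight_le (M := M) H n
  obtain ⟨B₁, hB₁1, hB₁⟩ := exists_hN_weight_le (M := M) H 1
  obtain ⟨C, hC1, hC⟩ := exists_hN_comp (lt_min one_pos H.hL) hK1 n
  have hT := H.hT
  have hc := H.hc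
  set N := 2 * T * (n + 1) * (C * (B + B₁ * (2 + |M|) * Z)) * (1 + 1 / c)
  refine ⟨1 + N, by have : 0 ≤ N := by positivity
                    linarith, fun D h a b hh ha hb => ?_⟩
  have hy := le_y H D n
  have hyn := y_nonneg H D n
  have hyn1 := y_nonneg H D (n + 1)
  have h0T : (0 : ℝ) ∈ Icc 0 T := ⟨le_rfl, H.hT.le⟩
  have ha0 : 0 ≤ a := (hN_nonneg _ _ _ _ _).trans (ha 0 h0T)
  have hb0 : 0 ≤ b := (hN_nonneg _ _ _ _ _).trans (hb 0 h0T)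
  have key : ∀ θ ∈ Icc 0 T, hN α 0 L n (fun m => ρ (θ, D.ζ (θ, m)) * h (θ, D.ζ (θ, m)) /
      D.v (θ, D.ζ (θ, m))) ≤ C * (B + B₁ * (2 + |M|) * Z) * (a + (D.y (n + 1) + 1) * b) := by
    intro θ hθ
    have hf : Sm 0 1 fun s => h (θ, s) :=
      (hh.comp (by fun_prop : C∞ fun s : ℝ => (θ, s))).sm 0 1
    obtain ⟨g1, g2⟩ := hB D θ hθ _ hf
    obtain ⟨-, g3⟩ := hB₁ D θ hθ _ hf
    have g4 := (hN_mono α 0 1 (fun s => h (θ, s)) (Nat.zero_le 1)).trans (hb θ hθ)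
    simp only at g4
    have g5 := ha θ hθ
    have g6 := hb θ hθ
    have g7 := hZ D θ hθ
    have g8 : D.y (1 + 1) ≤ |M| := D.bound_two.trans (le_abs_self M)
    have g9 := y_nonneg H D (1 + 1)
    have g10 := hN_nonneg α 0 L n fun m => D.ζ (θ, m)
    have g11 : D.y n ≤ D.y (n + 1) := D.mono (Nat.le_succ n)
    have g12 := hN_nonneg α 0 1 0 fun s => h (θ, s)
    rw [hN_congr n (integrand_eq H D hθ h)]
    refine (hC H.h0 H.h1 ((min_le_left _ _).trans (by norm_num)) ((min_le_right _ _).trans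
      (by linarith)) g1 (sm_ζ H D θ) (fun m hm => D.maps θ hθ m hm)
      (hK D θ hθ).1).trans ?_
    rw [mul_assoc]
    gcongr
    calc _ ≤ B * (a + (D.y (n + 1) + 1) * b) +
          B₁ * (b + (|M| + 1) * b) * (Z * (D.y (n + 1) + 1)) := by
          refine add_le_add (g2.trans (by gcongr)) ?_
          have e1 := g3.trans (by gcongr : _ ≤ B₁ * (b + (|M| + 1) * b))
          have e2 := g7.trans (by gcongr : _ ≤ Z * (D.y (n + 1) + 1))
          exact mul_le_mul e1 e2 g10 (by positivity)
      _ ≤ _ := by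
          have : 0 ≤ B₁ * (2 + |M|) * Z * a := by positivity
          linear_combination this
  refine (hN_integral_le (α := α) H.hT.le H.hL H.h1 n (D.contDiff_integrand H.hρ hh) key).trans ?_
  have e : D.y (n + 1) + 1 ≤ (1 + 1 / c) * D.y (n + 1) := by
    have : 1 ≤ 1 / c * D.y (n + 1) := by rw [one_div, inv_mul_eq_div]; exact (one_le_div H.hc).2 hy
    linarith
  have e2 : a ≤ (1 + 1 / c) * a := le_mul_of_one_le_left ha0 (by
    have := one_div_pos.2 H.hc
    linarith)
  calc _ ≤ 2 * T * (n + 1) * (C * (B + B₁ * (2 + |M|) * Z) *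
        ((1 + 1 / c) * a + ((1 + 1 / c) * D.y (n + 1)) * b)) := by gcongr
    _ = N * (a + D.y (n + 1) * b) := by simp only [N]; ring
    _ ≤ _ := by gcongr; linarith

lemma exists_hN_inv_E_le_of (n : ℕ) (hn : ∃ C : ℝ, 1 ≤ C ∧ ∀ (D : LevelData ρ T L α c M),
    ∀ θ ∈ Icc 0 T, hN α 0 L n (fun m => D.ζ (θ, m)) ≤ C * (D.y n + 1)) :
    ∃ C : ℝ, 1 ≤ C ∧ ∀ D : LevelData ρ T L α c M, Sm 0 L (D.E fun _ => 1)⁻¹ ∧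
      hN α 0 L n (D.E fun _ => 1)⁻¹ ≤ C * D.y (n + 1) := by
  obtain ⟨e, he, hE⟩ := exists_le_E_one (M := M) H
  obtain ⟨C, hC1, hC⟩ := exists_hN_E_le_of H n hn
  obtain ⟨K, hK1, hK⟩ := exists_ζ_one_le (M := M) H
  obtain ⟨C', hC'1, hC'⟩ := exists_hN_E_le_of (M := M) H 1 ⟨K, hK1,
    fun D θ hθ => (hK D θ hθ).1.trans (le_mul_of_one_le_right (by linarith) (by
      linarith [y_nonneg H D 1]))⟩
  obtain ⟨I, hI1, hI⟩ := exists_hN_inv H.h0 H.h1 H.hL he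
    (C' * (hN α 0 1 1 (fun _ => (1 : ℝ)) + M * hN α 0 1 1 fun _ => (1 : ℝ))) n
  set w : ℝ := hN α 0 1 n fun _ => (1 : ℝ)
  have hw : 0 ≤ w := hN_nonneg _ _ _ _ _
  set w' : ℝ := hN α 0 1 1 fun _ => (1 : ℝ)
  have hw' : 0 ≤ w' := hN_nonneg _ _ _ _ _
  have hd := one_div_pos.2 H.hc
  refine ⟨1 + I * (C * (w * (1 / c) + w') + 1 / c), by
    have : 0 ≤ I * (C * (w * (1 / c) + w') + 1 / c) := by positivity
    linarith, fun D => ?_⟩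
  have sE : Sm 0 L (D.E fun _ => 1) := (D.contDiff_E H.hρ contDiff_const).sm 0 L
  refine ⟨sE.inv fun m hm => (he.trans_le (hE D m hm)).ne', ?_⟩
  have hy := le_y H D n
  have e1 : 1 ≤ 1 / c * D.y (n + 1) := by
    rw [one_div, inv_mul_eq_div]; exact (one_le_div H.hc).2 hy
  have hy0 : 0 ≤ D.y (n + 1) := H.hc.le.trans hy
  calc _ ≤ I * (hN α 0 L n (D.E fun _ => 1) + 1) := hI (by linarith) sE (hE D)
        ((hC' D _ w' w' contDiff_const (fun θ _ => le_rfl) fun θ _ => le_rfl).trans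
          (by gcongr; exact D.bound_two))
    _ ≤ I * (C * (w + D.y (n + 1) * w') + 1) := by
        gcongr
        exact hC D _ w w' contDiff_const (fun θ _ => le_rfl) fun θ _ => le_rfl
    _ ≤ I * (C * (w * (1 / c * D.y (n + 1)) + D.y (n + 1) * w') + 1 / c * D.y (n + 1)) := by
        gcongr
        exact le_mul_of_one_le_right hw e1
    _ = I * (C * (w * (1 / c) + w') + 1 / c) * D.y (n + 1) := by ring
    _ ≤ _ := by gcongr; linarith

/-- The Hölder norms of the parametrizations of the level sets. -/
lemma exists_hN_ζ_le (n : ℕ) : ∃ C : ℝ, 1 ≤ C ∧ ∀ (D : LevelData ρ T L α c M),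
    ∀ θ ∈ Icc 0 T, hN α 0 L n (fun m => D.ζ (θ, m)) ≤ C * (D.y n + 1) := by
  obtain ⟨K, hK1, hK⟩ := exists_ζ_one_le (M := M) H
  have hK' : ∀ D : LevelData ρ T L α c M, ∀ n, K ≤ K * (D.y n + 1) := fun D n =>
    le_mul_of_one_le_right (by linarith) (by
      linarith [y_nonneg H D n])
  induction n with
  | zero => exact ⟨K, hK1, fun D θ hθ => (hN_mono α 0 L _ (Nat.zero_le 1)).trans
      ((hK D θ hθ).1.trans (hK' D 0))⟩
  | succ n ih =>
    obtain ⟨B, hB1, hB⟩ := exists_hN_inv_E_le_of H n ih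
    obtain ⟨B₀, hB₀1, hB₀⟩ := exists_hN_inv_E_le_of H 0
      ⟨K, hK1, fun D θ hθ => (hN_mono α 0 L _ (Nat.zero_le 1)).trans
        ((hK D θ hθ).1.trans (hK' D 0))⟩
    obtain ⟨Z, hZ1, hZ⟩ := ih
    obtain ⟨P, hP1, hP⟩ := exists_hN_inv_le (M := M) H n
    obtain ⟨P₁, hP₁1, hP₁⟩ := exists_hN_inv_le (M := M) H 1
    obtain ⟨C, hC1, hC⟩ := exists_hN_comp (lt_min one_pos H.hL) hK1 n
    obtain ⟨N, hN1, hmul⟩ := exists_hN_mul H.hL n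
    set A := C * (P + P₁ * (|M| + 1) * Z)
    set A₀ := K * (P₁ * (|M| + 1))
    refine ⟨K + N * (A * (B₀ * |M|) + A₀ * B), by
      have : 0 ≤ N * (A * (B₀ * |M|) + A₀ * B) := by positivity
      linarith, fun D θ hθ => ?_⟩
    have hy1 := y_nonneg H D (n + 1)
    have hy0 := y_nonneg H D n
    have hψ := sm_inv H D hθ
    have hm : MapsTo (fun m => D.ζ (θ, m)) (Icc 0 L) (Icc 0 1) := fun m hm => D.maps θ hθ m hm
    have sζ := sm_ζ H D θ
    obtain ⟨sI, hI⟩ := hB D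
    have e0 : hN α 0 1 1 (dI 0 1 (D.W θ))⁻¹ ≤ P₁ * (|M| + 1) := (hP₁ D θ hθ).trans (by
      have : D.y (1 + 1) ≤ |M| := D.bound_two.trans (le_abs_self M)
      gcongr)
    have e1 : hN α 0 L n ((dI 0 1 (D.W θ))⁻¹ ∘ fun m => D.ζ (θ, m)) ≤
        A * (D.y (n + 1) + 1) := by
      refine (hC H.h0 H.h1 ((min_le_left _ _).trans (by norm_num)) ((min_le_right _ _).trans
        (by linarith)) hψ sζ hm (hK D θ hθ).1).trans ?_
      have g := hN_nonneg α 0 L n fun m => D.ζ (θ, m)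
      have g1 : D.y n ≤ D.y (n + 1) := D.mono (Nat.le_succ n)
      calc _ ≤ C * (P * (D.y (n + 1) + 1) + P₁ * (|M| + 1) * (Z * (D.y (n + 1) + 1))) := by
            gcongr
            · exact hP D θ hθ
            · exact (hZ D θ hθ).trans (by gcongr)
        _ = _ := by simp only [A]; ring
    have e2 : hN α 0 L 0 ((dI 0 1 (D.W θ))⁻¹ ∘ fun m => D.ζ (θ, m)) ≤ A₀ := by
      refine (hN_zero_comp_le H.h0 H.h1 one_pos H.hL hψ sζ hm hK1 (hK D θ hθ).1).trans ?_
      have := (hN_mono α 0 1 (dI 0 1 (D.W θ))⁻¹ (Nat.zero_le 1)).trans e0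
      simp only [A₀]
      gcongr
    have e3 : hN α 0 L 0 (D.E fun _ => 1)⁻¹ ≤ B₀ * |M| := (hB₀ D).2.trans (by
      have : D.y (0 + 1) ≤ |M| := (D.mono one_le_two).trans (D.bound_two.trans (le_abs_self M))
      gcongr)
    rw [hN_succ, hN_congr n (dI_ζ H D hθ), add_mul]
    refine add_le_add (((hB_le_hN _ _ _ 1 _).trans (hK D θ hθ).1).trans (hK' D _)) ?_
    refine (hmul H.h0 H.h1 (by linarith) (hψ.comp sζ hm) sI).trans ?_
    have n1 := hN_nonneg α 0 L 0 (D.E fun _ => 1)⁻¹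
    have n2 := hN_nonneg α 0 L n (D.E fun _ => 1)⁻¹
    calc _ ≤ N * (A * (D.y (n + 1) + 1) * (B₀ * |M|) + A₀ * (B * (D.y (n + 1) + 1))) := by
          gcongr
          exact hI.trans (by gcongr; linarith)
      _ = _ := by ring

/-- The Hölder norms of the integrals over the level sets. -/
lemma exists_hN_E_le (n : ℕ) : ∃ C : ℝ, 1 ≤ C ∧ ∀ (D : LevelData ρ T L α c M) (h : ℝ × ℝ → ℝ)
    (a b : ℝ), C∞ h → (∀ θ ∈ Icc 0 T, hN α 0 1 n (fun s => h (θ, s)) ≤ a) →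
      (∀ θ ∈ Icc 0 T, hN α 0 1 1 (fun s => h (θ, s)) ≤ b) →
      hN α 0 L n (D.E h) ≤ C * (a + D.y (n + 1) * b) :=
  exists_hN_E_le_of H n (exists_hN_ζ_le H n)

lemma exists_hN_E_zero_le : ∃ C : ℝ, 1 ≤ C ∧ ∀ (D : LevelData ρ T L α c M) (h : ℝ × ℝ → ℝ)
    (b : ℝ), C∞ h → (∀ θ ∈ Icc 0 T, hN α 0 1 1 (fun s => h (θ, s)) ≤ b) →
      hN α 0 L 0 (D.E h) ≤ C * b := by
  obtain ⟨C, hC1, hC⟩ := exists_hN_E_le (M := M) H 0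
  refine ⟨C * (1 + |M|), by nlinarith [abs_nonneg M], fun D h b hh hb => ?_⟩
  have hb0 : 0 ≤ b := (hN_nonneg _ _ _ _ _).trans (hb 0 ⟨le_rfl, H.hT.le⟩)
  refine (hC D h b b hh (fun θ hθ => (hN_mono α 0 1 _ (Nat.zero_le 1)).trans (hb θ hθ)) hb).trans ?_
  have : D.y (0 + 1) ≤ |M| := (D.mono one_le_two).trans (D.bound_two.trans (le_abs_self M))
  rw [mul_assoc, add_mul, one_mul]
  gcongr

/-- The Hölder norms of the averages over the level sets. -/
lemma exists_hN_avg_le (n : ℕ) : ∃ C : ℝ, 1 ≤ C ∧ ∀ (D : LevelData ρ T L α c M) (h : ℝ × ℝ → ℝ)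
    (a b : ℝ), C∞ h → (∀ θ ∈ Icc 0 T, hN α 0 1 n (fun s => h (θ, s)) ≤ a) →
      (∀ θ ∈ Icc 0 T, hN α 0 1 1 (fun s => h (θ, s)) ≤ b) →
      Sm 0 L (D.E h * (D.E fun _ => 1)⁻¹) ∧
      hN α 0 L n (D.E h * (D.E fun _ => 1)⁻¹) ≤ C * (a + D.y (n + 1) * b) ∧
      hN α 0 L 0 (D.E h * (D.E fun _ => 1)⁻¹) ≤ C * b := by
  obtain ⟨C, hC1, hC⟩ := exists_hN_E_le (M := M) H n
  obtain ⟨C₀, hC₀1, hC₀⟩ := exists_hN_E_zero_le (M := M) H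
  obtain ⟨B, hB1, hB⟩ := exists_hN_inv_E_le_of H n
    (exists_hN_ζ_le H n)
  obtain ⟨B₀, hB₀1, hB₀⟩ := exists_hN_inv_E_le_of H 0
    (exists_hN_ζ_le H 0)
  obtain ⟨N, hN1, hmul⟩ := exists_hN_mul H.hL n
  obtain ⟨N₀, hN₀1, hN₀⟩ := exists_hN_mul H.hL 0
  set R := N * (C * (B₀ * |M|) + C₀ * B)
  set R₀ := N₀ * (C₀ * (B₀ * |M|) + C₀ * (B₀ * |M|))
  have hR : 0 ≤ R := by positivity
  have hR₀ : 0 ≤ R₀ := by positivity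
  refine ⟨1 + R + R₀, by linarith, fun D h a b hh ha hb => ?_⟩
  have h0T : (0 : ℝ) ∈ Icc 0 T := ⟨le_rfl, H.hT.le⟩
  have ha0 : 0 ≤ a := (hN_nonneg _ _ _ _ _).trans (ha 0 h0T)
  have hb0 : 0 ≤ b := (hN_nonneg _ _ _ _ _).trans (hb 0 h0T)
  have hy := y_nonneg H D (n + 1)
  have sE : Sm 0 L (D.E h) := (D.contDiff_E H.hρ hh).sm 0 L
  obtain ⟨sI, hI⟩ := hB D
  have e3 : hN α 0 L 0 (D.E fun _ => 1)⁻¹ ≤ B₀ * |M| := (hB₀ D).2.trans (by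
    have : D.y (0 + 1) ≤ |M| := (D.mono one_le_two).trans (D.bound_two.trans (le_abs_self M))
    gcongr)
  have e4 := hC D h a b hh ha hb
  have e5 := hC₀ D h b hh hb
  have n1 := hN_nonneg α 0 L 0 (D.E fun _ => 1)⁻¹
  have n2 := hN_nonneg α 0 L n (D.E fun _ => 1)⁻¹
  refine ⟨sE.mul sI, (hmul H.h0 H.h1 (by linarith) sE sI).trans ?_,
    (hN₀ H.h0 H.h1 (by linarith) sE sI).trans ?_⟩
  · calc _ ≤ N * (C * (a + D.y (n + 1) * b) * (B₀ * |M|) + C₀ * b * (B * D.y (n + 1))) := by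
          gcongr
      _ ≤ R * (a + D.y (n + 1) * b) := by
          have : 0 ≤ N * (C₀ * B) * a := by positivity
          simp only [R]
          linear_combination this
      _ ≤ _ := by gcongr; linarith
  · calc _ ≤ N₀ * (C₀ * b * (B₀ * |M|) + C₀ * b * (B₀ * |M|)) := by gcongr
      _ = R₀ * b := by simp only [R₀]; ring
      _ ≤ _ := by gcongr; linarith

lemma exists_hN_Q_le (n : ℕ) : ∃ C : ℝ, 1 ≤ C ∧ ∀ D : LevelData ρ T L α c M, ∀ θ ∈ Icc 0 T,
    hN α 0 L n (fun m => D.W θ (D.ζ (θ, m))) ≤ C * (D.y n + 1) := by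
  obtain ⟨K, hK1, hK⟩ := exists_ζ_one_le (M := M) H
  obtain ⟨C, hC1, hC⟩ := exists_hN_comp (lt_min one_pos H.hL) hK1 n
  obtain ⟨Z, hZ1, hZ⟩ := exists_hN_ζ_le (M := M) H n
  refine ⟨C * (1 + |M| * Z), by nlinarith [mul_nonneg (abs_nonneg M) (zero_le_one.trans hZ1)],
    fun D θ hθ => ?_⟩
  have e1 : hN α 0 1 1 (D.W θ) ≤ |M| := (D.bound 1 θ hθ).trans
    ((D.mono one_le_two).trans (D.bound_two.trans (le_abs_self M)))
  have e2 := D.bound n θ hθ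
  have e3 := hN_nonneg α 0 L n fun m => D.ζ (θ, m)
  refine (hC H.h0 H.h1 ((min_le_left _ _).trans (by norm_num)) ((min_le_right _ _).trans
    (by linarith)) (D.sm θ hθ) (sm_ζ H D θ)
    (fun m hm => D.maps θ hθ m hm) (hK D θ hθ).1).trans ?_
  rw [mul_assoc]
  gcongr
  calc _ ≤ D.y n + |M| * (Z * (D.y n + 1)) := by
        gcongr
        exact hZ D θ hθ
    _ ≤ _ := by linarith

/-- The Hölder norms of the second derivative of the inverse distribution function. -/
lemma exists_hN_second_le (n : ℕ) : ∃ C : ℝ, 1 ≤ C ∧ ∀ (D : LevelData ρ T L α c M)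
    (f g : ℝ × ℝ → ℝ) (a b a' b' : ℝ), C∞ f → C∞ g →
      (∀ θ ∈ Icc 0 T, hN α 0 1 (n + 1) (fun s => f (θ, s)) ≤ a) →
      (∀ θ ∈ Icc 0 T, hN α 0 1 1 (fun s => f (θ, s)) ≤ b) →
      (∀ θ ∈ Icc 0 T, hN α 0 1 (n + 1) (fun s => g (θ, s)) ≤ a') →
      (∀ θ ∈ Icc 0 T, hN α 0 1 1 (fun s => g (θ, s)) ≤ b') →
      hN α 0 L n (dI 0 L (D.E f * (D.E g * (D.E fun _ => 1)⁻¹) - D.E fun z => f z * g z)) ≤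
        C * (a * b' + b * a' + D.y (n + 2) * b * b') := by
  obtain ⟨C, hC1, hC⟩ := exists_hN_E_le (M := M) H (n + 1)
  obtain ⟨C₀, hC₀1, hC₀⟩ := exists_hN_E_zero_le (M := M) H
  obtain ⟨B, hB1, hB⟩ := exists_hN_avg_le (M := M) H (n + 1)
  obtain ⟨N, hN1, hmul⟩ := exists_hN_mul H.hL (n + 1)
  obtain ⟨P, hP1, hP⟩ := exists_hN_mul (sub_pos.2 (zero_lt_one' ℝ)) (n + 1)
  obtain ⟨P₁, hP₁1, hP₁⟩ := exists_hN_mul (sub_pos.2 (zero_lt_one' ℝ)) 1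
  set R := 2 * (N * (B * (C + C₀))) + C * (P + 2 * P₁)
  have hR : 0 ≤ R := by positivity
  refine ⟨1 + R, by linarith, fun D f g a b a' b' hf hg ha hb ha' hb' => ?_⟩
  have h0T : (0 : ℝ) ∈ Icc 0 T := ⟨le_rfl, H.hT.le⟩
  have ha0 : 0 ≤ a := (hN_nonneg _ _ _ _ _).trans (ha 0 h0T)
  have hb0 : 0 ≤ b := (hN_nonneg _ _ _ _ _).trans (hb 0 h0T)
  have ha0' : 0 ≤ a' := (hN_nonneg _ _ _ _ _).trans (ha' 0 h0T)
  have hb0' : 0 ≤ b' := (hN_nonneg _ _ _ _ _).trans (hb' 0 h0T)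
  have hy : 0 ≤ D.y (n + 1 + 1) := y_nonneg H D (n + 1 + 1)
  have sE : ∀ {h}, C∞ h → Sm 0 L (D.E h) := fun hh => (D.contDiff_E H.hρ hh).sm 0 L
  have sm : ∀ {h : ℝ × ℝ → ℝ}, C∞ h → ∀ θ, Sm 0 1 fun s => h (θ, s) :=
    fun hh θ => (hh.comp (by fun_prop : C∞ fun s : ℝ => (θ, s))).sm 0 1
  obtain ⟨sA, hA, hA0⟩ := hB D g a' b' hg ha' hb'
  have e1 := hC D f a b hf ha hb
  have e2 := hC₀ D f b hf hb
  have n1 := hN_nonneg α 0 L (n + 1) (D.E g * (D.E fun _ => 1)⁻¹)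
  have n2 := hN_nonneg α 0 L 0 (D.E g * (D.E fun _ => 1)⁻¹)
  have e3 : hN α 0 L (n + 1) (D.E f * (D.E g * (D.E fun _ => 1)⁻¹)) ≤
      2 * (N * (B * (C + C₀))) * (a * b' + b * a' + D.y (n + 2) * b * b') := by
    refine (hmul H.h0 H.h1 (by linarith) (sE hf) sA).trans ?_
    calc _ ≤ N * (C * (a + D.y (n + 1 + 1) * b) * (B * b') +
          C₀ * b * (B * (a' + D.y (n + 1 + 1) * b'))) := by gcongr
      _ ≤ _ := by
          have q1 : 0 ≤ N * B * C * (a * b' + 2 * (b * a') + D.y (n + 2) * b * b') := by positivity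
          have q2 : 0 ≤ N * B * C₀ * (2 * (a * b') + b * a' + D.y (n + 2) * b * b') := by
            positivity
          linear_combination q1 + q2
  have z1 : ∀ h : ℝ × ℝ → ℝ, ∀ n θ, hN α 0 1 0 (fun s => h (θ, s)) ≤ hN α 0 1 n fun s => h (θ, s) :=
    fun h n θ => hN_mono α 0 1 _ (Nat.zero_le n)
  have e4 : hN α 0 L (n + 1) (D.E fun z => f z * g z) ≤
      C * (P + 2 * P₁) * (a * b' + b * a' + D.y (n + 2) * b * b') := by
    refine (hC D _ (P * (a * b' + b * a')) (P₁ * (b * b' + b * b')) (hf.mul hg)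
      (fun θ hθ => ?_) fun θ hθ => ?_).trans ?_
    · refine (hP H.h0 H.h1 le_rfl (sm hf θ) (sm hg θ)).trans ?_
      have m1 := hN_nonneg α 0 1 0 fun s => g (θ, s)
      have m2 := hN_nonneg α 0 1 (n + 1) fun s => g (θ, s)
      gcongr
      exacts [ha θ hθ, (z1 g 1 θ).trans (hb' θ hθ), (z1 f 1 θ).trans (hb θ hθ), ha' θ hθ]
    · refine (hP₁ H.h0 H.h1 le_rfl (sm hf θ) (sm hg θ)).trans ?_
      have m1 := hN_nonneg α 0 1 0 fun s => g (θ, s)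
      have m2 := hN_nonneg α 0 1 1 fun s => g (θ, s)
      gcongr
      exacts [hb θ hθ, (z1 g 1 θ).trans (hb' θ hθ), (z1 f 1 θ).trans (hb θ hθ), hb' θ hθ]
    · have q1 : 0 ≤ C * P * (D.y (n + 2) * b * b') := by positivity
      have q2 : 0 ≤ C * P₁ * (a * b' + b * a') := by positivity
      linear_combination q1 + 2 * q2
  have s1 := (sE hf).mul sA
  have s2 := (sE (hf.mul hg)).const_mul (-1)
  have e5 : (D.E f * (D.E g * (D.E fun _ => 1)⁻¹) - D.E fun z => f z * g z) =
      D.E f * (D.E g * (D.E fun _ => 1)⁻¹) + fun m => -1 * D.E (fun z => f z * g z) m := by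
    ext m
    simp only [Pi.sub_apply, Pi.add_apply]
    ring
  refine (hN_deriv_le _ _ _ _ _).trans ?_
  rw [e5]
  refine (hN_add_le H.hL H.h1 _ s1 s2).trans ?_
  rw [hN_const_mul H.hL _ (sE (hf.mul hg)), abs_neg, abs_one, one_mul]
  have : 0 ≤ a * b' + b * a' + D.y (n + 2) * b * b' := by positivity
  linear_combination e3 + e4 + this

end LevelData

/-! ### The maps defined by the inverse distribution function and the level integrals -/

open Classical in
/-- The inverse distribution function, as an element of the space of smooth functions. -/
def distInvMap (Ω : Set Plane) (ω : calF Ω) : CInf (Icc 0 (area Ω)) :=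
  if h : ∃ f : CInf (Icc 0 (area Ω)), ∀ m ∈ Icc 0 (area Ω), f m = distInv Ω ω.1 m
  then h.choose else 0

lemma distInvMap_apply {Ω : Set Plane} {ω : calF Ω} (h : ∃ f : CInf (Icc 0 (area Ω)),
    ∀ m ∈ Icc 0 (area Ω), f m = distInv Ω ω.1 m) {m : ℝ} (hm : m ∈ Icc 0 (area Ω)) :
    distInvMap Ω ω m = distInv Ω ω.1 m := by
  rw [distInvMap, dif_pos h]
  exact h.choose_spec m hm

open Classical in
/-- The integral of `u / |∇ω|` over the level sets of `ω`, as a function of the area. -/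
def levelMap (Ω : Set Plane) (z : calF Ω × CInf (closure Ω)) : CInf (Icc 0 (area Ω)) :=
  if h : ∃ f : CInf (Icc 0 (area Ω)), ∀ m ∈ Icc 0 (area Ω),
    f m = levelInt Ω z.1.1 (fun x => z.2 x / gradNorm Ω z.1.1 x) (distInv Ω z.1.1 m)
  then h.choose else 0

lemma levelMap_apply {Ω : Set Plane} {z : calF Ω × CInf (closure Ω)}
    (h : ∃ f : CInf (Icc 0 (area Ω)), ∀ m ∈ Icc 0 (area Ω),
      f m = levelInt Ω z.1.1 (fun x => z.2 x / gradNorm Ω z.1.1 x) (distInv Ω z.1.1 m))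
    {m : ℝ} (hm : m ∈ Icc 0 (area Ω)) :
    levelMap Ω z m = levelInt Ω z.1.1 (fun x => z.2 x / gradNorm Ω z.1.1 x)
      (distInv Ω z.1.1 m) := by
  rw [levelMap, dif_pos h]
  exact h.choose_spec m hm

/-- The constant function one. -/
def CInf.one {E : Type*} [NormedAddCommGroup E] [NormedSpace ℝ E] (K : Set E) : CInf K :=
  CInf.mk' K (fun _ => 1) contDiff_const

lemma CInf.one_apply {E : Type*} [NormedAddCommGroup E] [NormedSpace ℝ E] {K : Set E} {x : E}
    (hx : x ∈ K) : CInf.one K x = 1 := CInf.mk'_apply _ hx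

/-- The average of `ν` over the level sets of `ω`, weighted by `1 / |∇ω|`. -/
def avgMap (Ω : Set Plane) (z : calF Ω × CInf (closure Ω)) : CInf (Icc 0 (area Ω)) :=
  CInf.mul (levelMap Ω z) (CInf.inv (levelMap Ω (z.1, CInf.one _)))

lemma CInf.pderiv_one_apply {L : ℝ} [GoodBody (Icc 0 L)] (f : CInf (Icc 0 L))
    {m : ℝ} (hm : m ∈ Icc 0 L) : CInf.pderiv (1 : ℝ) f m = dI 0 L f m := by
  rw [CInf.pderiv_apply _ _ hm]
  rfl

namespace AnnChart

variable {Ω Γi Γo : Set Plane} {ω₀ : CInf (closure Ω)} {χ : AnnChart Ω Γi Γo ω₀}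

variable (χ) in
/-- The functions near `ω₀` that are uniformly increasing along the rays of the chart. -/
def nbhd [GoodBody (closure Ω)] (α : ℝ) : Set (calF Ω) :=
  {ω | χ.rays.gr α 2 (ω.1 - ω₀) < (χ.b - χ.a) / 2}

variable (χ) in
/-- A family of functions over the chart that represents `ω + t ν`. -/
structure LineData (d : χ.Density) (ω ν : calF Ω) where
  F : Plane → ℝ
  N : Plane → ℝ
  eqF : EqOn ω.1 F (closure Ω)
  eqN : EqOn ν.1 N (closure Ω)
  Φ : χ.Fam F N
  R : Φ.AreaInv d
  p : ℝ
  q : ℝ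
  p' : ℝ
  q' : ℝ
  good : ∀ᶠ t in 𝓝 (0 : ℝ), Φ.Good t (p + t * p') (q + t * q')
  eq_i : ∀ x ∈ Γi, ω.1 x = p
  eq_o : ∀ x ∈ Γo, ω.1 x = q

section Neighborhood

variable [GoodBody (closure Ω)] {α : ℝ}

lemma isOpen_nbhd (h1 : α ≤ 1) : IsOpen (χ.nbhd α) :=
  isOpen_lt (((CurveFam.isGr h1).cont 2).comp (continuous_subtype_val.sub continuous_const))
    continuous_const

lemma rays_gr_le (h1 : α ≤ 1) {ω : calF Ω} (hω : ω ∈ χ.nbhd α) :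
    χ.rays.gr α 2 ω.1 ≤ χ.rays.gr α 2 ω₀ + (χ.b - χ.a) / 2 := by
  have := CurveFam.gr_add_le (Γ := χ.rays) h1 2 (ω.1 - ω₀) ω₀
  rw [sub_add_cancel] at this
  linarith [show χ.rays.gr α 2 (ω.1 - ω₀) < (χ.b - χ.a) / 2 from hω]

lemma hN_comp_ray_le (h1 : α ≤ 1) (n : ℕ) (f : CInf (closure Ω)) {θ : ℝ}
    (hθ : θ ∈ Icc 0 (2 * Real.pi)) : hN α 0 1 n (f ∘ χ.ray θ) ≤ χ.rays.gr α n f :=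
  CurveFam.hN_le_gr (Γ := χ.rays) h1 n f ⟨θ, hθ⟩

lemma dI_ray_mem (h1 : α ≤ 1) {ω : calF Ω} (hω : ω ∈ χ.nbhd α) {θ : ℝ}
    (hθ : θ ∈ Icc 0 (2 * Real.pi)) {s : ℝ} (hs : s ∈ Icc (0 : ℝ) 1) :
    dI 0 1 (ω.1 ∘ χ.ray θ) s ∈ Ioo ((χ.b - χ.a) / 2) (3 * (χ.b - χ.a) / 2) := by
  have s1 := χ.sm_ray (ω.1 - ω₀) θ
  have e0 : HasDerivWithinAt (ω₀ ∘ χ.ray θ) (χ.b - χ.a) (Icc 0 1) s := by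
    have : HasDerivWithinAt (fun s => χ.a + s * (χ.b - χ.a)) (χ.b - χ.a) (Icc 0 1) s := by
      simpa using (((hasDerivAt_id s).mul_const (χ.b - χ.a)).const_add χ.a).hasDerivWithinAt
    exact this.congr (fun s hs => χ.value s hs θ) (χ.value s hs θ)
  have e1 := dI_eq one_pos hs ((s1.hasDeriv hs).add e0)
  have e2 : (ω.1 - ω₀ : CInf (closure Ω)) ∘ χ.ray θ + ω₀ ∘ χ.ray θ = ω.1 ∘ χ.ray θ := by
    ext s
    simp
  rw [e2] at e1
  have h2 := (((s1.deriv one_pos).holderFin one_pos h1).abs_le hs).trans ((hN_deriv_le _ _ _ 0 _).trans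
    ((hN_mono α 0 1 _ one_le_two).trans (hN_comp_ray_le h1 2 (ω.1 - ω₀) hθ)))
  have h3 := abs_lt.1 (h2.trans_lt hω)
  rw [e1]
  constructor <;> linarith [h3.1, h3.2]

lemma dI_ray_eq {ω : calF Ω} {F N : Plane → ℝ} (hF : C∞ F)
    (hN : C∞ N) (h : EqOn ω.1 F (closure Ω)) {θ s : ℝ} (hs : s ∈ Icc (0 : ℝ) 1) :
    dSnd (χ.line F N) ((0, θ), s) = dI 0 1 (ω.1 ∘ χ.ray θ) s := by
  refine (dI_eq one_pos hs ((hasDerivAt_dSnd (contDiff_line hF hN) (0, θ)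
    s).hasDerivWithinAt.congr (fun s hs => ?_) ?_)).symm
  all_goals
    simp only [Function.comp_apply, line, ray, zero_mul, add_zero]
    exact h (χ.maps _ hs θ)

lemma exists_lineData (hA : AnnularData Ω Γi Γo) (h1 : α ≤ 1) {ω : calF Ω} (hω : ω ∈ χ.nbhd α)
    (d : χ.Density) (ν : calF Ω) : Nonempty (χ.LineData d ω ν) := by
  obtain ⟨F, hF, eF⟩ := ω.1.exists_ext
  obtain ⟨N, hN, eN⟩ := ν.1.exists_ext
  obtain ⟨p, hp⟩ := hA.exists_eq_i ω
  obtain ⟨p', hp'⟩ := hA.exists_eq_i ν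
  obtain ⟨q, hq⟩ := hA.exists_eq_o ω
  obtain ⟨q', hq'⟩ := hA.exists_eq_o ν
  obtain ⟨Φ⟩ := exists_fam (χ := χ) hF hN (half_pos (sub_pos.2 χ.lt)) fun s hs θ hθ => by
    rw [dI_ray_eq hF hN eF hs]
    exact dI_ray_mem h1 hω hθ hs
  obtain ⟨R⟩ := Φ.exists_areaInv d
  refine ⟨⟨F, N, eF, eN, Φ, R, p, q, p', q', ?_, hp, hq⟩⟩
  filter_upwards [Φ.eq] with t ht
  refine ⟨ht, fun θ => ?_, fun θ => ?_⟩
  · simp only [line]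
    rw [← eF (χ.maps 0 ⟨le_rfl, zero_le_one⟩ θ), ← eN (χ.maps 0 ⟨le_rfl, zero_le_one⟩ θ),
      hp _ (χ.inner_mem θ), hp' _ (χ.inner_mem θ)]
  · simp only [line]
    rw [← eF (χ.maps 1 ⟨zero_le_one, le_rfl⟩ θ), ← eN (χ.maps 1 ⟨zero_le_one, le_rfl⟩ θ),
      hq _ (χ.outer_mem θ), hq' _ (χ.outer_mem θ)]

end Neighborhood

namespace Fam

variable {F N : Plane → ℝ} (Φ : χ.Fam F N) (d : χ.Density)

lemma J_add_mul {U U' : Plane → ℝ} (hU : C∞ U) (hU' : C∞ U')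
    (c t l : ℝ) : Φ.J d (fun x => U x + c * U' x) (t, l) = Φ.J d U (t, l) + c * Φ.J d U' (t, l) := by
  have hσ : Continuous fun θ => Φ.σ ((t, θ), l) := Φ.smoothσ.continuous.comp (by fun_prop)
  have hc : ∀ {U : Plane → ℝ}, C∞ U → Continuous fun θ =>
      d.ρ (θ, Φ.σ ((t, θ), l)) * U (χ.g (Φ.σ ((t, θ), l), θ)) /
        Φ.V' ((t, θ), Φ.σ ((t, θ), l)) := fun hU =>
    ((d.smooth.continuous.comp (by fun_prop)).mul (hU.continuous.comp
      (χ.smooth.continuous.comp (by fun_prop)))).div (Φ.smooth'.continuous.comp (by fun_prop))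
      fun θ => (Φ.pos.trans_le (Φ.le _)).ne'
  rw [Φ.J_eq d (hU.add (contDiff_const.mul hU')), Φ.J_eq d hU, Φ.J_eq d hU',
    ← intervalIntegral.integral_const_mul, ← intervalIntegral.integral_add
      ((hc hU).intervalIntegrable _ _) (((hc hU').const_mul c).intervalIntegrable _ _)]
  refine intervalIntegral.integral_congr fun θ _ => ?_
  ring

end Fam

namespace LineData

variable {d : χ.Density} {ω ν : calF Ω} (S : χ.LineData d ω ν) (hA : AnnularData Ω Γi Γo)

lemma good_zero : S.Φ.Good 0 S.p S.q := by
  simpa using S.good.self_of_nhds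

lemma eqOn_line (t : ℝ) : EqOn (ω + t • ν).1 (fun x => S.F x + t * S.N x) (closure Ω) :=
  fun x hx => by
    show ω.1 x + t * ν.1 x = _
    rw [S.eqF hx, S.eqN hx]

lemma eqOn_zero : EqOn ω.1 (fun x => S.F x + 0 * S.N x) (closure Ω) := by
  simpa using S.eqOn_line 0

include S hA

lemma area_pos : 0 < area Ω := S.good_zero.area_pos S.eqOn_zero hA

lemma eventually_distInv : ∀ᶠ t in 𝓝 (0 : ℝ), ∀ m ∈ Icc 0 (area Ω),
    distInv Ω (ω + t • ν).1 m = S.R.Q (t, m) ∧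
    distInvMap Ω (ω + t • ν) m = distInv Ω (ω + t • ν).1 m := by
  filter_upwards [S.good] with t ht m hm
  have h : ∀ m ∈ Icc 0 (area Ω), distInv Ω (ω + t • ν).1 m = S.R.Q (t, m) := fun m hm =>
    ht.distInv_eq S.R (S.eqOn_line t) hA hm
  refine ⟨h m hm, distInvMap_apply ⟨CInf.mk' _ (fun m => S.R.Q (t, m)) (S.R.smooth.comp
    (contDiff_const.prodMk contDiff_id)), fun m hm => ?_⟩ hm⟩
  rw [CInf.mk'_apply _ hm, h m hm]

lemma distInv_eq {m : ℝ} (hm : m ∈ Icc 0 (area Ω)) :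
    distInv Ω ω.1 m = S.R.Q (0, m) ∧ distInvMap Ω ω m = distInv Ω ω.1 m := by
  simpa using (S.eventually_distInv hA).self_of_nhds m hm

variable [GoodBody (closure Ω)]

lemma eventually_levelMap : ∀ᶠ t in 𝓝 (0 : ℝ), ∀ (u : CInf (closure Ω)) (U : Plane → ℝ),
    C∞ U → EqOn u U (closure Ω) → ∀ m ∈ Icc 0 (area Ω),
    levelInt Ω (ω + t • ν).1 (fun x => u x / gradNorm Ω (ω + t • ν).1 x)
      (distInv Ω (ω + t • ν).1 m) = S.Φ.E S.R U (t, m) ∧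
    levelMap Ω (ω + t • ν, u) m =
      levelInt Ω (ω + t • ν).1 (fun x => u x / gradNorm Ω (ω + t • ν).1 x)
      (distInv Ω (ω + t • ν).1 m) := by
  filter_upwards [S.good, S.eventually_distInv hA] with t ht htQ u U hU hu m hm
  have h : ∀ m ∈ Icc 0 (area Ω), levelInt Ω (ω + t • ν).1
      (fun x => u x / gradNorm Ω (ω + t • ν).1 x) (distInv Ω (ω + t • ν).1 m) =
      S.Φ.E S.R U (t, m) := fun m hm => by
    rw [(htQ m hm).1]
    exact ht.levelInt_eq (S.eqOn_line t) (ht.Q_mem S.R (S.eqOn_line t) hA hm) hU hu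
  refine ⟨h m hm, levelMap_apply (z := (ω + t • ν, u)) ⟨CInf.mk' _ (fun m => S.Φ.E S.R U (t, m))
    ((S.Φ.contDiff_E S.R hU).comp (contDiff_const.prodMk contDiff_id)), fun m hm => ?_⟩ hm⟩
  rw [CInf.mk'_apply _ hm, h m hm]

lemma levelMap_eq {u : CInf (closure Ω)} {U : Plane → ℝ} (hU : C∞ U)
    (hu : EqOn u U (closure Ω)) {m : ℝ} (hm : m ∈ Icc 0 (area Ω)) :
    levelMap Ω (ω, u) m = S.Φ.E S.R U (0, m) := by
  have := (S.eventually_levelMap hA).self_of_nhds u U hU hu m hm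
  rw [← this.1, ← this.2, zero_smul, add_zero]

lemma levelMap_eq_levelInt (u : CInf (closure Ω)) {m : ℝ} (hm : m ∈ Icc 0 (area Ω)) :
    levelMap Ω (ω, u) m =
      levelInt Ω ω.1 (fun x => u x / gradNorm Ω ω.1 x) (distInv Ω ω.1 m) := by
  obtain ⟨U, hU, hu⟩ := u.exists_ext
  have := ((S.eventually_levelMap hA).self_of_nhds u U hU hu m hm).2
  simpa only [zero_smul, add_zero] using this

lemma levelMap_one_eq {m : ℝ} (hm : m ∈ Icc 0 (area Ω)) :
    levelMap Ω (ω, CInf.one _) m = S.Φ.E S.R (fun _ => 1) (0, m) :=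
  S.levelMap_eq hA contDiff_const (fun _ hx => CInf.one_apply hx) hm

lemma levelMap_one_mem_Pos : levelMap Ω (ω, CInf.one _) ∈ CInf.Pos (Icc 0 (area Ω)) := by
  have hK : 0 < S.Φ.K := S.Φ.pos.trans_le ((S.Φ.le 0).trans (S.Φ.ge 0))
  have hκ := d.pos
  refine ⟨2 * Real.pi * (d.κ / S.Φ.K), by positivity, fun m hm => ?_⟩
  rw [S.levelMap_one_eq hA hm]
  exact S.Φ.le_J_one d _

lemma avgMap_eq {u : CInf (closure Ω)} {U : Plane → ℝ} (hU : C∞ U)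
    (hu : EqOn u U (closure Ω)) {m : ℝ} (hm : m ∈ Icc 0 (area Ω)) :
    avgMap Ω (ω, u) m = S.Φ.E S.R U (0, m) / S.Φ.E S.R (fun _ => 1) (0, m) := by
  haveI := CInf.goodBody_Icc (S.area_pos hA)
  rw [avgMap, CInf.mul_apply, CInf.inv_apply (S.levelMap_one_mem_Pos hA) hm,
    S.levelMap_eq hA hU hu hm, S.levelMap_one_eq hA hm, div_eq_mul_inv]

lemma pderiv_levelMap_eq [GoodBody (Icc 0 (area Ω))] {u : CInf (closure Ω)} {U : Plane → ℝ}
    (hU : C∞ U) (hu : EqOn u U (closure Ω)) {m : ℝ} (hm : m ∈ Icc 0 (area Ω)) :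
    CInf.pderiv (1 : ℝ) (levelMap Ω (ω, u)) m = dSnd (S.Φ.E S.R U) (0, m) := by
  rw [CInf.pderiv_one_apply _ hm]
  exact dI_eq (S.area_pos hA) hm ((hasDerivAt_dSnd (S.Φ.contDiff_E S.R hU) 0
    m).hasDerivWithinAt.congr (fun m hm => S.levelMap_eq hA hU hu hm) (S.levelMap_eq hA hU hu hm))

lemma tendsto_distInvMap : Tendsto (fun t : ℝ => t⁻¹ • (distInvMap Ω (ω + t • ν) - distInvMap Ω ω))
    (𝓝[≠] 0) (𝓝 (avgMap Ω (ω, ν.1))) := by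
  have := CInf.tendsto_diffQuot (S.area_pos hA) S.R.smooth (f := fun t => distInvMap Ω (ω + t • ν))
    ((S.eventually_distInv hA).mono fun t ht m hm => (ht m hm).2.trans (ht m hm).1)
    (g := avgMap Ω (ω, ν.1)) fun m hm => by
      rw [S.avgMap_eq hA S.Φ.smoothN S.eqN (Ioo_subset_Icc_self hm)]
      exact S.Φ.hasDerivAt_Q_fst S.good_zero
        (S.good_zero.Q_mem S.R S.eqOn_zero hA (Ioo_subset_Icc_self hm))
  simpa only [zero_smul, add_zero] using this

/-- The directional derivative of the integral over the level sets. -/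
lemma tendsto_levelMap [GoodBody (Icc 0 (area Ω))] (u k : CInf (closure Ω)) :
    Tendsto (fun t : ℝ => t⁻¹ • (levelMap Ω (ω + t • ν, u + t • k) - levelMap Ω (ω, u)))
    (𝓝[≠] 0) (𝓝 (CInf.mul (levelMap Ω (ω, ν.1)) (CInf.pderiv (1 : ℝ) (levelMap Ω (ω, u))) -
      CInf.mul (levelMap Ω (ω, CInf.one _))
        (CInf.pderiv (1 : ℝ) (levelMap Ω (ω, CInf.mul u ν.1))) + levelMap Ω (ω, k))) := by
  obtain ⟨U, hU, hu⟩ := u.exists_ext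
  obtain ⟨W, hW, hk⟩ := k.exists_ext
  have hEU := S.Φ.contDiff_E S.R hU
  have hEW := S.Φ.contDiff_E S.R hW
  have hun : EqOn (CInf.mul u ν.1) (fun x => U x * S.N x) (closure Ω) := fun x hx => by
    rw [CInf.mul_apply, hu hx, S.eqN hx]
  have hLs := S.area_pos hA
  have := CInf.tendsto_diffQuot hLs (F := fun z => S.Φ.E S.R U z + z.1 * S.Φ.E S.R W z)
    (hEU.add (contDiff_fst.mul hEW)) (f := fun t => levelMap Ω (ω + t • ν, u + t • k))
    ((S.eventually_levelMap hA).mono fun t ht m hm => by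
      obtain ⟨e1, e2⟩ := ht (u + t • k) (fun x => U x + t * W x) (hU.add (contDiff_const.mul hW))
        (fun x hx => by
          show u x + t * k x = _
          rw [hu hx, hk hx]) m hm
      rw [e2, e1]
      exact S.Φ.J_add_mul d hU hW t t _)
    (g := CInf.mul (levelMap Ω (ω, ν.1)) (CInf.pderiv (1 : ℝ) (levelMap Ω (ω, u))) -
      CInf.mul (levelMap Ω (ω, CInf.one _))
        (CInf.pderiv (1 : ℝ) (levelMap Ω (ω, CInf.mul u ν.1))) + levelMap Ω (ω, k)) fun m hm => by
      have hm' := Ioo_subset_Icc_self hm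
      have hQ : S.R.Q (0, m) ∈ Ioo S.p S.q := by
        have a1 := S.good_zero.Q_zero S.R S.eqOn_zero hA
        have a2 := S.good_zero.Q_area S.R S.eqOn_zero hA
        have a3 := S.Φ.strictMono_Q S.R 0
        exact ⟨a1 ▸ a3 hm.1, a2 ▸ a3 hm.2⟩
      have b1 := S.Φ.hasDerivAt_E_fst S.R S.good_zero hU hQ
      have b2 : HasDerivAt (fun t : ℝ => t * S.Φ.E S.R W (t, m)) (S.Φ.E S.R W (0, m)) 0 := by
        have c1 : HasDerivAt (fun t => S.Φ.E S.R W (t, m)) (deriv (fun t => S.Φ.E S.R W (t, m)) 0)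
            0 := ((hEW.comp (by fun_prop : C∞ fun t : ℝ => (t, m))).differentiable
              (by simp) 0).hasDerivAt
        exact ((hasDerivAt_id (0 : ℝ)).mul c1).congr_deriv (by simp)
      refine (b1.add b2).congr_deriv ?_
      rw [CInf.add_apply, CInf.sub_apply, CInf.mul_apply, CInf.mul_apply,
        S.levelMap_eq hA S.Φ.smoothN S.eqN hm', S.levelMap_one_eq hA hm',
        S.levelMap_eq hA hW hk hm', S.pderiv_levelMap_eq hA hU hu hm',
        S.pderiv_levelMap_eq hA (hU.mul S.Φ.smoothN) hun hm']
  simpa only [zero_smul, add_zero] using this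

end LineData

end AnnChart

namespace AnnChart

variable {Ω Γi Γo : Set Plane} {ω₀ : CInf (closure Ω)} {χ : AnnChart Ω Γi Γo ω₀}
  [GoodBody (closure Ω)] {α : ℝ}

namespace LineData

variable {d : χ.Density} {ω ν : calF Ω} (S : χ.LineData d ω ν) (hA : AnnularData Ω Γi Γo)

include S

lemma gradientWithin_ne_zero {x : Plane} (hx : x ∈ closure Ω) :
    gradientWithin ω.1 (closure Ω) x ≠ 0 := by
  rw [CInf.gradientWithin_eq ω.1 S.Φ.smoothF S.eqF hx]
  intro h0
  obtain ⟨s, hs, θ, hθ, rfl⟩ := χ.surj x hx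
  have hθ' : θ ∈ Icc 0 (2 * Real.pi) := ⟨hθ.1, hθ.2.le⟩
  have h1 := S.Φ.pos.trans_le (S.Φ.le ((0, θ), s))
  rw [(S.good_zero.eq s hs θ hθ').2] at h1
  have h2 := hasDerivAt_dSnd (contDiff_line (χ := χ) S.Φ.smoothF S.Φ.smoothN) (0, θ) s
  have h3 : fderiv ℝ S.F (χ.g (s, θ)) = 0 := by
    rw [gradient] at h0
    simpa using h0
  have h4 : HasFDerivAt S.F (0 : Plane →L[ℝ] ℝ) (χ.ray θ s) := by
    rw [← h3]
    exact (S.Φ.smoothF.differentiable (by simp) _).hasFDerivAt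
  have h5 := h4.comp_hasDerivAt s (((χ.contDiff_ray θ).differentiable (by simp) s).hasDerivAt)
  have h6 : (fun s => χ.line S.F S.N ((0, θ), s)) = S.F ∘ χ.ray θ := by
    ext s
    simp [line, ray]
  rw [h6] at h2
  rw [h2.unique h5] at h1
  simp at h1

lemma mem_calFPlus : ω ∈ calFPlus Ω Γi Γo := by
  refine ⟨fun x hx => S.gradientWithin_ne_zero hx, fun x hx y hy => ?_⟩
  rw [S.eq_i x hx, S.eq_o y hy]
  exact S.good_zero.incr.lt

lemma levelInt_one_pos {l : ℝ} (hl : l ∈ ω.1 '' closure Ω) :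
    0 < levelInt Ω ω.1 (fun x => 1 / gradNorm Ω ω.1 x) l := by
  rw [S.good_zero.image_eq S.eqOn_zero] at hl
  rw [S.good_zero.levelInt_eq (d := d) S.eqOn_zero hl (f := fun _ => 1) (U := fun _ => 1)
    contDiff_const fun _ _ => rfl]
  exact S.Φ.J_one_pos d _

include hA in
lemma bijOn_distFun : BijOn (distFun Ω ω.1) (ω.1 '' closure Ω) (Icc 0 (area Ω)) :=
  S.good_zero.bijOn_distFun S.eqOn_zero hA

/-- The data for the Hölder estimates. -/
def levelData (h1 : α ≤ 1) (hω : ω ∈ χ.nbhd α) : LevelData d.ρ (2 * Real.pi) (area Ω) α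
    ((χ.b - χ.a) / 2) (χ.rays.gr α 2 ω₀ + (χ.b - χ.a) / 2) where
  W θ := ω.1 ∘ χ.ray θ
  ζ z := S.Φ.σ ((0, z.1), S.R.Q (0, z.2))
  v z := S.Φ.V' ((0, z.1), z.2)
  y n := χ.rays.gr α n ω.1
  sm θ _ := χ.sm_ray ω.1 θ
  le θ hθ s hs := (dI_ray_mem h1 hω hθ hs).1.le
  bound n θ hθ := hN_comp_ray_le h1 n ω.1 hθ
  mono := (CurveFam.isGr h1).mono ω.1
  bound_two := rays_gr_le h1 hω
  smoothζ := S.Φ.smoothσ.comp ((contDiff_const.prodMk contDiff_fst).prodMk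
    (S.R.smooth.comp (contDiff_const.prodMk contDiff_snd)))
  smoothv := S.Φ.smooth'.comp (by fun_prop)
  pos z := S.Φ.pos.trans_le (S.Φ.le _)
  eq θ hθ s hs := by
    rw [(S.good_zero.eq s hs θ hθ).2]
    exact dI_ray_eq S.Φ.smoothF S.Φ.smoothN S.eqF hs
  maps θ hθ m hm := S.good_zero.σ_mem hθ (S.good_zero.Q_mem S.R S.eqOn_zero hA hm)
  deriv θ hθ m hm := by
    have h := (S.Φ.hasDerivAt_σ (0, θ) (S.R.Q (0, m))).comp m (S.Φ.hasDerivAt_Q S.R 0 m)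
    rw [S.Φ.J_eq d contDiff_const, ← mul_inv] at h
    exact h

include hA

lemma E_eq (h1 : α ≤ 1) (hω : ω ∈ χ.nbhd α) {u : CInf (closure Ω)} {U : Plane → ℝ}
    (hU : C∞ U) (hu : EqOn u U (closure Ω)) :
    EqOn (levelMap Ω (ω, u)) ((S.levelData hA h1 hω).E fun z => U (χ.g (z.2, z.1)))
      (Icc 0 (area Ω)) := fun m hm => by
  rw [S.levelMap_eq hA hU hu hm]
  exact S.Φ.J_eq d hU 0 _

lemma E_one_eq (h1 : α ≤ 1) (hω : ω ∈ χ.nbhd α) :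
    EqOn (levelMap Ω (ω, CInf.one _)) ((S.levelData hA h1 hω).E fun _ => 1)
      (Icc 0 (area Ω)) :=
  S.E_eq hA h1 hω (U := fun _ => 1) contDiff_const fun _ hx => CInf.one_apply hx

lemma avg_eq (h1 : α ≤ 1) (hω : ω ∈ χ.nbhd α) {u : CInf (closure Ω)} {U : Plane → ℝ}
    (hU : C∞ U) (hu : EqOn u U (closure Ω)) :
    EqOn (avgMap Ω (ω, u)) (((S.levelData hA h1 hω).E fun z => U (χ.g (z.2, z.1))) *
      ((S.levelData hA h1 hω).E fun _ => 1)⁻¹) (Icc 0 (area Ω)) := fun m hm => by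
  haveI := CInf.goodBody_Icc (S.area_pos hA)
  rw [avgMap, CInf.mul_apply, CInf.inv_apply (S.levelMap_one_mem_Pos hA) hm,
    S.E_eq hA h1 hω hU hu hm, S.E_one_eq hA h1 hω hm]
  rfl

end LineData

lemma hN_chart_le (h1 : α ≤ 1) (n : ℕ) {u : CInf (closure Ω)} {U : Plane → ℝ}
    (hu : EqOn u U (closure Ω)) :
    ∀ θ ∈ Icc 0 (2 * Real.pi), hN α 0 1 n (fun s => U (χ.g (s, θ))) ≤ χ.rays.gr α n u :=
  fun θ hθ => by
    rw [hN_congr n fun s hs => (hu (χ.maps s hs θ)).symm]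
    exact hN_comp_ray_le h1 n u hθ

variable (hA : AnnularData Ω Γi Γo) (h0 : 0 ≤ α) (h1 : α ≤ 1) (hL : 0 < area Ω)

lemma contDiff_chart {U : Plane → ℝ} (hU : C∞ U) :
    C∞ fun z : ℝ × ℝ => U (χ.g (z.2, z.1)) :=
  hU.comp (χ.smooth.comp (contDiff_snd.prodMk contDiff_fst))

variable (χ) in
include h0 h1 hL in
lemma levelHyp (d : χ.Density) :
    LevelHyp d.ρ d.κ (2 * Real.pi) (area Ω) α ((χ.b - χ.a) / 2) :=
  ⟨d.smooth, d.pos, d.le, Real.two_pi_pos, hL, h0, h1, half_pos (sub_pos.2 χ.lt)⟩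

include hA h0 h1 hL

variable (χ)

lemma exists_hN_distInvMap_le (n : ℕ) : ∃ C : ℝ, 1 ≤ C ∧ ∀ ω ∈ χ.nbhd α,
    hN α 0 (area Ω) n (distInvMap Ω ω) ≤ C * (χ.rays.gr α n ω.1 + 1) := by
  obtain ⟨d⟩ := χ.exists_density
  obtain ⟨C, hC1, hC⟩ := LevelData.exists_hN_Q_le (M := χ.rays.gr α 2 ω₀ + (χ.b - χ.a) / 2) (χ.levelHyp h0 h1 hL d) n
  refine ⟨C, hC1, fun ω hω => ?_⟩
  obtain ⟨S⟩ := exists_lineData hA h1 hω d 0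
  refine le_of_eq_of_le (hN_congr n fun m hm => ?_)
    (hC (S.levelData hA h1 hω) 0 ⟨le_rfl, Real.two_pi_pos.le⟩)
  have h2 : (0 : ℝ) ∈ Icc 0 (2 * Real.pi) := ⟨le_rfl, Real.two_pi_pos.le⟩
  have h3 := S.good_zero.σ_mem h2 (S.good_zero.Q_mem S.R S.eqOn_zero hA hm)
  rw [(S.distInv_eq hA hm).2, (S.distInv_eq hA hm).1]
  refine (S.Φ.right_inv (0, 0) _).symm.trans ((S.good_zero.eq _ h3 0 h2).1.trans ?_)
  simp only [line, zero_mul, add_zero]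
  exact (S.eqF (χ.maps _ h3 0)).symm

lemma exists_hN_levelMap_le (n : ℕ) : ∃ C : ℝ, 1 ≤ C ∧ ∀ ω ∈ χ.nbhd α, ∀ u : CInf (closure Ω),
    hN α 0 (area Ω) n (levelMap Ω (ω, u)) ≤
      C * (χ.rays.gr α n u + χ.rays.gr α (n + 1) ω.1 * χ.rays.gr α 1 u) := by
  obtain ⟨d⟩ := χ.exists_density
  obtain ⟨C, hC1, hC⟩ := LevelData.exists_hN_E_le (M := χ.rays.gr α 2 ω₀ + (χ.b - χ.a) / 2) (χ.levelHyp h0 h1 hL d) n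
  refine ⟨C, hC1, fun ω hω u => ?_⟩
  obtain ⟨S⟩ := exists_lineData hA h1 hω d 0
  obtain ⟨U, hU, hu⟩ := u.exists_ext
  rw [hN_congr n (S.E_eq hA h1 hω hU hu)]
  exact hC (S.levelData hA h1 hω) _ _ _ (contDiff_chart hU) (hN_chart_le h1 n hu)
    (hN_chart_le h1 1 hu)

lemma exists_hN_avgMap_le (n : ℕ) : ∃ C : ℝ, 1 ≤ C ∧ ∀ ω ∈ χ.nbhd α, ∀ u : CInf (closure Ω),
    hN α 0 (area Ω) n (avgMap Ω (ω, u)) ≤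
      C * (χ.rays.gr α n u + χ.rays.gr α (n + 1) ω.1 * χ.rays.gr α 1 u) := by
  obtain ⟨d⟩ := χ.exists_density
  obtain ⟨C, hC1, hC⟩ := LevelData.exists_hN_avg_le (M := χ.rays.gr α 2 ω₀ + (χ.b - χ.a) / 2) (χ.levelHyp h0 h1 hL d) n
  refine ⟨C, hC1, fun ω hω u => ?_⟩
  obtain ⟨S⟩ := exists_lineData hA h1 hω d 0
  obtain ⟨U, hU, hu⟩ := u.exists_ext
  rw [hN_congr n (S.avg_eq hA h1 hω hU hu)]
  exact (hC (S.levelData hA h1 hω) _ _ _ (contDiff_chart hU) (hN_chart_le h1 n hu)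
    (hN_chart_le h1 1 hu)).2.1

lemma exists_hN_second_le (n : ℕ) [GoodBody (Icc 0 (area Ω))] : ∃ C : ℝ, 1 ≤ C ∧ ∀ ω ∈ χ.nbhd α,
    ∀ u w : CInf (closure Ω),
    hN α 0 (area Ω) n (CInf.pderiv (1 : ℝ) (CInf.mul (levelMap Ω (ω, u)) (avgMap Ω (ω, w)) -
      levelMap Ω (ω, CInf.mul u w))) ≤
      C * (χ.rays.gr α (n + 1) u * χ.rays.gr α 1 w + χ.rays.gr α 1 u * χ.rays.gr α (n + 1) w +
        χ.rays.gr α (n + 2) ω.1 * χ.rays.gr α 1 u * χ.rays.gr α 1 w) := by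
  obtain ⟨d⟩ := χ.exists_density
  obtain ⟨C, hC1, hC⟩ := LevelData.exists_hN_second_le (M := χ.rays.gr α 2 ω₀ + (χ.b - χ.a) / 2) (χ.levelHyp h0 h1 hL d) n
  refine ⟨C, hC1, fun ω hω u w => ?_⟩
  obtain ⟨S⟩ := exists_lineData hA h1 hω d 0
  obtain ⟨U, hU, hu⟩ := u.exists_ext
  obtain ⟨W, hW, hw⟩ := w.exists_ext
  have huw : EqOn (CInf.mul u w) (fun x => U x * W x) (closure Ω) := fun x hx => by
    rw [CInf.mul_apply, hu hx, hw hx]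
  have e : EqOn (CInf.mul (levelMap Ω (ω, u)) (avgMap Ω (ω, w)) - levelMap Ω (ω, CInf.mul u w) :
      CInf _) ((S.levelData hA h1 hω).E (fun z => U (χ.g (z.2, z.1))) *
      ((S.levelData hA h1 hω).E (fun z => W (χ.g (z.2, z.1))) *
      ((S.levelData hA h1 hω).E fun _ => 1)⁻¹) -
      (S.levelData hA h1 hω).E fun z => U (χ.g (z.2, z.1)) * W (χ.g (z.2, z.1)))
      (Icc 0 (area Ω)) := fun m hm => by
    rw [CInf.sub_apply, CInf.mul_apply, S.E_eq hA h1 hω hU hu hm, S.avg_eq hA h1 hω hW hw hm,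
      S.E_eq hA h1 hω (hU.mul hW) huw hm]
    rfl
  rw [hN_congr n fun m hm => (CInf.pderiv_one_apply _ hm).trans (dI_congr e hm)]
  exact hC (S.levelData hA h1 hω) _ _ _ _ _ _ (contDiff_chart hU) (contDiff_chart hW)
    (hN_chart_le h1 _ hu) (hN_chart_le h1 1 hu) (hN_chart_le h1 _ hw) (hN_chart_le h1 1 hw)

end AnnChart

/-! ### Smooth tameness near a point -/

/-- The interval, as a family of curves with one element. -/
def intervalFam {L : ℝ} (hL : 0 < L) : CurveFam (Icc 0 L) where
  A := Unit
  nonempty := ⟨()⟩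
  hi := L
  pos := hL
  γ _ := id
  smooth _ := contDiff_id
  maps _ := mapsTo_id _
  bound n := ⟨3 * (n + 1), by positivity, fun f _ => CInf.hN_le_sN hL n f⟩

lemma intervalFam_gr {L : ℝ} (hL : 0 < L) (α : ℝ) (n : ℕ) (f : CInf (Icc 0 L)) :
    (intervalFam hL).gr α n f = hN α 0 L n f :=
  ciSup_const (ι := Unit) (a := hN α 0 L n f)

namespace AnnChart

variable {Ω Γi Γo : Set Plane} {ω₀ : CInf (closure Ω)} (χ : AnnChart Ω Γi Γo ω₀)
  [GoodBody (closure Ω)] {α : ℝ}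

/-- The partial derivatives. -/
def partialD (i : Fin 2) : calF Ω →ₗ[ℝ] CInf (closure Ω) :=
  (CInf.pderiv (EuclideanSpace.single i (1 : ℝ))).comp (calF Ω).subtype

lemma norm_single (i : Fin 2) : ‖(EuclideanSpace.single i (1 : ℝ) : Plane)‖ ≤ 1 := by simp

lemma continuous_partialD (i : Fin 2) : Continuous (partialD (Ω := Ω) i) :=
  (CInf.continuous_pderiv (norm_single i)).comp continuous_subtype_val

/-- The norms of a function and of its partial derivatives along the rays. -/
def gradGr (α : ℝ) (n : ℕ) (ω : calF Ω) : ℝ :=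
  χ.rays.gr α n ω.1 + (χ.rays.gr α n (partialD 0 ω) + χ.rays.gr α n (partialD 1 ω))

/-- The grading of the pairs of functions. -/
abbrev pairGr (α : ℝ) : ℕ → calF Ω × CInf (closure Ω) → ℝ := prodGr (χ.gradGr α) (χ.rays.gr α)

variable {χ}

lemma isGr_gradGr (h1 : α ≤ 1) : IsGr (χ.gradGr α) := by
  have h := CurveFam.isGr (Γ := χ.rays) h1
  refine ⟨fun n x => ?_, fun x n m hnm => ?_, fun n x y => ?_, fun n => ?_, fun n => ?_⟩
  · exact add_nonneg (h.nonneg _ _) (add_nonneg (h.nonneg _ _) (h.nonneg _ _))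
  · exact add_le_add (h.mono _ hnm) (add_le_add (h.mono _ hnm) (h.mono _ hnm))
  · have a1 := h.add_le n x.1 y.1
    have a2 := h.add_le n (partialD 0 x) (partialD 0 y)
    have a3 := h.add_le n (partialD 1 x) (partialD 1 y)
    rw [← map_add] at a2 a3
    simp only [gradGr]
    have : χ.rays.gr α n (x + y).1 = χ.rays.gr α n (x.1 + y.1) := rfl
    linarith
  · exact ((h.cont n).comp continuous_subtype_val).add (((h.cont n).comp
      (continuous_partialD 0)).add ((h.cont n).comp (continuous_partialD 1)))
  · have : χ.rays.gr α n (0 : calF Ω).1 = 0 := h.zero n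
    rw [gradGr, map_zero, map_zero, h.zero, this]
    simp

lemma gr_le_gradGr (n : ℕ) (ω : calF Ω) : χ.rays.gr α n ω.1 ≤ χ.gradGr α n ω :=
  le_add_of_nonneg_right (add_nonneg (CurveFam.gr_nonneg _ _) (CurveFam.gr_nonneg _ _))

variable [GoodBody (Icc 0 (area Ω))] (hA : AnnularData Ω Γi Γo) (h0 : 0 ≤ α) (h1 : α ≤ 1)
  (hL : 0 < area Ω)

/-- The directional derivative of the integral over the level sets. -/
def levelDeriv (Ω : Set Plane) [GoodBody (Icc 0 (area Ω))]
    (z : (calF Ω × CInf (closure Ω)) × (calF Ω × CInf (closure Ω))) : CInf (Icc 0 (area Ω)) :=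
  CInf.mul (levelMap Ω (z.1.1, z.2.1.1)) (CInf.pderiv (1 : ℝ) (levelMap Ω z.1)) +
    (-1 : ℝ) • CInf.mul (levelMap Ω (z.1.1, CInf.one _))
      (CInf.pderiv (1 : ℝ) (levelMap Ω (z.1.1, CInf.mul z.1.2 z.2.1.1))) +
    levelMap Ω (z.1.1, z.2.2)

include hA h0 h1 hL

lemma gateaux_levelMap (z : calF Ω × CInf (closure Ω)) (hz : z ∈ χ.nbhd α ×ˢ univ)
    (w : calF Ω × CInf (closure Ω)) :
    Tendsto (fun t : ℝ => t⁻¹ • (levelMap Ω (z + t • w) - levelMap Ω z)) (𝓝[≠] 0)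
      (𝓝 (levelDeriv Ω (z, w))) := by
  obtain ⟨d⟩ := χ.exists_density
  obtain ⟨S⟩ := exists_lineData hA h1 hz.1 d w.1
  have := S.tendsto_levelMap hA z.2 w.2
  rw [sub_eq_add_neg, ← neg_one_smul ℝ] at this
  exact this

lemma gateaux_distInvMap (ω : calF Ω) (hω : ω ∈ χ.nbhd α) (ν : calF Ω) :
    Tendsto (fun t : ℝ => t⁻¹ • (distInvMap Ω (ω + t • ν) - distInvMap Ω ω)) (𝓝[≠] 0)
      (𝓝 (avgMap Ω (ω, ν.1))) := by
  obtain ⟨d⟩ := χ.exists_density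
  obtain ⟨S⟩ := exists_lineData hA h1 hω d ν
  exact S.tendsto_distInvMap hA

variable (χ)

lemma exists_sN_levelMap_le (n : ℕ) : ∃ C : ℝ, 1 ≤ C ∧ ∀ ω ∈ χ.nbhd α, ∀ u : CInf (closure Ω),
    CInf.sN n (levelMap Ω (ω, u)) ≤ C * (χ.rays.gr α n u + χ.rays.gr α (n + 1) ω.1 *
      χ.rays.gr α 1 u) := by
  obtain ⟨C, hC1, hC⟩ := χ.exists_hN_levelMap_le hA h0 h1 hL n
  exact ⟨C, hC1, fun ω hω u => (CInf.sN_le_hN hL h1 n _).trans (hC ω hω u)⟩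

/-- The low norms of the level integrals are uniformly controlled. -/
lemma exists_sN_one_levelMap_le : ∃ C : ℝ, 1 ≤ C ∧ ∀ ω ∈ χ.nbhd α, ∀ u : CInf (closure Ω),
    CInf.sN 0 (levelMap Ω (ω, u)) ≤ C * χ.rays.gr α 1 u ∧
    CInf.sN 0 (CInf.pderiv (1 : ℝ) (levelMap Ω (ω, u))) ≤ C * χ.rays.gr α 1 u := by
  obtain ⟨C, hC1, hC⟩ := χ.exists_sN_levelMap_le hA h0 h1 hL 1
  have hm : 0 ≤ χ.rays.gr α 2 ω₀ + (χ.b - χ.a) / 2 :=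
    add_nonneg (CurveFam.gr_nonneg _ _) (half_pos (sub_pos.2 χ.lt)).le
  refine ⟨C * (1 + (χ.rays.gr α 2 ω₀ + (χ.b - χ.a) / 2)), by nlinarith, fun ω hω u => ?_⟩
  have key : CInf.sN 1 (levelMap Ω (ω, u)) ≤
      C * (1 + (χ.rays.gr α 2 ω₀ + (χ.b - χ.a) / 2)) * χ.rays.gr α 1 u := by
    refine (hC ω hω u).trans ?_
    have h3 := rays_gr_le h1 hω
    have h4 := CurveFam.gr_nonneg (Γ := χ.rays) (α := α) 1 u
    rw [mul_assoc, add_mul, one_mul]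
    gcongr
  exact ⟨(CInf.sN_mono _ zero_le_one).trans key, (CInf.sN_pderiv_le (by simp) 0 _).trans key⟩

lemma continuousOn_levelMap : ContinuousOn (levelMap Ω) (χ.nbhd α ×ˢ univ) := by
  have hg := CurveFam.isGr (Γ := χ.rays) h1
  have cu : ∀ n (z₀ : calF Ω × CInf (closure Ω)), ∀ᶠ z in 𝓝 z₀,
      χ.rays.gr α n z.2 ≤ χ.rays.gr α n z₀.2 + 1 ∧
      χ.rays.gr α n z.1.1 ≤ χ.rays.gr α n z₀.1.1 + 1 := fun n z₀ =>
    ((((hg.cont n).comp continuous_snd).tendsto z₀).eventually (ge_mem_nhds (by simp))).and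
    ((((hg.cont n).comp (continuous_subtype_val.comp continuous_fst)).tendsto z₀).eventually
      (ge_mem_nhds (by simp)))
  refine CInf.continuousOn_of_gateaux hL ((isOpen_nbhd h1).prod isOpen_univ)
    (fun z hz w => gateaux_levelMap hA h0 h1 hL z hz w) (fun z₀ _ => ?_) fun z₀ _ n => ?_
  · obtain ⟨C, hC1, hC⟩ := χ.exists_sN_one_levelMap_le hA h0 h1 hL
    obtain ⟨K, hK⟩ := CurveFam.exists_gr_mul_le (Γ := χ.rays) h0 h1 1
    set A := χ.rays.gr α 1 z₀.2 + 1
    have hA0 : 0 ≤ A := add_nonneg (hg.nonneg _ _) zero_le_one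
    set I := χ.rays.gr α 1 (CInf.one (closure Ω))
    have hI : 0 ≤ I := hg.nonneg _ _
    refine ⟨_, cu 1 z₀, fun w => C * χ.rays.gr α 1 w.1.1 * (C * A) +
      C * I * (C * (2 * |K| * A * χ.rays.gr α 1 w.1.1)) + C * χ.rays.gr α 1 w.2, ?_, ?_, ?_⟩
    · have c1 := (hg.cont 1).comp (continuous_subtype_val.comp
        (continuous_fst (X := calF Ω) (Y := CInf (closure Ω))))
      have c2 := (hg.cont 1).comp (continuous_snd (X := calF Ω) (Y := CInf (closure Ω)))
      exact (((continuous_const.mul c1).mul continuous_const).add (continuous_const.mul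
        (continuous_const.mul (continuous_const.mul c1)))).add (continuous_const.mul c2)
    · have e : χ.rays.gr α 1 (0 : calF Ω × CInf (closure Ω)).1.1 = 0 := hg.zero 1
      have e' : χ.rays.gr α 1 (0 : calF Ω × CInf (closure Ω)).2 = 0 := hg.zero 1
      beta_reduce
      rw [e, e']
      ring
    · rintro z ⟨⟨hz, -⟩, hzO, -⟩ w
      have b1 := hC z.1 hzO
      have n1 := hg.nonneg 1 z.2
      have n2 := hg.nonneg 1 w.1.1
      have bm : χ.rays.gr α 1 (CInf.mul z.2 w.1.1) ≤ 2 * |K| * A * χ.rays.gr α 1 w.1.1 := by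
        have m1 := hg.mono z.2 zero_le_one
        have m2 := hg.mono w.1.1 zero_le_one
        have m3 := hg.nonneg 0 w.1.1
        simp only at m1 m2
        calc _ ≤ |K| * (χ.rays.gr α 1 z.2 * χ.rays.gr α 0 w.1.1 +
              χ.rays.gr α 0 z.2 * χ.rays.gr α 1 w.1.1) := (hK _ _).trans (by
                have := hg.nonneg 0 z.2
                gcongr
                exact le_abs_self K)
          _ ≤ |K| * (A * χ.rays.gr α 1 w.1.1 + A * χ.rays.gr α 1 w.1.1) := by
                gcongr
                exact m1.trans hz
          _ = _ := by ring
      refine (CInf.sN_add_le _ _ _).trans (add_le_add ((CInf.sN_add_le _ _ _).trans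
        (add_le_add ?_ ?_)) (b1 _).1)
      · refine (CInf.sN_mul_le _ _ _).trans ?_
        rw [pow_zero, one_mul]
        have := CInf.sN_nonneg 0 (CInf.pderiv (1 : ℝ) (levelMap Ω z))
        exact mul_le_mul (b1 _).1 ((b1 z.2).2.trans (by gcongr)) this (by positivity)
      · refine (CInf.sN_smul_le _ _ _).trans ?_
        rw [abs_neg, abs_one, one_mul]
        refine (CInf.sN_mul_le _ _ _).trans ?_
        rw [pow_zero, one_mul]
        exact mul_le_mul (b1 _).1 ((b1 _).2.trans (by gcongr)) (CInf.sN_nonneg _ _)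
          (by positivity)
  · obtain ⟨C, hC1, hC⟩ := χ.exists_sN_levelMap_le hA h0 h1 hL n
    refine ⟨_, (cu n z₀).and ((cu (n + 1) z₀).and (cu 1 z₀)), C * ((χ.rays.gr α n z₀.2 + 1) +
      (χ.rays.gr α (n + 1) z₀.1.1 + 1) * (χ.rays.gr α 1 z₀.2 + 1)), ?_⟩
    rintro z ⟨⟨⟨e1, -⟩, ⟨-, e2⟩, ⟨e3, -⟩⟩, hz, -⟩
    have n1 := hg.nonneg 1 z.2
    have n2 := hg.nonneg (n + 1) z₀.1.1
    exact (hC z.1 hz z.2).trans (by gcongr)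

lemma tameMap_levelMap : TameMap (χ.pairGr α) ((intervalFam hL).gr α)
    (χ.nbhd α ×ˢ univ) (levelMap Ω) where
  continuousOn := χ.continuousOn_levelMap hA h0 h1 hL
  estimate z₀ _ := by
    have hg := CurveFam.isGr (Γ := χ.rays) h1
    refine ⟨_, (((hg.cont 1).comp continuous_snd).tendsto z₀).eventually
      (ge_mem_nhds (lt_add_one _)), 1, fun n => ?_⟩
    obtain ⟨C, hC1, hC⟩ := χ.exists_hN_levelMap_le hA h0 h1 hL n
    set A := χ.rays.gr α 1 z₀.2 + 1
    refine ⟨C * (1 + A), ?_⟩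
    rintro z ⟨hz, hzO, -⟩
    replace hz : χ.rays.gr α 1 z.2 ≤ A := hz
    have n1 := hg.nonneg 1 z.2
    have n2 := hg.nonneg (n + 1) z.1.1
    have n3 := hg.nonneg (n + 1) z.2
    have n4 := hg.mono z.2 (Nat.le_succ n)
    have n5 := gr_le_gradGr (χ := χ) (α := α) (n + 1) z.1
    simp only [Nat.succ_eq_add_one] at n4
    rw [intervalFam_gr]
    have hA0 : 0 ≤ A := n1.trans hz
    have n6 : 0 ≤ χ.gradGr α (n + 1) z.1 := n2.trans n5
    refine (hC z.1 hzO z.2).trans ?_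
    rw [mul_assoc]
    gcongr
    simp only [prodGr]
    calc _ ≤ χ.rays.gr α (n + 1) z.2 + χ.gradGr α (n + 1) z.1 * A := by gcongr
      _ ≤ _ := by nlinarith

lemma SmT_levelMap (k : ℕ) : SmT ((intervalFam hL).gr α) k (calF Ω × CInf (closure Ω))
    (χ.pairGr α) (χ.nbhd α ×ˢ univ) (levelMap Ω) := by
  have hg := CurveFam.isGr (Γ := χ.rays) h1
  have hgF := isGr_gradGr (χ := χ) h1
  have hY := CurveFam.isGr (Γ := intervalFam hL) h1
  have hX := hgF.prod hg
  have hXX := hX.prod hX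
  have hT := χ.tameMap_levelMap hA h0 h1 hL
  have hopen := ((isOpen_nbhd (χ := χ) h1).prod
    (isOpen_univ (X := CInf (closure Ω))))
  induction k with
  | zero => exact hT
  | succ k ih =>
    set B := (χ.nbhd α ×ˢ (univ : Set (CInf (closure Ω)))) ×ˢ
      (univ : Set (calF Ω × CInf (closure Ω)))
    have f1 : SmTame (χ.pairGr α) _ B Prod.fst := SmTame.fst hX hX B
    have f2 : SmTame (χ.pairGr α) _ B Prod.snd := SmTame.snd hX hX B
    have g1 : SmTame (χ.gradGr α) _ B fun z => z.1.1 :=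
      (SmTame.fst hgF hg univ).comp hXX hX f1 (mapsTo_univ _ _)
    have g2 : SmTame (χ.rays.gr α) _ B fun z => z.1.2 :=
      (SmTame.snd hgF hg univ).comp hXX hX f1 (mapsTo_univ _ _)
    have g3 : SmTame (χ.gradGr α) _ B fun z => z.2.1 :=
      (SmTame.fst hgF hg univ).comp hXX hX f2 (mapsTo_univ _ _)
    have g4 : SmTame (χ.rays.gr α) _ B fun z => z.2.2 :=
      (SmTame.snd hgF hg univ).comp hXX hX f2 (mapsTo_univ _ _)
    have g5 : SmTame (χ.rays.gr α) _ B fun z => z.2.1.1 :=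
      (SmTame.of_linear_le (q := χ.rays.gr α) hgF (calF Ω).subtype continuous_subtype_val
        (fun n ω => gr_le_gradGr n ω) univ).comp hXX hgF g3 (mapsTo_univ _ _)
    have hE : ∀ {u : (calF Ω × CInf (closure Ω)) × (calF Ω × CInf (closure Ω)) → CInf (closure Ω)},
        SmT (χ.rays.gr α) k _ (prodGr (χ.pairGr α)
          (χ.pairGr α)) B u →
        SmT ((intervalFam hL).gr α) k _ (prodGr (χ.pairGr α)
          (χ.pairGr α)) B fun z => levelMap Ω (z.1.1, u z) := fun hu =>
      SmT.comp hXX hX ih (SmT.pair hXX (g1 k) hu) fun z hz => ⟨hz.1.1, mem_univ _⟩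
    have hD : ∀ {P : (calF Ω × CInf (closure Ω)) × (calF Ω × CInf (closure Ω)) →
        CInf (Icc 0 (area Ω))},
        SmT ((intervalFam hL).gr α) k _ (prodGr (χ.pairGr α)
          (χ.pairGr α)) B P →
        SmT ((intervalFam hL).gr α) k _ (prodGr (χ.pairGr α)
          (χ.pairGr α)) B fun z => CInf.pderiv (1 : ℝ) (P z) := fun hP =>
      SmT.comp hXX hY (SmT.linear hY (CInf.pderiv (1 : ℝ)) (CInf.continuous_pderiv (by simp))
        ⟨1, fun n => ⟨1, fun f => by
          rw [one_mul, intervalFam_gr, intervalFam_gr,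
            hN_congr n fun m hm => CInf.pderiv_one_apply f hm]
          exact hN_deriv_le _ _ _ _ _⟩⟩ k univ) hP (mapsTo_univ _ _)
    have hd : SmT ((intervalFam hL).gr α) k _ (prodGr (χ.pairGr α)
        (χ.pairGr α)) B (levelDeriv Ω) :=
      SmT.add hXX hY (SmT.add hXX hY
        (CurveFam.SmT_bilin hXX h0 h1 (hE (g5 k)) (hD (hE (g2 k))))
        (SmT.const_smul hXX hY (fun c n f => CurveFam.gr_smul c n f)
          (CurveFam.SmT_bilin hXX h0 h1 (hE (SmT.const hXX hg.zero _ k B))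
            (hD (hE (CurveFam.SmT_bilin hXX h0 h1 (g2 k) (g5 k))))) (-1)))
        (hE (g4 k))
    exact ⟨hT, levelDeriv Ω, CInf.hasHD_of_gateaux hopen
      (fun z hz w => gateaux_levelMap hA h0 h1 hL z hz w) hd.tameMap.continuousOn, hd⟩

lemma SmT_avgMap (k : ℕ) : SmT ((intervalFam hL).gr α) k (calF Ω × CInf (closure Ω))
    (χ.pairGr α) (χ.nbhd α ×ˢ univ) (avgMap Ω) := by
  have hg := CurveFam.isGr (Γ := χ.rays) h1
  have hgF := isGr_gradGr (χ := χ) h1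
  have hX := hgF.prod hg
  have hY := CurveFam.isGr (Γ := intervalFam hL) h1
  have hE := χ.SmT_levelMap hA h0 h1 hL k
  obtain ⟨d⟩ := χ.exists_density
  refine CurveFam.SmT_bilin hX h0 h1 hE (SmT.comp hX hY (CurveFam.smTame_inv h0 h1 k)
    (SmT.comp hX hX hE (SmT.pair hX (SmTame.fst hgF hg _ k) (SmT.const hX hg.zero _ k _))
      fun z hz => ⟨hz.1, mem_univ _⟩) fun z hz => ?_)
  obtain ⟨S⟩ := exists_lineData hA h1 hz.1 d 0
  exact S.levelMap_one_mem_Pos hA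

lemma continuousOn_distInvMap : ContinuousOn (distInvMap Ω) (χ.nbhd α) := by
  have hg := CurveFam.isGr (Γ := χ.rays) h1
  refine CInf.continuousOn_of_gateaux hL (isOpen_nbhd h1) (G := fun z => avgMap Ω (z.1, z.2.1))
    (fun ω hω ν => gateaux_distInvMap hA h0 h1 hL ω hω ν) (fun ω _ => ?_) fun ω _ n => ?_
  · obtain ⟨C, hC1, hC⟩ := χ.exists_hN_avgMap_le hA h0 h1 hL 0
    set M := χ.rays.gr α 2 ω₀ + (χ.b - χ.a) / 2
    refine ⟨univ, univ_mem, fun ν => C * ((1 + M) * χ.rays.gr α 1 ν.1), ?_, ?_, ?_⟩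
    · exact continuous_const.mul (continuous_const.mul
        ((hg.cont 1).comp continuous_subtype_val))
    · have e : χ.rays.gr α 1 (0 : calF Ω).1 = 0 := hg.zero 1
      beta_reduce
      rw [e]
      ring
    · rintro ω' ⟨-, hω'⟩ ν
      refine (CInf.sN_le_hN hL h1 0 _).trans ((hC ω' hω' ν.1).trans ?_)
      have a1 := hg.mono ν.1 zero_le_one
      have a2 : χ.rays.gr α (0 + 1) ω'.1 ≤ M :=
        (hg.mono ω'.1 one_le_two).trans (rays_gr_le h1 hω')
      have a3 := hg.nonneg 1 ν.1
      simp only at a1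
      beta_reduce
      rw [add_mul, one_mul]
      gcongr
  · obtain ⟨C, hC1, hC⟩ := χ.exists_hN_distInvMap_le hA h0 h1 hL n
    refine ⟨_, (((hg.cont n).comp continuous_subtype_val).tendsto ω).eventually
      (ge_mem_nhds (lt_add_one _)), C * ((χ.rays.gr α n ω.1 + 1) + 1), ?_⟩
    rintro ω' ⟨hω', hO⟩
    refine (CInf.sN_le_hN hL h1 n _).trans ((hC ω' hO).trans ?_)
    gcongr
    exact hω'

lemma smTame_distInvMap : SmTame ((intervalFam hL).gr α) (χ.gradGr α) (χ.nbhd α)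
    (distInvMap Ω) := by
  have hg := CurveFam.isGr (Γ := χ.rays) h1
  have hgF := isGr_gradGr (χ := χ) h1
  have hT : TameMap (χ.gradGr α) ((intervalFam hL).gr α) (χ.nbhd α) (distInvMap Ω) := by
    refine ⟨χ.continuousOn_distInvMap hA h0 h1 hL, fun ω _ => ⟨univ, univ_mem, 0, fun n => ?_⟩⟩
    obtain ⟨C, hC1, hC⟩ := χ.exists_hN_distInvMap_le hA h0 h1 hL n
    refine ⟨C, fun ω' hω' => ?_⟩
    rw [intervalFam_gr]
    refine (hC ω' hω'.2).trans ?_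
    gcongr
    exact gr_le_gradGr n ω'
  intro k
  cases k with
  | zero => exact hT
  | succ k =>
    have hd : SmT ((intervalFam hL).gr α) k (calF Ω × calF Ω)
        (prodGr (χ.gradGr α) (χ.gradGr α)) (χ.nbhd α ×ˢ univ)
        fun z => avgMap Ω (z.1, z.2.1) :=
      SmT.comp (hgF.prod hgF) (hgF.prod hg) (χ.SmT_avgMap hA h0 h1 hL k)
        (SmT.pair (hgF.prod hgF) (SmTame.fst hgF hgF _ k) (SmT.comp (hgF.prod hgF) hgF
          (SmTame.of_linear_le (q := χ.rays.gr α) hgF (calF Ω).subtype continuous_subtype_val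
            (fun n ω => gr_le_gradGr n ω) univ k) (SmTame.snd hgF hgF _ k) (mapsTo_univ _ _)))
        fun z hz => ⟨hz.1, mem_univ _⟩
    exact ⟨hT, _, CInf.hasHD_of_gateaux (isOpen_nbhd h1)
      (fun ω hω ν => gateaux_distInvMap hA h0 h1 hL ω hω ν) hd.tameMap.continuousOn, hd⟩

end AnnChart

namespace AnnChart

variable {Ω Γi Γo : Set Plane} {ω₀ : CInf (closure Ω)} {χ : AnnChart Ω Γi Γo ω₀}
  [GoodBody (closure Ω)] {α : ℝ}

namespace LineData

variable {d : χ.Density} {ω ν : calF Ω} (S : χ.LineData d ω ν) (hA : AnnularData Ω Γi Γo)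
include S hA

lemma eventually_avgMap {u : CInf (closure Ω)} {U : Plane → ℝ} (hU : C∞ U)
    (hu : EqOn u U (closure Ω)) : ∀ᶠ t in 𝓝 (0 : ℝ), ∀ m ∈ Icc 0 (area Ω),
    avgMap Ω (ω + t • ν, u) m = S.Φ.E S.R U (t, m) / S.Φ.E S.R (fun _ => 1) (t, m) := by
  haveI := CInf.goodBody_Icc (S.area_pos hA)
  filter_upwards [S.eventually_levelMap hA] with t ht m hm
  have h1 : ∀ m ∈ Icc 0 (area Ω), levelMap Ω (ω + t • ν, CInf.one _) m =
      S.Φ.E S.R (fun _ => 1) (t, m) := fun m hm => by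
    obtain ⟨e1, e2⟩ := ht (CInf.one _) (fun _ => 1) contDiff_const
      (fun _ hx => CInf.one_apply hx) m hm
    rw [e2, e1]
  have hK : 0 < S.Φ.K := S.Φ.pos.trans_le ((S.Φ.le 0).trans (S.Φ.ge 0))
  have hκ := d.pos
  obtain ⟨e1, e2⟩ := ht u U hU hu m hm
  rw [avgMap, CInf.mul_apply, CInf.inv_apply ⟨2 * Real.pi * (d.κ / S.Φ.K), by positivity,
    fun m hm => ?_⟩ hm, h1 m hm, e2, e1, div_eq_mul_inv]
  rw [h1 m hm]
  exact S.Φ.le_J_one d _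

/-- The directional derivative of the averages over the level sets. -/
lemma tendsto_avgMap [GoodBody (Icc 0 (area Ω))] (u : CInf (closure Ω)) :
    Tendsto (fun t : ℝ => t⁻¹ • (avgMap Ω (ω + t • ν, u) - avgMap Ω (ω, u))) (𝓝[≠] 0)
      (𝓝 (CInf.pderiv (1 : ℝ) (CInf.mul (levelMap Ω (ω, u)) (avgMap Ω (ω, ν.1)) -
        levelMap Ω (ω, CInf.mul u ν.1)))) := by
  obtain ⟨U, hU, hu⟩ := u.exists_ext
  have hL := S.area_pos hA
  have hun : EqOn (CInf.mul u ν.1) (fun x => U x * S.N x) (closure Ω) := fun x hx => by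
    rw [CInf.mul_apply, hu hx, S.eqN hx]
  have hE1 := S.Φ.contDiff_E S.R (U := fun _ => 1) contDiff_const
  have hpos : ∀ z, S.Φ.E S.R (fun _ => 1) z ≠ 0 := fun z => (S.Φ.J_one_pos d _).ne'
  have := CInf.tendsto_diffQuot hL (F := fun z => S.Φ.E S.R U z / S.Φ.E S.R (fun _ => 1) z)
    ((S.Φ.contDiff_E S.R hU).div hE1 hpos) (f := fun t => avgMap Ω (ω + t • ν, u))
    (S.eventually_avgMap hA hU hu)
    (g := CInf.pderiv (1 : ℝ) (CInf.mul (levelMap Ω (ω, u)) (avgMap Ω (ω, ν.1)) -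
        levelMap Ω (ω, CInf.mul u ν.1))) fun m hm => by
      have hm' := Ioo_subset_Icc_self hm
      have hQ : S.R.Q (0, m) ∈ Ioo S.p S.q := by
        have a1 := S.good_zero.Q_zero S.R S.eqOn_zero hA
        have a2 := S.good_zero.Q_area S.R S.eqOn_zero hA
        have a3 := S.Φ.strictMono_Q S.R 0
        exact ⟨a1 ▸ a3 hm.1, a2 ▸ a3 hm.2⟩
      have b1 := S.Φ.hasDerivAt_E_fst S.R S.good_zero hU hQ
      have b2 := S.Φ.hasDerivAt_E_fst S.R S.good_zero (U := fun _ => 1) contDiff_const hQ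
      simp only [one_mul] at b2
      refine (b1.div b2 (hpos _)).congr_deriv ?_
      have c : ∀ {U : Plane → ℝ}, C∞ U → HasDerivAt
          (fun m => S.Φ.E S.R U (0, m)) (dSnd (S.Φ.E S.R U) (0, m)) m := fun hU =>
        hasDerivAt_dSnd (S.Φ.contDiff_E S.R hU) 0 m
      have c1 := ((c hU).mul ((c S.Φ.smoothN).div (c (U := fun _ => 1) contDiff_const)
        (hpos _))).sub (c (hU.mul S.Φ.smoothN))
      have hval : ∀ m ∈ Icc 0 (area Ω), (CInf.mul (levelMap Ω (ω, u)) (avgMap Ω (ω, ν.1)) -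
          levelMap Ω (ω, CInf.mul u ν.1) : CInf _) m = S.Φ.E S.R U (0, m) *
          (S.Φ.E S.R S.N (0, m) / S.Φ.E S.R (fun _ => 1) (0, m)) -
          S.Φ.E S.R (fun x => U x * S.N x) (0, m) := fun m hm => by
        rw [CInf.sub_apply, CInf.mul_apply, S.levelMap_eq hA hU hu hm,
          S.avgMap_eq hA S.Φ.smoothN S.eqN hm, S.levelMap_eq hA (hU.mul S.Φ.smoothN) hun hm]
      rw [CInf.pderiv_one_apply _ hm', dI_eq hL hm' (c1.hasDerivWithinAt.congr hval (hval m hm'))]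
      have := hpos (0, m)
      simp only [Pi.div_apply]
      field_simp
      ring
  simpa only [zero_smul, add_zero] using this

end LineData

variable (hA : AnnularData Ω Γi Γo)

lemma mem_nbhd_self {ω : calF Ω} (χ : AnnChart Ω Γi Γo ω.1) (h1 : α ≤ 1) : ω ∈ χ.nbhd α := by
  show χ.rays.gr α 2 (ω.1 - ω.1) < _
  rw [sub_self, (CurveFam.isGr h1).zero]
  exact half_pos (sub_pos.2 χ.lt)

include hA in
lemma nbhd_subset (h1 : α ≤ 1) : χ.nbhd α ⊆ calFPlus Ω Γi Γo := fun ω hω => by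
  obtain ⟨d⟩ := χ.exists_density
  obtain ⟨S⟩ := exists_lineData hA h1 hω d 0
  exact S.mem_calFPlus

end AnnChart

section GradSq

variable {Ω Γi Γo : Set Plane} [GoodBody (closure Ω)]

open AnnChart

/-- The square of the norm of the gradient. -/
def gradSq (ω : calF Ω) : CInf (closure Ω) :=
  CInf.mul (partialD 0 ω) (partialD 0 ω) + CInf.mul (partialD 1 ω) (partialD 1 ω)

lemma gradNorm_eq (ω : calF Ω) {x : Plane} (hx : x ∈ closure Ω) :
    gradNorm Ω ω.1 x = √(gradSq ω x) := by
  have h : ∀ i : Fin 2, gradientWithin ω.1 (closure Ω) x i = partialD i ω x := fun i => by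
    have h1 : inner ℝ (gradientWithin ω.1 (closure Ω) x) (EuclideanSpace.single i (1 : ℝ)) =
        fderivWithin ℝ ω.1 (closure Ω) x (EuclideanSpace.single i 1) := by
      rw [gradientWithin, InnerProductSpace.toDual_symm_apply]
    rw [EuclideanSpace.inner_single_right] at h1
    refine Eq.trans (by simp) (h1.trans (CInf.pderiv_apply _ ω.1 hx).symm)
  rw [gradNorm, EuclideanSpace.norm_eq, Fin.sum_univ_two, Real.norm_eq_abs, Real.norm_eq_abs,
    sq_abs, sq_abs, h, h, gradSq, CInf.add_apply, CInf.mul_apply, CInf.mul_apply, sq, sq]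

lemma gradSq_mem_Pos (hA : AnnularData Ω Γi Γo) {ω : calF Ω} (hω : ω ∈ calFPlus Ω Γi Γo) :
    gradSq ω ∈ CInf.Pos (closure Ω) := by
  obtain ⟨y, hy, hmin⟩ := hA.body.compact.exists_isMinOn hA.nonempty.closure (gradSq ω).continuousOn
  refine ⟨gradSq ω y, ?_, fun x hx => hmin hx⟩
  have h : 0 < gradNorm Ω ω.1 y := norm_pos_iff.2 (hω.1 y hy)
  rwa [gradNorm_eq ω hy, Real.sqrt_pos] at h

/-- The integral over the level sets, as a function of the area. -/
def arcMap (Ω : Set Plane) [GoodBody (closure Ω)] (z : calF Ω × CInf (closure Ω)) :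
    CInf (Icc 0 (area Ω)) :=
  levelMap Ω (z.1, CInf.mul z.2 (CInf.sqrt (gradSq z.1)))

variable {ω₀ : CInf (closure Ω)} (χ : AnnChart Ω Γi Γo ω₀) {α : ℝ}
  [GoodBody (Icc 0 (area Ω))] (hA : AnnularData Ω Γi Γo) (h0 : 0 ≤ α) (h1 : α ≤ 1)
  (hL : 0 < area Ω)
include hA h0 h1 hL

lemma AnnChart.SmT_arcMap (k : ℕ) : SmT ((intervalFam hL).gr α) k (calF Ω × CInf (closure Ω))
    (χ.pairGr α) (χ.nbhd α ×ˢ univ) (arcMap Ω) := by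
  have hg := CurveFam.isGr (Γ := χ.rays) h1
  have hgF := isGr_gradGr (χ := χ) h1
  have hX := hgF.prod hg
  have hd : ∀ i : Fin 2, SmT (χ.rays.gr α) k (calF Ω × CInf (closure Ω))
      (χ.pairGr α) (χ.nbhd α ×ˢ univ) fun z => partialD i z.1 := fun i =>
    SmT.comp hX hgF (SmTame.of_linear_le (q := χ.rays.gr α) hgF (partialD i)
      (continuous_partialD i) (fun n ω => by
        have a0 := hg.nonneg n ω.1
        have a1 := hg.nonneg n (partialD 0 ω)
        have a2 := hg.nonneg n (partialD 1 ω)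
        simp only [gradGr]
        fin_cases i
        · simp only [Fin.zero_eta]; linarith
        · simp only [Fin.mk_one]; linarith) univ k) (SmTame.fst hgF hg _ k) (mapsTo_univ _ _)
  have hq : SmT (χ.rays.gr α) k (calF Ω × CInf (closure Ω))
      (χ.pairGr α) (χ.nbhd α ×ˢ univ) fun z => gradSq z.1 :=
    SmT.add hX hg (CurveFam.SmT_bilin hX h0 h1 (hd 0) (hd 0))
      (CurveFam.SmT_bilin hX h0 h1 (hd 1) (hd 1))
  have hs := SmT.comp hX hg (CurveFam.smTame_sqrt (Γ := χ.rays) h0 h1 k) hq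
    fun z hz => gradSq_mem_Pos hA (nbhd_subset hA h1 hz.1)
  exact SmT.comp hX hX (χ.SmT_levelMap hA h0 h1 hL k) (SmT.pair hX (SmTame.fst hgF hg _ k)
    (CurveFam.SmT_bilin hX h0 h1 (SmTame.snd hgF hg _ k) hs)) fun z hz => ⟨hz.1, mem_univ _⟩

end GradSq

lemma AnnularData.isOpen_calFPlus {Ω Γi Γo : Set Plane} (hA : AnnularData Ω Γi Γo) :
    IsOpen (calFPlus Ω Γi Γo) := by
  haveI := hA.body
  refine isOpen_iff_mem_nhds.2 fun ω hω => ?_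
  obtain ⟨χ⟩ := hA.exists_chart hω
  exact mem_of_superset ((χ.isOpen_nbhd (α := 1) le_rfl).mem_nhds (χ.mem_nbhd_self le_rfl))
    (AnnChart.nbhd_subset hA le_rfl)

lemma AnnularData.area_pos {Ω Γi Γo : Set Plane} (hA : AnnularData Ω Γi Γo) : 0 < area Ω :=
  ENNReal.toReal_pos (hA.isOpen.measure_pos volume hA.nonempty).ne'
    (((measure_mono subset_closure).trans_lt hA.body.compact.measure_lt_top).ne)

/-! ### The theorem -/

lemma arcMap_apply {Ω Γi Γo : Set Plane} [GoodBody (closure Ω)] (hA : AnnularData Ω Γi Γo)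
    {ω : calF Ω} (hω : ω ∈ calFPlus Ω Γi Γo) (u : CInf (closure Ω)) {m : ℝ}
    (hm : m ∈ Icc 0 (area Ω)) : arcMap Ω (ω, u) m = levelInt Ω ω.1 u (distInv Ω ω.1 m) := by
  obtain ⟨χ⟩ := hA.exists_chart hω
  obtain ⟨d⟩ := χ.exists_density
  obtain ⟨S⟩ := AnnChart.exists_lineData hA (α := 1) le_rfl (χ.mem_nbhd_self le_rfl) d 0
  rw [arcMap, S.levelMap_eq_levelInt hA _ hm]
  congr 1
  ext x
  by_cases hx : x ∈ closure Ω
  · have h : gradNorm Ω ω.1 x ≠ 0 := norm_ne_zero_iff.2 (hω.1 x hx)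
    rw [CInf.mul_apply, CInf.sqrt_apply (gradSq_mem_Pos hA hω) hx, ← gradNorm_eq ω hx,
      mul_div_assoc, div_self h, mul_one]
  · rw [CInf.mul_apply, u.eq_zero_of_notMem hx, zero_mul, zero_div]

namespace AnnChart

variable {Ω Γi Γo : Set Plane} {ω₀ : CInf (closure Ω)} (χ : AnnChart Ω Γi Γo ω₀)
  [GoodBody (closure Ω)] {α : ℝ} (h0 : 0 ≤ α) (h1 : α ≤ 1)
include h0 h1

lemma exists_gr_le (N : ℕ) : ∃ K : ℝ≥0, 1 ≤ K ∧ ∀ j ≤ N, ∀ f : CInf (closure Ω),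
    ENNReal.ofReal (χ.rays.gr α j f) ≤ K * CInf.grading (closure Ω) α j f := by
  choose C hC0 hC using fun n => χ.exists_gr_rays_le h0 h1 n
  refine ⟨1 + ∑ j ∈ Finset.range (N + 1), (C j).toNNReal, le_add_of_nonneg_right (by positivity),
    fun j hj f => (hC j f).trans ?_⟩
  refine mul_le_mul_left (ENNReal.coe_le_coe.2 ?_) _
  exact (Finset.single_le_sum (f := fun j => (C j).toNNReal) (fun _ _ => by positivity)
    (Finset.mem_range.2 (Nat.lt_succ_of_le hj))).trans (le_add_of_nonneg_left zero_le_one)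

lemma exists_gradGr_le (n : ℕ) : ∃ C : ℝ≥0, ∀ ω : calF Ω,
    ENNReal.ofReal (χ.gradGr α n ω) ≤ C * calF.grading Ω α (n + 1) ω := by
  obtain ⟨K, -, hK⟩ := χ.exists_gr_le h0 h1 n
  refine ⟨3 * K, fun ω => ?_⟩
  have h : ∀ i, ENNReal.ofReal (χ.rays.gr α n (partialD i ω)) ≤ K * calF.grading Ω α (n + 1) ω :=
    fun i => (hK n le_rfl _).trans (mul_le_mul_right (holderNorm_pderiv_le (norm_single i) α n ω.1) _)
  have h' : ENNReal.ofReal (χ.rays.gr α n ω.1) ≤ K * calF.grading Ω α (n + 1) ω :=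
    (hK n le_rfl _).trans (mul_le_mul_right (holderNorm_mono α (Nat.le_succ n) _) _)
  calc _ ≤ K * calF.grading Ω α (n + 1) ω + (K * calF.grading Ω α (n + 1) ω +
        K * calF.grading Ω α (n + 1) ω) :=
        ENNReal.ofReal_add_le.trans (add_le_add h' (ENNReal.ofReal_add_le.trans
          (add_le_add (h 0) (h 1))))
    _ = _ := by
        push_cast
        ring

lemma exists_radius : ∃ δ : ℝ≥0, 0 < δ ∧ ∀ ω : calF Ω,
    holderNorm (closure Ω) α 2 (ω.1 - ω₀ : CInf (closure Ω)) < δ → ω ∈ χ.nbhd α := by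
  obtain ⟨K, hK1, hK⟩ := χ.exists_gr_le h0 h1 2
  have hpos : 0 < ((χ.b - χ.a) / 2).toNNReal := Real.toNNReal_pos.2 (half_pos (sub_pos.2 χ.lt))
  have hK0 : 0 < K := zero_lt_one.trans_le hK1
  refine ⟨((χ.b - χ.a) / 2).toNNReal / K, div_pos hpos hK0, fun ω hω => ?_⟩
  have h2 : ENNReal.ofReal (χ.rays.gr α 2 (ω.1 - ω₀)) < ENNReal.ofReal ((χ.b - χ.a) / 2) := by
    refine (hK 2 le_rfl _).trans_lt ?_
    rw [ENNReal.coe_div hK0.ne', ENNReal.lt_div_iff_mul_lt (Or.inl (by simpa using hK0.ne'))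
      (Or.inl (by simp)), mul_comm] at hω
    exact hω
  exact (ENNReal.ofReal_lt_ofReal_iff (half_pos (sub_pos.2 χ.lt))).1 h2

end AnnChart

lemma ofReal_le_of_le_mul {C x : ℝ} (hC : 0 ≤ C) {X h : ℝ≥0∞} {r : ℝ} (hr : h ≤ ENNReal.ofReal r)
    (hrx : r ≤ C * x) (hx : ENNReal.ofReal x ≤ X) : h ≤ C.toNNReal * X := by
  refine hr.trans ((ENNReal.ofReal_le_ofReal hrx).trans ?_)
  rw [ENNReal.ofReal_mul hC]
  exact mul_le_mul_right hx _

lemma ofReal_add_mul_le {K : ℝ≥0} (hK : 1 ≤ K) {a b c : ℝ} (hb : 0 ≤ b) {A B C : ℝ≥0∞}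
    (ha' : ENNReal.ofReal a ≤ K * A) (hb' : ENNReal.ofReal b ≤ K * B)
    (hc' : ENNReal.ofReal c ≤ K * C) :
    ENNReal.ofReal (a + b * c) ≤ (K ^ 2 : ℝ≥0) * (A + B * C) := by
  have h : (K : ℝ≥0∞) ≤ (K ^ 2 : ℝ≥0) := ENNReal.coe_le_coe.2 (le_self_pow₀ hK two_ne_zero)
  refine ENNReal.ofReal_add_le.trans ?_
  rw [mul_add, ENNReal.ofReal_mul hb]
  refine add_le_add (ha'.trans (mul_le_mul_left h _)) ((mul_le_mul' hb' hc').trans_eq ?_)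
  push_cast
  ring

section Main

variable {Ω Γi Γo : Set Plane} [GoodBody (closure Ω)] [GoodBody (Icc 0 (area Ω))] {α : ℝ}
  (hA : AnnularData Ω Γi Γo) (h0 : 0 ≤ α) (h1 : α ≤ 1)

lemma grading_le (h1 : α ≤ 1) (hL : 0 < area Ω) (n : ℕ) (f : CInf (Icc 0 (area Ω))) :
    CInf.grading (Icc 0 (area Ω)) α n f ≤ ENNReal.ofReal (hN α 0 (area Ω) n f) :=
  holderNorm_Icc_le hL h1 n f.sm

include hA h0 h1

lemma isSmoothTameOn_distInvMap : IsSmoothTameOn (calF.grading Ω α)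
    (CInf.grading (Icc 0 (area Ω)) α) (calFPlus Ω Γi Γo) (distInvMap Ω)
    (iterGateaux (distInvMap Ω)) := by
  have hL := hA.area_pos
  refine isSmoothTameOn_of_local (q := (intervalFam hL).gr α) (fun n f => ?_) hA.isOpen_calFPlus
    fun ω hω => ?_
  · rw [intervalFam_gr]
    exact grading_le h1 hL n f
  · obtain ⟨χ⟩ := hA.exists_chart hω
    exact ⟨χ.nbhd α, AnnChart.nbhd_subset hA h1, AnnChart.isOpen_nbhd h1, χ.mem_nbhd_self h1,
      χ.gradGr α, AnnChart.isGr_gradGr h1, ⟨1, χ.exists_gradGr_le h0 h1⟩,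
      χ.smTame_distInvMap hA h0 h1 hL⟩

lemma isSmoothTameOn_arcMap :
    IsSmoothTameOn (prodGrading (calF.grading Ω α) (CInf.grading (closure Ω) α))
    (CInf.grading (Icc 0 (area Ω)) α) (calFPlus Ω Γi Γo ×ˢ univ) (arcMap Ω)
    (iterGateaux (arcMap Ω)) := by
  have hL := hA.area_pos
  refine isSmoothTameOn_of_local (q := (intervalFam hL).gr α) (fun n f => ?_)
    (hA.isOpen_calFPlus.prod isOpen_univ) fun z hz => ?_
  · rw [intervalFam_gr]
    exact grading_le h1 hL n f
  · obtain ⟨χ⟩ := hA.exists_chart hz.1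
    refine ⟨χ.nbhd α ×ˢ univ, prod_mono (AnnChart.nbhd_subset hA h1) le_rfl,
      (AnnChart.isOpen_nbhd h1).prod isOpen_univ, ⟨χ.mem_nbhd_self h1, mem_univ _⟩,
      χ.pairGr α, (AnnChart.isGr_gradGr h1).prod (CurveFam.isGr h1),
      ⟨1, fun n => ?_⟩, fun k => χ.SmT_arcMap hA h0 h1 hL k⟩
    obtain ⟨C, hC⟩ := χ.exists_gradGr_le h0 h1 n
    obtain ⟨K, -, hK⟩ := χ.exists_gr_le h0 h1 n
    refine ⟨C + K, fun z => ENNReal.ofReal_add_le.trans ?_⟩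
    have h2 := (hK n le_rfl z.2).trans (mul_le_mul_right (holderNorm_mono α (Nat.le_succ n) _) _)
    refine (add_le_add (hC z.1) h2).trans ?_
    rw [prodGrading, mul_add, ENNReal.coe_add]
    gcongr
    · exact le_self_add
    · exact le_add_self
    · exact le_rfl

omit h0 in
lemma iterGateaux_one_distInvMap {ω : calF Ω} (hω : ω ∈ calFPlus Ω Γi Γo) (ν : calF Ω) :
    iterGateaux (distInvMap Ω) 1 ω ![ν] = avgMap Ω (ω, ν.1) := by
  obtain ⟨χ⟩ := hA.exists_chart hω
  obtain ⟨d⟩ := χ.exists_density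
  obtain ⟨S⟩ := AnnChart.exists_lineData hA h1 (χ.mem_nbhd_self h1) d ν
  exact iterGateaux_succ_of_tendsto _ 0 ω ![ν] (S.tendsto_distInvMap hA)

omit h0 in
lemma iterGateaux_two_distInvMap {ω : calF Ω} (hω : ω ∈ calFPlus Ω Γi Γo) (ν₁ ν₂ : calF Ω) :
    iterGateaux (distInvMap Ω) 2 ω ![ν₁, ν₂] =
      CInf.pderiv (1 : ℝ) (CInf.mul (levelMap Ω (ω, ν₁.1)) (avgMap Ω (ω, ν₂.1)) -
        levelMap Ω (ω, CInf.mul ν₁.1 ν₂.1)) := by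
  obtain ⟨χ⟩ := hA.exists_chart hω
  obtain ⟨d⟩ := χ.exists_density
  obtain ⟨S⟩ := AnnChart.exists_lineData hA h1 (χ.mem_nbhd_self h1) d ν₂
  refine iterGateaux_succ_of_tendsto _ 1 ω ![ν₁, ν₂] ((S.tendsto_avgMap hA ν₁.1).congr' ?_)
  have e : (fun i : Fin 1 => (![ν₁, ν₂] : Fin 2 → calF Ω) i.castSucc) = ![ν₁] := by
    ext i
    fin_cases i
    rfl
  have hev : ∀ᶠ t in 𝓝[≠] (0 : ℝ), ω + t • ν₂ ∈ calFPlus Ω Γi Γo := by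
    have hc : Tendsto (fun t : ℝ => ω + t • ν₂) (𝓝 0) (𝓝 (ω + (0 : ℝ) • ν₂)) :=
      Continuous.tendsto (by fun_prop) 0
    rw [zero_smul, add_zero] at hc
    exact (hc.eventually (hA.isOpen_calFPlus.mem_nhds hω)).filter_mono nhdsWithin_le_nhds
  filter_upwards [hev] with t ht
  rw [e, iterGateaux_one_distInvMap hA h1 hω]
  congr 2
  exact (iterGateaux_one_distInvMap hA h1 ht ν₁).symm

end Main

theorem mainTheorem5 (Ω Γi Γo : Set Plane) (hΩ : IsAnnularDomain Ω Γi Γo)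
    (α : ℝ) (hα₀ : 0 < α) (hα₁ : α < 1) :
    -- `A_ω` is a bijection from the range of `ω` onto `[0, |Ω|]`, and `J_ω (1 / |∇ω|)` is positive
    (∀ ω ∈ calFPlus Ω Γi Γo,
      BijOn (distFun Ω ω.1) (ω.1 '' closure Ω) (Icc 0 (area Ω)) ∧
      ∀ l ∈ ω.1 '' closure Ω, 0 < levelInt Ω ω.1 (fun x => 1 / gradNorm Ω ω.1 x) l) ∧
    -- `Q(ω) = A_ω⁻¹` is smooth tame, with derivatives `D k`
    (∃ (Q : calF Ω → CInf (Icc 0 (area Ω)))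
        (D : (k : ℕ) → calF Ω → (Fin k → calF Ω) → CInf (Icc 0 (area Ω))),
      (∀ ω ∈ calFPlus Ω Γi Γo, ∀ m ∈ Icc 0 (area Ω), Q ω m = distInv Ω ω.1 m) ∧
      IsSmoothTameOn (calF.grading Ω α) (CInf.grading (Icc 0 (area Ω)) α)
        (calFPlus Ω Γi Γo) Q D ∧
      (∀ ω ∈ calFPlus Ω Γi Γo, ∀ ν : calF Ω, ∀ m ∈ Icc 0 (area Ω),
        D 1 ω ![ν] m =
          levelInt Ω ω.1 (fun x => ν.1 x / gradNorm Ω ω.1 x) (distInv Ω ω.1 m) /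
          levelInt Ω ω.1 (fun x => 1 / gradNorm Ω ω.1 x) (distInv Ω ω.1 m)) ∧
      ∀ ω₀ ∈ calFPlus Ω Γi Γo, ∃ δ : ℝ≥0, 0 < δ ∧ ∀ n : ℕ, ∃ C : ℝ≥0,
        ∀ ω ∈ calFPlus Ω Γi Γo, calF.grading Ω α 2 (ω - ω₀) < δ →
          CInf.grading (Icc 0 (area Ω)) α n (Q ω) ≤ C * (calF.grading Ω α n ω + 1) ∧
          (∀ ν : calF Ω, CInf.grading (Icc 0 (area Ω)) α n (D 1 ω ![ν]) ≤
            C * (calF.grading Ω α n ν + calF.grading Ω α (n + 1) ω * calF.grading Ω α 1 ν)) ∧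
          (∀ ν₁ ν₂ : calF Ω, CInf.grading (Icc 0 (area Ω)) α n (D 2 ω ![ν₁, ν₂]) ≤
            C * (calF.grading Ω α (n + 1) ν₁ * calF.grading Ω α 1 ν₂ +
              calF.grading Ω α 1 ν₁ * calF.grading Ω α (n + 1) ν₂ +
              calF.grading Ω α (n + 2) ω * calF.grading Ω α 2 ν₁ * calF.grading Ω α 2 ν₂))) ∧
    -- `(ω, u) ↦ J_ω u ∘ A_ω⁻¹` is smooth tame
    (∃ (R : calF Ω × CInf (closure Ω) → CInf (Icc 0 (area Ω)))
        (D : (k : ℕ) → calF Ω × CInf (closure Ω) →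
          (Fin k → calF Ω × CInf (closure Ω)) → CInf (Icc 0 (area Ω))),
      (∀ ω ∈ calFPlus Ω Γi Γo, ∀ u : CInf (closure Ω), ∀ m ∈ Icc 0 (area Ω),
        R (ω, u) m = levelInt Ω ω.1 u (distInv Ω ω.1 m)) ∧
      IsSmoothTameOn (prodGrading (calF.grading Ω α) (CInf.grading (closure Ω) α))
        (CInf.grading (Icc 0 (area Ω)) α) (calFPlus Ω Γi Γo ×ˢ univ) R D) ∧
    -- the tame estimate on `J_ω (u / |∇ω|) ∘ A_ω⁻¹`
    (∀ ω₀ ∈ calFPlus Ω Γi Γo, ∃ δ : ℝ≥0, 0 < δ ∧ ∀ n : ℕ, ∃ C : ℝ≥0,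
      ∀ ω ∈ calFPlus Ω Γi Γo, calF.grading Ω α 2 (ω - ω₀) < δ →
        ∀ u : CInf (closure Ω), ∃ g : CInf (Icc 0 (area Ω)),
          (∀ m ∈ Icc 0 (area Ω),
            g m = levelInt Ω ω.1 (fun x => u x / gradNorm Ω ω.1 x) (distInv Ω ω.1 m)) ∧
          CInf.grading (Icc 0 (area Ω)) α n g ≤
            C * (CInf.grading (closure Ω) α n u +
              calF.grading Ω α (n + 1) ω * CInf.grading (closure Ω) α 1 u)) := by

  have hA := hΩ.data
  haveI := hA.body
  have hL := hA.area_pos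
  haveI := CInf.goodBody_Icc hL
  have h0 := hα₀.le
  have h1 := hα₁.le
  have hS : ∀ ω ∈ calFPlus Ω Γi Γo, ∃ (χ : AnnChart Ω Γi Γo ω.1) (d : χ.Density),
      Nonempty (χ.LineData d ω 0) := fun ω hω => by
    obtain ⟨χ⟩ := hA.exists_chart hω
    obtain ⟨d⟩ := χ.exists_density
    exact ⟨χ, d, AnnChart.exists_lineData hA h1 (χ.mem_nbhd_self h1) d 0⟩
  have hE : ∀ ω ∈ calFPlus Ω Γi Γo, ∀ u : CInf (closure Ω), ∀ m ∈ Icc 0 (area Ω),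
      levelMap Ω (ω, u) m =
        levelInt Ω ω.1 (fun x => u x / gradNorm Ω ω.1 x) (distInv Ω ω.1 m) :=
    fun ω hω u m hm => by
      obtain ⟨χ, d, ⟨S⟩⟩ := hS ω hω
      exact S.levelMap_eq_levelInt hA u hm
  refine ⟨fun ω hω => ?_, ⟨distInvMap Ω, iterGateaux (distInvMap Ω), fun ω hω m hm => ?_,
    isSmoothTameOn_distInvMap hA h0 h1, fun ω hω ν m hm => ?_, fun ω₀ hω₀ => ?_⟩,
    ⟨arcMap Ω, iterGateaux (arcMap Ω), fun ω hω u m hm => arcMap_apply hA hω u hm,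
      isSmoothTameOn_arcMap hA h0 h1⟩, fun ω₀ hω₀ => ?_⟩
  · obtain ⟨χ, d, ⟨S⟩⟩ := hS ω hω
    exact ⟨S.bijOn_distFun hA, fun l hl => S.levelInt_one_pos hl⟩
  · obtain ⟨χ, d, ⟨S⟩⟩ := hS ω hω
    exact (S.distInv_eq hA hm).2
  · obtain ⟨χ, d, ⟨S⟩⟩ := hS ω hω
    have e := hE ω hω (CInf.one _) m hm
    have e' : (fun x => CInf.one (closure Ω) x / gradNorm Ω ω.1 x) =
        fun x => 1 / gradNorm Ω ω.1 x := by
      ext x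
      by_cases hx : x ∈ closure Ω
      · rw [CInf.one_apply hx]
      · have h : gradNorm Ω ω.1 x = 0 := by
          rw [gradNorm, gradientWithin, fderivWithin_zero_of_notMem_closure (by simpa using hx),
            map_zero, norm_zero]
        rw [h, div_zero, div_zero]
    rw [iterGateaux_one_distInvMap hA h1 hω, avgMap, CInf.mul_apply,
      CInf.inv_apply (S.levelMap_one_mem_Pos hA) hm, hE ω hω _ m hm, e, e', div_eq_mul_inv]
  · obtain ⟨χ⟩ := hA.exists_chart hω₀
    obtain ⟨δ, hδ, hO⟩ := χ.exists_radius h0 h1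
    refine ⟨δ, hδ, fun n => ?_⟩
    obtain ⟨K, hK1, hK⟩ := χ.exists_gr_le h0 h1 (n + 2)
    obtain ⟨C₁, hC₁1, hC₁⟩ := χ.exists_hN_distInvMap_le hA h0 h1 hL n
    obtain ⟨C₂, hC₂1, hC₂⟩ := χ.exists_hN_avgMap_le hA h0 h1 hL n
    obtain ⟨C₃, hC₃1, hC₃⟩ := χ.exists_hN_second_le hA h0 h1 hL n
    have hg := CurveFam.isGr (Γ := χ.rays) h1
    have hF : ∀ j ≤ n + 2, ∀ f : calF Ω,
        ENNReal.ofReal (χ.rays.gr α j f.1) ≤ K * calF.grading Ω α j f := fun j hj f => hK j hj f.1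
    have hKK : (1 : ℝ≥0) ≤ K ^ 2 := one_le_pow₀ hK1
    refine ⟨C₁.toNNReal * K + C₂.toNNReal * K ^ 2 + C₃.toNNReal * (K ^ 2) ^ 2,
      fun ω hω hωδ => ?_⟩
    have hωO := hO ω hωδ
    refine ⟨?_, fun ν => ?_, fun ν₁ ν₂ => ?_⟩
    · refine (ofReal_le_of_le_mul (by linarith) (grading_le h1 hL n _) (hC₁ ω hωO)
        (X := K * (calF.grading Ω α n ω + 1)) ?_).trans ?_
      · rw [mul_add, mul_one]
        refine ENNReal.ofReal_add_le.trans (add_le_add (hF n (by omega) ω) ?_)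
        rw [ENNReal.ofReal_one]
        exact ENNReal.one_le_coe_iff.2 hK1
      · rw [← mul_assoc, ← ENNReal.coe_mul]
        refine mul_le_mul_left (ENNReal.coe_le_coe.2 ?_) _
        rw [add_assoc]
        exact le_self_add
    · rw [iterGateaux_one_distInvMap hA h1 hω]
      refine (ofReal_le_of_le_mul (by linarith) (grading_le h1 hL n _) (hC₂ ω hωO ν.1)
        (ofReal_add_mul_le hK1 (hg.nonneg _ _) (hF n (by omega) ν) (hF (n + 1) (by omega) ω)
          (hF 1 (by omega) ν))).trans ?_
      rw [← mul_assoc, ← ENNReal.coe_mul]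
      refine mul_le_mul_left (ENNReal.coe_le_coe.2 ?_) _
      rw [add_assoc]
      exact le_self_add.trans le_add_self
    · rw [iterGateaux_two_distInvMap hA h1 hω]
      have h12 : ∀ ν : calF Ω, ENNReal.ofReal (χ.rays.gr α 1 ν.1) ≤ K * calF.grading Ω α 2 ν :=
        fun ν => (ENNReal.ofReal_le_ofReal (hg.mono ν.1 one_le_two)).trans (hF 2 (by omega) ν)
      have e1 : ENNReal.ofReal (χ.rays.gr α (n + 1) ν₁.1 * χ.rays.gr α 1 ν₂.1 +
          χ.rays.gr α 1 ν₁.1 * χ.rays.gr α (n + 1) ν₂.1) ≤ (K ^ 2 : ℝ≥0) *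
          (calF.grading Ω α (n + 1) ν₁ * calF.grading Ω α 1 ν₂ +
            calF.grading Ω α 1 ν₁ * calF.grading Ω α (n + 1) ν₂) := by
        refine ENNReal.ofReal_add_le.trans ?_
        rw [ENNReal.ofReal_mul (hg.nonneg _ _), ENNReal.ofReal_mul (hg.nonneg _ _)]
        refine (add_le_add (mul_le_mul' (hF (n + 1) (by omega) ν₁) (hF 1 (by omega) ν₂))
          (mul_le_mul' (hF 1 (by omega) ν₁) (hF (n + 1) (by omega) ν₂))).trans_eq ?_
        push_cast
        ring
      have e2 : ENNReal.ofReal (χ.rays.gr α (n + 2) ω.1 * χ.rays.gr α 1 ν₁.1) ≤ (K ^ 2 : ℝ≥0) *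
          (calF.grading Ω α (n + 2) ω * calF.grading Ω α 2 ν₁) := by
        rw [ENNReal.ofReal_mul (hg.nonneg _ _)]
        refine (mul_le_mul' (hF (n + 2) le_rfl ω) (h12 ν₁)).trans_eq ?_
        push_cast
        ring
      have e3 : ENNReal.ofReal (χ.rays.gr α 1 ν₂.1) ≤ (K ^ 2 : ℝ≥0) * calF.grading Ω α 2 ν₂ :=
        (h12 ν₂).trans (mul_le_mul_left (ENNReal.coe_le_coe.2 (le_self_pow₀ hK1 two_ne_zero)) _)
      refine (ofReal_le_of_le_mul (by linarith) (grading_le h1 hL n _) (hC₃ ω hωO ν₁.1 ν₂.1)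
        (ofReal_add_mul_le hKK (mul_nonneg (hg.nonneg _ _) (hg.nonneg _ _)) e1 e2 e3)).trans ?_
      rw [← mul_assoc, ← ENNReal.coe_mul]
      exact mul_le_mul_left (ENNReal.coe_le_coe.2 le_add_self) _
  · obtain ⟨χ⟩ := hA.exists_chart hω₀
    obtain ⟨δ, hδ, hO⟩ := χ.exists_radius h0 h1
    refine ⟨δ, hδ, fun n => ?_⟩
    obtain ⟨K, hK1, hK⟩ := χ.exists_gr_le h0 h1 (n + 1)
    obtain ⟨C, hC1, hC⟩ := χ.exists_hN_levelMap_le hA h0 h1 hL n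
    refine ⟨C.toNNReal * K ^ 2, fun ω hω hωδ u => ⟨levelMap Ω (ω, u), hE ω hω u, ?_⟩⟩
    rw [ENNReal.coe_mul, mul_assoc]
    exact ofReal_le_of_le_mul (by linarith) (grading_le h1 hL n _) (hC ω (hO ω hωδ) u)
      (ofReal_add_mul_le hK1 (CurveFam.gr_nonneg _ _) (hK n (by omega) u)
        (hK (n + 1) le_rfl ω.1) (hK 1 (by omega) u))
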